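/- **Setting.** Let $a>0$, $m\in\{1,2\}$, $n=m+1$, $-m<\beta<0$, $\mu=\beta/m$. The radial isothermal Euler system is $$(r^m\rho)_t+(r^m\rho u)_r=0,\qquad (r^m\rho u)_t+(r^m(\rho u^2+p))_r=mr^{m-1}p,\qquad p=a^2\rho .$$ With $\xi=r/t$, $u=U(\xi)$, $\rho=\operatorname{sgn}(t)|t|^\beta\Omega(\xi)$, smooth solutions satisfy $$(1)\quad U'=\frac{a^2}{(U-\xi)^2-a^2}\Big(\beta+\frac{mU}{\xi}\Big),\qquad (2)\quad \frac{\Omega'}{\Omega}=-\frac1{a^2}(U-\xi)U'.$$ Put $\xi_w=-\frac{am}{m+\beta}<0$, $U_w=\frac{a\beta}{m+\beta}$, $P_w=(\xi_w,U_w)$ and $$\lambda_\pm=\tfrac12\Big[1+\tfrac m2(1+\mu)\pm\sqrt{\big(1+\tfrac m2(1+\mu)\big)^2-2m(1+\mu)^2}\Big].$$ **Kink solution.** There is exactly one solution $U_k$ of (1) on $(-\infty,\xi_w)$ that approaches $P_w$ with slope $1-\lambda_+$, and it has a finite limit $U^*$ at $\xi=-\infty$. One has $U^*<0$ for example for $(m,\beta)=(1,-\frac12)$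 and $(m,\beta)=(2,-1)$. **Similarity functions.** Assume that $U^*<0$ and let $\Omega_0<0$. A *constructed profile* consists of the following. - $\hat U$, continuous on $[\xi_w,-\xi_w]$, with $\hat U(0)=0$, solving (1) on $(\xi_w,0)$ and $(0,-\xi_w)$ and joining $P_w$ to $-P_w$. - $\tilde U$, solving (1) on some $(\xi^*,\infty)$ with $0<\xi^*<-\xi_w$, with $\tilde U(\infty)=U^*$ and $\tilde U(\xi^*+)=\xi^*-a$. - $\xi_s\in(\xi^*,-\xi_w)$ with $\tilde U(\xi_s)=\xi_s+\frac{a^2}{\hat U(\xi_s)-\xi_s}$. - $U=U_k$ on $(-\infty,\xi_w)$, $U=\hat U$ on $[\xi_w,\xi_s)$, $U=\tilde U$ on $(\xi_s,\infty)$. - $\Omega$, solving (2) off $\{\xi_w,0,\xi_s\}$, continuous at $\xi_w$, with $\Omega(0-)=\Omega_0$, a finite limit $\Omega(0+)$, $\Omega(\xi)\sim C|\xi|^\beta$ as $\xi\to-\infty$, $\Omega(\xi)\sim -C\xi^\beta$ as $\xi\to+\infty$ for the same constant $C$, and $\Omega(\xi_s-)=\frac{(\tilde U(\xi_s)-\xi_s)^2}{a^2}\,\Omega(\xi_s+)$.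 Define $u(t,r)=U(r/t)$ and $\rho(t,r)=\operatorname{sgn}(t)|t|^\beta\Omega(r/t)$ for $t\ne0$ (with $\Omega(0)$ read as $\Omega(0-)$ for $t<0$ and as $\Omega(0+)$ for $t>0$), and $u(0,r)=U^*$, $\rho(0,r)=|C|r^\beta$. **Theorem.** Let $a,m,\beta$ be as above with $U^*<0$, and let $\Omega_0<0$. A constructed profile exists, and for every constructed profile: 1. $(\rho,u)$ is a radial weak solution, that is: $\rho$ and $u$ are measurable on $\mathbb R\times(0,\infty)$; $t\mapsto\rho(t)$ and $t\mapsto\rho(t)u(t)$ belong to $C^0(\mathbb R;L^1_{loc}([0,\infty),r^mdr))$; $\rho u^2,p\in L^1_{loc}(\mathbb R\times[0,\infty),dt\times r^mdr)$; and $$\int_{\mathbb R}\int_0^\infty(\rho\psi_t+\rho u\psi_r)\,r^m\,dr\,dt=0,\qquad \int_{\mathbb R}\int_0^\infty\Big(\rho u\psi_t+\rho u^2\psi_r+p\big(\psi_r+\tfrac{m\psi}{r}\big)\Big)r^m\,dr\,dt=0$$ for all compactly supported $\psi\in C^1(\mathbb R\times[0,\infty))$, where in the second identity also $\psi(t,0)\equiv0$.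 2. $\rho(t,\mathbf x)=\rho(t,|\mathbf x|)$, $\mathbf u(t,\mathbf x)=u(t,|\mathbf x|)\frac{\mathbf x}{|\mathbf x|}$ is a weak solution on $\mathbb R\times\mathbb R^n$ of $\rho_t+\operatorname{div}(\rho\mathbf u)=0$, $(\rho\mathbf u)_t+\operatorname{div}(\rho\mathbf u\otimes\mathbf u)+\nabla(a^2\rho)=0$, that is: $\rho$ and $\mathbf u$ are measurable; $\rho,\rho\mathbf u\in C^0(\mathbb R;L^1_{loc}(\mathbb R^n))$; $\rho|\mathbf u|^2,p\in L^1_{loc}(\mathbb R\times\mathbb R^n)$; and both laws hold in integrated form against all test functions in $C^1_c(\mathbb R\times\mathbb R^n)$. 3. $\rho>0$ for all $t\in\mathbb R$, $r>0$; and $\rho,u$ are continuous on $\mathbb R\times[0,\infty)$ away from the origin $(t,r)=(0,0)$ and the shock path $\{r=\xi_st,\ t>0\}$. 4. For $t<0$ there is a focusing weak discontinuity on the line $r=\xi_wt$, where $u-a=\xi_w$: there $u(t,\cdot)$ has outer one-sided $r$-derivative $(1-\lambda_+)/t$ and inner one-sided $r$-derivative $(1-\lambda_-)/t$, with $\lambda_-<\lambda_+$.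 5. For $t>0$ there is an expanding shock on the line $r=\xi_st$, with $\xi_s>0$: $\rho$ and $u$ jump there, the Rankine–Hugoniot conditions hold, and $u_-+a>\xi_s>u_++a$, where $\mp$ denotes the inner/outer side (entropy condition for a 2-shock). 6. The density blows up at the origin: $\rho(0,\mathbf x)=K|\mathbf x|^\beta$ for $\mathbf x\neq0$, with a constant $K>0$, and $\rho(t,\mathbf x)\to\infty$ as $(t,\mathbf x)\to(0,\mathbf 0)$, $(t,\mathbf x)\ne(0,\mathbf 0)$. 7. The velocity $u$ is globally bounded. -/

import Mathlib

open Set Filter Topology MeasureTheory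

noncomputable section

namespace IsothermalEuler

/-! ### Weak solutions of the barotropic Euler system -/

/-- `t ↦ f t` belongs to `C⁰(ℝ; L¹_loc(μ))`. -/
def ContinuousInL1loc {X F : Type*} [TopologicalSpace X] [MeasurableSpace X]
    [NormedAddCommGroup F] (μ : Measure X) (f : ℝ → X → F) : Prop :=
  (∀ t, LocallyIntegrable (f t) μ) ∧
    ∀ K : Set X, IsCompact K → ∀ t₀ : ℝ,
      Tendsto (fun t => ∫ x in K, ‖f t x - f t₀ x‖ ∂μ) (𝓝 t₀) (𝓝 0)

/-- Weak solutions `(ρ, u)` on `ℝ × ℝⁿ` of the barotropic Euler system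
`ρ_t + div (ρ u) = 0`, `(ρ u)_t + div (ρ u ⊗ u) + ∇ p(ρ) = 0`. -/
structure IsWeakSolution (n : ℕ) (p : ℝ → ℝ) (ρ : ℝ → EuclideanSpace ℝ (Fin n) → ℝ)
    (u : ℝ → EuclideanSpace ℝ (Fin n) → EuclideanSpace ℝ (Fin n)) : Prop where
  measurable_density : Measurable (fun z : ℝ × EuclideanSpace ℝ (Fin n) => ρ z.1 z.2)
  measurable_velocity : Measurable (fun z : ℝ × EuclideanSpace ℝ (Fin n) => u z.1 z.2)
  continuous_density : ContinuousInL1loc volume ρ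
  continuous_momentum : ContinuousInL1loc volume (fun t x => ρ t x • u t x)
  locallyIntegrable_energy : LocallyIntegrable
    (fun z : ℝ × EuclideanSpace ℝ (Fin n) => ρ z.1 z.2 * ‖u z.1 z.2‖ ^ 2) volume
  locallyIntegrable_pressure : LocallyIntegrable
    (fun z : ℝ × EuclideanSpace ℝ (Fin n) => p (ρ z.1 z.2)) volume
  mass : ∀ φ : ℝ × EuclideanSpace ℝ (Fin n) → ℝ, ContDiff ℝ 1 φ → HasCompactSupport φ →
    ∫ t : ℝ, ∫ x : EuclideanSpace ℝ (Fin n),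
      (ρ t x * fderiv ℝ φ (t, x) (1, 0) + ρ t x * fderiv ℝ φ (t, x) (0, u t x)) = 0
  momentum : ∀ φ : ℝ × EuclideanSpace ℝ (Fin n) → ℝ, ContDiff ℝ 1 φ → HasCompactSupport φ →
    ∀ i : Fin n, ∫ t : ℝ, ∫ x : EuclideanSpace ℝ (Fin n),
      (ρ t x * u t x i * fderiv ℝ φ (t, x) (1, 0)
        + ρ t x * u t x i * fderiv ℝ φ (t, x) (0, u t x)
        + p (ρ t x) * fderiv ℝ φ (t, x) (0, EuclideanSpace.single i 1)) = 0

/-- The measure `r ^ m dr` on the half line `r > 0`. -/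
def radialMeasure (m : ℕ) : Measure ℝ :=
  (volume.restrict (Ioi 0)).withDensity (fun r => ENNReal.ofReal (r ^ m))

/-- Test functions of class `C¹` on `ℝ × [0, ∞)`, up to the boundary, which vanish outside
some `[-T, T] × [0, R]`. -/
def IsRadialTest (ψ : ℝ × ℝ → ℝ) : Prop :=
  ContDiffOn ℝ 1 ψ (univ ×ˢ Ici 0) ∧
    ∃ T R : ℝ, 0 < T ∧ 0 < R ∧
      ∀ t r : ℝ, 0 ≤ r → (t, r) ∉ Icc (-T) T ×ˢ Icc 0 R → ψ (t, r) = 0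

/-- Radial weak solutions `(ρ, u)` on `ℝ × (0, ∞)` of `(r^m ρ)_t + (r^m ρ u)_r = 0`,
`(r^m ρ u)_t + (r^m (ρ u² + p))_r = m r^(m-1) p`. -/
structure IsRadialWeakSolution (m : ℕ) (p : ℝ → ℝ) (ρ u : ℝ → ℝ → ℝ) : Prop where
  measurable_density : Measurable (fun z : ℝ × Ioi (0 : ℝ) => ρ z.1 z.2)
  measurable_velocity : Measurable (fun z : ℝ × Ioi (0 : ℝ) => u z.1 z.2)
  continuous_density : ContinuousInL1loc (radialMeasure m) ρ
  continuous_momentum : ContinuousInL1loc (radialMeasure m) (fun t r => ρ t r * u t r)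
  locallyIntegrable_energy : LocallyIntegrable
    (fun z : ℝ × ℝ => ρ z.1 z.2 * u z.1 z.2 ^ 2) (volume.prod (radialMeasure m))
  locallyIntegrable_pressure : LocallyIntegrable
    (fun z : ℝ × ℝ => p (ρ z.1 z.2)) (volume.prod (radialMeasure m))
  mass : ∀ ψ : ℝ × ℝ → ℝ, IsRadialTest ψ →
    ∫ t : ℝ, ∫ r in Ioi (0 : ℝ),
      (ρ t r * deriv (fun s => ψ (s, r)) t
        + ρ t r * u t r * deriv (fun s => ψ (t, s)) r) * r ^ m = 0
  momentum : ∀ ψ : ℝ × ℝ → ℝ, IsRadialTest ψ → (∀ t, ψ (t, 0) = 0) →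
    ∫ t : ℝ, ∫ r in Ioi (0 : ℝ),
      (ρ t r * u t r * deriv (fun s => ψ (s, r)) t
        + ρ t r * u t r ^ 2 * deriv (fun s => ψ (t, s)) r
        + p (ρ t r) * (deriv (fun s => ψ (t, s)) r + m * ψ (t, r) / r)) * r ^ m = 0

/-- The fields `ρ`, `u` have at time `t` a jump discontinuity at `r = R t`; it satisfies the
Rankine-Hugoniot conditions and the entropy condition for a 2-shock.
Here `ρi, ui` are the inner (`r < R t`) and `ρo, uo` the outer (`r > R t`) states, and
`√(p'(ρ))` is the sound speed. -/
def IsTwoShock (p : ℝ → ℝ) (ρ u : ℝ → ℝ → ℝ) (R : ℝ → ℝ) (t : ℝ) : Prop :=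
  ∃ ρi ui ρo uo : ℝ,
    Tendsto (ρ t) (𝓝[<] R t) (𝓝 ρi) ∧ Tendsto (u t) (𝓝[<] R t) (𝓝 ui) ∧
    Tendsto (ρ t) (𝓝[>] R t) (𝓝 ρo) ∧ Tendsto (u t) (𝓝[>] R t) (𝓝 uo) ∧
    ρi ≠ ρo ∧ ui ≠ uo ∧
    deriv R t * (ρo - ρi) = ρo * uo - ρi * ui ∧
    deriv R t * (ρo * uo - ρi * ui) = (ρo * uo ^ 2 + p ρo) - (ρi * ui ^ 2 + p ρi) ∧
    deriv R t < ui + √(deriv p ρi) ∧ uo + √(deriv p ρo) < deriv R t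

/-! ### The similarity equations -/

/-- The isothermal pressure law. -/
def pressure (a ρ : ℝ) : ℝ := a ^ 2 * ρ

/-- `U` solves `U' = a² / ((U - ξ)² - a²) * (β + m U / ξ)` on `s`. -/
def SolvesU (a : ℝ) (m : ℕ) (β : ℝ) (U : ℝ → ℝ) (s : Set ℝ) : Prop :=
  ∀ ξ ∈ s, (U ξ - ξ) ^ 2 ≠ a ^ 2 ∧
    HasDerivAt U (a ^ 2 / ((U ξ - ξ) ^ 2 - a ^ 2) * (β + m * U ξ / ξ)) ξ

/-- `Ω` solves `Ω' / Ω = - (U - ξ) U' / a²` on `s`, in the form `Ω' = - (U - ξ) U' Ω / a²`. -/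
def SolvesOmega (a : ℝ) (U Ω : ℝ → ℝ) (s : Set ℝ) : Prop :=
  ∀ ξ ∈ s, HasDerivAt Ω (-(1 / a ^ 2) * (U ξ - ξ) * deriv U ξ * Ω ξ) ξ

/-- The critical point `P_w = (xiW, uW)`. -/
def xiW (a : ℝ) (m : ℕ) (β : ℝ) : ℝ := -(a * m / (m + β))

def uW (a : ℝ) (m : ℕ) (β : ℝ) : ℝ := a * β / (m + β)

/-- The radicand in the eigenvalues of the linearization at `P_w`, with `μ = β / m`. -/
def radicand (m : ℕ) (β : ℝ) : ℝ :=
  (1 + m / 2 * (1 + β / m)) ^ 2 - 2 * m * (1 + β / m) ^ 2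

def lamPlus (m : ℕ) (β : ℝ) : ℝ := ((1 + m / 2 * (1 + β / m)) + √(radicand m β)) / 2

def lamMinus (m : ℕ) (β : ℝ) : ℝ := ((1 + m / 2 * (1 + β / m)) - √(radicand m β)) / 2

/-- The kink solution: it solves the similarity equation on `(-∞, xiW)` and approaches `P_w`
with slope `1 - lamPlus`. -/
structure IsKink (a : ℝ) (m : ℕ) (β : ℝ) (U : ℝ → ℝ) : Prop where
  solves : SolvesU a m β U (Iio (xiW a m β))
  tendsto : Tendsto U (𝓝[<] xiW a m β) (𝓝 (uW a m β))
  slope : Tendsto (fun ξ => (U ξ - uW a m β) / (ξ - xiW a m β)) (𝓝[<] xiW a m β)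
    (𝓝 (1 - lamPlus m β))

/-- The kink solution has a strictly negative limit at `-∞`. -/
def KinkLimitNeg (a : ℝ) (m : ℕ) (β : ℝ) : Prop :=
  ∃ (U : ℝ → ℝ) (Ustar : ℝ), IsKink a m β U ∧ Tendsto U atBot (𝓝 Ustar) ∧ Ustar < 0

/-- The solution through `(0, 0)`, connecting the critical points `P_w` and `-P_w`. -/
structure IsHat (a : ℝ) (m : ℕ) (β : ℝ) (U : ℝ → ℝ) : Prop where
  continuousOn : ContinuousOn U (Icc (xiW a m β) (-xiW a m β))
  zero : U 0 = 0
  solves_neg : SolvesU a m β U (Ioo (xiW a m β) 0)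
  solves_pos : SolvesU a m β U (Ioo 0 (-xiW a m β))
  left : U (xiW a m β) = uW a m β
  right : U (-xiW a m β) = -uW a m β

/-- The solution which tends to `Ustar` at `+∞`, continued inwards to the point `xiStar` in
`(0, -xiW)` where it meets the line `U = ξ - a`. -/
structure IsTilde (a : ℝ) (m : ℕ) (β Ustar xiStar : ℝ) (U : ℝ → ℝ) : Prop where
  pos : 0 < xiStar
  lt : xiStar < -xiW a m β
  solves : SolvesU a m β U (Ioi xiStar)
  tendsto_atTop : Tendsto U atTop (𝓝 Ustar)
  tendsto_line : Tendsto U (𝓝[>] xiStar) (𝓝 (xiStar - a))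

/-- The outer velocity to which a jump at `ξ` connects the inner velocity `U ξ`. -/
def hugoniot (a : ℝ) (U : ℝ → ℝ) (ξ : ℝ) : ℝ := ξ + a ^ 2 / (U ξ - ξ)

/-- The pieces of a similarity profile `(U, Ω)`. The function `Ω` has a jump at `ξ = 0`, so
there are two pieces `OmNeg` (on `[xiW, 0]`) and `OmPos` (on `[0, xiS)`) next to `ξ = 0`. -/
structure Profile where
  Uk : ℝ → ℝ
  Uhat : ℝ → ℝ
  Utilde : ℝ → ℝ
  Omk : ℝ → ℝ
  OmNeg : ℝ → ℝ
  OmPos : ℝ → ℝ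
  Omtilde : ℝ → ℝ
  /-- limit of `U` at `±∞` -/
  Ustar : ℝ
  /-- point where `Utilde` meets the line `U = ξ - a` -/
  xiStar : ℝ
  /-- location of the shock -/
  xiS : ℝ
  /-- the constant with `Omk ξ ∼ C |ξ|^β` at `-∞` and `Omtilde ξ ∼ -C ξ^β` at `+∞` -/
  C : ℝ

/-- `S` is a profile constructed from the similarity equations, with `Ω(0-) = Ω₀`. -/
structure IsConstructed (a : ℝ) (m : ℕ) (β Ω₀ : ℝ) (S : Profile) : Prop where
  kink : IsKink a m β S.Uk
  kink_limit : Tendsto S.Uk atBot (𝓝 S.Ustar)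
  hat : IsHat a m β S.Uhat
  tilde : IsTilde a m β S.Ustar S.xiStar S.Utilde
  shock_mem : S.xiS ∈ Ioo S.xiStar (-xiW a m β)
  shock_eq : S.Utilde S.xiS = hugoniot a S.Uhat S.xiS
  omNeg_continuousOn : ContinuousOn S.OmNeg (Icc (xiW a m β) 0)
  omNeg_solves : SolvesOmega a S.Uhat S.OmNeg (Ioo (xiW a m β) 0)
  omNeg_zero : S.OmNeg 0 = Ω₀
  omk_solves : SolvesOmega a S.Uk S.Omk (Iio (xiW a m β))
  omk_tendsto : Tendsto S.Omk (𝓝[<] xiW a m β) (𝓝 (S.OmNeg (xiW a m β)))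
  omk_asymp : Tendsto (fun ξ => S.Omk ξ / |ξ| ^ β) atBot (𝓝 S.C)
  omtilde_solves : SolvesOmega a S.Utilde S.Omtilde (Ioi S.xiS)
  omtilde_continuous : ContinuousWithinAt S.Omtilde (Ici S.xiS) S.xiS
  omtilde_asymp : Tendsto (fun ξ => S.Omtilde ξ / ξ ^ β) atTop (𝓝 (-S.C))
  omPos_continuousOn : ContinuousOn S.OmPos (Icc 0 S.xiS)
  omPos_solves : SolvesOmega a S.Uhat S.OmPos (Ioo 0 S.xiS)
  omPos_shock : S.OmPos S.xiS = (S.Utilde S.xiS - S.xiS) ^ 2 / a ^ 2 * S.Omtilde S.xiS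

/-- The similarity function `U(ξ)`; `w` is the location of the kink. -/
def Profile.U (S : Profile) (w ξ : ℝ) : ℝ :=
  if ξ < w then S.Uk ξ else if ξ < S.xiS then S.Uhat ξ else S.Utilde ξ

/-- The similarity function `Ω(ξ)` for `ξ ≤ 0` (that is, for `t < 0`). -/
def Profile.OmegaNeg (S : Profile) (w ξ : ℝ) : ℝ :=
  if ξ < w then S.Omk ξ else S.OmNeg ξ

/-- The similarity function `Ω(ξ)` for `0 ≤ ξ` (that is, for `t > 0`). -/
def Profile.OmegaPos (S : Profile) (ξ : ℝ) : ℝ :=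
  if ξ < S.xiS then S.OmPos ξ else S.Omtilde ξ

/-- The radial velocity `u(t, r) = U(r / t)`. -/
def Profile.velocity (S : Profile) (a : ℝ) (m : ℕ) (β : ℝ) (t r : ℝ) : ℝ :=
  if t = 0 then S.Ustar else S.U (xiW a m β) (r / t)

/-- The radial density `ρ(t, r) = sgn(t) |t|^β Ω(r / t)`. -/
def Profile.density (S : Profile) (a : ℝ) (m : ℕ) (β : ℝ) (t r : ℝ) : ℝ :=
  if t < 0 then -(|t| ^ β * S.OmegaNeg (xiW a m β) (r / t))
  else if t = 0 then |S.C| * r ^ β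
  else |t| ^ β * S.OmegaPos (r / t)

end IsothermalEuler

end

open IsothermalEuler

/-!
The similarity equation for `U` is a scalar equation in the `(ξ, U)` plane which is singular on the
lines `|U - ξ| = a` and on `ξ = 0`. Scaling `ξ` and `U` reduces it to sound speed `1`, and
`β = m (s - 1)` with `0 < s < 1` places `P_w` at `ξ = -1/s`, where it is a node with the two slopes
`1 - λ₊` and `1 - λ₋`.

*The kink and its continuation.* An orbit with the steep slope exists by a contraction argument at
the singular point (`exists_steep_orbit`), and it separates: no orbit above it enters `P_w`
(`not_tendsto_zero_of_steep`). So the kink is unique (`IsKink.eqOn`). In the variable `ζ = 1 / ξ`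
the equation is regular at `ζ = 0` (`zetaField`), and the kink passes through `ξ = ∞` with the
finite value `U*` (`exists_maximal_kink`). If `U* < 0`, the continuation stays below the reflected
kink, which is the steep orbit into `-P_w`; since that orbit separates, the continuation misses
`-P_w` and reaches the line `U = ξ - a` at some `0 < ξ < -ξ_w` (`SolvesIn.lt_reflected`,
`exists_tilde`). For `β = -m/2` an explicit straight line above the kink shows that `U* < 0`
(`kink_limit_neg_of_half`).

*The inner solution and the shock.* The orbit through the origin is trapped in a triangle bounded
by a nullcline and the sonic line and ends in its corner `-P_w` (`exists_hat_orbit`); its odd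
extension joins `P_w` to `-P_w`. Every such orbit arrives with the flat slope, which attracts
(`hat_tendsto_lamMinus`). The intermediate value theorem places the shock (`exists_shock`). The
density profile is the exponential of an explicit primitive (`exists_exponent`), and is of size
`|ξ|^β` at infinity because `Ω' / Ω = β / ξ + O(ξ⁻²)` there (`exists_tendsto_exponent_sub_log`).

*The weak formulation.* The system is invariant under `(t, u) ↦ (-t, -u)`, so both halves `t < 0`
and `t > 0` are instances of one notion of expanding similarity flow (`SimilarityFlow`), with one
break in its profile across which the fluxes of mass and momentum are continuous: they are so
trivially at the kink and by the Rankine-Hugoniot relations at the shock. In the variable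
`σ = r / |t|` the two laws are ordinary differential equations with continuous fluxes. Tested
against `ψ(t, ·)` they give the time derivative of `∫ ρ ψ r^m dr` (`hasDerivAt_integral_mul_test`),
and this integral is continuous across `t = 0`, as both halves have the same asymptotics at `σ = ∞`
and are dominated by `r^β` with `β > -m`. Integration in time gives the weak identities
(`integral_balance`).

*Several space dimensions.* In polar coordinates the mass law is the radial law along each ray. For
the `i`-th component of the momentum law the test function along the ray of direction `ω` is
`ω_i φ(t, r ω)`; what remains is the pressure times a tangential expression, whose mean over each
sphere vanishes (`integral_sphere_tangential`, `integral_momentum_space`).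

*The density* satisfies `ρ ≥ c (|t| + r)^β` (`exists_lower_bound`), which gives positivity and, as
`β < 0`, the blow-up at the origin.
-/

namespace IsothermalEuler

/-! ### Scalar ordinary differential equations: uniqueness and continuation -/

/-- `y` solves the scalar equation `y' = F (t, y)` on `J`, with its graph over `J` inside the
domain `O`. -/
def SolvesIn (F : ℝ × ℝ → ℝ) (O : Set (ℝ × ℝ)) (y : ℝ → ℝ) (J : Set ℝ) : Prop :=
  ∀ t ∈ J, (t, y t) ∈ O ∧ HasDerivAt y (F (t, y t)) t

lemma SolvesIn.mono {F : ℝ × ℝ → ℝ} {O : Set (ℝ × ℝ)} {y : ℝ → ℝ} {J J' : Set ℝ}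
    (h : SolvesIn F O y J) (hJ : J' ⊆ J) : SolvesIn F O y J' := fun t ht => h t (hJ ht)

lemma SolvesIn.congr_of_eventuallyEq {F : ℝ × ℝ → ℝ} {O : Set (ℝ × ℝ)} {y z : ℝ → ℝ} {t : ℝ}
    (h : (t, y t) ∈ O ∧ HasDerivAt y (F (t, y t)) t) (hz : z =ᶠ[𝓝 t] y) :
    (t, z t) ∈ O ∧ HasDerivAt z (F (t, z t)) t := by
  rw [hz.eq_of_nhds]
  exact ⟨h.1, h.2.congr_of_eventuallyEq hz⟩

lemma SolvesIn.eqOn {F : ℝ × ℝ → ℝ} {O : Set (ℝ × ℝ)} (hO : IsOpen O) (hF : ContDiffOn ℝ 1 F O)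
    {y z : ℝ → ℝ} {J : Set ℝ} (hJo : IsOpen J) (hJ : IsPreconnected J) (hy : SolvesIn F O y J)
    (hz : SolvesIn F O z J) {t₀ : ℝ} (ht₀ : t₀ ∈ J) (h : y t₀ = z t₀) : EqOn y z J := by
  have key : ∀ t ∈ J, y t = z t → y =ᶠ[𝓝 t] z := by
    intro t ht hyz
    have hc : ContDiffAt ℝ 1 F (t, y t) := hF.contDiffAt (hO.mem_nhds (hy t ht).1)
    obtain ⟨K, N, hN, hK⟩ := hc.exists_lipschitzOnWith
    have hmem : ∀ w : ℝ → ℝ, SolvesIn F O w J → w t = y t →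
        ∀ᶠ τ in 𝓝 t, HasDerivAt w (F (τ, w τ)) τ ∧ w τ ∈ {u | (τ, u) ∈ N} := by
      intro w hw hwt
      have hcont : ContinuousAt (fun τ => (τ, w τ)) t :=
        continuousAt_id.prodMk (hw t ht).2.continuousAt
      have h1 : ∀ᶠ τ in 𝓝 t, (τ, w τ) ∈ N := hcont (by simpa [hwt] using hN)
      filter_upwards [h1, hJo.mem_nhds ht] with τ h1 h2
      exact ⟨(hw τ h2).2, h1⟩
    refine ODE_solution_unique_of_eventually (v := fun τ u => F (τ, u))
      (s := fun τ => {u | (τ, u) ∈ N}) (K := K) ?_ (hmem y hy rfl) (hmem z hz hyz.symm) hyz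
    refine Eventually.of_forall fun τ => ?_
    rw [lipschitzOnWith_iff_dist_le_mul] at hK ⊢
    intro u hu v hv
    have := hK (τ, u) hu (τ, v) hv
    simpa [Prod.dist_eq] using this
  have hu : IsOpen {t | t ∈ J ∧ y =ᶠ[𝓝 t] z} := hJo.inter (isOpen_setOfPred_eventually_nhds)
  have hsub : J ⊆ {t | t ∈ J ∧ y =ᶠ[𝓝 t] z} := by
    refine hJ.subset_of_closure_inter_subset hu ⟨t₀, ht₀, ht₀, key t₀ ht₀ h⟩ ?_
    rintro t ⟨htc, ht⟩
    refine ⟨ht, key t ht ?_⟩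
    have hd : ContinuousAt (fun τ => y τ - z τ) t :=
      (hy t ht).2.continuousAt.sub (hz t ht).2.continuousAt
    by_contra hne
    have hne' : ∀ᶠ τ in 𝓝 t, y τ - z τ ≠ 0 := hd.eventually_ne (sub_ne_zero.2 hne)
    obtain ⟨τ, hτ, hτ'⟩ := (mem_closure_iff_frequently.1 htc).and_eventually hne' |>.exists
    exact hτ' (sub_eq_zero.2 hτ.2.eq_of_nhds)
  exact fun t ht => (hsub ht).2.eq_of_nhds

lemma exists_local_solution {F : ℝ × ℝ → ℝ} {O : Set (ℝ × ℝ)} (hO : IsOpen O)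
    (hF : ContDiffOn ℝ 1 F O) {t₀ u₀ : ℝ} (h₀ : (t₀, u₀) ∈ O) :
    ∃ (y : ℝ → ℝ) (ε : ℝ), 0 < ε ∧ y t₀ = u₀ ∧ SolvesIn F O y (Ioo (t₀ - ε) (t₀ + ε)) := by
  have hc : ContDiffAt ℝ 1 (fun p : ℝ × ℝ => ((1 : ℝ), F p)) (t₀, u₀) :=
    contDiffAt_const.prodMk (hF.contDiffAt (hO.mem_nhds h₀))
  obtain ⟨γ, hγ0, ε, hε, hγ⟩ :=
    hc.exists_forall_mem_closedBall_exists_eq_forall_mem_Ioo_hasDerivAt₀ t₀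
  have h1 : ∀ t ∈ Ioo (t₀ - ε) (t₀ + ε), HasDerivAt (fun t => (γ t).1) 1 t := by
    intro t ht
    have := (hasFDerivAt_fst (𝕜 := ℝ) (E := ℝ) (F := ℝ) (p := γ t)).comp_hasDerivAt t (hγ t ht)
    exact this
  have h2 : ∀ t ∈ Ioo (t₀ - ε) (t₀ + ε), HasDerivAt (fun t => (γ t).2) (F (γ t)) t := by
    intro t ht
    have := (hasFDerivAt_snd (𝕜 := ℝ) (E := ℝ) (F := ℝ) (p := γ t)).comp_hasDerivAt t (hγ t ht)
    exact this
  have ht₀ : t₀ ∈ Ioo (t₀ - ε) (t₀ + ε) := ⟨by linarith, by linarith⟩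
  have h3 : ∀ t ∈ Ioo (t₀ - ε) (t₀ + ε), (γ t).1 = t := by
    have hsub : ∀ t ∈ Ioo (t₀ - ε) (t₀ + ε), HasDerivAt (fun t => (γ t).1 - t) 0 t :=
      fun t ht => by simpa using (h1 t ht).fun_sub (hasDerivAt_id' t)
    intro t ht
    have := isOpen_Ioo.is_const_of_deriv_eq_zero isPreconnected_Ioo
      (fun t ht => (hsub t ht).differentiableAt.differentiableWithinAt)
      (fun t ht => (hsub t ht).deriv) ht ht₀
    simp only [hγ0] at this
    linarith
  have hcont : ContinuousAt γ t₀ := (hγ t₀ ht₀).continuousAt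
  have hev : ∀ᶠ t in 𝓝 t₀, γ t ∈ O := hcont (by rw [hγ0]; exact hO.mem_nhds h₀)
  obtain ⟨δ, hδ, hδO⟩ := Metric.eventually_nhds_iff_ball.1 hev
  rw [Real.ball_eq_Ioo] at hδO
  have hs1 : Ioo (t₀ - min ε δ) (t₀ + min ε δ) ⊆ Ioo (t₀ - ε) (t₀ + ε) :=
    Ioo_subset_Ioo (by linarith [min_le_left ε δ]) (by linarith [min_le_left ε δ])
  have hs2 : Ioo (t₀ - min ε δ) (t₀ + min ε δ) ⊆ Ioo (t₀ - δ) (t₀ + δ) :=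
    Ioo_subset_Ioo (by linarith [min_le_right ε δ]) (by linarith [min_le_right ε δ])
  refine ⟨fun t => (γ t).2, min ε δ, lt_min hε hδ, by simp [hγ0], fun t ht => ?_⟩
  have e : (t, (γ t).2) = γ t := Prod.ext (h3 t (hs1 ht)).symm rfl
  simp only [e]
  exact ⟨hδO t (hs2 ht), h2 t (hs1 ht)⟩

/-- A solution with a limit inside the domain at the right end of its interval extends across
that end. -/
lemma SolvesIn.extend_right {F : ℝ × ℝ → ℝ} {O : Set (ℝ × ℝ)} (hO : IsOpen O)
    (hF : ContDiffOn ℝ 1 F O) {y : ℝ → ℝ} {A Z u : ℝ} (hAZ : A < Z)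
    (hy : SolvesIn F O y (Ioo A Z)) (hu : Tendsto y (𝓝[<] Z) (𝓝 u)) (hZ : (Z, u) ∈ O) :
    ∃ (Y : ℝ → ℝ) (Z' : ℝ), Z < Z' ∧ SolvesIn F O Y (Ioo A Z') ∧ EqOn Y y (Ioo A Z) := by
  obtain ⟨α, ε, hε, hα0, hα⟩ := exists_local_solution hO hF hZ
  set Y : ℝ → ℝ := fun t => if t < Z then y t else α t with hY
  have hYy : ∀ t < Z, Y t = y t := fun t ht => by simp [hY, ht]
  have hYα : ∀ t, Z ≤ t → Y t = α t := fun t ht => by simp [hY, not_lt.2 ht]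
  refine ⟨Y, Z + ε, by linarith, fun t ht => ?_, fun t ht => hYy t ht.2⟩
  rcases lt_trichotomy t Z with h | h | h
  · refine SolvesIn.congr_of_eventuallyEq (hy t ⟨ht.1, h⟩) ?_
    filter_upwards [Iio_mem_nhds h] with τ hτ using hYy τ hτ
  · subst h
    have hαt := hα t ⟨by linarith, by linarith⟩
    have hYt : Y t = u := by rw [hYα t le_rfl, hα0]
    refine ⟨by rwa [hYt], ?_⟩
    have hright : HasDerivWithinAt Y (F (t, Y t)) (Ici t) t := by
      have := hαt.2.hasDerivWithinAt (s := Ici t)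
      rw [← hYα t le_rfl] at this
      exact this.congr (fun τ hτ => hYα τ hτ) (hYα t le_rfl)
    have hlim : Tendsto (fun τ => F (τ, y τ)) (𝓝[<] t) (𝓝 (F (t, u))) := by
      have hc : ContinuousAt F (t, u) := (hF.continuousOn.continuousAt (hO.mem_nhds hZ))
      exact hc.tendsto.comp ((tendsto_nhdsWithin_of_tendsto_nhds tendsto_id).prodMk_nhds hu)
    have hleft : HasDerivWithinAt Y (F (t, Y t)) (Iic t) t := by
      rw [hYt]
      have hd : ∀ τ ∈ Ioo A t, HasDerivAt Y (F (τ, y τ)) τ := fun τ hτ =>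
        (hy τ hτ).2.congr_of_eventuallyEq
          (by filter_upwards [Iio_mem_nhds hτ.2] with σ hσ using hYy σ hσ)
      refine hasDerivWithinAt_Iic_of_tendsto_deriv (s := Ioo A t)
        (fun τ hτ => (hd τ hτ).differentiableAt.differentiableWithinAt) ?_
        (Ioo_mem_nhdsLT hAZ) ?_
      · refine ContinuousWithinAt.mono ?_ Ioo_subset_Iio_self
        rw [ContinuousWithinAt, hYt]
        refine hu.congr' ?_
        filter_upwards [self_mem_nhdsWithin] with τ hτ using (hYy τ hτ).symm
      · refine hlim.congr' ?_
        filter_upwards [Ioo_mem_nhdsLT hAZ] with τ hτ using ((hd τ hτ).deriv).symm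
    have := hleft.union hright
    rwa [Iic_union_Ici, hasDerivWithinAt_univ] at this
  · refine SolvesIn.congr_of_eventuallyEq (hα t ⟨by linarith, ht.2⟩) ?_
    filter_upwards [Ioi_mem_nhds h] with τ hτ using hYα τ (le_of_lt hτ)

/-- Maximal continuation to the right: the extended solution is either global, or has no limit
inside the domain at the right end of its interval of existence. -/
lemma SolvesIn.exists_maximal {F : ℝ × ℝ → ℝ} {O : Set (ℝ × ℝ)} (hO : IsOpen O)
    (hF : ContDiffOn ℝ 1 F O) {y : ℝ → ℝ} {A B : ℝ} (hAB : A < B)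
    (hy : SolvesIn F O y (Ioo A B)) :
    ∃ Y : ℝ → ℝ, EqOn Y y (Ioo A B) ∧ (SolvesIn F O Y (Ioi A) ∨
      ∃ Z, B ≤ Z ∧ SolvesIn F O Y (Ioo A Z) ∧
        ∀ u, Tendsto Y (𝓝[<] Z) (𝓝 u) → (Z, u) ∉ O) := by
  classical
  let S : Set ℝ := {T | B ≤ T ∧ ∃ Y, SolvesIn F O Y (Ioo A T) ∧ EqOn Y y (Ioo A B)}
  have hBS : B ∈ S := ⟨le_rfl, y, hy, fun _ _ => rfl⟩
  have hch : ∀ T : ℝ, ∃ Y : ℝ → ℝ, T ∈ S → SolvesIn F O Y (Ioo A T) ∧ EqOn Y y (Ioo A B) := by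
    intro T
    by_cases hT : T ∈ S
    · obtain ⟨_, Y, hY⟩ := hT
      exact ⟨Y, fun _ => hY⟩
    · exact ⟨y, fun h => absurd h hT⟩
  choose G hG using hch
  obtain ⟨t₁, ht₁⟩ := nonempty_Ioo.2 hAB
  have hcons : ∀ T ∈ S, ∀ T' ∈ S, T ≤ T' → EqOn (G T) (G T') (Ioo A T) := by
    intro T hT T' hT' hle
    refine SolvesIn.eqOn hO hF isOpen_Ioo isPreconnected_Ioo (hG T hT).1
      ((hG T' hT').1.mono (Ioo_subset_Ioo_right hle))
      (t₀ := t₁) ⟨ht₁.1, ht₁.2.trans_le hT.1⟩ ?_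
    rw [(hG T hT).2 ht₁, (hG T' hT').2 ht₁]
  let Y : ℝ → ℝ := fun t => if h : ∃ T ∈ S, t < T then G h.choose t else 0
  have hYG : ∀ T ∈ S, EqOn Y (G T) (Ioo A T) := by
    intro T hT t ht
    have h : ∃ T ∈ S, t < T := ⟨T, hT, ht.2⟩
    have hs := h.choose_spec
    have : Y t = G h.choose t := dif_pos h
    rw [this]
    rcases le_total h.choose T with hle | hle
    · exact hcons _ hs.1 _ hT hle ⟨ht.1, hs.2⟩
    · exact (hcons _ hT _ hs.1 hle ht).symm
  have hYsol : ∀ T ∈ S, SolvesIn F O Y (Ioo A T) := by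
    intro T hT t ht
    refine SolvesIn.congr_of_eventuallyEq ((hG T hT).1 t ht) ?_
    filter_upwards [isOpen_Ioo.mem_nhds ht] with τ hτ using hYG T hT hτ
  have hYy : EqOn Y y (Ioo A B) := fun t ht => by rw [hYG B hBS ht, (hG B hBS).2 ht]
  refine ⟨Y, hYy, ?_⟩
  by_cases hbdd : BddAbove S
  · right
    have hBZ : B ≤ sSup S := le_csSup hbdd hBS
    have hsol : SolvesIn F O Y (Ioo A (sSup S)) := by
      intro t ht
      obtain ⟨T, hT, htT⟩ := exists_lt_of_lt_csSup ⟨B, hBS⟩ ht.2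
      exact hYsol T hT t ⟨ht.1, htT⟩
    refine ⟨sSup S, hBZ, hsol, fun u hu hmem => ?_⟩
    obtain ⟨X, Z', hZ', hX, hXY⟩ := SolvesIn.extend_right hO hF (hAB.trans_le hBZ) hsol hu hmem
    have : Z' ∈ S := ⟨by linarith, X, hX, fun t ht => by
      rw [hXY ⟨ht.1, ht.2.trans_le hBZ⟩, hYy ht]⟩
    linarith [le_csSup hbdd this]
  · left
    intro t ht
    rw [not_bddAbove_iff] at hbdd
    obtain ⟨T, hT, htT⟩ := hbdd t
    exact hYsol T hT t ⟨ht, htT⟩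

/-! ### Scalar equations with a regular singular point -/

lemma integral_rpow_sub_one {k : ℝ} (hk : 0 < k) : ∫ σ in (0 : ℝ)..1, σ ^ (k - 1) = 1 / k := by
  rw [integral_rpow (Or.inl (by linarith))]
  simp [hk.ne']

/-- The contraction whose fixed point solves `τ δ' = -k δ + N (τ, δ)`: variation of constants
from `τ = 0`, after the substitution `ρ = τ σ`. -/
lemma exists_integral_fixedPoint {k : ℝ} (hk : 0 < k) {N : ℝ × ℝ → ℝ} (hN : Continuous N)
    {M : ℝ} (hM : ∀ p, |N p| ≤ M) (hL : ∀ τ x y, |N (τ, x) - N (τ, y)| ≤ k / 2 * |x - y|) :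
    ∃ δ : ℝ → ℝ, Continuous δ ∧
      ∀ τ, δ τ = ∫ σ in (0 : ℝ)..1, σ ^ (k - 1) * N (τ * σ, δ (τ * σ)) := by
  have hint : IntervalIntegrable (fun σ : ℝ => σ ^ (k - 1)) volume 0 1 :=
    intervalIntegral.intervalIntegrable_rpow' (by linarith)
  have hmeas : ∀ (δ : ℝ → ℝ), Continuous δ → ∀ τ : ℝ, AEStronglyMeasurable
      (fun σ : ℝ => σ ^ (k - 1) * N (τ * σ, δ (τ * σ))) (volume.restrict (uIoc 0 1)) := by
    intro δ hδ τ
    have h1 : Measurable (fun σ : ℝ => σ ^ (k - 1)) := by fun_prop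
    have h2 : Continuous (fun σ : ℝ => N (τ * σ, δ (τ * σ))) := by fun_prop
    exact (h1.mul h2.measurable).aestronglyMeasurable
  have hle : ∀ (δ : ℝ → ℝ) (τ : ℝ), ∀ σ ∈ uIoc (0 : ℝ) 1,
      ‖σ ^ (k - 1) * N (τ * σ, δ (τ * σ))‖ ≤ σ ^ (k - 1) * M := by
    intro δ τ σ hσ
    rw [uIoc_of_le zero_le_one] at hσ
    rw [norm_mul, Real.norm_of_nonneg (Real.rpow_nonneg hσ.1.le _)]
    exact mul_le_mul_of_nonneg_left (hM _) (Real.rpow_nonneg hσ.1.le _)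
  have hii : ∀ (δ : ℝ → ℝ), Continuous δ → ∀ τ : ℝ, IntervalIntegrable
      (fun σ : ℝ => σ ^ (k - 1) * N (τ * σ, δ (τ * σ))) volume 0 1 := by
    intro δ hδ τ
    refine (hint.mul_const M).mono_fun (hmeas δ hδ τ) ?_
    refine (ae_restrict_mem measurableSet_uIoc).mono fun σ hσ => ?_
    exact (hle δ τ σ hσ).trans (Real.le_norm_self _)
  have hcont : ∀ (δ : ℝ → ℝ), Continuous δ →
      Continuous fun τ => ∫ σ in (0 : ℝ)..1, σ ^ (k - 1) * N (τ * σ, δ (τ * σ)) := by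
    intro δ hδ
    refine intervalIntegral.continuous_of_dominated_interval (hmeas δ hδ)
      (fun τ => Eventually.of_forall (hle δ τ)) (hint.mul_const M) ?_
    exact Eventually.of_forall fun σ _ => by fun_prop
  have hbound : ∀ (δ : ℝ → ℝ) (τ : ℝ),
      ‖∫ σ in (0 : ℝ)..1, σ ^ (k - 1) * N (τ * σ, δ (τ * σ))‖ ≤ 1 / k * M := by
    intro δ τ
    rw [← integral_rpow_sub_one hk, ← intervalIntegral.integral_mul_const]
    refine intervalIntegral.norm_integral_le_of_norm_le zero_le_one ?_ (hint.mul_const M)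
    exact Eventually.of_forall fun σ hσ => hle δ τ σ (by rwa [uIoc_of_le zero_le_one])
  let T : BoundedContinuousFunction ℝ ℝ → BoundedContinuousFunction ℝ ℝ := fun δ =>
    BoundedContinuousFunction.ofNormedAddCommGroup
      (fun τ => ∫ σ in (0 : ℝ)..1, σ ^ (k - 1) * N (τ * σ, δ (τ * σ)))
      (hcont δ δ.continuous) (1 / k * M) (hbound δ)
  have hT : ContractingWith (1 / 2) T := by
    refine ⟨by norm_num [← NNReal.coe_lt_coe], LipschitzWith.of_dist_le_mul fun δ δ' => ?_⟩
    refine (BoundedContinuousFunction.dist_le (by positivity)).2 fun τ => ?_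
    change dist (∫ σ in (0 : ℝ)..1, σ ^ (k - 1) * N (τ * σ, δ (τ * σ)))
      (∫ σ in (0 : ℝ)..1, σ ^ (k - 1) * N (τ * σ, δ' (τ * σ))) ≤ _
    rw [dist_eq_norm, ← intervalIntegral.integral_sub (hii δ δ.continuous τ)
      (hii δ' δ'.continuous τ)]
    have e : ((1 / 2 : NNReal) : ℝ) * dist δ δ'
        = ∫ σ in (0 : ℝ)..1, σ ^ (k - 1) * (k / 2 * dist δ δ') := by
      rw [intervalIntegral.integral_mul_const, integral_rpow_sub_one hk]
      push_cast
      field_simp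
    rw [e]
    refine intervalIntegral.norm_integral_le_of_norm_le zero_le_one ?_ (hint.mul_const _)
    refine Eventually.of_forall fun σ hσ => ?_
    rw [← mul_sub, norm_mul, Real.norm_of_nonneg (Real.rpow_nonneg hσ.1.le _)]
    refine mul_le_mul_of_nonneg_left ?_ (Real.rpow_nonneg hσ.1.le _)
    refine (hL _ _ _).trans (mul_le_mul_of_nonneg_left ?_ (by positivity))
    exact BoundedContinuousFunction.dist_coe_le_dist (f := δ) (g := δ') (τ * σ)
  obtain ⟨δ, hδ⟩ : ∃ δ, T δ = δ := ⟨_, hT.fixedPoint_isFixedPt⟩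
  exact ⟨δ, δ.continuous, fun τ => (DFunLike.congr_fun hδ τ).symm⟩

lemma hasDerivAt_of_integral_fixedPoint {k : ℝ} (hk : 0 < k) {N : ℝ × ℝ → ℝ} (hN : Continuous N)
    {δ : ℝ → ℝ} (hδ : Continuous δ)
    (h : ∀ τ, δ τ = ∫ σ in (0 : ℝ)..1, σ ^ (k - 1) * N (τ * σ, δ (τ * σ))) {τ : ℝ} (hτ : 0 < τ) :
    HasDerivAt δ ((-k * δ τ + N (τ, δ τ)) / τ) τ := by
  set f : ℝ → ℝ := fun ρ => ρ ^ (k - 1) * N (ρ, δ ρ) with hf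
  have hNc : Continuous fun ρ => N (ρ, δ ρ) := by fun_prop
  have hfi : ∀ t, IntervalIntegrable f volume 0 t := fun t =>
    (intervalIntegral.intervalIntegrable_rpow' (by linarith)).mul_continuousOn hNc.continuousOn
  have hrep : ∀ t, 0 < t → δ t = t ^ (-k) * ∫ ρ in (0 : ℝ)..t, f ρ := by
    intro t ht
    have h1 : ∫ σ in (0 : ℝ)..1, f (t * σ) = t⁻¹ * ∫ ρ in (0 : ℝ)..t, f ρ := by
      rw [intervalIntegral.integral_comp_mul_left _ ht.ne']
      simp
    have h2 : ∫ σ in (0 : ℝ)..1, f (t * σ)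
        = t ^ (k - 1) * ∫ σ in (0 : ℝ)..1, σ ^ (k - 1) * N (t * σ, δ (t * σ)) := by
      rw [← intervalIntegral.integral_const_mul]
      refine intervalIntegral.integral_congr fun σ hσ => ?_
      rw [uIcc_of_le zero_le_one] at hσ
      simp only [hf]
      rw [Real.mul_rpow ht.le hσ.1, mul_assoc]
    rw [← h t, h1] at h2
    have h3 : t ^ (-k) * t = (t ^ (k - 1))⁻¹ := by
      rw [← Real.rpow_neg ht.le, ← Real.rpow_add_one ht.ne']
      congr 1
      ring
    have h4 : t ^ (k - 1) ≠ 0 := (Real.rpow_pos_of_pos ht _).ne'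
    have h5 : ∫ ρ in (0 : ℝ)..t, f ρ = t * (t ^ (k - 1) * δ t) := by
      rw [← h2]
      field_simp
    rw [h5, ← mul_assoc, h3]
    field_simp
  have hfc : ContinuousAt f τ :=
    (Real.continuousAt_rpow_const _ _ (Or.inl hτ.ne')).mul hNc.continuousAt
  have hfm : StronglyMeasurableAtFilter f (𝓝 τ) := by
    have h1 : Measurable (fun σ : ℝ => σ ^ (k - 1)) := by fun_prop
    exact (h1.mul hNc.measurable).stronglyMeasurable.stronglyMeasurableAtFilter
  have hd : HasDerivAt (fun t => ∫ ρ in (0 : ℝ)..t, f ρ) (f τ) τ :=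
    intervalIntegral.integral_hasDerivAt_right (hfi τ) hfm hfc
  have hp : HasDerivAt (fun t : ℝ => t ^ (-k)) (-k * τ ^ (-k - 1)) τ :=
    Real.hasDerivAt_rpow_const (Or.inl hτ.ne')
  have hprod := (hp.fun_mul hd).congr_of_eventuallyEq
    (by filter_upwards [Ioi_mem_nhds hτ] with t ht using hrep t ht)
  refine hprod.congr_deriv ?_
  have e1 : τ ^ (-k - 1) = τ ^ (-k) / τ := Real.rpow_sub_one hτ.ne' _
  have e2 : τ ^ (-k) * τ ^ (k - 1) = 1 / τ := by
    rw [← Real.rpow_add hτ, one_div, ← Real.rpow_neg_one]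
    congr 1
    ring
  have e3 : τ ^ (-k) * f τ = N (τ, δ τ) / τ := by
    simp only [hf]
    rw [← mul_assoc, e2]
    ring
  have e4 : -k * τ ^ (-k - 1) * ∫ ρ in (0 : ℝ)..τ, f ρ = -k * δ τ / τ := by
    rw [e1, hrep τ hτ]
    ring
  rw [e3, e4]
  ring

/-- The equation `τ κ' = G (τ, κ)` has a solution which tends to `κ₀` as `τ → 0+` if
`G (0, κ₀) = 0` and `∂G/∂κ (0, κ₀) < 0`. -/
lemma exists_solution_singular {G : ℝ × ℝ → ℝ} {κ₀ k : ℝ} (hk : 0 < k)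
    (hG : ContDiffAt ℝ 1 G (0, κ₀)) (h0 : G (0, κ₀) = 0)
    (hd : HasDerivAt (fun κ => G (0, κ)) (-k) κ₀) :
    ∃ h > 0, ∃ κ : ℝ → ℝ, (∀ τ ∈ Ioo 0 h, HasDerivAt κ (G (τ, κ τ) / τ) τ) ∧
      Tendsto κ (𝓝[>] 0) (𝓝 κ₀) := by
  have hs := hG.hasStrictFDerivAt one_ne_zero
  set L := fderiv ℝ G (0, κ₀) with hLdef
  have hL1 : L (0, 1) = -k := by
    have hpath : HasDerivAt (fun κ : ℝ => ((0 : ℝ), κ)) (0, 1) κ₀ :=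
      (hasDerivAt_const _ _).prodMk (hasDerivAt_id _)
    exact (hs.hasFDerivAt.comp_hasDerivAt κ₀ hpath).unique hd
  have hL2 : ∀ x : ℝ, L (0, x) = -k * x := by
    intro x
    have : ((0 : ℝ), x) = x • ((0 : ℝ), (1 : ℝ)) := by simp
    rw [this, map_smul, hL1, smul_eq_mul]
    ring
  have hev1 : ∀ᶠ p : (ℝ × ℝ) × ℝ × ℝ in 𝓝 ((0, κ₀), (0, κ₀)),
      ‖G p.1 - G p.2 - L (p.1 - p.2)‖ ≤ k / 2 * ‖p.1 - p.2‖ :=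
    hs.isLittleO.def (by positivity)
  have hev2 : ∀ᶠ p in 𝓝 ((0 : ℝ), κ₀), ContinuousAt G p :=
    (hG.eventually (by simp)).mono fun p hp => hp.continuousAt
  obtain ⟨r₁, hr₁, hb1⟩ := Metric.eventually_nhds_iff.1 hev1
  obtain ⟨r₂, hr₂, hb2⟩ := Metric.eventually_nhds_iff.1 hev2
  obtain ⟨r, hr, hrr⟩ := exists_between (lt_min hr₁ hr₂)
  have hr₁' := hrr.trans_le (min_le_left _ _)
  have hr₂' := hrr.trans_le (min_le_right _ _)
  have hrr' : -r ≤ r := by linarith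
  -- Clamping both variables to `[-r, r]` makes the nonlinear remainder `N` of `G` globally bounded
  -- with Lipschitz constant `k / 2`; the fixed point then stays inside the box for small `τ`.
  set c : ℝ → ℝ := fun x => (projIcc (-r) r hrr' x : ℝ) with hc
  have hcc : Continuous c := continuous_subtype_val.comp continuous_projIcc
  have hcr : ∀ x, |c x| ≤ r := fun x => abs_le.2 (projIcc (-r) r hrr' x).2
  have hcl : ∀ x y, |c x - c y| ≤ |x - y| := fun x y => by
    have := (LipschitzWith.projIcc hrr').dist_le_mul x y
    simpa [Subtype.dist_eq, Real.dist_eq] using this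
  have hcid : ∀ x, |x| ≤ r → c x = x := fun x hx => by
    simp only [hc, projIcc_of_mem hrr' (abs_le.1 hx)]
  have hnear : ∀ x y : ℝ, dist (c x, κ₀ + c y) (0, κ₀) ≤ r := fun x y => by
    rw [Prod.dist_eq]
    simp only [Real.dist_eq, sub_zero, add_sub_cancel_left]
    exact max_le (hcr x) (hcr y)
  set N : ℝ × ℝ → ℝ := fun p => G (c p.1, κ₀ + c p.2) + k * c p.2 with hN
  have hNc : Continuous N := by
    rw [continuous_iff_continuousAt]
    intro p
    have h1 : ContinuousAt G (c p.1, κ₀ + c p.2) := hb2 ((hnear _ _).trans_lt hr₂')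
    have h2 : ContinuousAt (fun p : ℝ × ℝ => (c p.1, κ₀ + c p.2)) p := by fun_prop
    have h3 : ContinuousAt (fun p : ℝ × ℝ => k * c p.2) p := by fun_prop
    exact (ContinuousAt.comp (f := fun p : ℝ × ℝ => (c p.1, κ₀ + c p.2)) h1 h2).add h3
  have hcN : ∀ p : ℝ × ℝ, N p = N (c p.1, c p.2) := fun p => by
    simp only [hN, hcid _ (hcr _)]
  obtain ⟨M, hM⟩ : ∃ M, ∀ p, |N p| ≤ M := by
    obtain ⟨M, hM⟩ := (isCompact_Icc (a := -r) (b := r)).prod (isCompact_Icc (a := -r) (b := r))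
      |>.exists_bound_of_continuousOn hNc.continuousOn
    refine ⟨M, fun p => ?_⟩
    rw [hcN]
    exact hM _ ⟨abs_le.1 (hcr _), abs_le.1 (hcr _)⟩
  have hNL : ∀ τ x y, |N (τ, x) - N (τ, y)| ≤ k / 2 * |x - y| := by
    intro τ x y
    have h1 := @hb1 ((c τ, κ₀ + c x), (c τ, κ₀ + c y)) (by
      rw [Prod.dist_eq]
      exact max_lt ((hnear _ _).trans_lt hr₁') ((hnear _ _).trans_lt hr₁'))
    simp only [Prod.mk_sub_mk, sub_self, add_sub_add_left_eq_sub, hL2, Prod.norm_def, norm_zero,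
      Real.norm_eq_abs] at h1
    rw [max_eq_right (abs_nonneg _)] at h1
    calc |N (τ, x) - N (τ, y)|
        = |G (c τ, κ₀ + c x) - G (c τ, κ₀ + c y) - -k * (c x - c y)| := by
          simp only [hN]
          congr 1
          ring
      _ ≤ k / 2 * |c x - c y| := h1
      _ ≤ k / 2 * |x - y| := mul_le_mul_of_nonneg_left (hcl x y) (by positivity)
  obtain ⟨δ, hδc, hδ⟩ := exists_integral_fixedPoint hk hNc hM hNL
  have hN0 : N (0, 0) = 0 := by
    simp [hN, hcid 0 (by simpa using hr.le), h0]
  have hδ0 : δ 0 = 0 := by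
    have h1 := hδ 0
    simp only [zero_mul, intervalIntegral.integral_mul_const, integral_rpow_sub_one hk] at h1
    have h2 := hNL 0 (δ 0) 0
    rw [hN0, sub_zero, sub_zero] at h2
    have h3 : |N (0, δ 0)| = k * |δ 0| := by
      have h4 : N (0, δ 0) = k * δ 0 := by
        conv_rhs => rw [h1]
        field_simp
      rw [h4, abs_mul, abs_of_pos hk]
    have h4 : k / 2 * |δ 0| ≤ 0 := by nlinarith
    have h5 : 0 ≤ |δ 0| := abs_nonneg _
    have h6 : |δ 0| = 0 := by
      by_contra hne
      have : 0 < |δ 0| := lt_of_le_of_ne h5 (Ne.symm hne)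
      have : 0 < k / 2 * |δ 0| := by positivity
      linarith
    exact abs_eq_zero.1 h6
  have hev3 : ∀ᶠ τ in 𝓝 (0 : ℝ), |δ τ| < r := by
    have : Tendsto (fun τ => |δ τ|) (𝓝 0) (𝓝 |δ 0|) := (hδc.abs).continuousAt
    rw [hδ0, abs_zero] at this
    exact this.eventually (Iio_mem_nhds hr)
  obtain ⟨h₁, hh₁, hh⟩ := Metric.eventually_nhds_iff.1 hev3
  refine ⟨min h₁ r, lt_min hh₁ hr, fun τ => κ₀ + δ τ, fun τ hτ => ?_, ?_⟩
  · have h1 : |δ τ| ≤ r := (hh (by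
      rw [Real.dist_eq, sub_zero, abs_of_pos hτ.1]
      exact hτ.2.trans_le (min_le_left _ _))).le
    have h2 : |τ| ≤ r := by
      rw [abs_of_pos hτ.1]
      exact (hτ.2.trans_le (min_le_right _ _)).le
    have h3 := (hasDerivAt_of_integral_fixedPoint hk hNc hδc hδ hτ.1).const_add κ₀
    refine h3.congr_deriv ?_
    simp only [hN, hcid _ h1, hcid _ h2]
    ring
  · have : Tendsto (fun τ => κ₀ + δ τ) (𝓝 0) (𝓝 (κ₀ + δ 0)) :=
      (continuous_const.add hδc).continuousAt
    rw [hδ0, add_zero] at this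
    exact tendsto_nhdsWithin_of_tendsto_nhds this

/-! ### Monotonicity, attraction and separation near a singular point -/

lemma monotoneOn_of_hasDerivAt {f f' : ℝ → ℝ} {D : Set ℝ} (hD : Convex ℝ D)
    (hf : ∀ x ∈ D, HasDerivAt f (f' x) x) (h : ∀ x ∈ D, 0 ≤ f' x) : MonotoneOn f D :=
  monotoneOn_of_deriv_nonneg hD (fun x hx => (hf x hx).continuousAt.continuousWithinAt)
    (fun x hx => (hf x (interior_subset hx)).differentiableAt.differentiableWithinAt)
    (fun x hx => by rw [(hf x (interior_subset hx)).deriv]; exact h x (interior_subset hx))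

lemma antitoneOn_of_hasDerivAt {f f' : ℝ → ℝ} {D : Set ℝ} (hD : Convex ℝ D)
    (hf : ∀ x ∈ D, HasDerivAt f (f' x) x) (h : ∀ x ∈ D, f' x ≤ 0) : AntitoneOn f D :=
  antitoneOn_of_deriv_nonpos hD (fun x hx => (hf x hx).continuousAt.continuousWithinAt)
    (fun x hx => (hf x (interior_subset hx)).differentiableAt.differentiableWithinAt)
    (fun x hx => by rw [(hf x (interior_subset hx)).deriv]; exact h x (interior_subset hx))

/-- If `τ θ' = G` and `G ≥ c > 0` wherever `θ ≥ L`, then a `θ` bounded below is eventually below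
`L` as `τ → 0+`: otherwise it would decrease at least as fast as `c log τ`. -/
lemma eventually_lt_of_singular {θ G : ℝ → ℝ} {τ₀ L A : ℝ} (hτ₀ : 0 < τ₀)
    (hd : ∀ τ ∈ Ioo 0 τ₀, HasDerivAt θ (G τ / τ) τ) (hb : ∀ τ ∈ Ioo 0 τ₀, A ≤ θ τ)
    {c : ℝ} (hc : 0 < c) (hG : ∀ᶠ τ in 𝓝[>] 0, L ≤ θ τ → c ≤ G τ) :
    ∀ᶠ τ in 𝓝[>] 0, θ τ < L := by
  obtain ⟨τ₁, hτ₁, hG'⟩ := mem_nhdsGT_iff_exists_Ioo_subset.1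
    (hG.and (Ioo_mem_nhdsGT hτ₀))
  have hτ₁' : (0 : ℝ) < τ₁ := hτ₁
  have hex : ∃ τ ∈ Ioo 0 τ₁, θ τ < L := by
    by_contra! hcon
    have hmono : MonotoneOn (fun τ => θ τ - c * Real.log τ) (Ioo 0 τ₁) := by
      refine monotoneOn_of_hasDerivAt (f' := fun τ => G τ / τ - c * τ⁻¹) (convex_Ioo _ _)
        (fun τ hτ => (hd τ (hG' hτ).2).fun_sub ((Real.hasDerivAt_log hτ.1.ne').const_mul c))
        fun τ hτ => ?_
      have h1 : c ≤ G τ := (hG' hτ).1 (hcon τ hτ)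
      have h2 : 0 < τ⁻¹ := inv_pos.2 hτ.1
      rw [div_eq_mul_inv, ← sub_mul]
      exact mul_nonneg (by linarith) h2.le
    have hlim : Tendsto (fun τ => c * Real.log τ) (𝓝[>] 0) atBot :=
      Real.tendsto_log_nhdsGT_zero.const_mul_atBot hc
    have hmid : τ₁ / 2 ∈ Ioo 0 τ₁ := ⟨by linarith, by linarith⟩
    have hev := hlim.eventually
      (eventually_lt_atBot (A - (θ (τ₁ / 2) - c * Real.log (τ₁ / 2))))
    obtain ⟨τ, h1, h2⟩ := (hev.and (Ioo_mem_nhdsGT hmid.1)).exists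
    have hmem : τ ∈ Ioo 0 τ₁ := ⟨h2.1, by linarith [h2.2, hmid.2]⟩
    have h3 := hmono hmem hmid h2.2.le
    have h4 := hb τ (hG' hmem).2
    simp only at h3
    linarith
  obtain ⟨τ₂, hτ₂, hlt⟩ := hex
  filter_upwards [Ioo_mem_nhdsGT hτ₂.1] with τ hτ
  by_contra! hge
  have hsub : Icc τ τ₂ ⊆ Ioo 0 τ₁ := fun x hx => ⟨hτ.1.trans_le hx.1, hx.2.trans_lt hτ₂.2⟩
  have := image_le_of_deriv_right_lt_deriv_boundary' (f := fun _ => L) (f' := fun _ => 0)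
    (a := τ) (b := τ₂) continuousOn_const (fun x _ => hasDerivWithinAt_const _ _ _) (B := θ)
    (B' := fun x => G x / x) hge
    (fun x hx => (hd x (hG' (hsub hx)).2).continuousAt.continuousWithinAt)
    (fun x hx => (hd x (hG' (hsub (Ico_subset_Icc_self hx))).2).hasDerivWithinAt)
    (fun x hx he => by
      have hx' := hsub (Ico_subset_Icc_self hx)
      exact div_pos (hc.trans_le ((hG' hx').1 he.le)) hx'.1)
    (right_mem_Icc.2 hτ.2.le)
  exact absurd hlt (not_lt.2 this)

/-- Bounded solutions of `τ θ' = G` tend to `L` as `τ → 0+` if `G` has the sign of `θ - L`,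
uniformly away from `L`: decreasing `τ` then drives `θ` towards `L`. -/
lemma tendsto_of_singular {θ G : ℝ → ℝ} {τ₀ L A B : ℝ} (hτ₀ : 0 < τ₀)
    (hd : ∀ τ ∈ Ioo 0 τ₀, HasDerivAt θ (G τ / τ) τ) (hb : ∀ τ ∈ Ioo 0 τ₀, θ τ ∈ Icc A B)
    (hup : ∀ ε > 0, ∃ c > 0, ∀ᶠ τ in 𝓝[>] 0, L + ε ≤ θ τ → c ≤ G τ)
    (hdown : ∀ ε > 0, ∃ c > 0, ∀ᶠ τ in 𝓝[>] 0, θ τ ≤ L - ε → G τ ≤ -c) :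
    Tendsto θ (𝓝[>] 0) (𝓝 L) := by
  rw [Metric.tendsto_nhds]
  intro ε hε
  obtain ⟨c, hc, h1⟩ := hup ε hε
  obtain ⟨c', hc', h2⟩ := hdown ε hε
  have h3 := eventually_lt_of_singular hτ₀ hd (fun τ hτ => (hb τ hτ).1) hc h1
  have h4 := eventually_lt_of_singular (θ := fun τ => -θ τ) (G := fun τ => -G τ) (L := -(L - ε))
    (A := -B) hτ₀ (fun τ hτ => (hd τ hτ).fun_neg.congr_deriv (neg_div _ _).symm)
    (fun τ hτ => neg_le_neg (hb τ hτ).2) hc' (h2.mono fun τ h h' => by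
      have := h (neg_le_neg_iff.1 h')
      linarith)
  filter_upwards [h3, h4] with τ h3 h4
  rw [Real.dist_eq, abs_lt]
  constructor <;> linarith

/-- The right-hand side of the similarity equation next to `P_w`, for `v = U - ξ - 1` as a
function of `τ = -1/s - ξ` (sound speed `1`). -/
noncomputable def nodeField (M s τ v : ℝ) : ℝ := 1 + M * (1 - s * τ / v) / ((1 / s + τ) * (2 + v))

lemma nodeField_sub_le {M s τ v w : ℝ} (hM : 0 < M) (hs : 0 < s) (hτ : 0 < τ) (hv : s * τ < v)
    (hvw : v ≤ w) :
    nodeField M s τ w - nodeField M s τ v ≤ M * s ^ 2 / 2 * (τ * (w - v) / (v * w)) := by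
  have hv0 : 0 < v := lt_trans (by positivity) hv
  have hw0 : 0 < w := hv0.trans_le hvw
  have hA : 0 < 1 - s * τ / v := by
    rw [sub_pos, div_lt_one hv0]
    exact hv
  have h1 : (1 - s * τ / v) / (2 + w) ≤ (1 - s * τ / v) / (2 + v) :=
    div_le_div_of_nonneg_left hA.le (by linarith) (by linarith)
  have h2 : (1 - s * τ / w) / (2 + w) - (1 - s * τ / v) / (2 + w)
      = s * (τ * (w - v) / (v * w)) / (2 + w) := by
    field_simp
    ring
  have hX : 0 ≤ τ * (w - v) / (v * w) :=
    div_nonneg (mul_nonneg hτ.le (by linarith)) (by positivity)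
  have h3 : s * (τ * (w - v) / (v * w)) / (2 + w) ≤ s * (τ * (w - v) / (v * w)) / 2 :=
    div_le_div_of_nonneg_left (by positivity) (by norm_num) (by linarith)
  have h4 : M / (1 / s + τ) ≤ M * s := by
    rw [div_le_iff₀ (by positivity)]
    have : M * s * (1 / s + τ) = M + M * s * τ := by field_simp
    rw [this]
    linarith [mul_pos (mul_pos hM hs) hτ]
  have h5 : 0 < M / (1 / s + τ) := by positivity
  have h6 : nodeField M s τ w - nodeField M s τ v
      = M / (1 / s + τ) * ((1 - s * τ / w) / (2 + w) - (1 - s * τ / v) / (2 + v)) := by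
    unfold nodeField
    rw [mul_sub (M / (1 / s + τ)), div_mul_div_comm, div_mul_div_comm]
    ring
  rw [h6]
  calc _ ≤ M / (1 / s + τ) * (s * (τ * (w - v) / (v * w)) / 2) :=
        mul_le_mul_of_nonneg_left (by linarith) h5.le
    _ ≤ M * s * (s * (τ * (w - v) / (v * w)) / 2) :=
        mul_le_mul_of_nonneg_right h4 (by positivity)
    _ = _ := by ring

/-- The steep orbit into the node `P_w` separates: an orbit above one that enters with slope at
least `ℓ`, where `ℓ²` exceeds the product of the two eigenvalues, does not enter the node. The
difference `D` would satisfy both `D ≥ c τ ^ k` with `k < 1` and `D ≤ K τ`. -/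
lemma not_tendsto_zero_of_steep {M s ℓ τ₀ : ℝ} {v w : ℝ → ℝ} (hM : 0 < M) (hs : 0 < s)
    (hℓ : 0 < ℓ) (hℓ2 : M * s ^ 2 / 2 < ℓ ^ 2) (hτ₀ : 0 < τ₀)
    (hv : ∀ τ ∈ Ioo 0 τ₀, HasDerivAt v (nodeField M s τ (v τ)) τ)
    (hw : ∀ τ ∈ Ioo 0 τ₀, HasDerivAt w (nodeField M s τ (w τ)) τ)
    (hsv : ∀ τ ∈ Ioo 0 τ₀, s * τ < v τ) (hℓv : ∀ τ ∈ Ioo 0 τ₀, ℓ * τ ≤ v τ)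
    (hvw : ∀ τ ∈ Ioo 0 τ₀, v τ < w τ) : ¬ Tendsto w (𝓝[>] 0) (𝓝 0) := by
  intro hw0
  set P := M * s ^ 2 / 2 with hP
  have hP0 : 0 < P := by positivity
  set k := P / ℓ ^ 2 with hk
  have hk1 : k < 1 := (div_lt_one (by positivity)).2 hℓ2
  have hD : ∀ τ ∈ Ioo 0 τ₀, HasDerivAt (fun τ => w τ - v τ)
      (nodeField M s τ (w τ) - nodeField M s τ (v τ)) τ := fun τ hτ => (hw τ hτ).fun_sub (hv τ hτ)
  have hDle : ∀ τ ∈ Ioo 0 τ₀, nodeField M s τ (w τ) - nodeField M s τ (v τ)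
      ≤ P * (τ * (w τ - v τ) / (v τ * w τ)) := fun τ hτ =>
    nodeField_sub_le hM hs hτ.1 (hsv τ hτ) (hvw τ hτ).le
  have hpos : ∀ τ ∈ Ioo 0 τ₀, 0 < ℓ * τ := fun τ hτ => mul_pos hℓ hτ.1
  -- the lower bound `w - v ≥ c τ ^ k`
  have hanti : AntitoneOn (fun τ => (w τ - v τ) * τ ^ (-k)) (Ioo 0 τ₀) := by
    refine antitoneOn_of_hasDerivAt (convex_Ioo _ _) (fun τ hτ => (hD τ hτ).fun_mul
      (Real.hasDerivAt_rpow_const (p := -k) (Or.inl hτ.1.ne'))) fun τ hτ => ?_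
    have h0 := hpos τ hτ
    have h1 : τ * (w τ - v τ) / (v τ * w τ) ≤ τ * (w τ - v τ) / (ℓ * τ * (ℓ * τ)) := by
      refine div_le_div_of_nonneg_left (mul_nonneg hτ.1.le (by linarith [hvw τ hτ]))
        (by positivity) ?_
      exact mul_le_mul (hℓv τ hτ) ((hℓv τ hτ).trans (hvw τ hτ).le) h0.le (h0.le.trans (hℓv τ hτ))
    have h2 : P * (τ * (w τ - v τ) / (ℓ * τ * (ℓ * τ))) = k * (w τ - v τ) / τ := by
      have := hτ.1.ne'
      rw [hk]
      field_simp
    have h3 : τ ^ (-k - 1) = τ ^ (-k) / τ := Real.rpow_sub_one hτ.1.ne' _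
    have h4 : 0 < τ ^ (-k) := Real.rpow_pos_of_pos hτ.1 _
    have h5 : nodeField M s τ (w τ) - nodeField M s τ (v τ) ≤ k * (w τ - v τ) / τ :=
      (hDle τ hτ).trans (by rw [← h2]; exact mul_le_mul_of_nonneg_left h1 hP0.le)
    rw [h3]
    have h6 := mul_le_mul_of_nonneg_right h5 h4.le
    have h7 : (w τ - v τ) * (-k * (τ ^ (-k) / τ)) = -(k * (w τ - v τ) / τ * τ ^ (-k)) := by ring
    rw [h7]
    linarith
  -- the upper bound `w - v ≤ (P / ℓ) τ`, if both orbits enter the node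
  have hanti2 : AntitoneOn (fun τ => (w τ - v τ) - P / ℓ * τ) (Ioo 0 τ₀) := by
    refine antitoneOn_of_hasDerivAt (convex_Ioo _ _) (fun τ hτ => (hD τ hτ).fun_sub
      ((hasDerivAt_id' τ).const_mul (P / ℓ))) fun τ hτ => ?_
    have h0 := hpos τ hτ
    have hv0 : 0 < v τ := h0.trans_le (hℓv τ hτ)
    have hw0 : 0 < w τ := hv0.trans (hvw τ hτ)
    have h1 : τ * (w τ - v τ) / (v τ * w τ) ≤ 1 / ℓ := by
      rw [div_le_div_iff₀ (by positivity) hℓ]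
      have : τ * (w τ - v τ) * ℓ ≤ v τ * (w τ - v τ) := by
        have := mul_le_mul_of_nonneg_right (hℓv τ hτ) (sub_nonneg.2 (hvw τ hτ).le)
        linarith
      nlinarith
    have h2 := (hDle τ hτ).trans (mul_le_mul_of_nonneg_left h1 hP0.le)
    have : P * (1 / ℓ) = P / ℓ := by ring
    linarith
  have hD0 : Tendsto (fun τ => (w τ - v τ) - P / ℓ * τ) (𝓝[>] 0) (𝓝 0) := by
    have h1 : Tendsto v (𝓝[>] 0) (𝓝 0) := by
      refine tendsto_of_tendsto_of_tendsto_of_le_of_le' tendsto_const_nhds hw0 ?_ ?_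
      · filter_upwards [Ioo_mem_nhdsGT hτ₀] with τ hτ using (hpos τ hτ).le.trans (hℓv τ hτ)
      · filter_upwards [Ioo_mem_nhdsGT hτ₀] with τ hτ using (hvw τ hτ).le
    have h2 : Tendsto (fun τ : ℝ => P / ℓ * τ) (𝓝[>] 0) (𝓝 (P / ℓ * 0)) :=
      tendsto_nhdsWithin_of_tendsto_nhds (tendsto_id.const_mul _)
    simpa using (hw0.sub h1).sub h2
  have hDK : ∀ τ ∈ Ioo 0 τ₀, w τ - v τ ≤ P / ℓ * τ := by
    intro τ hτ
    have : w τ - v τ - P / ℓ * τ ≤ 0 := by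
      refine ge_of_tendsto hD0 ?_
      filter_upwards [Ioo_mem_nhdsGT hτ.1] with σ hσ
      exact hanti2 ⟨hσ.1, hσ.2.trans hτ.2⟩ hτ hσ.2.le
    linarith
  have hmid : τ₀ / 2 ∈ Ioo 0 τ₀ := ⟨by linarith, by linarith⟩
  set c := (w (τ₀ / 2) - v (τ₀ / 2)) * (τ₀ / 2) ^ (-k) with hc
  have hc0 : 0 < c := mul_pos (by linarith [hvw _ hmid]) (Real.rpow_pos_of_pos hmid.1 _)
  have hlim : Tendsto (fun τ : ℝ => P / ℓ * τ ^ (1 - k)) (𝓝[>] 0) (𝓝 0) := by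
    have h1 : Tendsto (fun τ : ℝ => τ ^ (1 - k)) (𝓝 0) (𝓝 ((0 : ℝ) ^ (1 - k))) :=
      Real.continuousAt_rpow_const _ _ (Or.inr (by linarith))
    rw [Real.zero_rpow (by linarith)] at h1
    simpa using (tendsto_nhdsWithin_of_tendsto_nhds h1).const_mul (P / ℓ)
  have : c ≤ 0 := by
    refine ge_of_tendsto hlim ?_
    filter_upwards [Ioo_mem_nhdsGT hmid.1] with τ hτ
    have hτ' : τ ∈ Ioo 0 τ₀ := ⟨hτ.1, hτ.2.trans hmid.2⟩
    have h1 := hanti hτ' hmid hτ.2.le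
    have h2 : (w τ - v τ) * τ ^ (-k) ≤ P / ℓ * τ * τ ^ (-k) :=
      mul_le_mul_of_nonneg_right (hDK τ hτ') (Real.rpow_nonneg hτ.1.le _)
    have h3 : P / ℓ * τ * τ ^ (-k) = P / ℓ * τ ^ (1 - k) := by
      rw [mul_assoc, sub_eq_add_neg, Real.rpow_add hτ.1, Real.rpow_one]
    simp only at h1
    linarith
  linarith

/-! ### The critical point and its eigenvalues -/

section Parameters

variable {m : ℕ} {s : ℝ}

lemma xiW_eq (a : ℝ) (hm : 0 < m) (hs : 0 < s) : xiW a m (m * (s - 1)) = -(a / s) := by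
  have : (m : ℝ) ≠ 0 := by exact_mod_cast hm.ne'
  unfold xiW
  rw [show (m : ℝ) + m * (s - 1) = m * s by ring]
  field_simp

lemma uW_eq (a : ℝ) (hm : 0 < m) (hs : 0 < s) : uW a m (m * (s - 1)) = a - a / s := by
  have : (m : ℝ) ≠ 0 := by exact_mod_cast hm.ne'
  unfold uW
  rw [show (m : ℝ) + m * (s - 1) = m * s by ring]
  field_simp

lemma radicand_eq (hm : 0 < m) : radicand m (m * (s - 1)) = (1 + m / 2 * s) ^ 2 - 2 * m * s ^ 2 := by
  have : (m : ℝ) ≠ 0 := by exact_mod_cast hm.ne'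
  unfold radicand
  rw [show 1 + (m : ℝ) * (s - 1) / m = s by field_simp; ring]

lemma lamPlus_eq (hm : 0 < m) : lamPlus m (m * (s - 1))
    = ((1 + m / 2 * s) + √((1 + m / 2 * s) ^ 2 - 2 * m * s ^ 2)) / 2 := by
  have : (m : ℝ) ≠ 0 := by exact_mod_cast hm.ne'
  unfold lamPlus
  rw [radicand_eq hm, show 1 + (m : ℝ) * (s - 1) / m = s by field_simp; ring]

lemma lamMinus_eq (hm : 0 < m) : lamMinus m (m * (s - 1))
    = ((1 + m / 2 * s) - √((1 + m / 2 * s) ^ 2 - 2 * m * s ^ 2)) / 2 := by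
  have : (m : ℝ) ≠ 0 := by exact_mod_cast hm.ne'
  unfold lamMinus
  rw [radicand_eq hm, show 1 + (m : ℝ) * (s - 1) / m = s by field_simp; ring]

lemma radicand_pos (hm : m = 1 ∨ m = 2) (hs : 0 < s) (hs1 : s < 1) :
    0 < (1 + m / 2 * s) ^ 2 - 2 * m * s ^ 2 := by
  rcases hm with rfl | rfl <;> push_cast <;> nlinarith

lemma lam_add (hm : 0 < m) :
    lamPlus m (m * (s - 1)) + lamMinus m (m * (s - 1)) = 1 + m / 2 * s := by
  rw [lamPlus_eq hm, lamMinus_eq hm]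
  ring

lemma lam_mul (hm : m = 1 ∨ m = 2) (hs : 0 < s) (hs1 : s < 1) :
    lamPlus m (m * (s - 1)) * lamMinus m (m * (s - 1)) = m * s ^ 2 / 2 := by
  have hm0 : 0 < m := by omega
  rw [lamPlus_eq hm0, lamMinus_eq hm0]
  have := Real.sq_sqrt (radicand_pos hm hs hs1).le
  nlinarith

lemma lamMinus_lt_lamPlus (hm : m = 1 ∨ m = 2) (hs : 0 < s) (hs1 : s < 1) :
    lamMinus m (m * (s - 1)) < lamPlus m (m * (s - 1)) := by
  have hm0 : 0 < m := by omega
  rw [lamPlus_eq hm0, lamMinus_eq hm0]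
  have := Real.sqrt_pos.2 (radicand_pos hm hs hs1)
  linarith

lemma lam_factor (hm : m = 1 ∨ m = 2) (hs : 0 < s) (hs1 : s < 1) (x : ℝ) :
    (x - lamPlus m (m * (s - 1))) * (x - lamMinus m (m * (s - 1)))
      = x ^ 2 - (1 + m / 2 * s) * x + m * s ^ 2 / 2 := by
  have hm0 : 0 < m := by omega
  rw [← lam_mul hm hs hs1, ← lam_add hm0]
  ring

lemma s_between (hm : m = 1 ∨ m = 2) (hs : 0 < s) (hs1 : s < 1) :
    lamMinus m (m * (s - 1)) < s ∧ s < lamPlus m (m * (s - 1)) := by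
  have h := lam_factor hm hs hs1 s
  have hlt := lamMinus_lt_lamPlus hm hs hs1
  have hneg : s ^ 2 - (1 + m / 2 * s) * s + m * s ^ 2 / 2 < 0 := by nlinarith
  rw [← h] at hneg
  constructor
  · by_contra! hc
    have := mul_nonneg_of_nonpos_of_nonpos (sub_nonpos.2 (hc.trans hlt.le)) (sub_nonpos.2 hc)
    linarith
  · by_contra! hc
    have := mul_nonneg (sub_nonneg.2 hc) (sub_nonneg.2 (hlt.le.trans hc))
    linarith

lemma lamPlus_pos (hm : m = 1 ∨ m = 2) (hs : 0 < s) (hs1 : s < 1) :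
    0 < lamPlus m (m * (s - 1)) := hs.trans (s_between hm hs hs1).2

lemma lam_mul_lt_sq (hm : m = 1 ∨ m = 2) (hs : 0 < s) (hs1 : s < 1) :
    (m : ℝ) * s ^ 2 / 2 < lamPlus m (m * (s - 1)) ^ 2 := by
  rw [← lam_mul hm hs hs1, sq]
  exact mul_lt_mul_of_pos_left (lamMinus_lt_lamPlus hm hs hs1) (lamPlus_pos hm hs hs1)

end Parameters

/-! ### Continuity arguments -/

lemma pos_of_ne_zero {f : ℝ → ℝ} {S : Set ℝ} (hS : IsPreconnected S) (hf : ContinuousOn f S)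
    (h0 : ∀ x ∈ S, f x ≠ 0) {x₀ : ℝ} (hx₀ : x₀ ∈ S) (hpos : 0 < f x₀) : ∀ x ∈ S, 0 < f x := by
  intro x hx
  by_contra! hle
  obtain ⟨y, hy, hy0⟩ := hS.intermediate_value hx hx₀ hf ⟨hle, hpos.le⟩
  exact h0 y hy hy0

/-- A function that is positive at `a` and increases wherever it vanishes remains positive. -/
lemma pos_of_deriv_pos {f f' : ℝ → ℝ} {a b : ℝ} (hf : ∀ x ∈ Ico a b, HasDerivAt f (f' x) x)
    (ha : 0 < f a) (h : ∀ x ∈ Ico a b, f x = 0 → 0 < f' x) : ∀ x ∈ Ico a b, 0 < f x := by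
  have hnn : ∀ x ∈ Ico a b, 0 ≤ f x := by
    intro x hx
    have hsub : Icc a x ⊆ Ico a b := fun y hy => ⟨hy.1, hy.2.trans_lt hx.2⟩
    exact image_le_of_deriv_right_lt_deriv_boundary' (f := fun _ => 0) (f' := fun _ => 0)
      (a := a) (b := x) continuousOn_const (fun x _ => hasDerivWithinAt_const _ _ _) (B := f)
      (B' := f') ha.le (fun y hy => (hf y (hsub hy)).continuousAt.continuousWithinAt)
      (fun y hy => (hf y (hsub (Ico_subset_Icc_self hy))).hasDerivWithinAt)
      (fun y hy he => h y (hsub (Ico_subset_Icc_self hy)) he.symm) (right_mem_Icc.2 hx.1)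
  intro x hx
  refine lt_of_le_of_ne (hnn x hx) fun h0 => ?_
  have hax : a < x := lt_of_le_of_ne hx.1 (by rintro rfl; exact ha.ne h0)
  have hs := (hasDerivAt_iff_tendsto_slope.1 (hf x hx)).eventually (Ioi_mem_nhds (h x hx h0.symm))
  have hs' : ∀ᶠ y in 𝓝[<] x, 0 < slope f x y :=
    hs.filter_mono (nhdsWithin_mono _ fun y hy => ne_of_lt hy)
  obtain ⟨y, hy, hy'⟩ := (hs'.and (Ioo_mem_nhdsLT hax)).exists
  rw [slope_def_field, ← h0, sub_zero] at hy
  have h1 := hnn y ⟨hy'.1.le, hy'.2.trans hx.2⟩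
  have h2 := div_nonpos_of_nonneg_of_nonpos h1 (sub_nonpos.2 hy'.2.le)
  linarith

/-! ### Symmetries of the similarity equation -/

lemma SolvesU.mono {a β : ℝ} {m : ℕ} {U : ℝ → ℝ} {S T : Set ℝ} (hU : SolvesU a m β U S)
    (h : T ⊆ S) : SolvesU a m β U T := fun ξ hξ => hU ξ (h hξ)

lemma SolvesU.reflect {a β : ℝ} {m : ℕ} {U : ℝ → ℝ} {S : Set ℝ} (hU : SolvesU a m β U S) :
    SolvesU a m β (fun ξ => -U (-ξ)) {ξ | -ξ ∈ S} := by
  intro ξ hξ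
  obtain ⟨h1, h2⟩ := hU (-ξ) hξ
  have e : (-U (-ξ) - ξ) ^ 2 = (U (-ξ) - -ξ) ^ 2 := by ring
  refine ⟨by rwa [e], ?_⟩
  rw [e]
  refine (h2.comp ξ (hasDerivAt_neg ξ)).fun_neg.congr_deriv ?_
  rw [div_neg]
  ring

lemma SolvesU.scale {a β c : ℝ} {m : ℕ} {U : ℝ → ℝ} {S : Set ℝ} (hc : 0 < c)
    (hU : SolvesU a m β U S) :
    SolvesU (a / c) m β (fun x => U (c * x) / c) {x | c * x ∈ S} := by
  intro x hx
  obtain ⟨h1, h2⟩ := hU (c * x) hx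
  have e : (U (c * x) / c - x) ^ 2 = (U (c * x) - c * x) ^ 2 / c ^ 2 := by
    field_simp
  refine ⟨fun h => h1 ?_, ?_⟩
  · rw [e, div_pow] at h
    field_simp at h
    exact h
  · have h3 : HasDerivAt (fun x => c * x) c x := by simpa using (hasDerivAt_id' x).const_mul c
    refine ((h2.comp x h3).div_const c).congr_deriv ?_
    rw [e, div_pow, ← sub_div, div_div_div_cancel_right₀ (by positivity)]
    have h4 : m * U (c * x) / (c * x) = m * (U (c * x) / c) / x := by
      rw [← div_div, mul_div_assoc]
    rw [h4]
    field_simp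

/-! ### The similarity equation near the critical point -/

section Node

variable {m : ℕ} {s : ℝ}

lemma similarity_eq_nodeField {τ v : ℝ} (hs : 0 < s) (hτ : 0 < 1 / s + τ) (hv : v ≠ 0)
    (hv2 : 2 + v ≠ 0) :
    (1 : ℝ) ^ 2 / ((-(1 / s) - τ + 1 + v - (-(1 / s) - τ)) ^ 2 - 1 ^ 2)
      * (m * (s - 1) + m * (-(1 / s) - τ + 1 + v) / (-(1 / s) - τ))
      = 1 - nodeField m s τ v := by
  unfold nodeField
  have h1 : -(1 / s) - τ = -(1 / s + τ) := by ring
  rw [h1]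
  generalize hx : 1 / s + τ = x at *
  have hτ' : s * τ = s * x - 1 := by
    rw [← hx]
    field_simp
    ring
  rw [hτ']
  have hx0 := hτ.ne'
  have h3 : (-x + 1 + v - -x) ^ 2 - 1 ^ 2 = v * (2 + v) := by ring
  rw [h3]
  field_simp
  ring

lemma SolvesU.of_nodeField {v : ℝ → ℝ} {J : Set ℝ} (hs : 0 < s) (hJ : J ⊆ Ioi 0)
    (hv : ∀ τ ∈ J, 0 < v τ ∧ HasDerivAt v (nodeField m s τ (v τ)) τ) :
    SolvesU 1 m (m * (s - 1)) (fun ξ => ξ + 1 + v (-(1 / s) - ξ)) {ξ | -(1 / s) - ξ ∈ J} := by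
  intro ξ hξ
  obtain ⟨h1, h2⟩ := hv _ hξ
  have hτ : 0 < -(1 / s) - ξ := hJ hξ
  have hs' : 0 < 1 / s := by positivity
  refine ⟨by nlinarith, ?_⟩
  have he := similarity_eq_nodeField (m := m) hs (τ := -(1 / s) - ξ) (v := v (-(1 / s) - ξ))
    (by linarith) h1.ne' (by linarith)
  rw [sub_sub_cancel] at he
  rw [he]
  have h3 : HasDerivAt (fun ξ : ℝ => -(1 / s) - ξ) (-1) ξ := by
    simpa using (hasDerivAt_id' ξ).const_sub (-(1 / s))
  have h4 := (((hasDerivAt_id' ξ).add_const 1).fun_add (h2.comp ξ h3))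
  exact h4.congr_deriv (by ring)

lemma SolvesU.nodeField {U : ℝ → ℝ} {J : Set ℝ} (hs : 0 < s) (hJ : J ⊆ Iio (-(1 / s)))
    (hU : SolvesU 1 m (m * (s - 1)) U J) (hW : ∀ ξ ∈ J, 1 < U ξ - ξ) :
    ∀ τ, -(1 / s) - τ ∈ J → HasDerivAt (fun τ => U (-(1 / s) - τ) + 1 / s + τ - 1)
      (IsothermalEuler.nodeField m s τ (U (-(1 / s) - τ) + 1 / s + τ - 1)) τ := by
  intro τ hτ
  have hlt : -(1 / s) - τ < -(1 / s) := hJ hτ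
  have hs' : 0 < 1 / s := by positivity
  have hw := hW _ hτ
  have h1 := (hU _ hτ).2
  set v := U (-(1 / s) - τ) + 1 / s + τ - 1 with hv
  have hUv : U (-(1 / s) - τ) = -(1 / s) - τ + 1 + v := by rw [hv]; ring
  rw [hUv, similarity_eq_nodeField hs (by linarith) (by linarith) (by linarith)] at h1
  have h3 : HasDerivAt (fun τ : ℝ => -(1 / s) - τ) (-1) τ := by
    simpa using (hasDerivAt_id' τ).const_sub (-(1 / s))
  have h4 := (((h1.comp τ h3).add_const (1 / s)).fun_add (hasDerivAt_id' τ)).sub_const 1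
  exact h4.congr_deriv (by ring)

lemma nodeField_eqOn (hs : 0 < s) {v w : ℝ → ℝ}
    (hv : ∀ τ ∈ Ioi (0 : ℝ), 0 < v τ ∧ HasDerivAt v (nodeField m s τ (v τ)) τ)
    (hw : ∀ τ ∈ Ioi (0 : ℝ), 0 < w τ ∧ HasDerivAt w (nodeField m s τ (w τ)) τ) {τ₁ : ℝ}
    (hτ₁ : 0 < τ₁) (h : v τ₁ = w τ₁) : EqOn v w (Ioi 0) := by
  have hO : IsOpen (Ioi (0 : ℝ) ×ˢ Ioi (0 : ℝ)) := isOpen_Ioi.prod isOpen_Ioi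
  refine SolvesIn.eqOn (F := fun p => nodeField m s p.1 p.2) (O := Ioi (0 : ℝ) ×ˢ Ioi (0 : ℝ)) hO
    ?_ isOpen_Ioi isPreconnected_Ioi (fun τ hτ => ⟨⟨hτ, (hv τ hτ).1⟩, (hv τ hτ).2⟩)
    (fun τ hτ => ⟨⟨hτ, (hw τ hτ).1⟩, (hw τ hτ).2⟩) hτ₁ h
  intro p hp
  have hp1 : 0 < p.1 := hp.1
  have hp2 : 0 < p.2 := hp.2
  have hs' : 0 < 1 / s := by positivity
  have h1 : (1 / s + p.1) * (2 + p.2) ≠ 0 := by positivity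
  have h2 : p.2 ≠ 0 := hp2.ne'
  unfold nodeField
  refine ContDiffAt.contDiffWithinAt ?_
  fun_prop (disch := assumption)

/-- The steep orbit separates, in terms of its limiting slope: since `λ₊²` exceeds `m s² / 2`, the
product `λ₊ λ₋` of the eigenvalues, there is room for a slope `ℓ < λ₊` with the same property. -/
lemma not_tendsto_zero_of_steep_slope (hm : m = 1 ∨ m = 2) (hs : 0 < s) (hs1 : s < 1)
    {v w : ℝ → ℝ} (hv : ∀ τ ∈ Ioi (0 : ℝ), HasDerivAt v (nodeField m s τ (v τ)) τ)
    (hw : ∀ τ ∈ Ioi (0 : ℝ), HasDerivAt w (nodeField m s τ (w τ)) τ)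
    (hvw : ∀ τ ∈ Ioi (0 : ℝ), v τ < w τ)
    (hlim : Tendsto (fun τ => v τ / τ) (𝓝[>] 0) (𝓝 (lamPlus m (m * (s - 1))))) :
    ¬ Tendsto w (𝓝[>] 0) (𝓝 0) := by
  have hm0 : (0 : ℝ) < m := by exact_mod_cast (show 0 < m by omega)
  have hP := lam_mul_lt_sq hm hs hs1
  have hl := lamPlus_pos hm hs hs1
  have hsqrt : √((m : ℝ) * s ^ 2 / 2) < lamPlus m (m * (s - 1)) := (Real.sqrt_lt' hl).2 hP
  obtain ⟨ℓ, h1, h2⟩ := exists_between hsqrt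
  have hℓ0 : 0 < ℓ := (Real.sqrt_nonneg _).trans_lt h1
  have hev := (hlim.eventually (Ioi_mem_nhds h2)).and
    (hlim.eventually (Ioi_mem_nhds (s_between hm hs hs1).2))
  obtain ⟨τ₀, hτ₀, hsub⟩ := mem_nhdsGT_iff_exists_Ioo_subset.1 hev
  refine not_tendsto_zero_of_steep (τ₀ := τ₀) (v := v) hm0 hs hℓ0 ((Real.sqrt_lt' hℓ0).1 h1) hτ₀
    (fun τ hτ => hv τ hτ.1) (fun τ hτ => hw τ hτ.1) ?_ ?_ (fun τ hτ => hvw τ hτ.1)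
  · intro τ hτ
    exact (lt_div_iff₀ hτ.1).1 (hsub hτ).2
  · intro τ hτ
    exact ((lt_div_iff₀ hτ.1).1 (hsub hτ).1).le

/-- Next to `P_w`, an orbit that enters with the steep slope. -/
lemma exists_steep_orbit (hm : m = 1 ∨ m = 2) (hs : 0 < s) (hs1 : s < 1) :
    ∃ h > 0, ∃ v : ℝ → ℝ,
      (∀ τ ∈ Ioo 0 h, s * τ < v τ ∧ HasDerivAt v (nodeField m s τ (v τ)) τ) ∧
      Tendsto (fun τ => v τ / τ) (𝓝[>] 0) (𝓝 (lamPlus m (m * (s - 1)))) := by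
  have hm0 : (0 : ℝ) < m := by exact_mod_cast (show 0 < m by omega)
  set l := lamPlus m (m * (s - 1)) with hl
  have hl0 : 0 < l := lamPlus_pos hm hs hs1
  have hs' : 0 < 1 / s := by positivity
  -- the equation for the slope `θ = v / τ`
  set G : ℝ × ℝ → ℝ := fun p =>
    1 - p.2 + m * (1 - s / p.2) / ((1 / s + p.1) * (2 + p.1 * p.2)) with hG
  have hk : 0 < (l - lamMinus m (m * (s - 1))) / l :=
    div_pos (sub_pos.2 (lamMinus_lt_lamPlus hm hs hs1)) hl0
  have hGc : ContDiffAt ℝ 1 G (0, l) := by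
    have h1 : ((1 / s + (0 : ℝ)) * (2 + 0 * l)) ≠ 0 := by
      rw [add_zero, zero_mul, add_zero]
      positivity
    have h2 : l ≠ 0 := hl0.ne'
    simp only [hG]
    fun_prop (disch := assumption)
  have hG0 : ∀ x, x ≠ 0 → G (0, x) = 1 - x + m * s / 2 * (1 - s / x) := by
    intro x hx
    simp only [hG]
    field_simp
    ring
  have hfac := lam_factor hm hs hs1 l
  rw [← hl, sub_self, zero_mul] at hfac
  have hGz : G (0, l) = 0 := by
    rw [hG0 l hl0.ne']
    field_simp
    linarith
  have hGd : HasDerivAt (fun x => G (0, x)) (-((l - lamMinus m (m * (s - 1))) / l)) l := by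
    have h1 : HasDerivAt (fun x : ℝ => 1 - x + m * s / 2 * (1 - s / x))
        (-1 + m * s / 2 * (s / l ^ 2)) l := by
      have h2 : HasDerivAt (fun x : ℝ => s / x) (-(s / l ^ 2)) l := by
        have := (hasDerivAt_inv hl0.ne').const_mul s
        simp only [← div_eq_mul_inv] at this
        exact this.congr_deriv (by ring)
      exact (((hasDerivAt_id' l).const_sub 1).fun_add
        ((h2.const_sub 1).const_mul (m * s / 2))).congr_deriv (by ring)
    have h3 := h1.congr_of_eventuallyEq (f₁ := fun x => G (0, x))
      (by filter_upwards [Ioi_mem_nhds hl0] with x hx using hG0 x hx.ne')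
    refine h3.congr_deriv ?_
    have h4 := lam_mul hm hs hs1
    rw [← hl] at h4
    field_simp
    linarith
  obtain ⟨h, hh, θ, hθ, hθl⟩ := exists_solution_singular hk hGc hGz hGd
  obtain ⟨τ₀, hτ₀, hsub⟩ := mem_nhdsGT_iff_exists_Ioo_subset.1
    (hθl.eventually (Ioi_mem_nhds (s_between hm hs hs1).2))
  refine ⟨min h τ₀, lt_min hh hτ₀, fun τ => τ * θ τ, fun τ hτ => ?_, ?_⟩
  · have hτ1 : τ ∈ Ioo 0 h := ⟨hτ.1, hτ.2.trans_le (min_le_left _ _)⟩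
    have hτ2 : s < θ τ := hsub ⟨hτ.1, hτ.2.trans_le (min_le_right _ _)⟩
    have hτ0 := hτ.1
    refine ⟨by rw [mul_comm]; exact mul_lt_mul_of_pos_left hτ2 hτ.1, ?_⟩
    refine ((hasDerivAt_id' τ).fun_mul (hθ τ hτ1)).congr_deriv ?_
    have h1 : 0 < θ τ := hs.trans hτ2
    have h2 : 0 < 1 / s + τ := by linarith
    simp only [hG, nodeField]
    have e : s * τ / (τ * θ τ) = s / θ τ := by field_simp
    rw [e]
    field_simp
    ring
  · refine hθl.congr' ?_
    filter_upwards [self_mem_nhdsWithin] with τ hτ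
    have : τ ≠ 0 := ne_of_gt hτ
    field_simp

end Node

/-! ### The similarity equation in the variable `ζ = 1 / ξ` -/

/-- The right-hand side of the similarity equation in the variable `ζ = 1 / ξ` (sound speed `1`);
it is regular at `ζ = 0`, that is at `ξ = ±∞`. -/
noncomputable def zetaField (M s : ℝ) (p : ℝ × ℝ) : ℝ :=
  M * (1 - p.2 * p.1 - s) / ((1 - p.2 * p.1) ^ 2 - p.1 ^ 2)

/-- The part `|U - ξ| > 1`, `U / ξ < 1` of the phase plane, in the variable `ζ = 1 / ξ`. -/
def zetaDomain : Set (ℝ × ℝ) := {p | |p.1| < 1 - p.2 * p.1}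

lemma isOpen_zetaDomain : IsOpen zetaDomain :=
  isOpen_lt (by fun_prop) (by fun_prop)

lemma zetaDomain_denom {p : ℝ × ℝ} (hp : p ∈ zetaDomain) :
    0 < (1 - p.2 * p.1) ^ 2 - p.1 ^ 2 := by
  have h : |p.1| < 1 - p.2 * p.1 := hp
  rw [← sq_abs p.1]
  nlinarith [abs_nonneg p.1]

lemma contDiffOn_zetaField (M s : ℝ) : ContDiffOn ℝ 1 (zetaField M s) zetaDomain := by
  intro p hp
  have h := (zetaDomain_denom hp).ne'
  unfold zetaField
  refine ContDiffAt.contDiffWithinAt ?_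
  fun_prop (disch := assumption)

/-- The change of variables `ζ = 1 / ξ`, with `dζ/dξ = -1 / ξ²`. -/
lemma similarity_eq_zetaField {m : ℕ} {s ξ u : ℝ} (hξ : ξ ≠ 0)
    (h : (1 - u * ξ⁻¹) ^ 2 - (ξ⁻¹) ^ 2 ≠ 0) :
    (u - ξ) ^ 2 ≠ 1 ^ 2 ∧ 1 ^ 2 / ((u - ξ) ^ 2 - 1 ^ 2) * (m * (s - 1) + m * u / ξ)
      = zetaField m s (ξ⁻¹, u) * (-(ξ ^ 2)⁻¹) := by
  have e : (1 - u * ξ⁻¹) ^ 2 - (ξ⁻¹) ^ 2 = ((u - ξ) ^ 2 - 1 ^ 2) / ξ ^ 2 := by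
    field_simp
    ring
  have h2 : (u - ξ) ^ 2 - 1 ^ 2 ≠ 0 := fun h0 => h (by rw [e, h0, zero_div])
  refine ⟨fun h0 => h2 (by rw [h0, sub_self]), ?_⟩
  unfold zetaField
  simp only
  rw [e]
  field_simp
  ring

lemma SolvesIn.solvesU {m : ℕ} {s : ℝ} {Y : ℝ → ℝ} {J : Set ℝ}
    (hY : SolvesIn (zetaField m s) zetaDomain Y J) :
    SolvesU 1 m (m * (s - 1)) (fun ξ => Y ξ⁻¹) {ξ | ξ ≠ 0 ∧ ξ⁻¹ ∈ J} := by
  rintro ξ ⟨hξ, hJ⟩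
  obtain ⟨h1, h2⟩ := hY _ hJ
  obtain ⟨h3, h4⟩ := similarity_eq_zetaField (m := m) (s := s) hξ (zetaDomain_denom h1).ne'
  refine ⟨h3, ?_⟩
  rw [h4]
  exact h2.comp ξ (hasDerivAt_inv hξ)

lemma SolvesU.solvesIn_zeta {m : ℕ} {s : ℝ} {U : ℝ → ℝ} {J : Set ℝ}
    (hU : SolvesU 1 m (m * (s - 1)) U J) (hJ : J ⊆ Iio 0) (hW : ∀ ξ ∈ J, 1 < U ξ - ξ) :
    SolvesIn (zetaField m s) zetaDomain (fun ζ => U ζ⁻¹) {ζ | ζ⁻¹ ∈ J} := by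
  intro ζ hζ
  have hζ0 : ζ⁻¹ < 0 := hJ hζ
  have hζ0' : ζ < 0 := inv_lt_zero.1 hζ0
  have h1 := hW _ hζ
  have hmem : (ζ, U ζ⁻¹) ∈ zetaDomain := by
    change |ζ| < 1 - U ζ⁻¹ * ζ
    rw [abs_of_neg hζ0']
    have h2 := mul_lt_mul_of_neg_right h1 hζ0'
    rw [sub_mul, inv_mul_cancel₀ hζ0'.ne] at h2
    linarith
  refine ⟨hmem, ?_⟩
  have hd := zetaDomain_denom hmem
  obtain ⟨h3, h4⟩ := similarity_eq_zetaField (m := m) (s := s) (ξ := ζ⁻¹) (u := U ζ⁻¹) hζ0.ne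
    (by rw [inv_inv]; exact hd.ne')
  have h5 := (hU _ hζ).2
  rw [h4, inv_inv] at h5
  have h6 := h5.comp ζ (hasDerivAt_inv hζ0'.ne)
  refine h6.congr_deriv ?_
  have := hζ0'.ne
  field_simp

lemma tendsto_left_of_monotoneOn {f : ℝ → ℝ} {a b B : ℝ} (hab : a < b)
    (hf : MonotoneOn f (Ioo a b)) (hB : ∀ x ∈ Ioo a b, f x ≤ B) :
    ∃ u, Tendsto f (𝓝[<] b) (𝓝 u) :=
  ⟨_, hf.tendsto_nhdsWithin_Ioo_left (nonempty_Ioo.2 hab)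
    ⟨B, by rintro _ ⟨x, hx, rfl⟩; exact hB x hx⟩⟩

section Zeta

variable {m : ℕ} {s : ℝ} {Y : ℝ → ℝ}

/-- On the way from `P_w` to `ξ = -∞` the quantity `1 - U / ξ - s` remains positive. -/
lemma SolvesIn.above_nullcline {ζ₀ Z : ℝ} (hs1 : s < 1)
    (hY : SolvesIn (zetaField m s) zetaDomain Y (Ico ζ₀ Z)) (hZ : Z ≤ 0)
    (h0 : s < 1 - Y ζ₀ * ζ₀) : ∀ ζ ∈ Ico ζ₀ Z, s < 1 - Y ζ * ζ := by
  have key := pos_of_deriv_pos (f := fun ζ => 1 - Y ζ * ζ - s)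
    (f' := fun ζ => -(zetaField m s (ζ, Y ζ) * ζ + Y ζ * 1)) (a := ζ₀) (b := Z)
    (fun ζ hζ => ((((hY ζ hζ).2.fun_mul (hasDerivAt_id' ζ)).const_sub 1).sub_const s))
    (by simpa using h0) ?_
  · intro ζ hζ
    linarith [key ζ hζ]
  · intro ζ hζ he
    have hζ0 : ζ < 0 := hζ.2.trans_le hZ
    have hF : zetaField m s (ζ, Y ζ) = 0 := by
      unfold zetaField
      simp only
      rw [he]
      simp
    rw [hF, zero_mul, zero_add, mul_one, neg_pos]
    have : 0 < Y ζ * ζ := by linarith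
    by_contra! hc
    linarith [mul_nonpos_of_nonneg_of_nonpos hc hζ0.le]

lemma zetaField_pos {p : ℝ × ℝ} (hm : 0 < m) (hp : p ∈ zetaDomain) (h : s < 1 - p.2 * p.1) :
    0 < zetaField m s p :=
  div_pos (mul_pos (by exact_mod_cast hm) (by linarith)) (zetaDomain_denom hp)

lemma SolvesIn.monotoneOn_of_above {J : Set ℝ} (hm : 0 < m) (hJ : Convex ℝ J)
    (hY : SolvesIn (zetaField m s) zetaDomain Y J) (h : ∀ ζ ∈ J, s < 1 - Y ζ * ζ) :
    MonotoneOn Y J :=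
  monotoneOn_of_hasDerivAt hJ (fun ζ hζ => (hY ζ hζ).2)
    fun ζ hζ => (zetaField_pos hm (hY ζ hζ).1 (h ζ hζ)).le

/-- The kink orbit cannot end before `ζ = 0`: there `U` increases at a bounded rate and stays
inside the domain. -/
lemma SolvesIn.exists_limit_mem {ζ₀ Z : ℝ} (hm : 0 < m) (hs : 0 < s) (hs1 : s < 1)
    (hζ₀ : -s < ζ₀) (hZ₀ : ζ₀ < Z) (hZ : Z ≤ 0)
    (hY : SolvesIn (zetaField m s) zetaDomain Y (Ico ζ₀ Z)) (h0 : s < 1 - Y ζ₀ * ζ₀) :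
    ∃ u, Tendsto Y (𝓝[<] Z) (𝓝 u) ∧ (Z, u) ∈ zetaDomain := by
  have hab := SolvesIn.above_nullcline hs1 hY hZ h0
  have hmono := SolvesIn.monotoneOn_of_above hm (convex_Ico _ _) hY hab
  have hm' : (0 : ℝ) < m := by exact_mod_cast hm
  have hζ₀mem : ζ₀ ∈ Ico ζ₀ Z := left_mem_Ico.2 hZ₀
  set c := -ζ₀ with hc
  have hcs : c < s := by linarith
  have hc0 : 0 < c := by linarith
  set q := min 1 (1 - Y ζ₀ * ζ₀) with hq
  have hqs : s < q := lt_min hs1 h0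
  -- `q` is a lower bound for `1 - U ζ`
  have hQ : ∀ ζ ∈ Ico ζ₀ Z, q ≤ 1 - Y ζ * ζ := by
    intro ζ hζ
    have hζ0 : ζ < 0 := hζ.2.trans_le hZ
    have h1 := hmono hζ₀mem hζ hζ.1
    have h2 : 1 - Y ζ₀ * ζ ≤ 1 - Y ζ * ζ := by nlinarith
    refine le_trans ?_ h2
    rcases le_total 0 (Y ζ₀) with h3 | h3
    · exact (min_le_left _ _).trans (by nlinarith)
    · exact (min_le_right _ _).trans (by nlinarith [hζ.1])
  have hrate : ∀ ζ ∈ Ico ζ₀ Z, zetaField m s (ζ, Y ζ) ≤ m * (q / (q ^ 2 - c ^ 2)) := by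
    intro ζ hζ
    have hζ0 : ζ < 0 := hζ.2.trans_le hZ
    have h1 := hQ ζ hζ
    have h2 : ζ ^ 2 ≤ c ^ 2 := by nlinarith [hζ.1]
    unfold zetaField
    simp only
    generalize 1 - Y ζ * ζ = Q at *
    have hqc : 0 < q ^ 2 - c ^ 2 := by nlinarith
    have hQc : 0 < Q ^ 2 - c ^ 2 := by nlinarith
    rw [mul_div_assoc]
    refine mul_le_mul_of_nonneg_left ?_ hm'.le
    calc (Q - s) / (Q ^ 2 - ζ ^ 2) ≤ Q / (Q ^ 2 - c ^ 2) := by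
          refine div_le_div₀ (by linarith) (by linarith) hQc (by linarith)
      _ ≤ q / (q ^ 2 - c ^ 2) := by
          rw [div_le_div_iff₀ hQc hqc]
          nlinarith [mul_nonneg (sub_nonneg.2 h1) (sq_nonneg c),
            mul_nonneg (sub_nonneg.2 h1) (mul_nonneg (hs.le.trans hqs.le) (hs.le.trans (hqs.le.trans h1)))]
  set K := m * (q / (q ^ 2 - c ^ 2)) with hK
  have hanti : AntitoneOn (fun ζ => Y ζ - K * ζ) (Ico ζ₀ Z) :=
    antitoneOn_of_hasDerivAt (convex_Ico _ _)
      (fun ζ hζ => (hY ζ hζ).2.fun_sub ((hasDerivAt_id' ζ).const_mul K))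
      fun ζ hζ => by linarith [hrate ζ hζ]
  have hK0 : 0 ≤ K := by
    have : 0 < q ^ 2 - c ^ 2 := by nlinarith
    have : 0 < q := hs.trans hqs
    positivity
  obtain ⟨u, hu⟩ := tendsto_left_of_monotoneOn (B := Y ζ₀ - K * ζ₀) hZ₀
    (hmono.mono Ioo_subset_Ico_self) (fun ζ hζ => by
      have h1 := hanti hζ₀mem (Ioo_subset_Ico_self hζ) hζ.1.le
      have h2 : ζ < 0 := hζ.2.trans_le hZ
      simp only at h1
      nlinarith)
  refine ⟨u, hu, ?_⟩
  have hlim : Tendsto (fun ζ => 1 - Y ζ * ζ) (𝓝[<] Z) (𝓝 (1 - u * Z)) :=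
    (hu.mul (tendsto_nhdsWithin_of_tendsto_nhds tendsto_id)).const_sub 1
  have hge : q ≤ 1 - u * Z := by
    refine ge_of_tendsto hlim ?_
    filter_upwards [Ioo_mem_nhdsLT hZ₀] with ζ hζ using hQ ζ (Ioo_subset_Ico_self hζ)
  change |Z| < 1 - u * Z
  rw [abs_of_nonpos hZ]
  linarith

/-- The orbit that leaves `P_w` with the steep slope, in the variable `ζ = 1 / ξ`, as a maximal
solution: it passes through `ξ = ∞`, that is `ζ = 0`. -/
lemma exists_maximal_kink (hm : m = 1 ∨ m = 2) (hs : 0 < s) (hs1 : s < 1) :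
    ∃ Y : ℝ → ℝ,
      (SolvesIn (zetaField m s) zetaDomain Y (Ioi (-s)) ∨ ∃ Z, 0 < Z ∧
        SolvesIn (zetaField m s) zetaDomain Y (Ioo (-s) Z) ∧
        ∀ u, Tendsto Y (𝓝[<] Z) (𝓝 u) → (Z, u) ∉ zetaDomain) ∧
      (∀ ζ ∈ Ioo (-s) 0, s < 1 - Y ζ * ζ) ∧
      Tendsto (fun τ => (Y (-(1 / s) - τ)⁻¹ + 1 / s + τ - 1) / τ) (𝓝[>] 0)
        (𝓝 (lamPlus m (m * (s - 1)))) := by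
  have hm0 : 0 < m := by omega
  have hs' : 0 < 1 / s := by positivity
  obtain ⟨h, hh, v, hv, hvl⟩ := exists_steep_orbit hm hs hs1
  set U : ℝ → ℝ := fun ξ => ξ + 1 + v (-(1 / s) - ξ) with hU
  have hvpos : ∀ τ ∈ Ioo 0 h, 0 < v τ := fun τ hτ =>
    lt_trans (mul_pos hs hτ.1) (hv τ hτ).1
  have hUs := SolvesU.of_nodeField (m := m) (J := Ioo 0 h) hs (fun τ hτ => hτ.1)
    (fun τ hτ => ⟨hvpos τ hτ, (hv τ hτ).2⟩)
  have hyz := SolvesU.solvesIn_zeta hUs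
    (fun ξ hξ => by
      have : 0 < -(1 / s) - ξ := hξ.1
      change ξ < 0
      linarith)
    (fun ξ hξ => by
      have := hvpos _ hξ
      linarith)
  -- the interval `0 < τ < h` in terms of `ζ`
  set B := -(1 / s + h)⁻¹ with hB
  have hBs : -s < B := by
    rw [hB, neg_lt_neg_iff, inv_lt_comm₀ (by positivity) hs, ← one_div]
    linarith
  have hB0 : B < 0 := by
    rw [hB, neg_lt_zero]
    positivity
  have hτmem : ∀ ζ ∈ Ioo (-s) B, -(1 / s) - ζ⁻¹ ∈ Ioo 0 h := by
    intro ζ hζ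
    have hζ0 : 0 < -ζ := by linarith [hζ.2]
    have e : ζ⁻¹ = -(-ζ)⁻¹ := by rw [inv_neg, neg_neg]
    have h1 : 1 / s < (-ζ)⁻¹ := by
      rw [one_div, inv_lt_inv₀ hs hζ0]
      linarith [hζ.1]
    have h2 : (-ζ)⁻¹ < 1 / s + h := by
      rw [inv_lt_comm₀ hζ0 (by positivity)]
      linarith [hζ.2]
    rw [e]
    constructor <;> linarith
  obtain ⟨Y, hYy, hYmax⟩ := SolvesIn.exists_maximal isOpen_zetaDomain
    (contDiffOn_zetaField m s) hBs (hyz.mono fun ζ hζ => hτmem ζ hζ)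
  have habove0 : ∀ ζ ∈ Ioo (-s) B, s < 1 - Y ζ * ζ := by
    intro ζ hζ
    have hτ := hτmem ζ hζ
    have hζ0 : ζ < 0 := hζ.2.trans hB0
    have h1 := (hv _ hτ).1
    rw [hYy hζ]
    have h2 : s * (-(1 / s) - ζ⁻¹) = -1 - s * ζ⁻¹ := by
      field_simp
    rw [h2] at h1
    have h3 := mul_lt_mul_of_neg_right h1 hζ0
    have h4 : (-1 - s * ζ⁻¹) * ζ = -ζ - s := by
      have := hζ0.ne
      field_simp
    have h5 : (ζ⁻¹ + 1 + v (-(1 / s) - ζ⁻¹)) * ζ = 1 + ζ + v (-(1 / s) - ζ⁻¹) * ζ := by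
      have := hζ0.ne
      field_simp
    rw [h5]
    linarith
  have hmid : (-s + B) / 2 ∈ Ioo (-s) B := ⟨by linarith, by linarith⟩
  have hlim : Tendsto (fun τ => (Y (-(1 / s) - τ)⁻¹ + 1 / s + τ - 1) / τ) (𝓝[>] 0)
      (𝓝 (lamPlus m (m * (s - 1)))) := by
    refine hvl.congr' ?_
    filter_upwards [Ioo_mem_nhdsGT hh] with τ hτ
    have hmem : (-(1 / s) - τ)⁻¹ ∈ Ioo (-s) B := by
      rw [show -(1 / s) - τ = -(1 / s + τ) by ring, inv_neg, hB]
      have h1 : 0 < 1 / s + τ := by linarith [hτ.1]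
      constructor
      · rw [neg_lt_neg_iff, inv_lt_comm₀ h1 hs, ← one_div]
        linarith [hτ.1]
      · rw [neg_lt_neg_iff, inv_lt_inv₀ (by positivity) h1]
        linarith [hτ.2]
    rw [hYy hmem]
    simp only [inv_inv, sub_sub_cancel]
    congr 1
    ring
  have hmax : SolvesIn (zetaField m s) zetaDomain Y (Ioi (-s)) ∨ ∃ Z, 0 < Z ∧
      SolvesIn (zetaField m s) zetaDomain Y (Ioo (-s) Z) ∧
      ∀ u, Tendsto Y (𝓝[<] Z) (𝓝 u) → (Z, u) ∉ zetaDomain := by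
    rcases hYmax with hg | ⟨Z, hBZ, hZ, hZmax⟩
    · exact Or.inl hg
    · refine Or.inr ⟨Z, ?_, hZ, hZmax⟩
      by_contra! hZ0
      obtain ⟨u, hu, hmem⟩ := SolvesIn.exists_limit_mem hm0 hs hs1 hmid.1 (hmid.2.trans_le hBZ)
        hZ0 (hZ.mono fun ζ hζ => ⟨hmid.1.trans_le hζ.1, hζ.2⟩) (habove0 _ hmid)
      exact hZmax u hu hmem
  refine ⟨Y, hmax, fun ζ hζ => ?_, hlim⟩
  rcases lt_or_ge ζ B with hlt | hge
  · exact habove0 ζ ⟨hζ.1, hlt⟩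
  · have hsol : SolvesIn (zetaField m s) zetaDomain Y (Ico ((-s + B) / 2) 0) := by
      rcases hmax with hg | ⟨Z, hZ0, hZ, _⟩
      · exact hg.mono fun ζ hζ => hmid.1.trans_le hζ.1
      · exact hZ.mono fun ζ hζ => ⟨hmid.1.trans_le hζ.1, hζ.2.trans hZ0⟩
    exact SolvesIn.above_nullcline hs1 hsol le_rfl (habove0 _ hmid) ζ
      ⟨hmid.2.le.trans hge, hζ.2⟩

end Zeta

/-! ### The kink solution and its continuation through infinity -/

section Kink

variable {m : ℕ} {s : ℝ}

lemma tendsto_sub_nhdsGT (c : ℝ) : Tendsto (fun ξ : ℝ => c - ξ) (𝓝[<] c) (𝓝[>] 0) := by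
  refine tendsto_nhdsWithin_iff.2 ⟨?_, ?_⟩
  · have : Tendsto (fun ξ : ℝ => c - ξ) (𝓝 c) (𝓝 (c - c)) := (continuous_const.sub continuous_id).tendsto c
    rw [sub_self] at this
    exact tendsto_nhdsWithin_of_tendsto_nhds this
  · filter_upwards [self_mem_nhdsWithin] with ξ hξ using mem_Ioi.2 (sub_pos.2 (mem_Iio.1 hξ))

lemma tendsto_sub_nhdsLT (c : ℝ) : Tendsto (fun τ : ℝ => c - τ) (𝓝[>] 0) (𝓝[<] c) := by
  refine tendsto_nhdsWithin_iff.2 ⟨?_, ?_⟩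
  · have : Tendsto (fun τ : ℝ => c - τ) (𝓝 0) (𝓝 (c - 0)) := (continuous_const.sub continuous_id).tendsto 0
    rw [sub_zero] at this
    exact tendsto_nhdsWithin_of_tendsto_nhds this
  · filter_upwards [self_mem_nhdsWithin] with τ hτ using mem_Iio.2 (sub_lt_self c (mem_Ioi.1 hτ))

/-- The slope condition in the variables `τ = ξ_w - ξ`, `v = U - ξ - 1` of `nodeField`: the slope
of `U` at `P_w` is `1 - λ₊` if and only if `v / τ → λ₊`. -/
lemma IsKink.of_steep (hm : 0 < m) (hs : 0 < s) {U : ℝ → ℝ}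
    (hU : SolvesU 1 m (m * (s - 1)) U (Iio (-(1 / s))))
    (hlim : Tendsto (fun τ => (U (-(1 / s) - τ) + 1 / s + τ - 1) / τ) (𝓝[>] 0)
      (𝓝 (lamPlus m (m * (s - 1))))) : IsKink 1 m (m * (s - 1)) U := by
  have hx := xiW_eq (m := m) 1 hm hs
  have hu := uW_eq (m := m) 1 hm hs
  have hlim' := hlim.comp (tendsto_sub_nhdsGT (-(1 / s)))
  refine ⟨by rwa [hx], ?_, ?_⟩
  · rw [hx, hu]
    have h1 : Tendsto (fun ξ : ℝ => -(1 / s) - ξ) (𝓝[<] (-(1 / s))) (𝓝 0) :=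
      (tendsto_sub_nhdsGT _).mono_right nhdsWithin_le_nhds
    have h2 := ((hlim'.mul h1).sub h1).add_const (1 - 1 / s)
    rw [mul_zero, sub_zero, zero_add] at h2
    refine h2.congr' ?_
    filter_upwards [self_mem_nhdsWithin] with ξ hξ
    have hξ' : ξ < -(1 / s) := hξ
    have : -(1 / s) - ξ ≠ 0 := by linarith
    simp only [Function.comp_apply, sub_sub_cancel]
    rw [div_mul_cancel₀ _ this]
    ring
  · rw [hx, hu]
    refine (hlim'.const_sub 1).congr' ?_
    filter_upwards [self_mem_nhdsWithin] with ξ hξ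
    have hξ' : ξ < -(1 / s) := hξ
    have h1 : -(1 / s) - ξ ≠ 0 := by linarith
    have h2 : ξ - -(1 / s) ≠ 0 := by linarith
    simp only [Function.comp_apply, sub_sub_cancel]
    rw [show ξ - -(1 / s) = -(-(1 / s) - ξ) by ring, div_neg, eq_neg_iff_add_eq_zero]
    generalize -(1 / s) - ξ = x at h1
    field_simp
    ring

lemma IsKink.steep (hm : 0 < m) (hs : 0 < s) {U : ℝ → ℝ} (hU : IsKink 1 m (m * (s - 1)) U) :
    Tendsto (fun τ => (U (-(1 / s) - τ) + 1 / s + τ - 1) / τ) (𝓝[>] 0)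
      (𝓝 (lamPlus m (m * (s - 1)))) := by
  have h := hU.slope
  rw [xiW_eq 1 hm hs, uW_eq 1 hm hs] at h
  have h1 := (h.comp (tendsto_sub_nhdsLT (-(1 / s)))).const_sub 1
  rw [sub_sub_cancel] at h1
  refine h1.congr' ?_
  filter_upwards [self_mem_nhdsWithin] with τ hτ
  have hτ' : τ ≠ 0 := ne_of_gt hτ
  simp only [Function.comp_apply]
  rw [show -(1 / s) - τ - -(1 / s) = -τ by ring]
  field_simp
  ring

/-- The kink enters `P_w` from the supersonic side, and stays there since it cannot cross the sonic
line. -/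
lemma IsKink.one_lt (hm : m = 1 ∨ m = 2) (hs : 0 < s) (hs1 : s < 1) {U : ℝ → ℝ}
    (hU : IsKink 1 m (m * (s - 1)) U) : ∀ ξ ∈ Iio (-(1 / s)), 1 < U ξ - ξ := by
  have hm0 : 0 < m := by omega
  have hsol := hU.solves
  rw [xiW_eq 1 hm0 hs] at hsol
  have hev := (hU.steep hm0 hs).eventually (Ioi_mem_nhds (lamPlus_pos hm hs hs1))
  obtain ⟨τ, h1, h2⟩ := (hev.and self_mem_nhdsWithin).exists
  have hτ : 0 < τ := h2
  have h3 : 0 < U (-(1 / s) - τ) + 1 / s + τ - 1 := (div_pos_iff_of_pos_right hτ).1 h1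
  have hs' : 0 < 1 / s := by positivity
  have := pos_of_ne_zero (f := fun ξ => U ξ - ξ - 1) (S := Iio (-(1 / s))) isPreconnected_Iio
    (fun ξ hξ => (((hsol ξ hξ).2.continuousAt.sub continuousAt_id).sub
      continuousAt_const).continuousWithinAt)
    (fun ξ hξ h0 => (hsol ξ hξ).1 (by rw [sub_eq_zero.1 h0])) (x₀ := -(1 / s) - τ)
    (by simpa using hτ) (by linarith)
  intro ξ hξ
  linarith [this ξ hξ]

lemma IsKink.nodeField (hm : m = 1 ∨ m = 2) (hs : 0 < s) (hs1 : s < 1) {U : ℝ → ℝ}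
    (hU : IsKink 1 m (m * (s - 1)) U) : ∀ τ ∈ Ioi (0 : ℝ),
    0 < U (-(1 / s) - τ) + 1 / s + τ - 1 ∧
    HasDerivAt (fun τ => U (-(1 / s) - τ) + 1 / s + τ - 1)
      (IsothermalEuler.nodeField m s τ (U (-(1 / s) - τ) + 1 / s + τ - 1)) τ := by
  intro τ hτ
  have hsol := hU.solves
  rw [xiW_eq 1 (by omega) hs] at hsol
  have hmem : -(1 / s) - τ ∈ Iio (-(1 / s)) := mem_Iio.2 (sub_lt_self _ (mem_Ioi.1 hτ))
  exact ⟨by linarith [hU.one_lt hm hs hs1 _ hmem],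
    hsol.nodeField hs le_rfl (hU.one_lt hm hs hs1) τ hmem⟩

/-- Uniqueness of the kink: two different kinks would be ordered throughout, and the steep orbit
separates. -/
lemma IsKink.eqOn (hm : m = 1 ∨ m = 2) (hs : 0 < s) (hs1 : s < 1) {U V : ℝ → ℝ}
    (hU : IsKink 1 m (m * (s - 1)) U) (hV : IsKink 1 m (m * (s - 1)) V) :
    EqOn U V (Iio (-(1 / s))) := by
  have hm0 : 0 < m := by omega
  have zero : ∀ {W : ℝ → ℝ}, IsKink 1 m (m * (s - 1)) W →
      Tendsto (fun τ => W (-(1 / s) - τ) + 1 / s + τ - 1) (𝓝[>] 0) (𝓝 0) := by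
    intro W hW
    have h1 : Tendsto (fun τ : ℝ => τ) (𝓝[>] 0) (𝓝 0) :=
      tendsto_nhdsWithin_of_tendsto_nhds tendsto_id
    have h2 := (hW.steep hm0 hs).mul h1
    rw [mul_zero] at h2
    refine h2.congr' ?_
    filter_upwards [self_mem_nhdsWithin] with τ hτ
    have hτ' : τ ≠ 0 := ne_of_gt hτ
    field_simp
  have main : ∀ {A B : ℝ → ℝ}, IsKink 1 m (m * (s - 1)) A → IsKink 1 m (m * (s - 1)) B →
      ∀ τ ∈ Ioi (0 : ℝ), ¬ A (-(1 / s) - τ) < B (-(1 / s) - τ) := by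
    intro A B hA hB τ hτ hlt
    have hall := pos_of_ne_zero (S := Ioi (0 : ℝ)) (f := fun τ =>
      (B (-(1 / s) - τ) + 1 / s + τ - 1) - (A (-(1 / s) - τ) + 1 / s + τ - 1)) isPreconnected_Ioi
      (fun τ hτ => ((hB.nodeField hm hs hs1 τ hτ).2.continuousAt.sub
        (hA.nodeField hm hs hs1 τ hτ).2.continuousAt).continuousWithinAt)
      (fun σ hσ h0 => by
        have := nodeField_eqOn hs (hB.nodeField hm hs hs1) (hA.nodeField hm hs hs1) hσ
          (sub_eq_zero.1 h0) hτ
        simp only at this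
        linarith) hτ (by linarith)
    exact not_tendsto_zero_of_steep_slope hm hs hs1 (fun τ hτ => (hA.nodeField hm hs hs1 τ hτ).2)
      (fun τ hτ => (hB.nodeField hm hs hs1 τ hτ).2)
      (fun τ hτ => by linarith [hall τ hτ]) (hA.steep hm0 hs) (zero hB)
  intro ξ hξ
  have hξ' : ξ < -(1 / s) := hξ
  have hτ : -(1 / s) - ξ ∈ Ioi (0 : ℝ) := sub_pos.2 hξ'
  have h1 := main hU hV _ hτ
  have h2 := main hV hU _ hτ
  rw [sub_sub_cancel] at h1 h2
  exact le_antisymm (not_lt.1 h2) (not_lt.1 h1)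

lemma inv_mem_Ioo_of_lt (hs : 0 < s) {ξ : ℝ} (hξ : ξ < -(1 / s)) : ξ⁻¹ ∈ Ioo (-s) 0 := by
  have hs' : 0 < 1 / s := by positivity
  have h0 : ξ < 0 := by linarith
  refine ⟨?_, inv_lt_zero.2 h0⟩
  have h1 : 1 / s < -ξ := by linarith
  have h2 : (-ξ)⁻¹ < s := by
    rw [inv_lt_comm₀ (by linarith) hs, ← one_div]
    exact h1
  rw [inv_neg] at h2
  linarith

lemma SolvesIn.isKink (hm : 0 < m) (hs : 0 < s) {Y : ℝ → ℝ}
    (hY : SolvesIn (zetaField m s) zetaDomain Y (Ioo (-s) 0))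
    (hlim : Tendsto (fun τ => (Y (-(1 / s) - τ)⁻¹ + 1 / s + τ - 1) / τ) (𝓝[>] 0)
        (𝓝 (lamPlus m (m * (s - 1))))) : IsKink 1 m (m * (s - 1)) (fun ξ => Y ξ⁻¹) := by
  refine IsKink.of_steep hm hs (fun ξ hξ => hY.solvesU ξ ?_) hlim
  have := inv_mem_Ioo_of_lt hs hξ
  exact ⟨fun h0 => by simp [h0] at this, this⟩

/-- The continuation of the kink orbit through `ζ = 0` lies, for `0 < ζ < s`, below the reflected
kink if the limit at infinity is negative. -/
lemma SolvesIn.lt_reflected {Y : ℝ → ℝ} {Z : ℝ} (hs : 0 < s) (hZ : 0 < Z)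
    (hY : SolvesIn (zetaField m s) zetaDomain Y (Ioo (-s) Z)) (h0 : Y 0 < 0) :
    ∀ ζ ∈ Ico 0 (min s Z), Y ζ < -Y (-ζ) := by
  set δ := min s Z with hδ
  have hδ0 : 0 < δ := lt_min hs hZ
  have hR : SolvesIn (zetaField m s) zetaDomain (fun ζ => -Y (-ζ)) (Ioo (-δ) s) := by
    intro ζ hζ
    obtain ⟨h1, h2⟩ := hY (-ζ) ⟨by linarith [hζ.2], by linarith [hζ.1, min_le_right s Z]⟩
    have h1' : |-ζ| < 1 - Y (-ζ) * -ζ := h1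
    refine ⟨?_, ?_⟩
    · change |ζ| < 1 - -Y (-ζ) * ζ
      rw [abs_neg] at h1'
      linarith
    · have h3 : HasDerivAt (fun ζ => Y (-ζ)) (zetaField m s (-ζ, Y (-ζ)) * -1) ζ :=
        h2.comp ζ (hasDerivAt_neg ζ)
      refine h3.fun_neg.congr_deriv ?_
      unfold zetaField
      simp only
      ring
  have hmem : (0 : ℝ) ∈ Ioo (-δ) δ := ⟨by linarith, hδ0⟩
  have hY' : SolvesIn (zetaField m s) zetaDomain Y (Ioo (-δ) δ) :=
    hY.mono (Ioo_subset_Ioo (by linarith [min_le_left s Z]) (min_le_right _ _))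
  have hR' := hR.mono (Ioo_subset_Ioo_right (min_le_left s Z))
  have hall := pos_of_ne_zero (S := Ioo (-δ) δ) (f := fun ζ => -Y (-ζ) - Y ζ) isPreconnected_Ioo
    (fun ζ hζ => ((hR' ζ hζ).2.continuousAt.sub (hY' ζ hζ).2.continuousAt).continuousWithinAt)
    (fun ζ hζ he => by
      have := SolvesIn.eqOn isOpen_zetaDomain (contDiffOn_zetaField m s) isOpen_Ioo
        isPreconnected_Ioo hR' hY' hζ (sub_eq_zero.1 he) hmem
      simp only [neg_zero] at this
      linarith) hmem (by simp only [neg_zero]; linarith)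
  intro ζ hζ
  linarith [hall ζ ⟨by linarith [hζ.1], hζ.2⟩]

/-- Beyond infinity the inequality `1 - U / ξ > s` persists: for `ζ < s` it holds for the reflected
kink, and for `ζ ≥ s` it is implied by `|U - ξ| > 1`. -/
lemma SolvesIn.above_of_lt_reflected {Y : ℝ → ℝ} {Z : ℝ} (hs : 0 < s) (hs1 : s < 1) (hZ : 0 < Z)
    (hY : SolvesIn (zetaField m s) zetaDomain Y (Ioo (-s) Z)) (h0 : Y 0 < 0)
    (habove : ∀ ζ ∈ Ioo (-s) 0, s < 1 - Y ζ * ζ) : ∀ ζ ∈ Ico 0 Z, s < 1 - Y ζ * ζ := by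
  intro ζ hζ
  rcases eq_or_lt_of_le hζ.1 with rfl | hpos
  · simpa using hs1
  rcases lt_or_ge ζ s with hlt | hge
  · have h1 := hY.lt_reflected hs hZ h0 ζ ⟨hζ.1, lt_min hlt hζ.2⟩
    have h2 := habove (-ζ) ⟨by linarith, by linarith⟩
    have h3 := mul_lt_mul_of_pos_right h1 hpos
    linarith
  · have h1 : |ζ| < 1 - Y ζ * ζ := (hY ζ ⟨by linarith, hζ.2⟩).1
    rw [abs_of_pos hpos] at h1
    linarith

/-- The continuation of the kink orbit does not stay away from the line `U = ξ - 1`: otherwise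
`U` would grow logarithmically in `ζ`. -/
lemma SolvesIn.not_global {Y : ℝ → ℝ} (hm : 0 < m) (hs : 0 < s) (hs1 : s < 1)
    (hY : SolvesIn (zetaField m s) zetaDomain Y (Ioi (-s)))
    (habove : ∀ ζ ∈ Ici (0 : ℝ), s < 1 - Y ζ * ζ) : False := by
  have hm' : (0 : ℝ) < m := by exact_mod_cast hm
  have hY0 : SolvesIn (zetaField m s) zetaDomain Y (Ici 0) := hY.mono fun ζ hζ => by
    have : (0 : ℝ) ≤ ζ := hζ
    change -s < ζ
    linarith
  have hmono := hY0.monotoneOn_of_above hm (convex_Ici 0) habove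
  set K := 1 + |Y 0| with hK
  have hK0 : 0 < K := by positivity
  have hlog : MonotoneOn (fun ζ => Y ζ - m / (2 * K) * Real.log ζ) (Ici 2) := by
    refine monotoneOn_of_hasDerivAt (convex_Ici 2) (fun ζ hζ => ?_) (f' := fun ζ =>
      zetaField m s (ζ, Y ζ) - m / (2 * K) * ζ⁻¹) (fun ζ hζ => ?_)
    · have h2 : (2 : ℝ) ≤ ζ := hζ
      exact (hY0 ζ (by change (0 : ℝ) ≤ ζ; linarith)).2.fun_sub
        ((Real.hasDerivAt_log (by linarith)).const_mul _)
    · have h2 : (2 : ℝ) ≤ ζ := hζ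
      have hζ0 : ζ ∈ Ici (0 : ℝ) := by change (0 : ℝ) ≤ ζ; linarith
      have h3 : |ζ| < 1 - Y ζ * ζ := (hY0 ζ hζ0).1
      have h4 := hmono (mem_Ici.2 le_rfl) hζ0 hζ0
      have h5 := zetaDomain_denom (hY0 ζ hζ0).1
      rw [abs_of_nonneg hζ0] at h3
      have h6 : 1 - Y ζ * ζ ≤ K * ζ := by
        have := neg_abs_le (Y 0)
        nlinarith
      simp only at h5 ⊢
      unfold zetaField
      simp only
      generalize 1 - Y ζ * ζ = Q at *
      have hζ' : 0 < ζ := by linarith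
      have h7 : m * (1 / (2 * Q)) ≤ m * ((Q - s) / (Q ^ 2 - ζ ^ 2)) := by
        refine mul_le_mul_of_nonneg_left ?_ hm'.le
        rw [div_le_div_iff₀ (by linarith) h5]
        nlinarith
      have h8 : m / (2 * K) * ζ⁻¹ ≤ m * (1 / (2 * Q)) := by
        rw [div_mul_eq_mul_div, mul_div_assoc]
        refine mul_le_mul_of_nonneg_left ?_ hm'.le
        rw [inv_eq_one_div, div_div]
        exact one_div_le_one_div_of_le (by linarith) (by linarith)
      rw [mul_div_assoc]
      linarith
  have hlim : Tendsto (fun ζ : ℝ => m / (2 * K) * Real.log ζ) atTop atTop :=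
    Real.tendsto_log_atTop.const_mul_atTop (by positivity)
  obtain ⟨ζ, h1, h2⟩ := ((hlim.eventually
    (eventually_gt_atTop (-(Y 2 - m / (2 * K) * Real.log 2)))).and (eventually_ge_atTop 2)).exists
  have h3 := hlog (mem_Ici.2 le_rfl) h2 h2
  have h4 : |ζ| < 1 - Y ζ * ζ := (hY0 ζ (by change (0 : ℝ) ≤ ζ; linarith)).1
  rw [abs_of_pos (by linarith)] at h4
  simp only at h3
  nlinarith

/-- The continuation of the kink orbit through infinity meets the line `U = ξ - 1` inside
`0 < ξ < 1 / s`. It cannot end at `-P_w`, since the reflected kink is the steep orbit there. -/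
lemma exists_tilde (hm : m = 1 ∨ m = 2) (hs : 0 < s) (hs1 : s < 1) {Y : ℝ → ℝ}
    (hY : SolvesIn (zetaField m s) zetaDomain Y (Ioi (-s)) ∨ ∃ Z, 0 < Z ∧
        SolvesIn (zetaField m s) zetaDomain Y (Ioo (-s) Z) ∧
        ∀ u, Tendsto Y (𝓝[<] Z) (𝓝 u) → (Z, u) ∉ zetaDomain)
    (habove : ∀ ζ ∈ Ioo (-s) 0, s < 1 - Y ζ * ζ)
    (hlim : Tendsto (fun τ => (Y (-(1 / s) - τ)⁻¹ + 1 / s + τ - 1) / τ) (𝓝[>] 0)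
        (𝓝 (lamPlus m (m * (s - 1))))) (h0 : Y 0 < 0) :
    ∃ xiStar, IsTilde 1 m (m * (s - 1)) (Y 0) xiStar (fun ξ => Y ξ⁻¹) := by
  have hm0 : 0 < m := by omega
  rcases hY with hY | ⟨Z, hZ, hY, hmax⟩
  · refine (hY.not_global hm0 hs hs1 fun ζ hζ => ?_).elim
    have hζ' : 0 ≤ ζ := hζ
    exact SolvesIn.above_of_lt_reflected (Z := ζ + 1) hs hs1 (by linarith)
      (hY.mono Ioo_subset_Ioi_self) h0 habove ζ ⟨hζ, by linarith⟩
  have hab := hY.above_of_lt_reflected hs hs1 hZ h0 habove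
  have hY0 : SolvesIn (zetaField m s) zetaDomain Y (Ico 0 Z) :=
    hY.mono fun ζ hζ => ⟨by linarith [hζ.1], hζ.2⟩
  have hmono := hY0.monotoneOn_of_above hm0 (convex_Ico 0 Z) hab
  have hdom : ∀ ζ ∈ Ioo 0 Z, ζ < 1 - Y ζ * ζ := fun ζ hζ => by
    have h1 : |ζ| < 1 - Y ζ * ζ := (hY0 ζ (Ioo_subset_Ico_self hζ)).1
    rwa [abs_of_pos hζ.1] at h1
  have hmid : Z / 2 < Z := by linarith
  obtain ⟨u, hu⟩ := tendsto_left_of_monotoneOn (f := Y) (B := 2 / Z) hmid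
    (hmono.mono fun ζ hζ => ⟨by linarith [hζ.1], hζ.2⟩) (fun ζ hζ => by
      have h1 : 0 < ζ := by linarith [hζ.1]
      have h2 := hdom ζ ⟨h1, hζ.2⟩
      rw [le_div_iff₀ hZ]
      nlinarith [hζ.1])
  have hlimQ : Tendsto (fun ζ => 1 - Y ζ * ζ) (𝓝[<] Z) (𝓝 (1 - u * Z)) :=
    (hu.mul (tendsto_nhdsWithin_of_tendsto_nhds tendsto_id)).const_sub 1
  have hge : Z ≤ 1 - u * Z := by
    refine le_of_tendsto_of_tendsto (tendsto_nhdsWithin_of_tendsto_nhds tendsto_id) hlimQ ?_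
    filter_upwards [Ioo_mem_nhdsLT hZ] with ζ hζ using (hdom ζ hζ).le
  have hnot : ¬ |Z| < 1 - u * Z := hmax u hu
  rw [abs_of_pos hZ, not_lt] at hnot
  have hZu : 1 - u * Z = Z := le_antisymm hnot hge
  -- the orbit ends beyond `ζ = s`
  have hsZ : s < Z := by
    rcases lt_trichotomy s Z with h | h | h
    · exact h
    · exfalso
      subst h
      have hkink := SolvesIn.isKink hm0 hs (hY.mono (Ioo_subset_Ioo_right hs.le)) hlim
      have hneg : ∀ ξ : ℝ, ξ < -(1 / s) → -ξ⁻¹ ∈ Ioo 0 s := fun ξ hξ => by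
        have := inv_mem_Ioo_of_lt hs hξ
        exact ⟨by linarith [this.2], by linarith [this.1]⟩
      have hlt := hY.lt_reflected hs hs h0
      rw [min_self] at hlt
      have hRsol : SolvesU 1 m (m * (s - 1)) (fun ξ => -Y (-ξ⁻¹)) (Iio (-(1 / s))) := by
        intro ξ hξ
        have hmem := hneg ξ hξ
        have h1 := hY.solvesU.reflect ξ ⟨fun h => by simp [neg_eq_zero.1 h] at hmem, by
          rw [inv_neg]
          exact ⟨by linarith [hmem.1], hmem.2⟩⟩
        simpa only [inv_neg] using h1
      have hRW : ∀ ξ ∈ Iio (-(1 / s)), 1 < -Y (-ξ⁻¹) - ξ := by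
        intro ξ hξ
        have hξ' : ξ < -(1 / s) := hξ
        have hmem := hneg ξ hξ
        have h1 := hdom _ hmem
        have h2 : 0 < -ξ := by
          have : 0 < 1 / s := by positivity
          linarith
        have h3 := mul_lt_mul_of_pos_right h1 h2
        have h4 : -ξ⁻¹ * -ξ = 1 := by
          have := h2.ne'
          rw [neg_mul_neg, inv_mul_cancel₀ (by linarith)]
        rw [h4, sub_mul, mul_assoc, h4] at h3
        linarith
      have hw := hRsol.nodeField hs le_rfl hRW
      refine not_tendsto_zero_of_steep_slope hm hs hs1
        (fun τ hτ => (hkink.nodeField hm hs hs1 τ hτ).2)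
        (fun τ hτ => hw τ (mem_Iio.2 (sub_lt_self _ (mem_Ioi.1 hτ)))) ?_ hlim ?_
      · intro τ hτ
        have hmem := hneg (-(1 / s) - τ) (sub_lt_self _ hτ)
        have := hlt _ ⟨hmem.1.le, hmem.2⟩
        rw [neg_neg] at this
        linarith
      · have h1 : Tendsto (fun τ : ℝ => -(-(1 / s) - τ)⁻¹) (𝓝[>] 0) (𝓝[<] s) := by
          refine tendsto_nhdsWithin_iff.2 ⟨?_, ?_⟩
          · have h2 : ContinuousAt (fun τ : ℝ => -(-(1 / s) - τ)⁻¹) 0 := by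
              have : -(1 / s) - (0 : ℝ) ≠ 0 := by
                have := hs.ne'
                simp [this]
              fun_prop (disch := assumption)
            have h3 := h2.tendsto
            have h4 : -(-(1 / s) - (0 : ℝ))⁻¹ = s := by simp
            rw [h4] at h3
            exact tendsto_nhdsWithin_of_tendsto_nhds h3
          · filter_upwards [self_mem_nhdsWithin] with τ hτ
            exact (hneg _ (sub_lt_self _ hτ)).2
        have h2 := (((hu.comp h1).neg.add_const (1 / s)).add
          (tendsto_nhdsWithin_of_tendsto_nhds (tendsto_id (x := 𝓝 (0 : ℝ))) :
            Tendsto id (𝓝[>] (0 : ℝ)) (𝓝 0))).sub_const 1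
        have h3 : -u + 1 / s + 0 - 1 = 0 := by
          field_simp
          linarith
        rw [h3] at h2
        exact h2
    · exfalso
      have hc : ContinuousAt Y (-Z) := (hY (-Z) ⟨by linarith, by linarith⟩).2.continuousAt
      have h1 : Tendsto (fun ζ => -Y (-ζ)) (𝓝[<] Z) (𝓝 (-Y (-Z))) :=
        (tendsto_nhdsWithin_of_tendsto_nhds
          (ContinuousAt.comp (f := fun ζ : ℝ => -ζ) hc continuous_neg.continuousAt)).neg
      have h2 : u ≤ -Y (-Z) := by
        refine le_of_tendsto_of_tendsto hu h1 ?_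
        filter_upwards [Ioo_mem_nhdsLT hZ] with ζ hζ
        exact (hY.lt_reflected hs hZ h0 ζ ⟨hζ.1.le, by rw [min_eq_right h.le]; exact hζ.2⟩).le
      have h3 := habove (-Z) ⟨by linarith, by linarith⟩
      nlinarith
  refine ⟨Z⁻¹, inv_pos.2 hZ, ?_, ?_, ?_, ?_⟩
  · rw [xiW_eq 1 hm0 hs, neg_neg, one_div]
    exact inv_strictAnti₀ hs hsZ
  · intro ξ hξ
    have hξ' : Z⁻¹ < ξ := hξ
    have hξ0 : 0 < ξ := (inv_pos.2 hZ).trans hξ'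
    refine hY.solvesU ξ ⟨hξ0.ne', ?_, ?_⟩
    · linarith [inv_pos.2 hξ0]
    · exact (inv_lt_comm₀ hZ hξ0).1 hξ'
  · exact (hY 0 ⟨by linarith, hZ⟩).2.continuousAt.tendsto.comp tendsto_inv_atTop_zero
  · have h1 : Tendsto (fun ξ : ℝ => ξ⁻¹) (𝓝[>] Z⁻¹) (𝓝[<] Z) := by
      refine tendsto_nhdsWithin_iff.2 ⟨?_, ?_⟩
      · have := (continuousAt_inv₀ (inv_pos.2 hZ).ne').tendsto
        rw [inv_inv] at this
        exact tendsto_nhdsWithin_of_tendsto_nhds this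
      · filter_upwards [self_mem_nhdsWithin] with ξ hξ
        exact (inv_lt_comm₀ hZ ((inv_pos.2 hZ).trans hξ)).1 hξ
    have h2 := hu.comp h1
    have h3 : u = Z⁻¹ - 1 := by
      have := hZ.ne'
      field_simp
      linarith
    rw [h3] at h2
    exact h2

end Kink

section KinkLimit

variable {m : ℕ}

/-- For `s = 1/2` the line `U = -1 + (3/2) (ζ + 1/2)` is a barrier above the kink. -/
lemma kink_limit_neg_of_half (hm : m = 1 ∨ m = 2) {Y : ℝ → ℝ} {δ : ℝ} (hδ : 0 < δ)
    (hY : SolvesIn (zetaField m (1 / 2)) zetaDomain Y (Ioo (-(1 / 2)) δ))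
    (hlim : Tendsto (fun τ => (Y (-(1 / (1 / 2)) - τ)⁻¹ + 1 / (1 / 2) + τ - 1) / τ) (𝓝[>] 0)
        (𝓝 (lamPlus m (m * (1 / 2 - 1))))) : Y 0 < 0 := by
  have hm2 : (m : ℝ) ≤ 2 := by rcases hm with rfl | rfl <;> norm_num
  -- in the variables `τ`, `v` at `P_w` the barrier has the slope `11 / 8`
  have hlam : lamPlus m (m * (1 / 2 - 1)) < 11 / 8 := by
    rw [lamPlus_eq (by omega)]
    have h1 : √((1 + (m : ℝ) / 2 * (1 / 2)) ^ 2 - 2 * m * (1 / 2) ^ 2) < 11 / 4 - (1 + m / 2 * (1 / 2)) := by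
      rw [Real.sqrt_lt' (by linarith)]
      rcases hm with rfl | rfl <;> norm_num
    linarith
  have hlim2 : Tendsto (fun τ : ℝ => 1 + 3 / (4 * (2 + τ))) (𝓝[>] 0) (𝓝 (11 / 8)) := by
    have : ContinuousAt (fun τ : ℝ => 1 + 3 / (4 * (2 + τ))) 0 := by
      have : 4 * (2 + (0 : ℝ)) ≠ 0 := by norm_num
      fun_prop (disch := assumption)
    have h := this.tendsto
    norm_num at h
    exact tendsto_nhdsWithin_of_tendsto_nhds h
  obtain ⟨τ, h1, h2⟩ := ((hlim.eventually_lt hlim2 hlam).and self_mem_nhdsWithin).exists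
  have hτ : 0 < τ := h2
  set ζ₀ := (-(1 / (1 / 2)) - τ)⁻¹ with hζ₀
  have hζ₀' : ζ₀ = -(2 + τ)⁻¹ := by
    rw [hζ₀, ← inv_neg]
    congr 1
    ring
  have hinv : (2 + τ)⁻¹ < 1 / 2 := by
    rw [one_div]
    exact inv_strictAnti₀ (by norm_num) (by linarith)
  have hinv0 : 0 < (2 + τ)⁻¹ := by positivity
  have hstart : 0 < -1 + 3 / 2 * (ζ₀ + 1 / 2) - Y ζ₀ := by
    rw [div_lt_iff₀ hτ] at h1
    have e1 : (1 + 3 / (4 * (2 + τ))) * τ = τ + 3 / 2 * (ζ₀ + 1 / 2) := by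
      rw [hζ₀']
      field_simp
      ring
    rw [e1] at h1
    norm_num at h1
    linarith
  have key := pos_of_deriv_pos (f := fun ζ => -1 + 3 / 2 * (ζ + 1 / 2) - Y ζ)
    (f' := fun ζ => 3 / 2 - zetaField m (1 / 2) (ζ, Y ζ)) (a := ζ₀) (b := 0) (fun ζ hζ => ?_)
    hstart (fun ζ hζ he => ?_)
  · have hc : ContinuousAt Y 0 := (hY 0 ⟨by norm_num, hδ⟩).2.continuousAt
    have h3 : Tendsto (fun ζ : ℝ => -1 + 3 / 2 * (ζ + 1 / 2) - Y ζ) (𝓝[<] 0)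
        (𝓝 (-1 + 3 / 2 * (0 + 1 / 2) - Y 0)) := by
      have : ContinuousAt (fun ζ : ℝ => -1 + 3 / 2 * (ζ + 1 / 2) - Y ζ) 0 := by fun_prop
      exact tendsto_nhdsWithin_of_tendsto_nhds this
    have h4 : 0 ≤ -1 + 3 / 2 * (0 + 1 / 2) - Y 0 := by
      refine ge_of_tendsto h3 ?_
      filter_upwards [Ioo_mem_nhdsLT (show ζ₀ < 0 by linarith)] with ζ hζ
      exact (key ζ (Ioo_subset_Ico_self hζ)).le
    linarith
  · have hd := (hY ζ ⟨by linarith [hζ.1], hζ.2.trans hδ⟩).2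
    refine (((((hasDerivAt_id' ζ).add_const (1 / 2)).const_mul (3 / 2)).const_add (-1)).fun_sub
      hd).congr_deriv (by ring)
  · have hdom := zetaDomain_denom (hY ζ ⟨by linarith [hζ.1], hζ.2.trans hδ⟩).1
    have hYζ : Y ζ = -1 + 3 / 2 * (ζ + 1 / 2) := by linarith
    rw [sub_pos]
    unfold zetaField
    rw [div_lt_iff₀ hdom]
    simp only at hdom ⊢
    rw [hYζ]
    obtain ⟨y, hy⟩ : ∃ y, y = ζ + 1 / 2 := ⟨_, rfl⟩
    have hζy : ζ = y - 1 / 2 := by linarith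
    have hy0 : 0 < y := by linarith [hζ.1]
    have hy1 : y < 1 / 2 := by linarith [hζ.2]
    rw [hζy]
    have e1 : 1 - (-1 + 3 / 2 * (y - 1 / 2 + 1 / 2)) * (y - 1 / 2) - 1 / 2
        = y * (7 / 4 - 3 / 2 * y) := by ring
    have e2 : (1 - (-1 + 3 / 2 * (y - 1 / 2 + 1 / 2)) * (y - 1 / 2)) ^ 2 - (y - 1 / 2) ^ 2
        = y * (11 / 4 - 3 / 2 * y) * (1 + y * (3 / 4 - 3 / 2 * y)) := by ring
    rw [e1, e2]
    have h5 : 0 < y * (7 / 4 - 3 / 2 * y) := mul_pos hy0 (by linarith)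
    have h6 : 0 < y * (11 / 4 - 3 / 2 * y) := mul_pos hy0 (by linarith)
    have h7 : 0 ≤ y * (3 / 4 - 3 / 2 * y) := mul_nonneg hy0.le (by linarith)
    calc (m : ℝ) * (y * (7 / 4 - 3 / 2 * y)) ≤ 2 * (y * (7 / 4 - 3 / 2 * y)) :=
          mul_le_mul_of_nonneg_right hm2 h5.le
      _ < 3 / 2 * (y * (11 / 4 - 3 / 2 * y)) := by nlinarith
      _ ≤ 3 / 2 * (y * (11 / 4 - 3 / 2 * y) * (1 + y * (3 / 4 - 3 / 2 * y))) := by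
          nlinarith [mul_nonneg h6.le h7]

end KinkLimit

/-! ### The solution through the origin -/

section Hat

variable {m : ℕ} {s : ℝ}

/-- The similarity equation between `ξ = 0` and `-P_w` for `R = ξ - U` (sound speed `1`). -/
noncomputable def hatField (M s : ℝ) (p : ℝ × ℝ) : ℝ := 1 - M * (p.2 / p.1 - s) / (1 - p.2 ^ 2)

/-- The triangle bounded by the nullcline `R = s ξ` and the sonic line `R = 1`; its corner
`ξ = 1 / s` is the critical point `-P_w`. -/
def hatDomain (s : ℝ) : Set (ℝ × ℝ) := {p | 0 < p.1 ∧ s * p.1 < p.2 ∧ p.2 < 1}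

lemma isOpen_hatDomain : IsOpen (hatDomain s) :=
  (isOpen_lt continuous_const continuous_fst).inter
    ((isOpen_lt (continuous_const.mul continuous_fst) continuous_snd).inter
      (isOpen_lt continuous_snd continuous_const))

lemma hatDomain_denom (hs : 0 < s) {p : ℝ × ℝ} (hp : p ∈ hatDomain s) : 0 < 1 - p.2 ^ 2 := by
  obtain ⟨h1, h2, h3⟩ := hp
  have : 0 < p.2 := (mul_pos hs h1).trans h2
  nlinarith

lemma contDiffOn_hatField (M : ℝ) (hs : 0 < s) : ContDiffOn ℝ 1 (hatField M s) (hatDomain s) := by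
  intro p hp
  have h := (hatDomain_denom hs hp).ne'
  have h2 : p.1 ≠ 0 := hp.1.ne'
  unfold hatField
  refine ContDiffAt.contDiffWithinAt ?_
  fun_prop (disch := assumption)

lemma similarity_eq_hatField {ξ u : ℝ} (hξ : ξ ≠ 0) (h : (u - ξ) ^ 2 ≠ 1 ^ 2) :
    1 ^ 2 / ((u - ξ) ^ 2 - 1 ^ 2) * (m * (s - 1) + m * u / ξ) = 1 - hatField m s (ξ, ξ - u) := by
  have h1 : (u - ξ) ^ 2 - 1 ^ 2 ≠ 0 := sub_ne_zero.2 h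
  have h2 : 1 - (ξ - u) ^ 2 ≠ 0 := fun h0 => h1 (by linarith [sub_sq_comm u ξ])
  have h3 : (u - ξ) ^ 2 - 1 ^ 2 = -(1 - (ξ - u) ^ 2) := by ring
  unfold hatField
  simp only
  rw [h3]
  generalize 1 - (ξ - u) ^ 2 = D at *
  field_simp
  ring

/-- The orbit through the origin reaches the corner of the triangle: it cannot leave through the
nullcline, where `R` grows faster than `s ξ`, nor through the sonic line, where `R` decreases. -/
lemma exists_hat_orbit (hm : m = 1 ∨ m = 2) (hs : 0 < s) (hs1 : s < 1) :
    ∃ R : ℝ → ℝ, SolvesIn (hatField m s) (hatDomain s) R (Ioo 0 (1 / s)) ∧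
      Tendsto R (𝓝[>] 0) (𝓝 0) ∧ Tendsto R (𝓝[<] (1 / s)) (𝓝 1) := by
  have hm0 : (0 : ℝ) < m := by exact_mod_cast (show 0 < m by omega)
  set κ₀ : ℝ := m * (1 - s) / (m + 1) with hκ₀
  have hκ0 : 0 < κ₀ := div_pos (mul_pos hm0 (by linarith)) (by linarith)
  have hκ1 : κ₀ < 1 - s := by
    rw [hκ₀, div_lt_iff₀ (by linarith)]
    nlinarith
  -- the equation for `κ = U / ξ`
  set G : ℝ × ℝ → ℝ := fun p =>
    m * (1 - s - p.2) / (1 - ((p.2 - 1) * p.1) ^ 2) - p.2 with hG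
  have hGc : ContDiffAt ℝ 1 G (0, κ₀) := by
    have h1 : 1 - ((κ₀ - 1) * (0 : ℝ)) ^ 2 ≠ 0 := by norm_num
    simp only [hG]
    fun_prop (disch := assumption)
  have hG0 : ∀ κ, G (0, κ) = m * (1 - s - κ) - κ := fun κ => by simp [hG]
  have hGz : G (0, κ₀) = 0 := by
    rw [hG0, hκ₀]
    field_simp
    ring
  have hGd : HasDerivAt (fun κ => G (0, κ)) (-(m + 1 : ℝ)) κ₀ := by
    simp only [hG0]
    exact ((((hasDerivAt_id' κ₀).const_sub (1 - s)).const_mul (m : ℝ)).fun_sub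
      (hasDerivAt_id' κ₀)).congr_deriv (by ring)
  obtain ⟨h, hh, κ, hκ, hκl⟩ := exists_solution_singular (by linarith) hGc hGz hGd
  obtain ⟨h', hh', hsub⟩ := mem_nhdsGT_iff_exists_Ioo_subset.1
    ((hκl.eventually (Ioi_mem_nhds hκ0)).and (hκl.eventually (Iio_mem_nhds hκ1)))
  set B := min (min h h') 1 with hB
  have hB0 : 0 < B := lt_min (lt_min hh hh') one_pos
  have hBh : B ≤ h := (min_le_left _ _).trans (min_le_left _ _)
  have hBh' : B ≤ h' := (min_le_left _ _).trans (min_le_right _ _)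
  have hB1 : B ≤ 1 := min_le_right _ _
  have hloc : SolvesIn (hatField m s) (hatDomain s) (fun ξ => ξ * (1 - κ ξ)) (Ioo 0 B) := by
    intro ξ hξ
    obtain ⟨h1, h2⟩ := hsub ⟨hξ.1, hξ.2.trans_le hBh'⟩
    have h1' : 0 < κ ξ := h1
    have h2' : κ ξ < 1 - s := h2
    have hmem : (ξ, ξ * (1 - κ ξ)) ∈ hatDomain s := by
      refine ⟨hξ.1, ?_, ?_⟩
      · rw [mul_comm]
        exact mul_lt_mul_of_pos_left (by linarith) hξ.1
      · have := hξ.2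
        have := hξ.1
        simp only
        nlinarith
    refine ⟨hmem, ?_⟩
    refine ((hasDerivAt_id' ξ).fun_mul
      ((hκ ξ ⟨hξ.1, hξ.2.trans_le hBh⟩).const_sub 1)).congr_deriv ?_
    have hξ0 := hξ.1.ne'
    have h3 := (hatDomain_denom hs hmem).ne'
    simp only at h3
    simp only [hatField, hG]
    have e : (κ ξ - 1) * ξ = -(ξ * (1 - κ ξ)) := by ring
    rw [e, neg_sq, mul_div_cancel_left₀ _ hξ0, mul_neg, mul_div_cancel₀ _ hξ0]
    ring
  obtain ⟨R, hRy, hRmax⟩ := SolvesIn.exists_maximal isOpen_hatDomain (contDiffOn_hatField m hs)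
    hB0 hloc
  have hR0 : Tendsto R (𝓝[>] 0) (𝓝 0) := by
    have h1 : Tendsto (fun ξ : ℝ => ξ) (𝓝[>] 0) (𝓝 0) :=
      tendsto_nhdsWithin_of_tendsto_nhds tendsto_id
    have h2 := h1.mul (hκl.const_sub 1)
    rw [zero_mul] at h2
    refine h2.congr' ?_
    filter_upwards [Ioo_mem_nhdsGT hB0] with ξ hξ using (hRy hξ).symm
  rcases hRmax with hglob | ⟨Z, hBZ, hRZ, hmax⟩
  · obtain ⟨⟨_, h1, h2⟩, _⟩ := hglob (1 / s) (by rw [mem_Ioi]; positivity)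
    simp only at h1 h2
    rw [mul_one_div_cancel hs.ne'] at h1
    linarith
  have hZ0 : 0 < Z := hB0.trans_le hBZ
  have hdom : ∀ ξ ∈ Ioo 0 Z, s * ξ < R ξ ∧ R ξ < 1 := fun ξ hξ => (hRZ ξ hξ).1.2
  have hmono : MonotoneOn (fun ξ => ξ - R ξ) (Ioo 0 Z) := by
    refine monotoneOn_of_hasDerivAt (convex_Ioo _ _)
      (fun ξ hξ => (hasDerivAt_id' ξ).fun_sub (hRZ ξ hξ).2) fun ξ hξ => ?_
    have h1 := hatDomain_denom hs (hRZ ξ hξ).1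
    have h2 : s < R ξ / ξ := (lt_div_iff₀ hξ.1).2 (hdom ξ hξ).1
    simp only [hatField, sub_sub_cancel]
    exact div_nonneg (mul_nonneg hm0.le (by linarith)) h1.le
  obtain ⟨u, hu⟩ := tendsto_left_of_monotoneOn (B := Z) hZ0 hmono fun ξ hξ => by
    have := (hdom ξ hξ).1
    have := mul_pos hs hξ.1
    linarith [hξ.2]
  have hid : Tendsto (fun ξ : ℝ => ξ) (𝓝[<] Z) (𝓝 Z) :=
    tendsto_nhdsWithin_of_tendsto_nhds tendsto_id
  have hRlim : Tendsto R (𝓝[<] Z) (𝓝 (Z - u)) := by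
    refine (hid.sub hu).congr fun ξ => ?_
    ring
  generalize Z - u = ρ at hRlim
  have hnear : ∀ᶠ ξ in 𝓝[<] Z, ξ ∈ Ioo 0 Z := Ioo_mem_nhdsLT hZ0
  have hρ1 : ρ ≤ 1 := le_of_tendsto hRlim (hnear.mono fun ξ hξ => (hdom ξ hξ).2.le)
  have hρs : s * Z ≤ ρ := le_of_tendsto_of_tendsto (hid.const_mul s) hRlim
    (hnear.mono fun ξ hξ => (hdom ξ hξ).1.le)
  have hnot := hmax ρ hRlim
  -- the orbit does not cross the nullcline
  have hne1 : s * Z < 1 → ρ ≠ s * Z := by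
    intro hsZ hρ
    have h1 : Tendsto (fun ξ => hatField m s (ξ, R ξ) - s) (𝓝[<] Z) (𝓝 (1 - s)) := by
      have h2 : ContinuousAt (hatField m s) (Z, ρ) := by
        have e1 : 1 - ρ ^ 2 ≠ 0 := by
          rw [hρ]
          have := mul_pos hs hZ0
          nlinarith
        have e2 : Z ≠ 0 := hZ0.ne'
        unfold hatField
        fun_prop (disch := assumption)
      have h3 : hatField m s (Z, ρ) = 1 := by
        have := hZ0.ne'
        simp [hatField, hρ, this]
      have h4 := (h2.tendsto.comp (hid.prodMk_nhds hRlim)).sub_const s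
      rwa [h3] at h4
    obtain ⟨z, hz, hzsub⟩ := mem_nhdsLT_iff_exists_Ioo_subset.1
      ((h1.eventually (Ioi_mem_nhds (show 0 < 1 - s by linarith))).and hnear)
    have hmon : MonotoneOn (fun ξ => R ξ - s * ξ) (Ioo z Z) :=
      monotoneOn_of_hasDerivAt (convex_Ioo _ _)
        (fun ξ hξ => (hRZ ξ (hzsub hξ).2).2.fun_sub ((hasDerivAt_id' ξ).const_mul s))
        fun ξ hξ => by
          have : 0 < hatField m s (ξ, R ξ) - s := (hzsub hξ).1
          linarith
    obtain ⟨ξ₁, hξ₁⟩ := nonempty_Ioo.2 (show z < Z from hz)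
    have h5 : Tendsto (fun ξ => R ξ - s * ξ) (𝓝[<] Z) (𝓝 (ρ - s * Z)) :=
      hRlim.sub (hid.const_mul s)
    have h6 : R ξ₁ - s * ξ₁ ≤ ρ - s * Z := by
      refine ge_of_tendsto h5 ?_
      filter_upwards [Ioo_mem_nhdsLT hξ₁.2] with ξ hξ
      exact hmon hξ₁ ⟨hξ₁.1.trans hξ.1, hξ.2⟩ hξ.1.le
    have := (hdom ξ₁ (hzsub hξ₁).2).1
    linarith
  -- the orbit does not cross the sonic line
  have hne2 : s * Z < 1 → ρ ≠ 1 := by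
    intro hsZ hρ
    have h1 : Tendsto (fun ξ => m * (R ξ / ξ - s) - (1 - R ξ ^ 2)) (𝓝[<] Z)
        (𝓝 (m * (1 / Z - s))) := by
      have h2 := (((hRlim.div hid hZ0.ne').sub_const s).const_mul (m : ℝ)).sub
        ((hRlim.pow 2).const_sub 1)
      rw [hρ] at h2
      simpa using h2
    have hpos : 0 < m * (1 / Z - s) := by
      refine mul_pos hm0 ?_
      rw [sub_pos, lt_div_iff₀ hZ0]
      exact hsZ
    obtain ⟨z, hz, hzsub⟩ := mem_nhdsLT_iff_exists_Ioo_subset.1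
      ((h1.eventually (Ioi_mem_nhds hpos)).and hnear)
    have hanti : AntitoneOn R (Ioo z Z) :=
      antitoneOn_of_hasDerivAt (convex_Ioo _ _) (fun ξ hξ => (hRZ ξ (hzsub hξ).2).2)
        fun ξ hξ => by
          have h3 : 0 < m * (R ξ / ξ - s) - (1 - R ξ ^ 2) := (hzsub hξ).1
          have h4 := hatDomain_denom hs (hRZ ξ (hzsub hξ).2).1
          simp only [hatField]
          rw [sub_nonpos, le_div_iff₀ h4]
          simp only at h4 ⊢
          linarith
    obtain ⟨ξ₁, hξ₁⟩ := nonempty_Ioo.2 (show z < Z from hz)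
    have h6 : ρ ≤ R ξ₁ := by
      refine le_of_tendsto hRlim ?_
      filter_upwards [Ioo_mem_nhdsLT hξ₁.2] with ξ hξ
      exact hanti hξ₁ ⟨hξ₁.1.trans hξ.1, hξ.2⟩ hξ.1.le
    have := (hdom ξ₁ (hzsub hξ₁).2).2
    linarith
  have hsZ : s * Z = 1 := by
    by_contra hne
    have hlt : s * Z < 1 := lt_of_le_of_ne (hρs.trans hρ1) hne
    exact hnot ⟨hZ0, lt_of_le_of_ne hρs (hne1 hlt).symm, lt_of_le_of_ne hρ1 (hne2 hlt)⟩
  have hZs : Z = 1 / s := by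
    rw [eq_div_iff hs.ne', mul_comm]
    exact hsZ
  have hρ : ρ = 1 := le_antisymm hρ1 (hsZ ▸ hρs)
  rw [hZs] at hRZ hRlim
  rw [hρ] at hRlim
  exact ⟨R, hRZ, hR0, hRlim⟩

/-- The solution through the origin is the odd extension of `ξ - R(ξ)`, where `R` is the orbit in
the triangle. It is written as `H(ξ) - H(-ξ)` with `H` continuous and zero for `ξ ≤ 0`. -/
lemma exists_hat (hm : m = 1 ∨ m = 2) (hs : 0 < s) (hs1 : s < 1) :
    ∃ U : ℝ → ℝ, IsHat 1 m (m * (s - 1)) U := by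
  have hm0 : 0 < m := by omega
  obtain ⟨R, hR, hR0, hR1⟩ := exists_hat_orbit hm hs hs1
  have hs' : 0 < 1 / s := by positivity
  set H : ℝ → ℝ := fun ξ => if ξ ≤ 0 then 0 else if ξ < 1 / s then ξ - R ξ else 1 / s - 1 with hH
  have H0 : ∀ ξ ≤ 0, H ξ = 0 := fun ξ hξ => by simp [hH, hξ]
  have H1 : ∀ ξ ∈ Ioo 0 (1 / s), H ξ = ξ - R ξ := fun ξ hξ => by
    simp only [hH, not_le.2 hξ.1, if_false, if_pos hξ.2]
  have H2 : ∀ ξ, 1 / s ≤ ξ → H ξ = 1 / s - 1 := fun ξ hξ => by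
    simp only [hH, not_le.2 (hs'.trans_le hξ), if_false, not_lt.2 hξ]
  have hHc : Continuous H := by
    rw [continuous_iff_continuousAt]
    intro ξ
    rcases lt_trichotomy ξ 0 with h | h | h
    · exact continuousAt_const.congr
        (by filter_upwards [Iio_mem_nhds h] with x hx using (H0 x (le_of_lt hx)).symm)
    · subst h
      refine continuousAt_iff_continuous_left'_right'.2 ⟨?_, ?_⟩
      · rw [ContinuousWithinAt, H0 0 le_rfl]
        exact tendsto_const_nhds.congr'
          (by filter_upwards [self_mem_nhdsWithin] with x hx using (H0 x (le_of_lt hx)).symm)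
      · rw [ContinuousWithinAt, H0 0 le_rfl]
        have h1 : Tendsto (fun ξ : ℝ => ξ - R ξ) (𝓝[>] 0) (𝓝 (0 - 0)) :=
          (tendsto_nhdsWithin_of_tendsto_nhds tendsto_id).sub hR0
        rw [sub_zero] at h1
        exact h1.congr'
          (by filter_upwards [Ioo_mem_nhdsGT hs'] with x hx using (H1 x hx).symm)
    rcases lt_trichotomy ξ (1 / s) with h' | h' | h'
    · have hc : ContinuousAt (fun ξ => ξ - R ξ) ξ :=
        continuousAt_id.sub (hR ξ ⟨h, h'⟩).2.continuousAt
      exact hc.congr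
        (by filter_upwards [Ioo_mem_nhds h h'] with x hx using (H1 x hx).symm)
    · subst h'
      refine continuousAt_iff_continuous_left'_right'.2 ⟨?_, ?_⟩
      · rw [ContinuousWithinAt, H2 _ le_rfl]
        have h1 : Tendsto (fun ξ : ℝ => ξ - R ξ) (𝓝[<] (1 / s)) (𝓝 (1 / s - 1)) :=
          (tendsto_nhdsWithin_of_tendsto_nhds tendsto_id).sub hR1
        exact h1.congr'
          (by filter_upwards [Ioo_mem_nhdsLT hs'] with x hx using (H1 x hx).symm)
      · rw [ContinuousWithinAt, H2 _ le_rfl]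
        exact tendsto_const_nhds.congr'
          (by filter_upwards [self_mem_nhdsWithin] with x hx using (H2 x (le_of_lt hx)).symm)
    · exact continuousAt_const.congr
        (by filter_upwards [Ioi_mem_nhds h'] with x hx using (H2 x (le_of_lt hx)).symm)
  have hpos : SolvesU 1 m (m * (s - 1)) (fun ξ => H ξ - H (-ξ)) (Ioo 0 (1 / s)) := by
    intro ξ hξ
    have h1 := hR ξ hξ
    have hev : (fun ξ => H ξ - H (-ξ)) =ᶠ[𝓝 ξ] fun ξ => ξ - R ξ := by
      filter_upwards [isOpen_Ioo.mem_nhds hξ] with x hx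
      rw [H1 x hx, H0 (-x) (by linarith [hx.1]), sub_zero]
    have hval : H ξ - H (-ξ) = ξ - R ξ := hev.eq_of_nhds
    have hd := hatDomain_denom hs h1.1
    have hW : (H ξ - H (-ξ) - ξ) ^ 2 ≠ 1 ^ 2 := by
      rw [hval, show ξ - R ξ - ξ = -R ξ by ring, neg_sq]
      simp only at hd
      intro h
      linarith
    refine ⟨hW, ?_⟩
    rw [similarity_eq_hatField hξ.1.ne' hW, hval, sub_sub_cancel]
    exact ((hasDerivAt_id' ξ).fun_sub h1.2).congr_of_eventuallyEq hev
  refine ⟨fun ξ => H ξ - H (-ξ), (by fun_prop), by simp, ?_, ?_, ?_, ?_⟩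
  · rw [xiW_eq 1 hm0 hs]
    have h1 := hpos.reflect
    refine fun ξ hξ => ?_
    have h2 := h1 ξ ⟨by linarith [hξ.2], by linarith [hξ.1]⟩
    simpa only [neg_sub, neg_neg] using h2
  · rw [xiW_eq 1 hm0 hs, neg_neg]
    exact hpos
  · rw [xiW_eq 1 hm0 hs, uW_eq 1 hm0 hs, neg_neg, H2 _ le_rfl, H0 _ (by linarith)]
    ring
  · rw [xiW_eq 1 hm0 hs, uW_eq 1 hm0 hs, neg_neg, H2 _ le_rfl, H0 _ (by linarith)]
    ring

/-- Every solution that joins the origin to `-P_w` stays above the nullcline `R = s ξ`. -/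
lemma hat_above_nullcline (hm : 0 < m) (hs : 0 < s) (hs1 : s < 1) {V : ℝ → ℝ}
    (hc : ContinuousOn V (Icc 0 (1 / s))) (h0 : V 0 = 0)
    (hV : SolvesU 1 m (m * (s - 1)) V (Ioo 0 (1 / s))) :
    ∀ ξ ∈ Ioo 0 (1 / s), s * ξ < ξ - V ξ ∧ ξ - V ξ < 1 := by
  have hs' : 0 < 1 / s := by positivity
  have hmR : (0 : ℝ) < m := by exact_mod_cast hm
  have hsq : ∀ ξ ∈ Ico 0 (1 / s), 0 < 1 - (V ξ - ξ) ^ 2 := by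
    refine pos_of_ne_zero (convex_Ico _ _).isPreconnected ?_ ?_ (left_mem_Ico.2 hs') (by simp [h0])
    · exact continuousOn_const.sub (((hc.mono Ico_subset_Icc_self).sub continuousOn_id).pow 2)
    · intro ξ hξ h
      rcases eq_or_lt_of_le hξ.1 with rfl | hlt
      · simp [h0] at h
      · exact (hV ξ ⟨hlt, hξ.2⟩).1 (by linarith)
  have hlt1 : ∀ ξ ∈ Ico 0 (1 / s), ξ - V ξ < 1 := fun ξ hξ => by
    nlinarith [hsq ξ hξ]
  have hd : ∀ ξ ∈ Ioo 0 (1 / s), HasDerivAt (fun ξ => ξ - V ξ - s * ξ)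
      (hatField m s (ξ, ξ - V ξ) - s) ξ := by
    intro ξ hξ
    have h1 := (hV ξ hξ).2
    rw [similarity_eq_hatField hξ.1.ne' (hV ξ hξ).1] at h1
    exact (((hasDerivAt_id' ξ).fun_sub h1).fun_sub ((hasDerivAt_id' ξ).const_mul s)).congr_deriv
      (by ring)
  refine fun ξ hξ => ⟨?_, hlt1 ξ (Ioo_subset_Ico_self hξ)⟩
  by_contra! hle
  have hcont : ContinuousOn (fun ξ => ξ - V ξ - s * ξ) (Icc 0 ξ) :=
    (continuousOn_id.sub (hc.mono (Icc_subset_Icc_right hξ.2.le))).sub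
      (continuousOn_const.mul continuousOn_id)
  -- backwards from a point below the nullcline the orbit stays below it
  have hbelow : ∀ x ∈ Icc 0 ξ, x - V x - s * x ≤ 0 := by
    have hrev : ContinuousOn (fun y => (ξ - y) - V (ξ - y) - s * (ξ - y)) (Icc 0 ξ) :=
      hcont.comp (f := fun y => ξ - y) (continuousOn_const.sub continuousOn_id)
        fun y hy => ⟨by linarith [hy.2], by linarith [hy.1]⟩
    intro x hx
    have hdr : ∀ y ∈ Ico 0 ξ, HasDerivAt (fun y => (ξ - y) - V (ξ - y) - s * (ξ - y))
        (-(hatField m s (ξ - y, (ξ - y) - V (ξ - y)) - s)) y := by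
      intro y hy
      have := (hd (ξ - y) ⟨by linarith [hy.2], by linarith [hy.1, hξ.2]⟩).comp y
        ((hasDerivAt_id' y).const_sub ξ)
      exact this.congr_deriv (by ring)
    have := image_le_of_deriv_right_lt_deriv_boundary' (a := 0) (b := ξ)
      (f := fun y => (ξ - y) - V (ξ - y) - s * (ξ - y))
      (f' := fun y => -(hatField m s (ξ - y, (ξ - y) - V (ξ - y)) - s)) hrev
      (fun y hy => (hdr y hy).hasDerivWithinAt) (B := fun _ => 0) (B' := fun _ => 0)
      (by simp only [sub_zero]; linarith) continuousOn_const
      (fun y _ => hasDerivWithinAt_const _ _ _) (fun y hy he => by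
        have hξy : 0 < ξ - y := by linarith [hy.2]
        have e : (ξ - y) - V (ξ - y) = s * (ξ - y) := by linarith
        rw [e]
        simp only [hatField]
        rw [mul_div_cancel_right₀ _ hξy.ne']
        simp
        linarith)
      (show ξ - x ∈ Icc 0 ξ from ⟨by linarith [hx.2], by linarith [hx.1]⟩)
    simpa using this
  -- below the nullcline `R' ≥ 1`, so `R ≥ x`, which contradicts `R ≤ s x`
  have hmono : MonotoneOn (fun x => x - V x - s * x - (1 - s) * x) (Ioo 0 ξ) := by
    refine monotoneOn_of_hasDerivAt (convex_Ioo _ _) (fun x hx =>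
      (hd x ⟨hx.1, hx.2.trans hξ.2⟩).fun_sub ((hasDerivAt_id' x).const_mul (1 - s)))
      fun x hx => ?_
    have h1 := hsq x ⟨hx.1.le, hx.2.trans hξ.2⟩
    have h2 := hbelow x ⟨hx.1.le, hx.2.le⟩
    have h3 : (x - V x) / x - s ≤ 0 := by
      rw [sub_nonpos, div_le_iff₀ hx.1]
      linarith
    have h4 : (m : ℝ) * ((x - V x) / x - s) / (1 - (x - V x) ^ 2) ≤ 0 :=
      div_nonpos_of_nonpos_of_nonneg (mul_nonpos_of_nonneg_of_nonpos hmR.le h3)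
        (by rw [sub_sq_comm]; exact h1.le)
    simp only [hatField]
    linarith
  have hlim : Tendsto (fun x => x - V x - s * x - (1 - s) * x) (𝓝[>] 0) (𝓝 0) := by
    have h1 : ContinuousWithinAt V (Icc 0 (1 / s)) 0 := hc 0 (left_mem_Icc.2 hs'.le)
    have h2 : Tendsto V (𝓝[>] 0) (𝓝 0) := by
      rw [ContinuousWithinAt, h0] at h1
      refine h1.mono_left ?_
      rw [← nhdsWithin_Ioo_eq_nhdsGT hs']
      exact nhdsWithin_mono _ Ioo_subset_Icc_self
    have h3 : Tendsto (fun x : ℝ => x) (𝓝[>] 0) (𝓝 0) :=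
      tendsto_nhdsWithin_of_tendsto_nhds tendsto_id
    simpa using ((h3.sub h2).sub (h3.const_mul s)).sub (h3.const_mul (1 - s))
  have hmid : ξ / 2 ∈ Ioo 0 ξ := ⟨by linarith [hξ.1], by linarith [hξ.1]⟩
  have h5 : 0 ≤ ξ / 2 - V (ξ / 2) - s * (ξ / 2) - (1 - s) * (ξ / 2) := by
    refine le_of_tendsto hlim ?_
    filter_upwards [Ioo_mem_nhdsGT hmid.1] with x hx
    exact hmono ⟨hx.1, hx.2.trans hmid.2⟩ hmid hx.2.le
  have h6 := hbelow (ξ / 2) ⟨hmid.1.le, hmid.2.le⟩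
  have h7 : 0 < (1 - s) * (ξ / 2) := mul_pos (by linarith) hmid.1
  linarith

/-- Every solution that joins the origin to `-P_w` enters with the flat slope: backwards from the
node the flat direction attracts. -/
lemma hat_tendsto_lamMinus (hm : m = 1 ∨ m = 2) (hs : 0 < s) (hs1 : s < 1) {V : ℝ → ℝ}
    (hc : ContinuousOn V (Icc 0 (1 / s))) (h0 : V 0 = 0)
    (hV : SolvesU 1 m (m * (s - 1)) V (Ioo 0 (1 / s))) :
    Tendsto (fun τ => (1 - (1 / s - τ - V (1 / s - τ))) / τ) (𝓝[>] 0)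
      (𝓝 (lamMinus m (m * (s - 1)))) := by
  have hm0 : 0 < m := by omega
  have hmR : (0 : ℝ) < m := by exact_mod_cast hm0
  have hs' : 0 < 1 / s := by positivity
  have habove := hat_above_nullcline hm0 hs hs1 hc h0 hV
  set θ : ℝ → ℝ := fun τ => (1 - (1 / s - τ - V (1 / s - τ))) / τ with hθ
  set D : ℝ → ℝ := fun τ => (1 / s - τ) * (2 - τ * θ τ) with hD
  have hmem : ∀ τ ∈ Ioo 0 (1 / s), 1 / s - τ ∈ Ioo 0 (1 / s) := fun τ hτ =>
    ⟨by linarith [hτ.2], by linarith [hτ.1]⟩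
  have hb : ∀ τ ∈ Ioo 0 (1 / s), 0 < θ τ ∧ θ τ < s := by
    intro τ hτ
    obtain ⟨h1, h2⟩ := habove _ (hmem τ hτ)
    constructor
    · exact div_pos (by linarith) hτ.1
    · rw [hθ, div_lt_iff₀ hτ.1]
      have : s * (1 / s - τ) = 1 - s * τ := by field_simp
      linarith
  have hτθ : ∀ τ ∈ Ioo 0 (1 / s), τ * θ τ = 1 - (1 / s - τ - V (1 / s - τ)) := fun τ hτ =>
    mul_div_cancel₀ _ hτ.1.ne'
  have hDle : ∀ τ ∈ Ioo 0 (1 / s), 0 < D τ ∧ D τ ≤ 2 / s ∧ 2 / s - 3 * τ ≤ D τ := by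
    intro τ hτ
    obtain ⟨h1, h2⟩ := hb τ hτ
    have h3 : τ * θ τ < τ * s := mul_lt_mul_of_pos_left h2 hτ.1
    have h4 : τ * s < 1 := by
      have := mul_lt_mul_of_pos_right hτ.2 hs
      rwa [one_div_mul_cancel hs.ne'] at this
    have h5 : 0 < τ * θ τ := mul_pos hτ.1 h1
    have h6 : 0 < 1 / s - τ := by linarith [hτ.2]
    have e1 : (2 : ℝ) / s = 1 / s * 2 := by ring
    refine ⟨mul_pos h6 (by linarith), ?_, ?_⟩
    · rw [e1]
      exact mul_le_mul (by linarith [hτ.1]) (by linarith) (by linarith) hs'.le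
    · have h7 : (1 / s - τ) * (τ * θ τ) ≤ 1 / s * (τ * s) :=
        mul_le_mul (by linarith [hτ.1]) h3.le h5.le hs'.le
      have h8 : 1 / s * (τ * s) = τ := by field_simp
      rw [e1]
      simp only [hD]
      nlinarith
  set G : ℝ → ℝ := fun τ => ((1 - θ τ) * θ τ * D τ - m * (s - θ τ)) / (θ τ * D τ) with hG
  have hd : ∀ τ ∈ Ioo 0 (1 / s), HasDerivAt θ (G τ / τ) τ := by
    intro τ hτ
    have h1 := hV _ (hmem τ hτ)
    have h2 := h1.2
    rw [similarity_eq_hatField (hmem τ hτ).1.ne' h1.1] at h2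
    have h3 : HasDerivAt (fun τ : ℝ => 1 / s - τ) (-1) τ := by
      simpa using (hasDerivAt_id' τ).const_sub (1 / s)
    have h4 := (((h3.fun_sub (h2.comp τ h3)).const_sub 1).fun_div (hasDerivAt_id' τ) hτ.1.ne')
    refine h4.congr_deriv ?_
    obtain ⟨hp1, hp2⟩ := hb τ hτ
    obtain ⟨hD1, -, -⟩ := hDle τ hτ
    have e1 : 1 - (1 / s - τ - V (1 / s - τ)) = τ * θ τ := (hτθ τ hτ).symm
    have e2 : 1 / s - τ - V (1 / s - τ) = 1 - τ * θ τ := by linarith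
    have e3 : 1 - (1 - τ * θ τ) ^ 2 = τ * θ τ * (2 - τ * θ τ) := by ring
    have e4 : (1 - τ * θ τ) / (1 / s - τ) - s = τ * (s - θ τ) / (1 / s - τ) := by
      have := (hmem τ hτ).1.ne'
      rw [eq_div_iff this, sub_mul, div_mul_cancel₀ _ this]
      field_simp
      ring
    simp only [hatField, Function.comp_apply]
    rw [e1, e2, e3, e4]
    have hx : 0 < 1 / s - τ := (hmem τ hτ).1
    have hy : 0 < 2 - τ * θ τ := by
      have := hD1
      simp only [hD] at this
      exact (pos_iff_pos_of_mul_pos this).1 hx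
    simp only [hG, hD]
    generalize 1 / s - τ = x at hx
    generalize hyy : 2 - τ * θ τ = y at hy
    have hτ0 := hτ.1
    field_simp
    ring
  have hfac := lam_factor hm hs hs1
  have hsb := s_between hm hs hs1
  have hll := lamMinus_lt_lamPlus hm hs hs1
  set l := lamPlus m (m * (s - 1)) with hl
  set l' := lamMinus m (m * (s - 1)) with hl'
  have hnum : ∀ x : ℝ, (1 - x) * x * (2 / s) - m * (s - x) = 2 / s * ((l - x) * (x - l')) := by
    intro x
    have h1 : (l - x) * (x - l') = -(x ^ 2 - (1 + m / 2 * s) * x + m * s ^ 2 / 2) := by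
      rw [← hfac x]
      ring
    rw [h1]
    field_simp
    ring
  refine tendsto_of_singular hs' hd (A := 0) (B := s)
    (fun τ hτ => ⟨(hb τ hτ).1.le, (hb τ hτ).2.le⟩) ?_ ?_
  · intro ε hε
    have hc1 : 0 < (l - s) * ε / s := div_pos (mul_pos (by linarith) hε) hs
    refine ⟨(l - s) * ε / s / 2, half_pos hc1, ?_⟩
    filter_upwards [Ioo_mem_nhdsGT hs', Ioo_mem_nhdsGT (div_pos hc1 three_pos)] with τ hτ hτ' hge
    obtain ⟨hp1, hp2⟩ := hb τ hτ
    obtain ⟨hD1, hD2, hD3⟩ := hDle τ hτ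
    have h1 : (1 - θ τ) * θ τ * (2 / s - 3 * τ) ≤ (1 - θ τ) * θ τ * D τ :=
      mul_le_mul_of_nonneg_left hD3 (mul_nonneg (by linarith) hp1.le)
    have h2 : (1 - θ τ) * θ τ * (3 * τ) ≤ 1 * (3 * τ) :=
      mul_le_mul_of_nonneg_right (by nlinarith) (by linarith [hτ.1])
    have h3 : 2 / s * ((l - s) * ε) ≤ 2 / s * ((l - θ τ) * (θ τ - l')) :=
      mul_le_mul_of_nonneg_left
        (mul_le_mul (by linarith) (by linarith) hε.le (by linarith)) (by positivity)
    have h4 : τ * 3 < (l - s) * ε / s := (lt_div_iff₀ three_pos).1 hτ'.2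
    have h5 : 2 / s * ((l - s) * ε) = 2 * ((l - s) * ε / s) := by ring
    have h6 := hnum (θ τ)
    have h7 : (l - s) * ε / s ≤ (1 - θ τ) * θ τ * D τ - m * (s - θ τ) := by
      rw [mul_sub] at h1
      linarith
    have h8 : θ τ * D τ ≤ 2 := by
      calc θ τ * D τ ≤ s * (2 / s) := mul_le_mul hp2.le hD2 hD1.le hs.le
        _ = 2 := by field_simp
    exact div_le_div₀ (hc1.le.trans h7) h7 (mul_pos hp1 hD1) h8
  · intro ε hε
    have hc1 : 0 < (l - l') * ε / s := div_pos (mul_pos (by linarith) hε) hs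
    refine ⟨(l - l') * ε / s, hc1, ?_⟩
    filter_upwards [Ioo_mem_nhdsGT hs'] with τ hτ hle
    obtain ⟨hp1, hp2⟩ := hb τ hτ
    obtain ⟨hD1, hD2, -⟩ := hDle τ hτ
    have h1 : (1 - θ τ) * θ τ * D τ ≤ (1 - θ τ) * θ τ * (2 / s) :=
      mul_le_mul_of_nonneg_left hD2 (mul_nonneg (by linarith) hp1.le)
    have h3 : 2 / s * ((l - l') * ε) ≤ 2 / s * ((l - θ τ) * (l' - θ τ)) :=
      mul_le_mul_of_nonneg_left
        (mul_le_mul (by linarith) (by linarith) hε.le (by linarith)) (by positivity)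
    have h5 : 2 / s * ((l - l') * ε) = 2 * ((l - l') * ε / s) := by ring
    have h6 := hnum (θ τ)
    have h6' : (l - θ τ) * (l' - θ τ) = -((l - θ τ) * (θ τ - l')) := by ring
    have h7 : (1 - θ τ) * θ τ * D τ - m * (s - θ τ) ≤ -(2 * ((l - l') * ε / s)) := by
      rw [h6', mul_neg] at h3
      linarith
    have h8 : θ τ * D τ ≤ 2 := by
      calc θ τ * D τ ≤ s * (2 / s) := mul_le_mul hp2.le hD2 hD1.le hs.le
        _ = 2 := by field_simp
    rw [hG, div_le_iff₀ (mul_pos hp1 hD1)]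
    nlinarith

end Hat

/-! ### The pieces of the velocity profile for a general sound speed -/

section Scaling

variable {a c β : ℝ} {m : ℕ} {U : ℝ → ℝ}

lemma xiW_div (a c β : ℝ) (m : ℕ) : xiW (a / c) m β = xiW a m β / c := by
  unfold xiW
  ring

lemma uW_div (a c β : ℝ) (m : ℕ) : uW (a / c) m β = uW a m β / c := by
  unfold uW
  ring

lemma tendsto_const_mul_nhdsLT (hc : 0 < c) (w : ℝ) :
    Tendsto (fun x => c * x) (𝓝[<] (w / c)) (𝓝[<] w) := by
  refine tendsto_nhdsWithin_iff.2 ⟨?_, ?_⟩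
  · have : Tendsto (fun x => c * x) (𝓝 (w / c)) (𝓝 (c * (w / c))) :=
      (continuous_const.mul continuous_id).tendsto _
    rw [mul_div_cancel₀ _ hc.ne'] at this
    exact tendsto_nhdsWithin_of_tendsto_nhds this
  · filter_upwards [self_mem_nhdsWithin] with x hx
    have := (lt_div_iff₀ hc).1 (mem_Iio.1 hx)
    rw [mem_Iio]
    linarith

lemma tendsto_const_mul_nhdsGT (hc : 0 < c) (w : ℝ) :
    Tendsto (fun x => c * x) (𝓝[>] (w / c)) (𝓝[>] w) := by
  refine tendsto_nhdsWithin_iff.2 ⟨?_, ?_⟩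
  · have : Tendsto (fun x => c * x) (𝓝 (w / c)) (𝓝 (c * (w / c))) :=
      (continuous_const.mul continuous_id).tendsto _
    rw [mul_div_cancel₀ _ hc.ne'] at this
    exact tendsto_nhdsWithin_of_tendsto_nhds this
  · filter_upwards [self_mem_nhdsWithin] with x hx
    have := (div_lt_iff₀ hc).1 (mem_Ioi.1 hx)
    rw [mem_Ioi]
    linarith

lemma scaled_slope (hc : 0 < c) (w u x : ℝ) :
    (U (c * x) - u) / (c * x - w) = (U (c * x) / c - u / c) / (x - w / c) := by
  rw [← sub_div, show x - w / c = (c * x - w) / c by field_simp,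
    div_div_div_cancel_right₀ hc.ne']

lemma IsKink.scale (hc : 0 < c) (hU : IsKink a m β U) :
    IsKink (a / c) m β (fun x => U (c * x) / c) := by
  refine ⟨?_, ?_, ?_⟩
  · rw [xiW_div]
    refine (hU.solves.scale hc).mono fun x hx => ?_
    have := (lt_div_iff₀ hc).1 (mem_Iio.1 hx)
    change c * x < _
    linarith
  · rw [xiW_div, uW_div]
    exact (hU.tendsto.comp (tendsto_const_mul_nhdsLT hc _)).div_const c
  · rw [xiW_div, uW_div]
    exact (hU.slope.comp (tendsto_const_mul_nhdsLT hc _)).congr fun x => scaled_slope hc _ _ x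

lemma IsHat.scale (hc : 0 < c) (hU : IsHat a m β U) :
    IsHat (a / c) m β (fun x => U (c * x) / c) := by
  have hlo : ∀ w x : ℝ, w / c < x → w < c * x := fun w x h => by
    have := (div_lt_iff₀ hc).1 h
    linarith
  have hhi : ∀ w x : ℝ, x < w / c → c * x < w := fun w x h => by
    have := (lt_div_iff₀ hc).1 h
    linarith
  have hw : -(xiW a m β / c) = -xiW a m β / c := by ring
  refine ⟨?_, by simp [hU.zero], ?_, ?_, ?_, ?_⟩
  · rw [xiW_div, hw]
    refine ContinuousOn.div_const (hU.continuousOn.comp (f := fun x => c * x)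
      (continuous_const.mul continuous_id).continuousOn fun x hx => ⟨?_, ?_⟩) c
    · have := (div_le_iff₀ hc).1 hx.1
      linarith
    · have := (le_div_iff₀ hc).1 hx.2
      linarith
  · rw [xiW_div]
    refine (hU.solves_neg.scale hc).mono fun x hx => ⟨hlo _ _ hx.1, ?_⟩
    exact mul_neg_of_pos_of_neg hc hx.2
  · rw [xiW_div, hw]
    exact (hU.solves_pos.scale hc).mono fun x hx => ⟨mul_pos hc hx.1, hhi _ _ hx.2⟩
  · rw [xiW_div, uW_div, mul_div_cancel₀ _ hc.ne', hU.left]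
  · rw [xiW_div, uW_div, hw, mul_div_cancel₀ _ hc.ne', hU.right, neg_div]

lemma IsTilde.scale {Ustar xiStar : ℝ} (hc : 0 < c) (hU : IsTilde a m β Ustar xiStar U) :
    IsTilde (a / c) m β (Ustar / c) (xiStar / c) (fun x => U (c * x) / c) := by
  refine ⟨div_pos hU.pos hc, ?_, ?_, ?_, ?_⟩
  · rw [xiW_div, ← neg_div]
    exact div_lt_div_of_pos_right hU.lt hc
  · refine (hU.solves.scale hc).mono fun x hx => ?_
    have := (div_lt_iff₀ hc).1 (mem_Ioi.1 hx)
    change _ < c * x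
    linarith
  · exact (hU.tendsto_atTop.comp (tendsto_id.const_mul_atTop hc)).div_const c
  · rw [← sub_div]
    exact (hU.tendsto_line.comp (tendsto_const_mul_nhdsGT hc _)).div_const c

lemma exists_eq_mul_sub_one (hm : m = 1 ∨ m = 2) (hβ : -(m : ℝ) < β) (hβ' : β < 0) :
    ∃ s : ℝ, 0 < s ∧ s < 1 ∧ β = m * (s - 1) := by
  have hm0 : (0 : ℝ) < m := by exact_mod_cast (show 0 < m by omega)
  refine ⟨1 + β / m, ?_, ?_, ?_⟩
  · have : -1 < β / m := by
      rw [lt_div_iff₀ hm0]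
      linarith
    linarith
  · linarith [div_neg_of_neg_of_pos hβ' hm0]
  · field_simp
    ring

lemma IsKink.eqOn_of_sound_speed (ha : 0 < a) (hm : m = 1 ∨ m = 2) (hβ : -(m : ℝ) < β)
    (hβ' : β < 0) {V : ℝ → ℝ} (hU : IsKink a m β U) (hV : IsKink a m β V) :
    EqOn U V (Iio (xiW a m β)) := by
  obtain ⟨s, hs, hs1, rfl⟩ := exists_eq_mul_sub_one hm hβ hβ'
  have hU1 := hU.scale ha
  have hV1 := hV.scale ha
  rw [div_self ha.ne'] at hU1 hV1
  have h := IsKink.eqOn hm hs hs1 hU1 hV1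
  intro ξ hξ
  rw [xiW_eq a (by omega) hs, mem_Iio] at hξ
  have h1 := h (show ξ / a ∈ Iio (-(1 / s)) by
    rw [mem_Iio, div_lt_iff₀ ha]
    linarith [show -(1 / s) * a = -(a / s) by ring])
  simp only [mul_div_cancel₀ _ ha.ne'] at h1
  exact (div_left_inj' ha.ne').1 h1

/-- The kink is the part `ζ < 0` of the maximal orbit, and its limit at `-∞` the value at `ζ = 0`. -/
lemma exists_kink (ha : 0 < a) (hm : m = 1 ∨ m = 2) (hβ : -(m : ℝ) < β) (hβ' : β < 0) :
    ∃ (Uk : ℝ → ℝ) (Ustar : ℝ), IsKink a m β Uk ∧ Tendsto Uk atBot (𝓝 Ustar) := by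
  obtain ⟨s, hs, hs1, rfl⟩ := exists_eq_mul_sub_one hm hβ hβ'
  obtain ⟨Y, hY, habove, hlim⟩ := exists_maximal_kink hm hs hs1
  obtain ⟨δ, hδ, hYδ⟩ : ∃ δ > 0, SolvesIn (zetaField m s) zetaDomain Y (Ioo (-s) δ) := by
    rcases hY with hY | ⟨Z, hZ, hY, _⟩
    · exact ⟨1, one_pos, hY.mono Ioo_subset_Ioi_self⟩
    · exact ⟨Z, hZ, hY⟩
  have hk := SolvesIn.isKink (by omega) hs (hYδ.mono (Ioo_subset_Ioo_right hδ.le)) hlim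
  have hc : ContinuousAt Y 0 := (hYδ 0 ⟨by linarith, hδ⟩).2.continuousAt
  have hk' := hk.scale (one_div_pos.2 ha)
  rw [one_div_one_div] at hk'
  refine ⟨_, Y 0 / (1 / a), hk', ?_⟩
  have h1 : Tendsto (fun x : ℝ => 1 / a * x) atBot atBot :=
    tendsto_id.const_mul_atBot (one_div_pos.2 ha)
  exact ((hc.tendsto.comp (tendsto_inv_atBot_zero.comp h1)).div_const _)

lemma kinkLimitNeg_of_half (ha : 0 < a) (hm : m = 1 ∨ m = 2) (hβ : β = -(m / 2)) :
    KinkLimitNeg a m β := by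
  have hβm : β = m * (1 / 2 - 1) := by
    rw [hβ]
    ring
  subst hβm
  have hm0 : 0 < m := by omega
  obtain ⟨Y, hY, habove, hlim⟩ := exists_maximal_kink hm (s := 1 / 2) (by norm_num) (by norm_num)
  obtain ⟨δ, hδ, hYδ⟩ : ∃ δ > 0,
      SolvesIn (zetaField m (1 / 2)) zetaDomain Y (Ioo (-(1 / 2)) δ) := by
    rcases hY with hY | ⟨Z, hZ, hY, _⟩
    · exact ⟨1, one_pos, hY.mono Ioo_subset_Ioi_self⟩
    · exact ⟨Z, hZ, hY⟩
  have hneg := kink_limit_neg_of_half hm hδ hYδ hlim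
  have hk := SolvesIn.isKink hm0 (by norm_num) (hYδ.mono (Ioo_subset_Ioo_right hδ.le)) hlim
  have hc : ContinuousAt Y 0 := (hYδ 0 ⟨by norm_num, hδ⟩).2.continuousAt
  have hk' := hk.scale (one_div_pos.2 ha)
  rw [one_div_one_div] at hk'
  refine ⟨_, Y 0 / (1 / a), hk', ?_, div_neg_of_neg_of_pos hneg (one_div_pos.2 ha)⟩
  have h1 : Tendsto (fun x : ℝ => 1 / a * x) atBot atBot :=
    tendsto_id.const_mul_atBot (one_div_pos.2 ha)
  exact ((hc.tendsto.comp (tendsto_inv_atBot_zero.comp h1)).div_const _)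

lemma xiW_neg (ha : 0 < a) (hm : m = 1 ∨ m = 2) (hβ : -(m : ℝ) < β) : xiW a m β < 0 := by
  have hm0 : (0 : ℝ) < m := by exact_mod_cast (show 0 < m by omega)
  unfold xiW
  rw [neg_lt_zero]
  exact div_pos (mul_pos ha hm0) (by linarith)

lemma uW_sub_xiW (hβ : -(m : ℝ) < β) : uW a m β - a = xiW a m β := by
  have : (m : ℝ) + β ≠ 0 := by linarith
  unfold uW xiW
  field_simp
  ring

/-- The inner solution is subsonic relative to the rays `r = ξ t`. -/
lemma IsHat.abs_sub_lt (ha : 0 < a) (hw : xiW a m β < 0) (hU : IsHat a m β U) :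
    ∀ ξ ∈ Ioo (xiW a m β) (-xiW a m β), |U ξ - ξ| < a := by
  have key := pos_of_ne_zero (S := Ioo (xiW a m β) (-xiW a m β))
    (f := fun ξ => a ^ 2 - (U ξ - ξ) ^ 2) isPreconnected_Ioo
    (continuousOn_const.sub (((hU.continuousOn.mono Ioo_subset_Icc_self).sub
      continuousOn_id).pow 2)) (fun ξ hξ h => ?_) (x₀ := 0) ⟨hw, by linarith⟩
    (by simp only [hU.zero]; nlinarith)
  · intro ξ hξ
    exact abs_lt_of_sq_lt_sq (by linarith [key ξ hξ]) ha.le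
  · rcases lt_trichotomy ξ 0 with h0 | h0 | h0
    · exact (hU.solves_neg ξ ⟨hξ.1, h0⟩).1 (by linarith)
    · subst h0
      rw [hU.zero] at h
      nlinarith
    · exact (hU.solves_pos ξ ⟨h0, hξ.2⟩).1 (by linarith)

/-- The outer solution is supersonic relative to the rays `r = ξ t`. -/
lemma IsTilde.sub_lt {Ustar xiStar : ℝ} (hU : IsTilde a m β Ustar xiStar U) :
    ∀ ξ, xiStar < ξ → U ξ - ξ < -a := by
  have h1 : Tendsto (fun ξ => ξ + -U ξ) atTop atTop :=
    tendsto_id.atTop_add hU.tendsto_atTop.neg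
  obtain ⟨x₀, hx₀, hx₁⟩ := ((h1.eventually_gt_atTop a).and (eventually_gt_atTop xiStar)).exists
  have hc : ContinuousOn U (Ioi xiStar) := fun ξ hξ =>
    (hU.solves ξ hξ).2.continuousAt.continuousWithinAt
  have key := pos_of_ne_zero (S := Ioi xiStar) (f := fun ξ => -a - (U ξ - ξ)) isPreconnected_Ioi
    (continuousOn_const.sub (hc.sub continuousOn_id)) (fun ξ hξ h => ?_) (x₀ := x₀) hx₁
    (by linarith)
  · intro ξ hξ
    linarith [key ξ hξ]
  · refine (hU.solves ξ hξ).1 ?_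
    rw [show U ξ - ξ = -a by linarith, neg_sq]

/-- The inner solution leaves `P_w` with the flat slope; by reflection this is
`hat_tendsto_lamMinus` at `-P_w`. -/
lemma IsHat.slope (ha : 0 < a) (hm : m = 1 ∨ m = 2) (hβ : -(m : ℝ) < β) (hβ' : β < 0)
    (hU : IsHat a m β U) :
    Tendsto (fun ξ => (U ξ - uW a m β) / (ξ - xiW a m β)) (𝓝[>] xiW a m β)
      (𝓝 (1 - lamMinus m β)) := by
  obtain ⟨s, hs, hs1, rfl⟩ := exists_eq_mul_sub_one hm hβ hβ'
  have hm0 : 0 < m := by omega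
  have hs' : 0 < 1 / s := by positivity
  have hU1 := hU.scale ha
  rw [div_self ha.ne'] at hU1
  set V := fun x => U (a * x) / a with hV
  have hc := hU1.continuousOn
  have hsol := hU1.solves_neg
  rw [xiW_eq 1 hm0 hs] at hc hsol
  have hlim := hat_tendsto_lamMinus hm hs hs1 (V := fun x => -V (-x))
    ((hc.comp (f := fun x => -x) continuousOn_neg
      fun x hx => ⟨by linarith [hx.2], by linarith [hx.1]⟩).neg)
    (by simp [hU1.zero])
    (hsol.reflect.mono fun x hx => ⟨by linarith [hx.2], by linarith [hx.1]⟩)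
  have hcomp : Tendsto (fun ξ => (ξ - xiW a m (m * (s - 1))) / a)
      (𝓝[>] xiW a m (m * (s - 1))) (𝓝[>] 0) := by
    refine tendsto_nhdsWithin_iff.2 ⟨?_, ?_⟩
    · have : ContinuousAt (fun ξ => (ξ - xiW a m (m * (s - 1))) / a) (xiW a m (m * (s - 1))) := by
        fun_prop
      have h := this.tendsto
      rw [sub_self, zero_div] at h
      exact tendsto_nhdsWithin_of_tendsto_nhds h
    · filter_upwards [self_mem_nhdsWithin] with ξ hξ
      exact mem_Ioi.2 (div_pos (sub_pos.2 hξ) ha)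
  refine ((hlim.comp hcomp).const_sub 1).congr' ?_
  filter_upwards [self_mem_nhdsWithin] with ξ hξ
  have hξ0 : ξ - xiW a m (m * (s - 1)) ≠ 0 := sub_ne_zero.2 (ne_of_gt hξ)
  have e : a * (-(1 / s - (ξ - xiW a m (m * (s - 1))) / a)) = ξ := by
    rw [xiW_eq a hm0 hs]
    field_simp
    ring
  simp only [Function.comp_apply, hV, e]
  rw [uW_eq a hm0 hs]
  rw [xiW_eq a hm0 hs] at hξ0 ⊢
  obtain ⟨x, rfl⟩ : ∃ x, ξ = x - a / s := ⟨ξ + a / s, by ring⟩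
  rw [show x - a / s - -(a / s) = x by ring] at hξ0 ⊢
  field_simp
  ring

/-- Between the origin and `-P_w` the inner solution stays strictly below the diagonal, so that the
gas crosses the rays `r = ξ t` inwards. -/
lemma IsHat.sub_neg (ha : 0 < a) (hm : m = 1 ∨ m = 2) (hβ : -(m : ℝ) < β) (hβ' : β < 0)
    (hU : IsHat a m β U) : ∀ ξ ∈ Ioo 0 (-xiW a m β), U ξ - ξ < 0 := by
  obtain ⟨s, hs, hs1, rfl⟩ := exists_eq_mul_sub_one hm hβ hβ'
  have hm0 : 0 < m := by omega
  have hs' : 0 < 1 / s := by positivity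
  have hU1 := hU.scale ha
  rw [div_self ha.ne'] at hU1
  have hc := hU1.continuousOn
  have hsol := hU1.solves_pos
  rw [xiW_eq 1 hm0 hs, neg_neg] at hc hsol
  intro ξ hξ
  rw [xiW_eq a hm0 hs, neg_neg] at hξ
  have h0 : 0 < ξ / a := div_pos hξ.1 ha
  have h := (hat_above_nullcline hm0 hs hs1 (hc.mono (Icc_subset_Icc_left (by linarith)))
    (by simp [hU.zero]) hsol (ξ / a) ⟨h0, by
      rw [div_lt_iff₀ ha]
      linarith [hξ.2, show 1 / s * a = a / s by ring]⟩).1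
  simp only [mul_div_cancel₀ _ ha.ne'] at h
  rw [← sub_div] at h
  have h2 : 0 < (ξ - U ξ) / a := (mul_pos hs h0).trans h
  have := (div_pos_iff_of_pos_right ha).1 h2
  linarith

lemma exists_hat_of_sound_speed (ha : 0 < a) (hm : m = 1 ∨ m = 2) (hβ : -(m : ℝ) < β)
    (hβ' : β < 0) : ∃ U : ℝ → ℝ, IsHat a m β U := by
  obtain ⟨s, hs, hs1, rfl⟩ := exists_eq_mul_sub_one hm hβ hβ'
  obtain ⟨U, hU⟩ := exists_hat hm hs hs1
  have := hU.scale (one_div_pos.2 ha)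
  rw [one_div_one_div] at this
  exact ⟨_, this⟩

/-- The kink and the outer solution are the two parts `ζ < 0` and `ζ > 0` of one orbit, whence their
common limit at infinity. -/
lemma exists_kink_tilde (ha : 0 < a) (hm : m = 1 ∨ m = 2) (hβ : -(m : ℝ) < β) (hβ' : β < 0)
    (hneg : KinkLimitNeg a m β) : ∃ (Uk Utilde : ℝ → ℝ) (Ustar xiStar : ℝ), IsKink a m β Uk ∧
      Tendsto Uk atBot (𝓝 Ustar) ∧ IsTilde a m β Ustar xiStar Utilde := by
  obtain ⟨s, hs, hs1, rfl⟩ := exists_eq_mul_sub_one hm hβ hβ'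
  have hm0 : 0 < m := by omega
  obtain ⟨Y, hY, habove, hlim⟩ := exists_maximal_kink hm hs hs1
  obtain ⟨δ, hδ, hYδ⟩ : ∃ δ > 0, SolvesIn (zetaField m s) zetaDomain Y (Ioo (-s) δ) := by
    rcases hY with hY | ⟨Z, hZ, hY, _⟩
    · exact ⟨1, one_pos, hY.mono Ioo_subset_Ioi_self⟩
    · exact ⟨Z, hZ, hY⟩
  have hk := SolvesIn.isKink hm0 hs (hYδ.mono (Ioo_subset_Ioo_right hδ.le)) hlim
  have hc : ContinuousAt Y 0 := (hYδ 0 ⟨by linarith, hδ⟩).2.continuousAt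
  have hk' := hk.scale (one_div_pos.2 ha)
  rw [one_div_one_div] at hk'
  have h1 : Tendsto (fun x : ℝ => 1 / a * x) atBot atBot :=
    tendsto_id.const_mul_atBot (one_div_pos.2 ha)
  have hlim' := (hc.tendsto.comp (tendsto_inv_atBot_zero.comp h1)).div_const (1 / a)
  obtain ⟨V, Vstar, hV, hVlim, hVneg⟩ := hneg
  have hY0 : Y 0 / (1 / a) = Vstar := by
    refine tendsto_nhds_unique (hlim'.congr' ?_) hVlim
    filter_upwards [eventually_lt_atBot (xiW a m (m * (s - 1)))] with ξ hξ
    exact IsKink.eqOn_of_sound_speed ha hm hβ hβ' hk' hV hξ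
  have hY0' : Y 0 < 0 := by
    by_contra! h
    have := div_nonneg h (one_div_pos.2 ha).le
    linarith
  obtain ⟨xiStar, ht⟩ := exists_tilde hm hs hs1 hY habove hlim hY0'
  have ht' := ht.scale (one_div_pos.2 ha)
  rw [one_div_one_div] at ht'
  exact ⟨_, _, _, _, hk', hlim', ht'⟩

/-- Along the subsonic inner solution the jump condition first selects outer states below the
supersonic outer solution and then, at `-P_w`, above it: the shock sits where they cross. -/
lemma exists_shock (ha : 0 < a) (hm : m = 1 ∨ m = 2) (hβ : -(m : ℝ) < β) (hβ' : β < 0)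
    {V : ℝ → ℝ} {Ustar xiStar : ℝ} (hU : IsHat a m β U) (hV : IsTilde a m β Ustar xiStar V) :
    ∃ xiS ∈ Ioo xiStar (-xiW a m β), V xiS = hugoniot a U xiS := by
  have hw := xiW_neg ha hm hβ
  have hUc : ContinuousOn U (Ioc 0 (-xiW a m β)) :=
    hU.continuousOn.mono fun x hx => ⟨by linarith [hx.1], hx.2⟩
  have hneg : ∀ ξ ∈ Ioc 0 (-xiW a m β), U ξ - ξ < 0 := by
    intro ξ hξ
    rcases eq_or_lt_of_le hξ.2 with rfl | hlt
    · rw [hU.right]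
      linarith [uW_sub_xiW (a := a) hβ]
    · exact hU.sub_neg ha hm hβ hβ' ξ ⟨hξ.1, hlt⟩
  have hHc : ContinuousOn (hugoniot a U) (Ioc 0 (-xiW a m β)) :=
    continuousOn_id.add (continuousOn_const.div (hUc.sub continuousOn_id)
      fun ξ hξ => (hneg ξ hξ).ne)
  have hVc : ContinuousOn V (Ioi xiStar) := fun ξ hξ =>
    (hV.solves ξ hξ).2.continuousAt.continuousWithinAt
  have hstar : hugoniot a U xiStar < xiStar - a := by
    have h1 := hU.abs_sub_lt ha hw xiStar ⟨by linarith [hV.pos], hV.lt⟩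
    have h2 := hneg xiStar ⟨hV.pos, hV.lt.le⟩
    have : a ^ 2 / (U xiStar - xiStar) < -a := by
      rw [div_lt_iff_of_neg h2]
      nlinarith [(abs_lt.1 h1).1]
    unfold hugoniot
    linarith
  have hH : Tendsto (hugoniot a U) (𝓝[>] xiStar) (𝓝 (hugoniot a U xiStar)) :=
    ((hHc xiStar ⟨hV.pos, hV.lt.le⟩).continuousAt
      (Ioc_mem_nhds hV.pos hV.lt)).tendsto.mono_left nhdsWithin_le_nhds
  obtain ⟨x₀, hx₀, hx₁⟩ := ((hH.eventually_lt hV.tendsto_line hstar).and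
    (Ioo_mem_nhdsGT hV.lt)).exists
  have hend : V (-xiW a m β) < hugoniot a U (-xiW a m β) := by
    have h1 := hV.sub_lt _ hV.lt
    have h2 : U (-xiW a m β) - -xiW a m β = -a := by
      rw [hU.right]
      linarith [uW_sub_xiW (a := a) hβ]
    unfold hugoniot
    rw [h2, show a ^ 2 / -a = -a by field_simp]
    linarith
  have hsub : Icc x₀ (-xiW a m β) ⊆ Ioc 0 (-xiW a m β) := fun x hx =>
    ⟨(hV.pos.trans hx₁.1).trans_le hx.1, hx.2⟩
  have hcont : ContinuousOn (fun ξ => V ξ - hugoniot a U ξ) (Icc x₀ (-xiW a m β)) :=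
    (hVc.mono fun x hx => mem_Ioi.2 (hx₁.1.trans_le hx.1)).sub (hHc.mono hsub)
  obtain ⟨x, hx, hx0⟩ := intermediate_value_Ioo' hx₁.2.le hcont
    (show (0 : ℝ) ∈ Ioo _ _ from ⟨by linarith, by linarith⟩)
  exact ⟨x, ⟨hx₁.1.trans hx.1, hx.2⟩, by linarith⟩

end Scaling

/-! ### The density profile -/

section Density

variable {a β : ℝ} {m : ℕ} {U Ω Φ : ℝ → ℝ} {J : Set ℝ}

/-- Integration by parts turns `∫ (W - ξ) W'` into an expression which makes sense for every
continuous `W`, so that the density stays continuous at the corners of the velocity. -/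
lemma exists_exponent (a : ℝ) {W : ℝ → ℝ} (hW : Continuous W) :
    ∃ Φ : ℝ → ℝ, Continuous Φ ∧
      ∀ ξ W', HasDerivAt W W' ξ → HasDerivAt Φ (-(1 / a ^ 2) * (W ξ - ξ) * W') ξ := by
  refine ⟨fun ξ => -(1 / a ^ 2) * (W ξ ^ 2 / 2 - ξ * W ξ + ∫ x in (0 : ℝ)..ξ, W x), ?_, ?_⟩
  · have := intervalIntegral.continuous_primitive (μ := volume)
      (fun x y => hW.intervalIntegrable x y) 0
    fun_prop
  · intro ξ W' h
    have h1 := intervalIntegral.integral_hasDerivAt_right (hW.intervalIntegrable 0 ξ)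
      (hW.stronglyMeasurableAtFilter _ _) hW.continuousAt
    refine ((((h.fun_pow 2).div_const 2).fun_sub ((hasDerivAt_id' ξ).fun_mul h)).fun_add
      h1).const_mul (-(1 / a ^ 2)) |>.congr_deriv ?_
    push_cast
    ring

lemma exists_exponent_on (a : ℝ) {W : ℝ → ℝ} (hW : Continuous W) (hJ : IsOpen J)
    (h : EqOn U W J) (hd : ∀ ξ ∈ J, DifferentiableAt ℝ U ξ) :
    ∃ Φ : ℝ → ℝ, Continuous Φ ∧
      ∀ ξ ∈ J, HasDerivAt Φ (-(1 / a ^ 2) * (U ξ - ξ) * deriv U ξ) ξ := by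
  obtain ⟨Φ, hΦ, hΦ'⟩ := exists_exponent a hW
  refine ⟨Φ, hΦ, fun ξ hξ => ?_⟩
  rw [h hξ]
  exact hΦ' ξ _ ((hd ξ hξ).hasDerivAt.congr_of_eventuallyEq
    (h.symm.eventuallyEq_of_mem (hJ.mem_nhds hξ)))

lemma SolvesOmega.const_mul_exp
    (hΦ : ∀ ξ ∈ J, HasDerivAt Φ (-(1 / a ^ 2) * (U ξ - ξ) * deriv U ξ) ξ) (k : ℝ) :
    SolvesOmega a U (fun ξ => k * Real.exp (Φ ξ)) J := fun ξ hξ =>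
  ((hΦ ξ hξ).exp.const_mul k).congr_deriv (by ring)

/-- On an interval the equation for `Ω` has a one-dimensional space of solutions, so `Ω` does not
change sign. -/
lemma SolvesOmega.exists_eq_const_mul_exp (hJ : IsOpen J) (hJ' : IsPreconnected J)
    (hΩ : SolvesOmega a U Ω J)
    (hΦ : ∀ ξ ∈ J, HasDerivAt Φ (-(1 / a ^ 2) * (U ξ - ξ) * deriv U ξ) ξ) :
    ∃ k : ℝ, ∀ ξ ∈ J, Ω ξ = k * Real.exp (Φ ξ) := by
  have hd : ∀ ξ ∈ J, HasDerivAt (fun ξ => Ω ξ * Real.exp (-Φ ξ)) 0 ξ := fun ξ hξ =>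
    ((hΩ ξ hξ).fun_mul (hΦ ξ hξ).fun_neg.exp).congr_deriv (by ring)
  obtain ⟨k, hk⟩ := hJ.exists_is_const_of_deriv_eq_zero hJ'
    (fun ξ hξ => (hd ξ hξ).differentiableAt.differentiableWithinAt) (fun ξ hξ => (hd ξ hξ).deriv)
  refine ⟨k, fun ξ hξ => ?_⟩
  rw [← hk ξ hξ, mul_assoc, ← Real.exp_add, neg_add_cancel, Real.exp_zero, mul_one]

lemma SolvesOmega.mono {K : Set ℝ} (hΩ : SolvesOmega a U Ω J) (h : K ⊆ J) :
    SolvesOmega a U Ω K := fun ξ hξ => hΩ ξ (h hξ)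

lemma SolvesOmega.congr {V A : ℝ → ℝ} (hJ : IsOpen J) (hΩ : SolvesOmega a U Ω J)
    (hU : EqOn V U J) (hA : EqOn A Ω J) : SolvesOmega a V A J := fun ξ hξ => by
  have h1 := hU.eventuallyEq_of_mem (hJ.mem_nhds hξ)
  rw [hU hξ, hA hξ, h1.deriv_eq]
  exact (hΩ ξ hξ).congr_of_eventuallyEq (hA.eventuallyEq_of_mem (hJ.mem_nhds hξ))

lemma SolvesU.congr {V : ℝ → ℝ} (hJ : IsOpen J) (hU : SolvesU a m β U J) (h : EqOn V U J) :
    SolvesU a m β V J := fun ξ hξ => by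
  rw [h hξ]
  exact ⟨(hU ξ hξ).1, (hU ξ hξ).2.congr_of_eventuallyEq (h.eventuallyEq_of_mem (hJ.mem_nhds hξ))⟩

lemma SolvesOmega.reflect (hΩ : SolvesOmega a U Ω J) :
    SolvesOmega a (fun x => -U (-x)) (fun x => Ω (-x)) (Neg.neg ⁻¹' J) := fun ξ hξ => by
  have h := (hΩ (-ξ) hξ).comp ξ (hasDerivAt_neg ξ)
  refine h.congr_deriv ?_
  rw [deriv.fun_neg, deriv_comp_neg]
  ring

lemma SolvesOmega.const_mul (hΩ : SolvesOmega a U Ω J) (k : ℝ) :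
    SolvesOmega a U (fun x => k * Ω x) J := fun ξ hξ =>
  ((hΩ ξ hξ).const_mul k).congr_deriv (by ring)

lemma tendsto_of_deriv_le_inv_sq {f f' : ℝ → ℝ} {b K : ℝ} (hb : 0 < b)
    (hf : ∀ x, b ≤ x → HasDerivAt f (f' x) x) (h : ∀ x, b ≤ x → |f' x| ≤ K / x ^ 2) :
    ∃ L, Tendsto f atTop (𝓝 L) := by
  refine ⟨_, tendsto_limUnder_of_hasDerivAt_of_integrableOn_Ioi (a := b) (f' := f')
    (fun x hx => hf x (mem_Ioi.1 hx).le) ?_⟩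
  have h1 : IntegrableOn (fun x : ℝ => K * x ^ (-2 : ℝ)) (Ioi b) :=
    (integrableOn_Ioi_rpow_of_lt (by norm_num) hb).const_mul K
  refine Integrable.mono' h1 ?_ ?_
  · exact ((measurable_deriv f).aestronglyMeasurable).congr
      ((ae_restrict_mem measurableSet_Ioi).mono fun x hx => (hf x (mem_Ioi.1 hx).le).deriv)
  · filter_upwards [ae_restrict_mem measurableSet_Ioi] with x hx
    have hx0 : 0 < x := hb.trans hx
    rw [Real.norm_eq_abs, Real.rpow_neg hx0.le, ← div_eq_mul_inv]
    exact_mod_cast h x (mem_Ioi.1 hx).le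

/-- Far out the velocity is bounded, so `Ω' / Ω` differs from `β / ξ` by `O(ξ⁻²)`. -/
lemma exists_tendsto_exponent_sub_log {b Ustar : ℝ} (ha : a ≠ 0) (hb : 0 ≤ b) (hU : SolvesU a m β U (Ioi b))
    (hlim : Tendsto U atTop (𝓝 Ustar))
    (hΦ : ∀ ξ ∈ Ioi b, HasDerivAt Φ (-(1 / a ^ 2) * (U ξ - ξ) * deriv U ξ) ξ) :
    ∃ L, Tendsto (fun ξ => Φ ξ - β * Real.log ξ) atTop (𝓝 L) := by
  set M := |Ustar| + 1 with hM
  have hMpos : 0 < M := by positivity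
  have hev : ∀ᶠ ξ in atTop, |U ξ| < M := hlim.abs.eventually_lt_const (by linarith)
  obtain ⟨B, hB⟩ := eventually_atTop.1 hev
  -- for `ξ ≥ N` both `|U|` and `|a|` are at most `ξ / 4`
  set N := max (max (b + 1) B) (max (4 * M) (4 * |a|)) with hN
  have hNb : b + 1 ≤ N := (le_max_left _ _).trans (le_max_left _ _)
  have hNB : B ≤ N := (le_max_right _ _).trans (le_max_left _ _)
  have hNM : 4 * M ≤ N := (le_max_left _ _).trans (le_max_right _ _)
  have hNa : 4 * |a| ≤ N := (le_max_right _ _).trans (le_max_right _ _)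
  refine tendsto_of_deriv_le_inv_sq (b := N) (by linarith)
    (K := (|β| * (2 * M + |a|) + m * (2 * M)) * 4)
    (f' := fun ξ => (β * ((ξ - U ξ) * U ξ + a ^ 2) + m * U ξ * (ξ - U ξ)) /
      (ξ * ((U ξ - ξ) ^ 2 - a ^ 2))) (fun ξ hξ => ?_) (fun ξ hξ => ?_)
  · have hξb : b < ξ := by linarith
    have hξ0 : ξ ≠ 0 := by linarith
    obtain ⟨hne, hd⟩ := hU ξ hξb
    refine ((hΦ ξ hξb).fun_sub ((Real.hasDerivAt_log hξ0).const_mul β)).congr_deriv ?_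
    have hne' : (U ξ - ξ) ^ 2 - a ^ 2 ≠ 0 := sub_ne_zero.2 hne
    rw [hd.deriv]
    field_simp
    ring
  · have hξ0 : 0 < ξ := by linarith
    have hUξ := (hB ξ (by linarith)).le
    have hU1 := abs_le.1 hUξ
    have ha1 := abs_nonneg a
    have hden : ξ ^ 2 / 4 * ξ ≤ ξ * ((U ξ - ξ) ^ 2 - a ^ 2) := by
      have h1 : 3 / 4 * ξ ≤ ξ - U ξ := by linarith
      have h2 : (3 / 4 * ξ) ^ 2 ≤ (U ξ - ξ) ^ 2 := by nlinarith
      have h3 : a ^ 2 ≤ (ξ / 4) ^ 2 := by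
        rw [← sq_abs a]
        exact pow_le_pow_left₀ ha1 (by linarith) 2
      nlinarith
    have hnum : |β * ((ξ - U ξ) * U ξ + a ^ 2) + m * U ξ * (ξ - U ξ)| ≤
        (|β| * (2 * M + |a|) + m * (2 * M)) * ξ := by
      have h1 : |ξ - U ξ| ≤ 2 * ξ := abs_le.2 ⟨by linarith, by linarith⟩
      have h2 : |(ξ - U ξ) * U ξ| ≤ 2 * ξ * M := by
        rw [abs_mul]
        exact mul_le_mul h1 hUξ (abs_nonneg _) (by linarith)
      have h3 : |a ^ 2| ≤ |a| * ξ := by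
        rw [abs_of_nonneg (sq_nonneg a), ← sq_abs a]
        nlinarith
      have h4 : |m * U ξ * (ξ - U ξ)| ≤ m * (2 * ξ * M) := by
        rw [mul_assoc, abs_mul, Nat.abs_cast, mul_comm (U ξ)]
        exact mul_le_mul_of_nonneg_left h2 (Nat.cast_nonneg _)
      calc _ ≤ |β| * |(ξ - U ξ) * U ξ + a ^ 2| + |m * U ξ * (ξ - U ξ)| := by
            rw [← abs_mul]
            exact abs_add_le _ _
        _ ≤ |β| * (2 * ξ * M + |a| * ξ) + m * (2 * ξ * M) := by
            refine add_le_add (mul_le_mul_of_nonneg_left ?_ (abs_nonneg _)) h4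
            exact (abs_add_le _ _).trans (add_le_add h2 h3)
        _ = _ := by ring
    have hden0 : 0 < ξ ^ 2 / 4 * ξ := by positivity
    rw [abs_div, abs_of_pos (hden0.trans_le hden), div_le_div_iff₀ (hden0.trans_le hden)
      (by positivity)]
    have hC : 0 ≤ (|β| * (2 * M + |a|) + m * (2 * M)) := by positivity
    calc _ ≤ (|β| * (2 * M + |a|) + m * (2 * M)) * ξ * ξ ^ 2 :=
          mul_le_mul_of_nonneg_right hnum (sq_nonneg _)
      _ = (|β| * (2 * M + |a|) + m * (2 * M)) * 4 * (ξ ^ 2 / 4 * ξ) := by ring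
      _ ≤ _ := mul_le_mul_of_nonneg_left hden (by positivity)

lemma tendsto_const_mul_exp_div_rpow {L : ℝ}
    (h : Tendsto (fun ξ => Φ ξ - β * Real.log ξ) atTop (𝓝 L)) (k : ℝ) :
    Tendsto (fun ξ => k * Real.exp (Φ ξ) / ξ ^ β) atTop (𝓝 (k * Real.exp L)) := by
  refine (((Real.continuous_exp.tendsto L).comp h).const_mul k).congr' ?_
  filter_upwards [eventually_gt_atTop 0] with ξ hξ
  rw [Function.comp_apply, Real.exp_sub, Real.rpow_def_of_pos hξ, mul_div_assoc, mul_comm β]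

end Density

/-! ### Existence and signs of the density profile -/

section Profile

variable {a β : ℝ} {m : ℕ} {U : ℝ → ℝ}

lemma continuous_ite_of_tendsto {f : ℝ → ℝ} {w l : ℝ} (hf : ContinuousOn f (Iio w))
    (hl : Tendsto f (𝓝[<] w) (𝓝 l)) : Continuous fun x => if x < w then f x else l := by
  rw [continuous_iff_continuousAt]
  intro x
  rcases lt_trichotomy x w with h | rfl | h
  · refine (hf.continuousAt (Iio_mem_nhds h)).congr ?_
    filter_upwards [Iio_mem_nhds h] with y hy
    rw [if_pos (mem_Iio.1 hy)]
  · rw [continuousAt_iff_continuous_left'_right']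
    constructor
    · refine Tendsto.congr' ?_ (by simpa using hl)
      filter_upwards [self_mem_nhdsWithin] with y hy
      rw [if_pos (mem_Iio.1 hy)]
    · refine Tendsto.congr' ?_ (by simpa using tendsto_const_nhds)
      filter_upwards [self_mem_nhdsWithin] with y hy
      rw [if_neg (not_lt.2 (mem_Ioi.1 hy).le)]
  · refine (continuousAt_const (y := l)).congr ?_
    filter_upwards [Ioi_mem_nhds h] with y hy
    rw [if_neg (not_lt.2 (mem_Ioi.1 hy).le)]

lemma IsKink.continuousOn (hU : IsKink a m β U) : ContinuousOn U (Iio (xiW a m β)) :=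
  fun ξ hξ => (hU.solves ξ hξ).2.continuousAt.continuousWithinAt

lemma IsKink.exists_exponent (hU : IsKink a m β U) :
    ∃ Φ : ℝ → ℝ, Continuous Φ ∧
      ∀ ξ ∈ Iio (xiW a m β), HasDerivAt Φ (-(1 / a ^ 2) * (U ξ - ξ) * deriv U ξ) ξ :=
  exists_exponent_on a (continuous_ite_of_tendsto hU.continuousOn hU.tendsto) isOpen_Iio
    (fun _ hξ => (if_pos (mem_Iio.1 hξ)).symm) fun ξ hξ => (hU.solves ξ hξ).2.differentiableAt

lemma IsHat.exists_exponent (hw : xiW a m β < 0) (hU : IsHat a m β U) :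
    ∃ Φ : ℝ → ℝ, Continuous Φ ∧ ∀ ξ ∈ Ioo (xiW a m β) 0 ∪ Ioo 0 (-xiW a m β),
      HasDerivAt Φ (-(1 / a ^ 2) * (U ξ - ξ) * deriv U ξ) ξ := by
  refine exists_exponent_on a (hU.continuousOn.domRestrict.Icc_extend' (h := by linarith))
    (isOpen_Ioo.union isOpen_Ioo) (fun ξ hξ => ?_) (fun ξ hξ => ?_)
  · rw [IccExtend_of_mem _ _ (show ξ ∈ Icc (xiW a m β) (-xiW a m β) from ?_)]
    · rfl
    · rcases hξ with h | h
      · exact ⟨h.1.le, by linarith [h.2]⟩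
      · exact ⟨by linarith [h.1], h.2.le⟩
  · rcases hξ with h | h
    · exact (hU.solves_neg ξ h).2.differentiableAt
    · exact (hU.solves_pos ξ h).2.differentiableAt

lemma IsTilde.exists_exponent {Ustar xiStar xiS : ℝ} (hU : IsTilde a m β Ustar xiStar U)
    (hS : xiStar < xiS) :
    ∃ Φ : ℝ → ℝ, Continuous Φ ∧
      ∀ ξ ∈ Ioi xiS, HasDerivAt Φ (-(1 / a ^ 2) * (U ξ - ξ) * deriv U ξ) ξ := by
  have hc : Continuous fun ξ => U (max ξ xiS) := by
    rw [continuous_iff_continuousAt]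
    intro ξ
    exact ContinuousAt.comp (f := fun ξ => max ξ xiS)
      (hU.solves _ (lt_max_of_lt_right hS)).2.continuousAt (by fun_prop)
  refine exists_exponent_on a hc isOpen_Ioi (fun ξ hξ => ?_) fun ξ hξ =>
    (hU.solves ξ (hS.trans hξ)).2.differentiableAt
  simp only [max_eq_left (mem_Ioi.1 hξ).le]

lemma IsKink.exists_tendsto_exponent {Ustar : ℝ} {Φ : ℝ → ℝ} (ha : 0 < a) (hw : xiW a m β < 0)
    (hU : IsKink a m β U) (hlim : Tendsto U atBot (𝓝 Ustar))
    (hΦ : ∀ ξ ∈ Iio (xiW a m β), HasDerivAt Φ (-(1 / a ^ 2) * (U ξ - ξ) * deriv U ξ) ξ) :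
    ∃ L, Tendsto (fun ξ => Φ (-ξ) - β * Real.log ξ) atTop (𝓝 L) := by
  refine exists_tendsto_exponent_sub_log (U := fun x => -U (-x)) (m := m) (b := -xiW a m β)
    ha.ne' (by linarith) ?_ ((hlim.comp tendsto_neg_atTop_atBot).neg) ?_
  · exact hU.solves.reflect.mono fun x hx => by
      have := mem_Ioi.1 hx
      change -x < _
      linarith
  · intro ξ hξ
    have := mem_Ioi.1 hξ
    refine ((hΦ (-ξ) (mem_Iio.2 (by linarith))).comp ξ (hasDerivAt_neg ξ)).congr_deriv ?_
    rw [deriv.fun_neg, deriv_comp_neg]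
    ring

/-- The constants in the four exponentials are determined in turn by `Ω(0-) = Ω₀`, continuity at
`ξ_w`, the common constant `C` at `±∞`, and the jump relation at the shock. -/
lemma exists_profile (ha : 0 < a) (hm : m = 1 ∨ m = 2) (hβ : -(m : ℝ) < β) (hβ' : β < 0)
    (hneg : KinkLimitNeg a m β) (Ω₀ : ℝ) : ∃ S : Profile, IsConstructed a m β Ω₀ S := by
  have hw := xiW_neg ha hm hβ
  obtain ⟨Uk, Ut, Ustar, xiStar, hk, hlim, ht⟩ := exists_kink_tilde ha hm hβ hβ' hneg
  obtain ⟨Uh, hh⟩ := exists_hat_of_sound_speed ha hm hβ hβ'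
  obtain ⟨xiS, hS, hSeq⟩ := exists_shock ha hm hβ hβ' hh ht
  obtain ⟨Φk, hΦkc, hΦk⟩ := hk.exists_exponent
  obtain ⟨Φh, hΦhc, hΦh⟩ := hh.exists_exponent hw
  obtain ⟨Φt, hΦtc, hΦt⟩ := ht.exists_exponent hS.1
  obtain ⟨Lk, hLk⟩ := hk.exists_tendsto_exponent ha hw hlim hΦk
  have hxS : 0 < xiS := ht.pos.trans hS.1
  obtain ⟨Lt, hLt⟩ := exists_tendsto_exponent_sub_log ha.ne' hxS.le
    (ht.solves.mono (Ioi_subset_Ioi hS.1.le)) ht.tendsto_atTop hΦt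
  set kn := Ω₀ * Real.exp (-Φh 0) with hkn
  set kk := kn * Real.exp (Φh (xiW a m β)) * Real.exp (-Φk (xiW a m β)) with hkk
  set C := kk * Real.exp Lk with hC
  set kt := -C * Real.exp (-Lt) with hkt
  set kp := (Ut xiS - xiS) ^ 2 / a ^ 2 * (kt * Real.exp (Φt xiS)) * Real.exp (-Φh xiS) with hkp
  have hcan : ∀ x y : ℝ, x * Real.exp (-y) * Real.exp y = x := fun x y => by
    rw [mul_assoc, ← Real.exp_add, neg_add_cancel, Real.exp_zero, mul_one]
  refine ⟨⟨Uk, Uh, Ut, fun ξ => kk * Real.exp (Φk ξ), fun ξ => kn * Real.exp (Φh ξ),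
    fun ξ => kp * Real.exp (Φh ξ), fun ξ => kt * Real.exp (Φt ξ), Ustar, xiStar, xiS, C⟩,
    hk, hlim, hh, ht, hS, hSeq, ?_, ?_, ?_, ?_, ?_, ?_, ?_, ?_, ?_, ?_, ?_, ?_⟩
  · exact (continuous_const.mul (Real.continuous_exp.comp hΦhc)).continuousOn
  · exact SolvesOmega.const_mul_exp (fun ξ hξ => hΦh ξ (Or.inl hξ)) kn
  · exact hcan _ _
  · exact SolvesOmega.const_mul_exp hΦk kk
  · have h : Continuous fun ξ => kk * Real.exp (Φk ξ) :=
      continuous_const.mul (Real.continuous_exp.comp hΦkc)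
    have h1 := h.tendsto (xiW a m β)
    rw [hkk, hcan] at h1
    exact h1.mono_left nhdsWithin_le_nhds
  · refine ((tendsto_const_mul_exp_div_rpow hLk kk).comp tendsto_neg_atBot_atTop).congr' ?_
    filter_upwards [eventually_lt_atBot 0] with ξ hξ
    simp only [Function.comp_apply, neg_neg, abs_of_neg hξ]
  · exact SolvesOmega.const_mul_exp hΦt kt
  · exact (continuous_const.mul (Real.continuous_exp.comp hΦtc)).continuousWithinAt
  · have h := tendsto_const_mul_exp_div_rpow hLt kt
    rwa [hkt, hcan] at h
  · exact (continuous_const.mul (Real.continuous_exp.comp hΦhc)).continuousOn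
  · exact SolvesOmega.const_mul_exp
      (fun ξ hξ => hΦh ξ (Or.inr ⟨hξ.1, hξ.2.trans hS.2⟩)) kp
  · exact hcan _ _

lemma eqOn_const_mul_exp_of_continuousOn {Ω Φ : ℝ → ℝ} {x y : ℝ} (hxy : x < y)
    (hc : ContinuousOn Ω (Icc x y)) (hΩ : SolvesOmega a U Ω (Ioo x y)) (hΦc : Continuous Φ)
    (hΦ : ∀ ξ ∈ Ioo x y, HasDerivAt Φ (-(1 / a ^ 2) * (U ξ - ξ) * deriv U ξ) ξ) :
    ∃ k : ℝ, EqOn Ω (fun ξ => k * Real.exp (Φ ξ)) (Icc x y) := by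
  obtain ⟨k, hk⟩ := hΩ.exists_eq_const_mul_exp isOpen_Ioo isPreconnected_Ioo hΦ
  refine ⟨k, ?_⟩
  refine Set.EqOn.of_subset_closure (s := Ioo x y) hk hc
    (continuous_const.mul (Real.continuous_exp.comp hΦc)).continuousOn Ioo_subset_Icc_self ?_
  rw [closure_Ioo hxy.ne]

lemma mul_exp_neg_iff {k x : ℝ} : k * Real.exp x < 0 ↔ k < 0 :=
  ⟨fun h => by
    by_contra! hk
    linarith [mul_nonneg hk (Real.exp_pos x).le], fun h => mul_neg_of_neg_of_pos h (Real.exp_pos x)⟩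

lemma mul_exp_pos_iff {k x : ℝ} : 0 < k * Real.exp x ↔ 0 < k :=
  mul_pos_iff_of_pos_right (Real.exp_pos x)

variable {Ω₀ : ℝ} {S : Profile}

lemma IsConstructed.omNeg_neg (ha : 0 < a) (hm : m = 1 ∨ m = 2) (hβ : -(m : ℝ) < β) (hΩ : Ω₀ < 0)
    (hS : IsConstructed a m β Ω₀ S) : ∀ ξ ∈ Icc (xiW a m β) 0, S.OmNeg ξ < 0 := by
  have hw := xiW_neg ha hm hβ
  obtain ⟨Φ, hΦc, hΦ⟩ := hS.hat.exists_exponent hw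
  obtain ⟨k, hk⟩ := eqOn_const_mul_exp_of_continuousOn hw hS.omNeg_continuousOn hS.omNeg_solves hΦc
    fun ξ hξ => hΦ ξ (Or.inl hξ)
  have h0 := hk (right_mem_Icc.2 hw.le)
  rw [hS.omNeg_zero] at h0
  have hkneg : k < 0 := mul_exp_neg_iff.1 (h0 ▸ hΩ)
  intro ξ hξ
  rw [hk hξ]
  exact mul_exp_neg_iff.2 hkneg

/-- The outer density profile for `t < 0` inherits its sign from `Ω₀` through `ξ_w`, and passes it
on to the asymptotic constant. -/
lemma IsConstructed.omk_neg (ha : 0 < a) (hm : m = 1 ∨ m = 2) (hβ : -(m : ℝ) < β) (hΩ : Ω₀ < 0)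
    (hS : IsConstructed a m β Ω₀ S) : (∀ ξ < xiW a m β, S.Omk ξ < 0) ∧ S.C < 0 := by
  have hw := xiW_neg ha hm hβ
  obtain ⟨Φ, hΦc, hΦ⟩ := hS.kink.exists_exponent
  obtain ⟨k, hk⟩ := hS.omk_solves.exists_eq_const_mul_exp isOpen_Iio isPreconnected_Iio hΦ
  have h : Continuous fun ξ => k * Real.exp (Φ ξ) :=
    continuous_const.mul (Real.continuous_exp.comp hΦc)
  have hkw : S.OmNeg (xiW a m β) = k * Real.exp (Φ (xiW a m β)) := by
    refine tendsto_nhds_unique hS.omk_tendsto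
      (((h.tendsto (xiW a m β)).mono_left nhdsWithin_le_nhds).congr' ?_)
    filter_upwards [self_mem_nhdsWithin] with ξ hξ using (hk ξ hξ).symm
  have hkneg : k < 0 :=
    mul_exp_neg_iff.1 (hkw ▸ hS.omNeg_neg ha hm hβ hΩ _ (left_mem_Icc.2 hw.le))
  refine ⟨fun ξ hξ => hk ξ hξ ▸ mul_exp_neg_iff.2 hkneg, ?_⟩
  obtain ⟨L, hL⟩ := hS.kink.exists_tendsto_exponent ha hw hS.kink_limit hΦ
  have hC : S.C = k * Real.exp L := by
    refine tendsto_nhds_unique hS.omk_asymp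
      (((tendsto_const_mul_exp_div_rpow hL k).comp tendsto_neg_atBot_atTop).congr' ?_)
    filter_upwards [eventually_lt_atBot (xiW a m β)] with ξ hξ
    simp only [Function.comp_apply, neg_neg, abs_of_neg (hξ.trans hw), hk ξ hξ]
  rw [hC]
  exact mul_exp_neg_iff.2 hkneg

lemma IsConstructed.xiS_pos (hS : IsConstructed a m β Ω₀ S) : 0 < S.xiS :=
  hS.tilde.pos.trans hS.shock_mem.1

/-- The outer density profile for `t > 0` has the sign of its asymptotic constant `-C`. -/
lemma IsConstructed.omtilde_pos (ha : 0 < a) (hm : m = 1 ∨ m = 2) (hβ : -(m : ℝ) < β)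
    (hΩ : Ω₀ < 0) (hS : IsConstructed a m β Ω₀ S) : ∀ ξ, S.xiS ≤ ξ → 0 < S.Omtilde ξ := by
  obtain ⟨Φ, hΦc, hΦ⟩ := hS.tilde.exists_exponent hS.shock_mem.1
  obtain ⟨k, hk⟩ := hS.omtilde_solves.exists_eq_const_mul_exp isOpen_Ioi isPreconnected_Ioi hΦ
  have h : Continuous fun ξ => k * Real.exp (Φ ξ) :=
    continuous_const.mul (Real.continuous_exp.comp hΦc)
  obtain ⟨L, hL⟩ := exists_tendsto_exponent_sub_log ha.ne' hS.xiS_pos.le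
    (hS.tilde.solves.mono (Ioi_subset_Ioi hS.shock_mem.1.le)) hS.tilde.tendsto_atTop hΦ
  have hC : -S.C = k * Real.exp L := by
    refine tendsto_nhds_unique hS.omtilde_asymp
      ((tendsto_const_mul_exp_div_rpow hL k).congr' ?_)
    filter_upwards [eventually_gt_atTop S.xiS] with ξ hξ
    rw [hk ξ hξ]
  have hkpos : 0 < k := mul_exp_pos_iff.1 (hC ▸ neg_pos.2 (hS.omk_neg ha hm hβ hΩ).2)
  intro ξ hξ
  rcases eq_or_lt_of_le hξ with rfl | hlt
  · have : S.Omtilde S.xiS = k * Real.exp (Φ S.xiS) := by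
      refine tendsto_nhds_unique (hS.omtilde_continuous.tendsto.mono_left
        (nhdsWithin_mono _ Ioi_subset_Ici_self))
        (((h.tendsto S.xiS).mono_left nhdsWithin_le_nhds).congr' ?_)
      filter_upwards [self_mem_nhdsWithin] with ξ hξ using (hk ξ hξ).symm
    rw [this]
    exact mul_exp_pos_iff.2 hkpos
  · rw [hk ξ hlt]
    exact mul_exp_pos_iff.2 hkpos

lemma IsConstructed.tilde_sub_lt (hS : IsConstructed a m β Ω₀ S) : S.Utilde S.xiS - S.xiS < -a :=
  hS.tilde.sub_lt _ hS.shock_mem.1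

lemma IsConstructed.omPos_pos (ha : 0 < a) (hm : m = 1 ∨ m = 2) (hβ : -(m : ℝ) < β)
    (hΩ : Ω₀ < 0) (hS : IsConstructed a m β Ω₀ S) : ∀ ξ ∈ Icc 0 S.xiS, 0 < S.OmPos ξ := by
  obtain ⟨Φ, hΦc, hΦ⟩ := hS.hat.exists_exponent (xiW_neg ha hm hβ)
  obtain ⟨k, hk⟩ := eqOn_const_mul_exp_of_continuousOn hS.xiS_pos hS.omPos_continuousOn
    hS.omPos_solves hΦc fun ξ hξ => hΦ ξ (Or.inr ⟨hξ.1, hξ.2.trans hS.shock_mem.2⟩)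
  have hs : 0 < S.OmPos S.xiS := by
    have h1 := hS.tilde_sub_lt
    rw [hS.omPos_shock]
    have h2 : (S.Utilde S.xiS - S.xiS) ^ 2 > 0 := by nlinarith
    exact mul_pos (div_pos h2 (by positivity)) (hS.omtilde_pos ha hm hβ hΩ _ le_rfl)
  rw [hk (right_mem_Icc.2 hS.xiS_pos.le)] at hs
  have hkpos := mul_exp_pos_iff.1 hs
  intro ξ hξ
  rw [hk hξ]
  exact mul_exp_pos_iff.2 hkpos

end Profile

/-! ### Expanding similarity flows -/

/-- The part `t > 0` of a similarity flow on the half line `0 ≤ σ = r / t`: velocity profile `V`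
and density profile `A` with one break point `b`, across which the fluxes of mass and momentum are
continuous. Since the isothermal system is invariant under `(t, u) ↦ (-t, -u)`, the part `t < 0` is
of the same kind, with profiles `-U (-σ)` and `|Ω (-σ)|`; this allows both to be treated at once.
The numbers `κ` and `v` describe the asymptotic state at `σ = ∞`, that is at `t = 0`. -/
structure SimilarityFlow (a : ℝ) (m : ℕ) (β : ℝ) (V A : ℝ → ℝ) (b κ v : ℝ) : Prop where
  break_pos : 0 < b
  solvesU : SolvesU a m β V (Ioi 0 ∩ {b}ᶜ)
  solvesOmega : SolvesOmega a V A (Ioi 0 ∩ {b}ᶜ)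
  velocity_continuousOn : ContinuousOn V (Ici 0 ∩ {b}ᶜ)
  density_continuousOn : ContinuousOn A (Ici 0 ∩ {b}ᶜ)
  mass_flux : ContinuousAt (fun σ => (V σ - σ) * A σ) b
  momentum_flux : ContinuousAt (fun σ => (V σ - σ) * A σ * V σ + a ^ 2 * A σ) b
  density_bound : ∃ c K : ℝ, 0 < c ∧ ∀ σ, 0 ≤ σ → c * (1 + σ) ^ β ≤ A σ ∧ A σ ≤ K * (1 + σ) ^ β
  velocity_bound : ∃ M : ℝ, ∀ σ, 0 ≤ σ → |V σ| ≤ M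
  density_tendsto : Tendsto (fun σ => A σ / σ ^ β) atTop (𝓝 κ)
  velocity_tendsto : Tendsto V atTop (𝓝 v)

section Bounds

variable {f : ℝ → ℝ} {b : ℝ}

lemma exists_bound_of_tendsto {l₁ l₂ l₃ : ℝ} (hc : ContinuousOn f (Ici 0 ∩ {b}ᶜ))
    (h₁ : Tendsto f (𝓝[<] b) (𝓝 l₁)) (h₂ : Tendsto f (𝓝[>] b) (𝓝 l₂))
    (h₃ : Tendsto f atTop (𝓝 l₃)) : ∃ K, ∀ σ, 0 ≤ σ → f σ ≤ K := by
  obtain ⟨N, hN⟩ := eventually_atTop.1 (h₃.eventually_le_const (lt_add_one l₃))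
  have key : ∃ K, ∀ σ ∈ Icc 0 N, f σ ≤ K := by
    refine isCompact_Icc.induction_on (p := fun s => ∃ K, ∀ σ ∈ s, f σ ≤ K) ⟨0, by simp⟩ ?_ ?_ ?_
    · rintro s t hst ⟨K, hK⟩
      exact ⟨K, fun σ hσ => hK σ (hst hσ)⟩
    · rintro s t ⟨K, hK⟩ ⟨L, hL⟩
      refine ⟨max K L, fun σ hσ => ?_⟩
      rcases hσ with h | h
      · exact (hK σ h).trans (le_max_left _ _)
      · exact (hL σ h).trans (le_max_right _ _)
    · intro x hx
      suffices ∃ K, ∀ᶠ y in 𝓝[Icc 0 N] x, f y ≤ K by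
        obtain ⟨K, hK⟩ := this
        exact ⟨_, hK, K, fun σ hσ => hσ⟩
      rcases eq_or_ne x b with rfl | hxb
      · refine ⟨max (l₁ + 1) (max (f x) (l₂ + 1)), ?_⟩
        refine Filter.Eventually.filter_mono nhdsWithin_le_nhds ?_
        rw [← nhdsLT_sup_nhdsGE, ← Ioi_insert, nhdsWithin_insert, eventually_sup, eventually_sup]
        refine ⟨?_, ?_, ?_⟩
        · filter_upwards [h₁.eventually_le_const (lt_add_one l₁)] with y hy
          exact hy.trans (le_max_left _ _)
        · rw [eventually_pure]
          exact (le_max_left _ _).trans (le_max_right _ _)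
        · filter_upwards [h₂.eventually_le_const (lt_add_one l₂)] with y hy
          exact hy.trans ((le_max_right _ _).trans (le_max_right _ _))
      · have h := hc x ⟨hx.1, hxb⟩
        refine ⟨f x + 1, ?_⟩
        have h' : ∀ᶠ y in 𝓝[Ici 0 ∩ {b}ᶜ] x, f y ≤ f x + 1 :=
          h.eventually_le_const (lt_add_one _)
        refine h'.filter_mono ?_
        rw [nhdsWithin_inter_of_mem' (nhdsWithin_le_nhds
          (isOpen_compl_singleton.mem_nhds hxb))]
        exact nhdsWithin_mono _ Icc_subset_Ici_self
  obtain ⟨K, hK⟩ := key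
  refine ⟨max K (l₃ + 1), fun σ hσ => ?_⟩
  rcases le_total σ N with h | h
  · exact (hK σ ⟨hσ, h⟩).trans (le_max_left _ _)
  · exact (hN σ h).trans (le_max_right _ _)

lemma exists_abs_bound_of_tendsto {l₁ l₂ l₃ : ℝ} (hc : ContinuousOn f (Ici 0 ∩ {b}ᶜ))
    (h₁ : Tendsto f (𝓝[<] b) (𝓝 l₁)) (h₂ : Tendsto f (𝓝[>] b) (𝓝 l₂))
    (h₃ : Tendsto f atTop (𝓝 l₃)) : ∃ K, ∀ σ, 0 ≤ σ → |f σ| ≤ K :=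
  exists_bound_of_tendsto hc.abs h₁.abs h₂.abs h₃.abs

lemma tendsto_one_add_div_rpow (β : ℝ) :
    Tendsto (fun σ : ℝ => (1 + σ) ^ β / σ ^ β) atTop (𝓝 1) := by
  have h : Tendsto (fun σ : ℝ => σ⁻¹ + 1) atTop (𝓝 1) := by
    simpa using tendsto_inv_atTop_zero.add_const (1 : ℝ)
  have h1 := h.rpow_const (p := β) (Or.inl one_ne_zero)
  rw [Real.one_rpow] at h1
  refine h1.congr' ?_
  filter_upwards [eventually_gt_atTop 0] with σ hσ
  rw [← Real.div_rpow (by linarith) hσ.le]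
  congr 1
  field_simp

lemma exists_rpow_bounds {l₁ l₂ κ β : ℝ} (hb : 0 < b) (hc : ContinuousOn f (Ici 0 ∩ {b}ᶜ))
    (hpos : ∀ σ, 0 ≤ σ → 0 < f σ) (hl₁ : 0 < l₁) (hl₂ : 0 < l₂) (hκ : 0 < κ)
    (h₁ : Tendsto f (𝓝[<] b) (𝓝 l₁)) (h₂ : Tendsto f (𝓝[>] b) (𝓝 l₂))
    (h₃ : Tendsto (fun σ => f σ / σ ^ β) atTop (𝓝 κ)) :
    ∃ c K : ℝ, 0 < c ∧ ∀ σ, 0 ≤ σ → c * (1 + σ) ^ β ≤ f σ ∧ f σ ≤ K * (1 + σ) ^ β := by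
  have hp : ∀ σ : ℝ, 0 ≤ σ → 0 < (1 + σ) ^ β := fun σ hσ => Real.rpow_pos_of_pos (by linarith) _
  have hpc : ContinuousOn (fun σ : ℝ => (1 + σ) ^ β) (Ici 0) := fun σ hσ => by
    have : 0 ≤ σ := hσ
    exact ((continuousAt_const.add continuousAt_id).rpow_const
      (Or.inl (show (1 : ℝ) + σ ≠ 0 by positivity))).continuousWithinAt
  have hpb : Tendsto (fun σ : ℝ => (1 + σ) ^ β) (𝓝 b) (𝓝 ((1 + b) ^ β)) :=
    (hpc b hb.le).continuousAt (Ici_mem_nhds hb)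
  have hbne := (hp b hb.le).ne'
  have h₄ : Tendsto (fun σ => f σ / (1 + σ) ^ β) atTop (𝓝 κ) := by
    have h := h₃.div (tendsto_one_add_div_rpow β) one_ne_zero
    rw [div_one] at h
    refine h.congr' ?_
    filter_upwards [eventually_gt_atTop 0] with σ hσ
    rw [Pi.div_apply, div_div_div_cancel_right₀ (Real.rpow_pos_of_pos hσ _).ne']
  have hgc : ContinuousOn (fun σ => f σ / (1 + σ) ^ β) (Ici 0 ∩ {b}ᶜ) :=
    hc.div (hpc.mono inter_subset_left) fun σ hσ => (hp σ hσ.1).ne'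
  have hg₁ := h₁.div (hpb.mono_left nhdsWithin_le_nhds) hbne
  have hg₂ := h₂.div (hpb.mono_left nhdsWithin_le_nhds) hbne
  obtain ⟨K, hK⟩ := exists_bound_of_tendsto hgc hg₁ hg₂ h₄
  have hbpos := hp b hb.le
  obtain ⟨L, hL⟩ := exists_bound_of_tendsto (hgc.inv₀ fun σ hσ =>
    (div_pos (hpos σ hσ.1) (hp σ hσ.1)).ne') (hg₁.inv₀ (div_pos hl₁ hbpos).ne')
    (hg₂.inv₀ (div_pos hl₂ hbpos).ne') (h₄.inv₀ hκ.ne')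
  have hL0 : 0 < L := (inv_pos.2 (div_pos (hpos 0 le_rfl) (hp 0 le_rfl))).trans_le (hL 0 le_rfl)
  refine ⟨L⁻¹, K, inv_pos.2 hL0, fun σ hσ => ⟨?_, (div_le_iff₀ (hp σ hσ)).1 (hK σ hσ)⟩⟩
  rw [← le_div_iff₀ (hp σ hσ)]
  exact inv_le_of_inv_le₀ (div_pos (hpos σ hσ) (hp σ hσ)) (hL σ hσ)

end Bounds

section Flows

variable {a β Ω₀ : ℝ} {m : ℕ} {S : Profile}

/-- The equations hold on the open half line off the break point if they hold for the two pieces. -/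
lemma solves_off_break {V A V₁ A₁ V₂ A₂ : ℝ → ℝ} {b : ℝ}
    (hU₁ : SolvesU a m β V₁ (Ioo 0 b)) (hU₂ : SolvesU a m β V₂ (Ioi b))
    (hA₁ : SolvesOmega a V₁ A₁ (Ioo 0 b)) (hA₂ : SolvesOmega a V₂ A₂ (Ioi b))
    (hV₁ : EqOn V V₁ (Ioo 0 b)) (hV₂ : EqOn V V₂ (Ioi b))
    (hA₁' : EqOn A A₁ (Ioo 0 b)) (hA₂' : EqOn A A₂ (Ioi b)) :
    SolvesU a m β V (Ioi 0 ∩ {b}ᶜ) ∧ SolvesOmega a V A (Ioi 0 ∩ {b}ᶜ) := by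
  have h : ∀ σ ∈ Ioi 0 ∩ {b}ᶜ, σ ∈ Ioo 0 b ∨ σ ∈ Ioi b := fun σ hσ => by
    rcases lt_or_gt_of_ne hσ.2 with h | h
    · exact Or.inl ⟨hσ.1, h⟩
    · exact Or.inr h
  constructor
  · intro σ hσ
    rcases h σ hσ with h | h
    · exact hU₁.congr isOpen_Ioo hV₁ σ h
    · exact hU₂.congr isOpen_Ioi hV₂ σ h
  · intro σ hσ
    rcases h σ hσ with h | h
    · exact hA₁.congr isOpen_Ioo hV₁ hA₁' σ h
    · exact hA₂.congr isOpen_Ioi hV₂ hA₂' σ h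

lemma continuousOn_off_break {V V₁ V₂ : ℝ → ℝ} {b : ℝ} (h₁ : ContinuousOn V₁ (Ico 0 b))
    (h₂ : ContinuousOn V₂ (Ioi b)) (hV₁ : EqOn V V₁ (Ico 0 b)) (hV₂ : EqOn V V₂ (Ioi b)) :
    ContinuousOn V (Ici 0 ∩ {b}ᶜ) := by
  intro σ hσ
  rcases lt_or_gt_of_ne hσ.2 with h | h
  · have := (h₁ σ ⟨hσ.1, h⟩).congr hV₁ (hV₁ ⟨hσ.1, h⟩)
    refine this.mono_of_mem_nhdsWithin ?_
    rw [← Ici_inter_Iio]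
    exact inter_mem (mem_of_superset self_mem_nhdsWithin inter_subset_left)
      (nhdsWithin_le_nhds (Iio_mem_nhds h))
  · exact ((h₂.continuousAt (Ioi_mem_nhds h)).congr
      (hV₂.symm.eventuallyEq_of_mem (Ioi_mem_nhds h))).continuousWithinAt

lemma continuousAt_of_tendsto {f : ℝ → ℝ} {b : ℝ} (h₁ : Tendsto f (𝓝[<] b) (𝓝 (f b)))
    (h₂ : Tendsto f (𝓝[>] b) (𝓝 (f b))) : ContinuousAt f b :=
  continuousAt_iff_continuous_left'_right'.2 ⟨h₁, h₂⟩

/-- The velocity profile of the flow for `t < 0` run backwards. -/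
noncomputable def Profile.backVelocity (S : Profile) (w σ : ℝ) : ℝ := -S.U w (-σ)

/-- The density profile of the flow for `t < 0` run backwards. -/
noncomputable def Profile.backDensity (S : Profile) (w σ : ℝ) : ℝ := -S.OmegaNeg w (-σ)

lemma IsConstructed.backVelocity_inner (hS : IsConstructed a m β Ω₀ S) {w : ℝ} :
    EqOn (S.backVelocity w) (fun σ => -S.Uhat (-σ)) (Icc 0 (-w)) := fun σ hσ => by
  have := hS.xiS_pos
  simp only [Profile.backVelocity, Profile.U, if_neg (show ¬ -σ < w by linarith [hσ.2]),
    if_pos (show -σ < S.xiS by linarith [hσ.1])]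

lemma Profile.backVelocity_outer {w : ℝ} :
    EqOn (S.backVelocity w) (fun σ => -S.Uk (-σ)) (Ioi (-w)) := fun σ hσ => by
  simp only [Profile.backVelocity, Profile.U, if_pos (show -σ < w by linarith [mem_Ioi.1 hσ])]

lemma Profile.backDensity_inner {w : ℝ} :
    EqOn (S.backDensity w) (fun σ => -S.OmNeg (-σ)) (Icc 0 (-w)) := fun σ hσ => by
  simp only [Profile.backDensity, Profile.OmegaNeg, if_neg (show ¬ -σ < w by linarith [hσ.2])]

lemma Profile.backDensity_outer {w : ℝ} :
    EqOn (S.backDensity w) (fun σ => -S.Omk (-σ)) (Ioi (-w)) := fun σ hσ => by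
  simp only [Profile.backDensity, Profile.OmegaNeg,
    if_pos (show -σ < w by linarith [mem_Ioi.1 hσ])]

lemma tendsto_left_of_eqOn {f g : ℝ → ℝ} {b : ℝ} (hb : 0 < b) (hg : ContinuousOn g (Icc 0 b))
    (h : EqOn f g (Ico 0 b)) : Tendsto f (𝓝[<] b) (𝓝 (g b)) := by
  have h1 : Tendsto g (𝓝[<] b) (𝓝 (g b)) :=
    ((hg b (right_mem_Icc.2 hb.le)).mono_of_mem_nhdsWithin (Icc_mem_nhdsLT hb)).tendsto
  exact h1.congr' (h.symm.eventuallyEq_of_mem (Ico_mem_nhdsLT hb))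

lemma tendsto_right_of_eqOn {f g : ℝ → ℝ} {b l : ℝ} (hg : Tendsto g (𝓝[>] b) (𝓝 l))
    (h : EqOn f g (Ioi b)) : Tendsto f (𝓝[>] b) (𝓝 l) :=
  hg.congr' (h.symm.eventuallyEq_of_mem self_mem_nhdsWithin)

lemma IsConstructed.backVelocity_hat_continuousOn (hw : xiW a m β < 0)
    (hS : IsConstructed a m β Ω₀ S) :
    ContinuousOn (fun σ => -S.Uhat (-σ)) (Icc 0 (-xiW a m β)) :=
  (hS.hat.continuousOn.comp continuousOn_neg
    fun σ hσ => ⟨by linarith [hσ.2], by linarith [hσ.1]⟩).neg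

lemma IsConstructed.backVelocity_tendsto_left (hw : xiW a m β < 0)
    (hS : IsConstructed a m β Ω₀ S) :
    Tendsto (S.backVelocity (xiW a m β)) (𝓝[<] (-xiW a m β)) (𝓝 (-uW a m β)) := by
  have := tendsto_left_of_eqOn (by linarith) (hS.backVelocity_hat_continuousOn hw)
    (hS.backVelocity_inner.mono Ico_subset_Icc_self)
  rwa [neg_neg, hS.hat.left] at this

lemma IsConstructed.backVelocity_tendsto_right (hS : IsConstructed a m β Ω₀ S) :
    Tendsto (S.backVelocity (xiW a m β)) (𝓝[>] (-xiW a m β)) (𝓝 (-uW a m β)) :=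
  tendsto_right_of_eqOn (hS.kink.tendsto.comp tendsto_neg_nhdsGT_neg).neg
    Profile.backVelocity_outer

lemma IsConstructed.backVelocity_continuousAt (hw : xiW a m β < 0)
    (hS : IsConstructed a m β Ω₀ S) :
    ContinuousAt (S.backVelocity (xiW a m β)) (-xiW a m β) := by
  have h : S.backVelocity (xiW a m β) (-xiW a m β) = -uW a m β := by
    rw [hS.backVelocity_inner (right_mem_Icc.2 (by linarith))]
    simp only [neg_neg, hS.hat.left]
  exact continuousAt_of_tendsto (h ▸ hS.backVelocity_tendsto_left hw)
    (h ▸ hS.backVelocity_tendsto_right)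

lemma IsConstructed.backDensity_omNeg_continuousOn (hS : IsConstructed a m β Ω₀ S) :
    ContinuousOn (fun σ => -S.OmNeg (-σ)) (Icc 0 (-xiW a m β)) :=
  (hS.omNeg_continuousOn.comp continuousOn_neg
    fun σ hσ => ⟨by linarith [hσ.2], by linarith [hσ.1]⟩).neg

lemma IsConstructed.backDensity_tendsto_left (hw : xiW a m β < 0)
    (hS : IsConstructed a m β Ω₀ S) :
    Tendsto (S.backDensity (xiW a m β)) (𝓝[<] (-xiW a m β)) (𝓝 (-S.OmNeg (xiW a m β))) := by
  have := tendsto_left_of_eqOn (by linarith) hS.backDensity_omNeg_continuousOn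
    (Profile.backDensity_inner.mono Ico_subset_Icc_self)
  rwa [neg_neg] at this

lemma IsConstructed.backDensity_tendsto_right (hS : IsConstructed a m β Ω₀ S) :
    Tendsto (S.backDensity (xiW a m β)) (𝓝[>] (-xiW a m β)) (𝓝 (-S.OmNeg (xiW a m β))) :=
  tendsto_right_of_eqOn (hS.omk_tendsto.comp tendsto_neg_nhdsGT_neg).neg
    Profile.backDensity_outer

lemma IsConstructed.backDensity_continuousAt (hw : xiW a m β < 0)
    (hS : IsConstructed a m β Ω₀ S) :
    ContinuousAt (S.backDensity (xiW a m β)) (-xiW a m β) := by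
  have h : S.backDensity (xiW a m β) (-xiW a m β) = -S.OmNeg (xiW a m β) := by
    rw [Profile.backDensity_inner (right_mem_Icc.2 (by linarith))]
    simp only [neg_neg]
  exact continuousAt_of_tendsto (h ▸ hS.backDensity_tendsto_left hw)
    (h ▸ hS.backDensity_tendsto_right)

/-- The part `t < 0`, reversed in time, with the break at the weak discontinuity. -/
lemma IsConstructed.back_flow (ha : 0 < a) (hm : m = 1 ∨ m = 2) (hβ : -(m : ℝ) < β)
    (hΩ : Ω₀ < 0) (hS : IsConstructed a m β Ω₀ S) :
    SimilarityFlow a m β (S.backVelocity (xiW a m β)) (S.backDensity (xiW a m β)) (-xiW a m β)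
      (-S.C) (-S.Ustar) := by
  have hw := xiW_neg ha hm hβ
  have hb : 0 < -xiW a m β := by linarith
  set w := xiW a m β with hwdef
  have hvi : EqOn (S.backVelocity w) (fun σ => -S.Uhat (-σ)) (Icc 0 (-w)) :=
    hS.backVelocity_inner
  have hvo : EqOn (S.backVelocity w) (fun σ => -S.Uk (-σ)) (Ioi (-w)) :=
    Profile.backVelocity_outer
  have hdi : EqOn (S.backDensity w) (fun σ => -S.OmNeg (-σ)) (Icc 0 (-w)) :=
    Profile.backDensity_inner
  have hdo : EqOn (S.backDensity w) (fun σ => -S.Omk (-σ)) (Ioi (-w)) :=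
    Profile.backDensity_outer
  have hneg : ∀ σ ∈ Ioi (-w), -σ ∈ Iio w := fun σ hσ => by
    have := mem_Ioi.1 hσ
    exact mem_Iio.2 (by linarith)
  have hneg' : ∀ σ ∈ Ioo 0 (-w), -σ ∈ Ioo w 0 := fun σ hσ =>
    ⟨by linarith [hσ.2], by linarith [hσ.1]⟩
  have hΩ₁ : SolvesOmega a (fun σ => -S.Uhat (-σ)) (fun σ => -S.OmNeg (-σ)) (Ioo 0 (-w)) := by
    have := (hS.omNeg_solves.reflect.mono hneg').const_mul (-1)
    simpa only [neg_one_mul] using this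
  have hΩ₂ : SolvesOmega a (fun σ => -S.Uk (-σ)) (fun σ => -S.Omk (-σ)) (Ioi (-w)) := by
    have := (hS.omk_solves.reflect.mono hneg).const_mul (-1)
    simpa only [neg_one_mul] using this
  obtain ⟨hsU, hsA⟩ := solves_off_break (hS.hat.solves_neg.reflect.mono hneg')
    (hS.kink.solves.reflect.mono hneg) hΩ₁ hΩ₂ (hvi.mono Ioo_subset_Icc_self) hvo
    (hdi.mono Ioo_subset_Icc_self) hdo
  have hvc := continuousOn_off_break ((hS.backVelocity_hat_continuousOn hw).mono
    Ico_subset_Icc_self) (fun σ hσ => ((hS.kink.solves.reflect.mono hneg) σ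
      hσ).2.continuousAt.continuousWithinAt) (hvi.mono Ico_subset_Icc_self) hvo
  have hdc := continuousOn_off_break (hS.backDensity_omNeg_continuousOn.mono
    Ico_subset_Icc_self) (fun σ hσ => (hΩ₂ σ hσ).continuousAt.continuousWithinAt)
    (hdi.mono Ico_subset_Icc_self) hdo
  have hvb := hS.backVelocity_continuousAt hw
  have hdb := hS.backDensity_continuousAt hw
  have hvlim : Tendsto (S.backVelocity w) atTop (𝓝 (-S.Ustar)) :=
    (hS.kink_limit.comp tendsto_neg_atTop_atBot).neg.congr'
      (hvo.symm.eventuallyEq_of_mem (Ioi_mem_atTop _))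
  have hdlim : Tendsto (fun σ => S.backDensity w σ / σ ^ β) atTop (𝓝 (-S.C)) := by
    refine (hS.omk_asymp.comp tendsto_neg_atTop_atBot).neg.congr' ?_
    filter_upwards [Ioi_mem_atTop (-w)] with σ hσ
    have h0 : 0 < σ := hb.trans hσ
    rw [hdo hσ, Function.comp_apply, abs_neg, abs_of_pos h0, neg_div]
  have hdpos : ∀ σ, 0 ≤ σ → 0 < S.backDensity w σ := by
    intro σ hσ
    rcases le_or_gt σ (-w) with h | h
    · rw [hdi ⟨hσ, h⟩, neg_pos]
      exact hS.omNeg_neg ha hm hβ hΩ _ ⟨by linarith, by linarith⟩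
    · rw [hdo h, neg_pos]
      exact (hS.omk_neg ha hm hβ hΩ).1 _ (hneg σ h)
  have hOw : 0 < -S.OmNeg w :=
    neg_pos.2 (hS.omNeg_neg ha hm hβ hΩ _ (left_mem_Icc.2 hw.le))
  exact
    { break_pos := hb
      solvesU := hsU
      solvesOmega := hsA
      velocity_continuousOn := hvc
      density_continuousOn := hdc
      mass_flux := (hvb.sub continuousAt_id).mul hdb
      momentum_flux := (((hvb.sub continuousAt_id).mul hdb).mul hvb).add (hdb.const_mul _)
      density_bound := exists_rpow_bounds hb hdc hdpos hOw hOw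
        (neg_pos.2 (hS.omk_neg ha hm hβ hΩ).2) (hS.backDensity_tendsto_left hw)
        hS.backDensity_tendsto_right hdlim
      velocity_bound := exists_abs_bound_of_tendsto hvc (hS.backVelocity_tendsto_left hw)
        hS.backVelocity_tendsto_right hvlim
      density_tendsto := hdlim
      velocity_tendsto := hvlim }

lemma IsConstructed.U_inner (hw : xiW a m β < 0) :
    EqOn (S.U (xiW a m β)) S.Uhat (Ico 0 S.xiS) := fun σ hσ => by
  simp only [Profile.U, if_neg (show ¬ σ < xiW a m β by linarith [hσ.1]), if_pos hσ.2]

lemma IsConstructed.U_outer (hw : xiW a m β < 0) (hS : IsConstructed a m β Ω₀ S) :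
    EqOn (S.U (xiW a m β)) S.Utilde (Ici S.xiS) := fun σ hσ => by
  have := hS.xiS_pos
  have h := mem_Ici.1 hσ
  simp only [Profile.U, if_neg (show ¬ σ < xiW a m β by linarith), if_neg (not_lt.2 h)]

lemma Profile.OmegaPos_inner : EqOn S.OmegaPos S.OmPos (Ico 0 S.xiS) := fun σ hσ => by
  simp only [Profile.OmegaPos, if_pos hσ.2]

lemma Profile.OmegaPos_outer : EqOn S.OmegaPos S.Omtilde (Ici S.xiS) := fun σ hσ => by
  simp only [Profile.OmegaPos, if_neg (not_lt.2 (mem_Ici.1 hσ))]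

lemma IsConstructed.hat_continuousOn_inner (hw : xiW a m β < 0) (hS : IsConstructed a m β Ω₀ S) :
    ContinuousOn S.Uhat (Icc 0 S.xiS) :=
  hS.hat.continuousOn.mono (Icc_subset_Icc hw.le hS.shock_mem.2.le)

lemma IsConstructed.U_tendsto_left (hw : xiW a m β < 0) (hS : IsConstructed a m β Ω₀ S) :
    Tendsto (S.U (xiW a m β)) (𝓝[<] S.xiS) (𝓝 (S.Uhat S.xiS)) :=
  tendsto_left_of_eqOn hS.xiS_pos (hS.hat_continuousOn_inner hw) (IsConstructed.U_inner hw)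

lemma IsConstructed.U_tendsto_right (hw : xiW a m β < 0) (hS : IsConstructed a m β Ω₀ S) :
    Tendsto (S.U (xiW a m β)) (𝓝[>] S.xiS) (𝓝 (S.Utilde S.xiS)) :=
  tendsto_right_of_eqOn ((hS.tilde.solves S.xiS hS.shock_mem.1).2.continuousAt.tendsto.mono_left
    nhdsWithin_le_nhds) ((hS.U_outer hw).mono Ioi_subset_Ici_self)

lemma IsConstructed.OmegaPos_tendsto_left (hS : IsConstructed a m β Ω₀ S) :
    Tendsto S.OmegaPos (𝓝[<] S.xiS) (𝓝 (S.OmPos S.xiS)) :=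
  tendsto_left_of_eqOn hS.xiS_pos hS.omPos_continuousOn Profile.OmegaPos_inner

lemma IsConstructed.OmegaPos_tendsto_right (hS : IsConstructed a m β Ω₀ S) :
    Tendsto S.OmegaPos (𝓝[>] S.xiS) (𝓝 (S.Omtilde S.xiS)) :=
  tendsto_right_of_eqOn (hS.omtilde_continuous.tendsto.mono_left
    (nhdsWithin_mono _ Ioi_subset_Ici_self)) (Profile.OmegaPos_outer.mono Ioi_subset_Ici_self)

lemma IsConstructed.hat_sub_neg (ha : 0 < a) (hm : m = 1 ∨ m = 2) (hβ : -(m : ℝ) < β)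
    (hβ' : β < 0) (hS : IsConstructed a m β Ω₀ S) : S.Uhat S.xiS - S.xiS < 0 :=
  hS.hat.sub_neg ha hm hβ hβ' _ ⟨hS.xiS_pos, hS.shock_mem.2⟩

/-- Prandtl's relation for an isothermal shock. -/
lemma IsConstructed.shock_mul (ha : 0 < a) (hm : m = 1 ∨ m = 2) (hβ : -(m : ℝ) < β)
    (hβ' : β < 0) (hS : IsConstructed a m β Ω₀ S) :
    (S.Uhat S.xiS - S.xiS) * (S.Utilde S.xiS - S.xiS) = a ^ 2 := by
  rw [hS.shock_eq, hugoniot, add_sub_cancel_left,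
    mul_div_cancel₀ _ (hS.hat_sub_neg ha hm hβ hβ').ne]

lemma IsConstructed.shock_mass (ha : 0 < a) (hm : m = 1 ∨ m = 2) (hβ : -(m : ℝ) < β)
    (hβ' : β < 0) (hS : IsConstructed a m β Ω₀ S) :
    (S.Uhat S.xiS - S.xiS) * S.OmPos S.xiS = (S.Utilde S.xiS - S.xiS) * S.Omtilde S.xiS := by
  have h := hS.shock_mul ha hm hβ hβ'
  rw [hS.omPos_shock]
  field_simp
  rw [← h]
  ring

lemma IsConstructed.shock_momentum (ha : 0 < a) (hm : m = 1 ∨ m = 2) (hβ : -(m : ℝ) < β)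
    (hβ' : β < 0) (hS : IsConstructed a m β Ω₀ S) :
    (S.Uhat S.xiS - S.xiS) * S.OmPos S.xiS * S.Uhat S.xiS + a ^ 2 * S.OmPos S.xiS =
      (S.Utilde S.xiS - S.xiS) * S.Omtilde S.xiS * S.Utilde S.xiS + a ^ 2 * S.Omtilde S.xiS := by
  have h := hS.shock_mul ha hm hβ hβ'
  have h1 : a ^ 2 * S.OmPos S.xiS = (S.Utilde S.xiS - S.xiS) ^ 2 * S.Omtilde S.xiS := by
    rw [hS.omPos_shock]
    field_simp
  rw [h1, hS.shock_mass ha hm hβ hβ', ← h]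
  ring

/-- The part `t > 0`, with the break at the shock; there the fluxes are continuous by the
Rankine-Hugoniot relations. -/
lemma IsConstructed.forward_flow (ha : 0 < a) (hm : m = 1 ∨ m = 2) (hβ : -(m : ℝ) < β)
    (hβ' : β < 0) (hΩ : Ω₀ < 0) (hS : IsConstructed a m β Ω₀ S) :
    SimilarityFlow a m β (S.U (xiW a m β)) S.OmegaPos S.xiS (-S.C) S.Ustar := by
  have hw := xiW_neg ha hm hβ
  have hb := hS.xiS_pos
  have hvi := IsConstructed.U_inner (S := S) hw
  have hvo := hS.U_outer hw
  have hdi := Profile.OmegaPos_inner (S := S)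
  have hdo := Profile.OmegaPos_outer (S := S)
  have hsub : Ioo 0 S.xiS ⊆ Ioo 0 (-xiW a m β) := Ioo_subset_Ioo_right hS.shock_mem.2.le
  have htS : SolvesU a m β S.Utilde (Ioi S.xiS) :=
    hS.tilde.solves.mono (Ioi_subset_Ioi hS.shock_mem.1.le)
  obtain ⟨hsU, hsA⟩ := solves_off_break (hS.hat.solves_pos.mono hsub) htS hS.omPos_solves
    hS.omtilde_solves (hvi.mono Ioo_subset_Ico_self) (hvo.mono Ioi_subset_Ici_self)
    (hdi.mono Ioo_subset_Ico_self) (hdo.mono Ioi_subset_Ici_self)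
  have hvc := continuousOn_off_break ((hS.hat_continuousOn_inner hw).mono Ico_subset_Icc_self)
    (fun σ hσ => (htS σ hσ).2.continuousAt.continuousWithinAt) hvi (hvo.mono Ioi_subset_Ici_self)
  have hdc := continuousOn_off_break (hS.omPos_continuousOn.mono Ico_subset_Icc_self)
    (fun σ hσ => (hS.omtilde_solves σ hσ).continuousAt.continuousWithinAt) hdi
    (hdo.mono Ioi_subset_Ici_self)
  have hvl := hS.U_tendsto_left hw
  have hvr := hS.U_tendsto_right hw
  have hdl := hS.OmegaPos_tendsto_left
  have hdr := hS.OmegaPos_tendsto_right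
  have hVb := hvo (mem_Ici.2 le_rfl)
  have hAb := hdo (mem_Ici.2 le_rfl)
  have hidl : Tendsto (fun σ : ℝ => σ) (𝓝[<] S.xiS) (𝓝 S.xiS) :=
    tendsto_id.mono_left nhdsWithin_le_nhds
  have hidr : Tendsto (fun σ : ℝ => σ) (𝓝[>] S.xiS) (𝓝 S.xiS) :=
    tendsto_id.mono_left nhdsWithin_le_nhds
  have hvlim : Tendsto (S.U (xiW a m β)) atTop (𝓝 S.Ustar) :=
    hS.tilde.tendsto_atTop.congr' (hvo.symm.eventuallyEq_of_mem (Ici_mem_atTop _))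
  have hdlim : Tendsto (fun σ => S.OmegaPos σ / σ ^ β) atTop (𝓝 (-S.C)) := by
    refine hS.omtilde_asymp.congr' ?_
    filter_upwards [Ici_mem_atTop S.xiS] with σ hσ
    rw [hdo hσ]
  have hdpos : ∀ σ, 0 ≤ σ → 0 < S.OmegaPos σ := by
    intro σ hσ
    rcases lt_or_ge σ S.xiS with h | h
    · rw [hdi ⟨hσ, h⟩]
      exact hS.omPos_pos ha hm hβ hΩ _ ⟨hσ, h.le⟩
    · rw [hdo h]
      exact hS.omtilde_pos ha hm hβ hΩ _ h
  exact
    { break_pos := hb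
      solvesU := hsU
      solvesOmega := hsA
      velocity_continuousOn := hvc
      density_continuousOn := hdc
      mass_flux := by
        refine continuousAt_of_tendsto ?_ ?_
        · simp only [hVb, hAb, ← hS.shock_mass ha hm hβ hβ']
          exact (hvl.sub hidl).mul hdl
        · simp only [hVb, hAb]
          exact (hvr.sub hidr).mul hdr
      momentum_flux := by
        refine continuousAt_of_tendsto ?_ ?_
        · simp only [hVb, hAb, ← hS.shock_momentum ha hm hβ hβ']
          exact (((hvl.sub hidl).mul hdl).mul hvl).add (hdl.const_mul _)
        · simp only [hVb, hAb]
          exact (((hvr.sub hidr).mul hdr).mul hvr).add (hdr.const_mul _)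
      density_bound := exists_rpow_bounds hb hdc hdpos
        (hS.omPos_pos ha hm hβ hΩ _ (right_mem_Icc.2 hb.le)) (hS.omtilde_pos ha hm hβ hΩ _ le_rfl)
        (neg_pos.2 (hS.omk_neg ha hm hβ hΩ).2) hdl hdr hdlim
      velocity_bound := exists_abs_bound_of_tendsto hvc hvl hvr hvlim
      density_tendsto := hdlim
      velocity_tendsto := hvlim }

end Flows

/-! ### Radial test functions -/

section RadialTest

variable {ψ : ℝ × ℝ → ℝ}

lemma isOpen_halfPlane : IsOpen (univ ×ˢ Ioi 0 : Set (ℝ × ℝ)) := isOpen_univ.prod isOpen_Ioi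

lemma IsRadialTest.contDiffOn (hψ : IsRadialTest ψ) : ContDiffOn ℝ 1 ψ (univ ×ˢ Ioi 0) :=
  hψ.1.mono (prod_mono_right Ioi_subset_Ici_self)

lemma IsRadialTest.hasFDerivAt (hψ : IsRadialTest ψ) (t : ℝ) {r : ℝ} (hr : 0 < r) :
    HasFDerivAt ψ (fderiv ℝ ψ (t, r)) (t, r) :=
  ((hψ.contDiffOn.differentiableOn one_ne_zero).differentiableAt
    (isOpen_halfPlane.mem_nhds (mem_prod.2 ⟨mem_univ t, mem_Ioi.2 hr⟩))).hasFDerivAt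

lemma IsRadialTest.hasDerivAt_time (hψ : IsRadialTest ψ) (t : ℝ) {r : ℝ} (hr : 0 < r) :
    HasDerivAt (fun s => ψ (s, r)) (fderiv ℝ ψ (t, r) (1, 0)) t :=
  (hψ.hasFDerivAt t hr).comp_hasDerivAt t ((hasDerivAt_id t).prodMk (hasDerivAt_const t r))

lemma IsRadialTest.hasDerivAt_radius (hψ : IsRadialTest ψ) (t : ℝ) {r : ℝ} (hr : 0 < r) :
    HasDerivAt (fun s => ψ (t, s)) (fderiv ℝ ψ (t, r) (0, 1)) r :=
  (hψ.hasFDerivAt t hr).comp_hasDerivAt r ((hasDerivAt_const r t).prodMk (hasDerivAt_id r))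

lemma IsRadialTest.continuousOn_fderiv (hψ : IsRadialTest ψ) (v : ℝ × ℝ) :
    ContinuousOn (fun z => fderiv ℝ ψ z v) (univ ×ˢ Ioi 0) :=
  (hψ.contDiffOn.continuousOn_fderiv_of_isOpen isOpen_halfPlane le_rfl).clm_apply
    continuousOn_const

lemma IsRadialTest.continuousOn_deriv_time (hψ : IsRadialTest ψ) :
    ContinuousOn (fun z : ℝ × ℝ => deriv (fun s => ψ (s, z.2)) z.1) (univ ×ˢ Ioi 0) :=
  (hψ.continuousOn_fderiv (1, 0)).congr fun z hz => (hψ.hasDerivAt_time z.1 hz.2).deriv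

lemma IsRadialTest.continuousOn_deriv_radius (hψ : IsRadialTest ψ) :
    ContinuousOn (fun z : ℝ × ℝ => deriv (fun s => ψ (z.1, s)) z.2) (univ ×ˢ Ioi 0) :=
  (hψ.continuousOn_fderiv (0, 1)).congr fun z hz => (hψ.hasDerivAt_radius z.1 hz.2).deriv

lemma IsRadialTest.exists_bounds (hψ : IsRadialTest ψ) :
    ∃ B T R : ℝ, 0 < B ∧ 0 < T ∧ 0 < R ∧
      (∀ t r, 0 < r → |ψ (t, r)| ≤ B ∧ |deriv (fun s => ψ (s, r)) t| ≤ B ∧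
        |deriv (fun s => ψ (t, s)) r| ≤ B) ∧
      ∀ t r, 0 < r → (T < |t| ∨ R < r) → ψ (t, r) = 0 ∧ deriv (fun s => ψ (s, r)) t = 0 ∧
        deriv (fun s => ψ (t, s)) r = 0 := by
  obtain ⟨hc, T, R, hT, hR, hz⟩ := id hψ
  set S : Set (ℝ × ℝ) := univ ×ˢ Ici 0 with hS
  set Q : Set (ℝ × ℝ) := Icc (-T) T ×ˢ Icc 0 R with hQ
  have hQc : IsCompact Q := isCompact_Icc.prod isCompact_Icc
  have hQS : Q ⊆ S := fun z hz => ⟨mem_univ _, hz.2.1⟩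
  have hUD : UniqueDiffOn ℝ S := uniqueDiffOn_univ.prod (uniqueDiffOn_Ici 0)
  obtain ⟨B₀, hB₀⟩ := hQc.exists_bound_of_continuousOn (hc.continuousOn.mono hQS)
  obtain ⟨B₁, hB₁⟩ := hQc.exists_bound_of_continuousOn
    ((hc.continuousOn_fderivWithin hUD le_rfl).mono hQS)
  have hzero : ∀ t r, 0 < r → (t, r) ∉ Q → ψ (t, r) = 0 ∧ deriv (fun s => ψ (s, r)) t = 0 ∧
      deriv (fun s => ψ (t, s)) r = 0 := by
    intro t r hr hn
    have hev : ψ =ᶠ[𝓝 (t, r)] fun _ => 0 := by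
      filter_upwards [isOpen_halfPlane.mem_nhds ⟨mem_univ t, hr⟩,
        hQc.isClosed.isOpen_compl.mem_nhds hn] with z hz1 hz2
      exact hz z.1 z.2 (mem_Ioi.1 hz1.2).le hz2
    have hf : fderiv ℝ ψ (t, r) = 0 := by
      rw [hev.fderiv_eq]
      simp
    refine ⟨hz t r hr.le hn, ?_, ?_⟩
    · rw [(hψ.hasDerivAt_time t hr).deriv, hf]
      simp
    · rw [(hψ.hasDerivAt_radius t hr).deriv, hf]
      simp
  refine ⟨|B₀| + |B₁| + 1, T, R, by positivity, hT, hR, fun t r hr => ?_, fun t r hr h => ?_⟩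
  · by_cases hm : (t, r) ∈ Q
    · have h0 := hB₀ _ hm
      have h1 := hB₁ _ hm
      have hnhds : S ∈ 𝓝 (t, r) := mem_of_superset
        (isOpen_halfPlane.mem_nhds ⟨mem_univ t, hr⟩) (prod_mono_right Ioi_subset_Ici_self)
      rw [fderivWithin_of_mem_nhds hnhds] at h1
      have h2 : ∀ v : ℝ × ℝ, ‖v‖ ≤ 1 → |fderiv ℝ ψ (t, r) v| ≤ B₁ := fun v hv =>
        ((fderiv ℝ ψ (t, r)).le_of_opNorm_le_of_le h1 hv).trans_eq (mul_one _)
      have hb0 := le_abs_self B₀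
      have hb1 := le_abs_self B₁
      have hb2 := abs_nonneg B₀
      have hb3 := abs_nonneg B₁
      rw [Real.norm_eq_abs] at h0
      refine ⟨by linarith, ?_, ?_⟩
      · rw [(hψ.hasDerivAt_time t hr).deriv]
        linarith [h2 (1, 0) (by simp [Prod.norm_def])]
      · rw [(hψ.hasDerivAt_radius t hr).deriv]
        linarith [h2 (0, 1) (by simp [Prod.norm_def])]
    · obtain ⟨h1, h2, h3⟩ := hzero t r hr hm
      rw [h1, h2, h3, abs_zero]
      have : 0 ≤ |B₀| + |B₁| + 1 := by positivity
      exact ⟨this, this, this⟩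
  · refine hzero t r hr fun hm => ?_
    rcases h with h | h
    · exact absurd (abs_le.2 hm.1) (not_le.2 h)
    · exact absurd hm.2.2 (not_le.2 h)

lemma IsRadialTest.reverse (hψ : IsRadialTest ψ) : IsRadialTest fun z => ψ (-z.1, z.2) := by
  obtain ⟨hc, T, R, hT, hR, hz⟩ := hψ
  refine ⟨hc.comp (f := fun z : ℝ × ℝ => (-z.1, z.2)) (by fun_prop)
    (fun z hz => ⟨mem_univ _, hz.2⟩), T, R, hT, hR, fun t r hr hn => hz _ _ hr fun hm => hn ?_⟩
  exact ⟨⟨by linarith [hm.1.2], by linarith [hm.1.1]⟩, hm.2⟩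

lemma deriv_time_reverse (ψ : ℝ × ℝ → ℝ) (t r : ℝ) :
    deriv (fun s => ψ (-s, r)) t = -deriv (fun s => ψ (s, r)) (-t) :=
  deriv_comp_neg (fun s => ψ (s, r)) t

end RadialTest

/-! ### Balance laws for expanding similarity fields -/

section HalfLaw

variable {A F P : ℝ → ℝ} {b K β : ℝ} {m : ℕ} {ψ : ℝ × ℝ → ℝ}

lemma ae_ne_restrict_Ioi (b : ℝ) : ∀ᵐ x ∂(volume.restrict (Ioi (0 : ℝ))), x ≠ b :=
  ae_restrict_of_ae (Measure.ae_ne volume b)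

lemma aestronglyMeasurable_of_continuousOn_off {g : ℝ → ℝ} (hg : ContinuousOn g (Ioi 0 ∩ {b}ᶜ)) :
    AEStronglyMeasurable g (volume.restrict (Ioi 0)) := by
  have h := hg.aestronglyMeasurable (μ := volume) (measurableSet_Ioi.inter
    (measurableSet_singleton b).compl)
  rwa [← Measure.restrict_restrict measurableSet_Ioi,
    Measure.restrict_eq_self_of_ae_mem (s := {b}ᶜ) (Measure.ae_ne volume b)] at h

lemma integrableOn_of_bounded {g : ℝ → ℝ} {N C : ℝ} (hg : ContinuousOn g (Ioi 0 ∩ {b}ᶜ))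
    (hC : ∀ σ ∈ Ioc 0 N, |g σ| ≤ C) (hN : ∀ σ, 0 < σ → N < σ → g σ = 0) :
    IntegrableOn g (Ioi 0) := by
  have h1 : IntegrableOn ((Ioc 0 N).indicator fun _ => C) (Ioi 0) := by
    refine Integrable.integrableOn ?_
    rw [integrable_indicator_iff measurableSet_Ioc]
    exact integrableOn_const (by simp)
  refine Integrable.mono' h1 (aestronglyMeasurable_of_continuousOn_off hg) ?_
  filter_upwards [ae_restrict_mem measurableSet_Ioi] with σ hσ
  by_cases h : σ ≤ N
  · rw [indicator_of_mem (show σ ∈ Ioc 0 N from ⟨hσ, h⟩)]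
    exact hC σ ⟨hσ, h⟩
  · rw [hN σ hσ (not_le.1 h), norm_zero, indicator_of_notMem (fun h' => h h'.2)]

lemma IsRadialTest.hasDerivAt_ray (hψ : IsRadialTest ψ) {t σ : ℝ} (ht : 0 < t) (hσ : 0 < σ) :
    HasDerivAt (fun s => ψ (s, s * σ)) (deriv (fun s => ψ (s, t * σ)) t +
      σ * deriv (fun s => ψ (t, s)) (t * σ)) t := by
  have hr : 0 < t * σ := mul_pos ht hσ
  have h := (hψ.hasFDerivAt t hr).comp_hasDerivAt t
    ((hasDerivAt_id t).prodMk ((hasDerivAt_id t).mul_const σ))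
  rw [(hψ.hasDerivAt_time t hr).deriv, (hψ.hasDerivAt_radius t hr).deriv]
  refine h.congr_deriv ?_
  rw [show ((1 : ℝ), 1 * σ) = (1, 0) + σ • ((0 : ℝ), (1 : ℝ)) by simp, map_add, map_smul,
    smul_eq_mul]

/-- Differentiation of `∫ g(σ) ψ(t, tσ) σ^m dσ` in `t`. -/
lemma hasDerivAt_integral_ray (hA : ContinuousOn A (Ioi 0 ∩ {b}ᶜ))
    (hK : ∀ σ, 0 < σ → |A σ| ≤ K) (hψ : IsRadialTest ψ) {t : ℝ} (ht : 0 < t) :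
    IntegrableOn (fun σ => A σ * ψ (t, t * σ) * σ ^ m) (Ioi 0) ∧
    IntegrableOn (fun σ => A σ * (deriv (fun s => ψ (s, t * σ)) t +
      σ * deriv (fun s => ψ (t, s)) (t * σ)) * σ ^ m) (Ioi 0) ∧
    HasDerivAt (fun t => ∫ σ in Ioi (0 : ℝ), A σ * ψ (t, t * σ) * σ ^ m)
      (∫ σ in Ioi (0 : ℝ), A σ * (deriv (fun s => ψ (s, t * σ)) t +
        σ * deriv (fun s => ψ (t, s)) (t * σ)) * σ ^ m) t := by
  obtain ⟨B, T, R, hB, hT, hR, hbd, hz⟩ := hψ.exists_bounds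
  have hK0 : 0 ≤ K := (abs_nonneg _).trans (hK 1 one_pos)
  -- for times `s > t / 2` the test function vanishes where `σ > N`
  set N := 2 * R / t with hN
  have hN0 : 0 < N := by positivity
  have hout : ∀ s ∈ Ioi (t / 2), ∀ σ, N < σ → R < s * σ := fun s hs σ hσ => by
    have h1 : 2 * R < σ * t := (div_lt_iff₀ ht).1 hσ
    have h2 := mem_Ioi.1 hs
    have h3 : 0 < σ := hN0.trans hσ
    nlinarith
  have hcray : ∀ s, 0 < s → ContinuousOn (fun σ => ψ (s, s * σ)) (Ioi 0) := fun s hs =>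
    hψ.contDiffOn.continuousOn.comp (f := fun σ => (s, s * σ)) (by fun_prop)
      fun σ hσ => ⟨mem_univ _, mul_pos hs hσ⟩
  have hc1 : ContinuousOn (fun σ => deriv (fun s => ψ (s, t * σ)) t) (Ioi 0) :=
    hψ.continuousOn_deriv_time.comp (f := fun σ => (t, t * σ)) (by fun_prop)
      fun σ hσ => ⟨mem_univ _, mul_pos ht hσ⟩
  have hc2 : ContinuousOn (fun σ => deriv (fun s => ψ (t, s)) (t * σ)) (Ioi 0) :=
    hψ.continuousOn_deriv_radius.comp (f := fun σ => (t, t * σ)) (by fun_prop)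
      fun σ hσ => ⟨mem_univ _, mul_pos ht hσ⟩
  have hpow : ∀ σ ∈ Ioc 0 N, σ ^ m ≤ N ^ m := fun σ hσ => pow_le_pow_left₀ hσ.1.le hσ.2 m
  have hcA : ∀ s, 0 < s → ContinuousOn (fun σ => A σ * ψ (s, s * σ) * σ ^ m)
      (Ioi 0 ∩ {b}ᶜ) := fun s hs =>
    (hA.mul ((hcray s hs).mono inter_subset_left)).mul (continuous_pow m).continuousOn
  have hint : IntegrableOn (fun σ => A σ * ψ (t, t * σ) * σ ^ m) (Ioi 0) := by
    refine integrableOn_of_bounded (N := N) (C := K * B * N ^ m) (hcA t ht) ?_ ?_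
    · intro σ hσ
      rw [abs_mul, abs_mul, abs_of_nonneg (pow_nonneg hσ.1.le m)]
      exact mul_le_mul (mul_le_mul (hK σ hσ.1) (hbd t _ (mul_pos ht hσ.1)).1 (abs_nonneg _) hK0)
        (hpow σ hσ) (pow_nonneg hσ.1.le m) (by positivity)
    · intro σ hσ h
      rw [(hz t _ (mul_pos ht hσ) (Or.inr (hout t (mem_Ioi.2 (by linarith)) σ h))).1]
      ring
  refine ⟨hint, hasDerivAt_integral_of_dominated_loc_of_deriv_le
    (μ := volume.restrict (Ioi 0)) (F := fun t σ => A σ * ψ (t, t * σ) * σ ^ m)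
    (F' := fun t σ => A σ * (deriv (fun s => ψ (s, t * σ)) t +
        σ * deriv (fun s => ψ (t, s)) (t * σ)) * σ ^ m)
    (bound := (Ioc 0 N).indicator fun _ => K * (B + N * B) * N ^ m)
    (Ioi_mem_nhds (show t / 2 < t by linarith)) ?_ ?_ ?_ ?_ ?_ ?_⟩
  · filter_upwards [Ioi_mem_nhds ht] with s hs
    exact aestronglyMeasurable_of_continuousOn_off (hcA s hs)
  · exact hint
  · exact aestronglyMeasurable_of_continuousOn_off ((hA.mul ((hc1.add
      (continuousOn_id.mul hc2)).mono inter_subset_left)).mul (continuous_pow m).continuousOn)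
  · filter_upwards [ae_restrict_mem measurableSet_Ioi] with σ hσ s hs
    have hσ0 : 0 < σ := hσ
    have hs0 : 0 < s := by linarith [mem_Ioi.1 hs]
    have hr := mul_pos hs0 hσ0
    by_cases h : σ ≤ N
    · rw [indicator_of_mem (show σ ∈ Ioc 0 N from ⟨hσ0, h⟩), Real.norm_eq_abs, abs_mul, abs_mul,
        abs_of_nonneg (pow_nonneg hσ0.le m)]
      have h1 : |deriv (fun u => ψ (u, s * σ)) s + σ * deriv (fun u => ψ (s, u)) (s * σ)|
          ≤ B + N * B := by
        refine (abs_add_le _ _).trans (add_le_add (hbd s _ hr).2.1 ?_)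
        rw [abs_mul, abs_of_pos hσ0]
        exact mul_le_mul h (hbd s _ hr).2.2 (abs_nonneg _) hN0.le
      exact mul_le_mul (mul_le_mul (hK σ hσ0) h1 (abs_nonneg _) hK0)
        (hpow σ ⟨hσ0, h⟩) (pow_nonneg hσ0.le m) (by positivity)
    · obtain ⟨_, h2, h3⟩ := hz s _ hr (Or.inr (hout s hs σ (not_le.1 h)))
      rw [h2, h3, indicator_of_notMem (fun h' => h h'.2)]
      simp
  · refine Integrable.integrableOn ?_
    rw [integrable_indicator_iff measurableSet_Ioc]
    exact integrableOn_const (by simp)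
  · filter_upwards [ae_restrict_mem measurableSet_Ioi] with σ hσ s hs
    have hs0 : 0 < s := by linarith [mem_Ioi.1 hs]
    exact ((hψ.hasDerivAt_ray hs0 hσ).const_mul (A σ)).mul_const (σ ^ m)

/-- The balance law of a similarity field tested against `ψ` at a fixed time, in the variable
`σ = r / t`; the boundary terms vanish since `σ^m (F - σ A)` does at the origin. -/
lemma integral_balance_eq_zero (hm : m ≠ 0) (hA : ContinuousOn A (Ioi 0 ∩ {b}ᶜ))
    (hP : ContinuousOn P (Ioi 0 ∩ {b}ᶜ)) (hKA : ∀ σ, 0 < σ → |A σ| ≤ K)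
    (hKP : ∀ σ, 0 < σ → |P σ| ≤ K)
    (hΦc : ContinuousOn (fun σ => σ ^ m * (F σ - σ * A σ)) (Ici 0))
    (hΦ : ∀ σ ∈ Ioi 0 ∩ {b}ᶜ, HasDerivAt (fun σ => σ ^ m * (F σ - σ * A σ))
      (-(β + m + 1) * σ ^ m * A σ + m * σ ^ (m - 1) * P σ) σ)
    (hψ : IsRadialTest ψ) {t : ℝ} (ht : 0 < t) :
    IntegrableOn (fun σ => (-(β + m + 1) * σ ^ m * A σ + m * σ ^ (m - 1) * P σ) * ψ (t, t * σ) +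
      σ ^ m * (F σ - σ * A σ) * (t * deriv (fun s => ψ (t, s)) (t * σ))) (Ioi 0) ∧
    ∫ σ in Ioi (0 : ℝ), ((-(β + m + 1) * σ ^ m * A σ + m * σ ^ (m - 1) * P σ) * ψ (t, t * σ) +
      σ ^ m * (F σ - σ * A σ) * (t * deriv (fun s => ψ (t, s)) (t * σ))) = 0 := by
  obtain ⟨B, T, R, hB, hT, hR, hbd, hz⟩ := hψ.exists_bounds
  have hK0 : 0 ≤ K := (abs_nonneg _).trans (hKA 1 one_pos)
  set N := (R + 1) / t with hN
  have hN0 : 0 < N := by positivity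
  have hout : ∀ σ, N ≤ σ → R < t * σ := fun σ hσ => by
    have := (div_le_iff₀ ht).1 hσ
    linarith
  set g : ℝ → ℝ := fun σ =>
    (-(β + m + 1) * σ ^ m * A σ + m * σ ^ (m - 1) * P σ) * ψ (t, t * σ) +
      σ ^ m * (F σ - σ * A σ) * (t * deriv (fun s => ψ (t, s)) (t * σ)) with hg
  have hcψ : ContinuousOn (fun σ => ψ (t, t * σ)) (Ici 0) :=
    hψ.1.continuousOn.comp (f := fun σ => (t, t * σ)) (by fun_prop)
      fun σ hσ => ⟨mem_univ _, mul_nonneg ht.le hσ⟩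
  have hc2 : ContinuousOn (fun σ => deriv (fun s => ψ (t, s)) (t * σ)) (Ioi 0) :=
    hψ.continuousOn_deriv_radius.comp (f := fun σ => (t, t * σ)) (by fun_prop)
      fun σ hσ => ⟨mem_univ _, mul_pos ht hσ⟩
  have hgc : ContinuousOn g (Ioi 0 ∩ {b}ᶜ) := by
    refine ((((continuousOn_const.mul (continuous_pow m).continuousOn).mul hA).add
      ((continuousOn_const.mul (continuous_pow (m - 1)).continuousOn).mul hP)).mul
      (hcψ.mono (inter_subset_left.trans Ioi_subset_Ici_self))).add
      ((hΦc.mono (inter_subset_left.trans Ioi_subset_Ici_self)).mul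
      (continuousOn_const.mul (hc2.mono inter_subset_left)))
  obtain ⟨L, hL⟩ := isCompact_Icc.exists_bound_of_continuousOn
    (hΦc.mono (fun σ hσ => hσ.1 : Icc 0 N ⊆ Ici 0))
  have hint : IntegrableOn g (Ioi 0) := by
    refine integrableOn_of_bounded (N := N)
      (C := (|-(β + m + 1)| * N ^ m * K + m * N ^ (m - 1) * K) * B + L * (t * B)) hgc ?_ ?_
    · intro σ hσ
      have hr := mul_pos ht hσ.1
      have h1 : ∀ k : ℕ, σ ^ k ≤ N ^ k := fun k => pow_le_pow_left₀ hσ.1.le hσ.2 k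
      have h2 : ∀ k : ℕ, 0 ≤ σ ^ k := fun k => pow_nonneg hσ.1.le k
      have hL0 := hL σ ⟨hσ.1.le, hσ.2⟩
      rw [Real.norm_eq_abs] at hL0
      have e1 : |-(β + m + 1) * σ ^ m * A σ| ≤ |-(β + m + 1)| * N ^ m * K := by
        rw [abs_mul, abs_mul, abs_of_nonneg (h2 m)]
        exact mul_le_mul (mul_le_mul_of_nonneg_left (h1 m) (abs_nonneg _)) (hKA σ hσ.1)
          (abs_nonneg _) (by positivity)
      have e2 : |m * σ ^ (m - 1) * P σ| ≤ m * N ^ (m - 1) * K := by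
        rw [abs_mul, abs_mul, abs_of_nonneg (h2 _), Nat.abs_cast]
        exact mul_le_mul (mul_le_mul_of_nonneg_left (h1 _) (Nat.cast_nonneg _)) (hKP σ hσ.1)
          (abs_nonneg _) (by positivity)
      refine (abs_add_le _ _).trans (add_le_add ?_ ?_)
      · rw [abs_mul]
        exact mul_le_mul ((abs_add_le _ _).trans (add_le_add e1 e2)) (hbd t _ hr).1
          (abs_nonneg _) (by positivity)
      · rw [abs_mul, abs_mul t, abs_of_pos ht]
        exact mul_le_mul hL0 (mul_le_mul_of_nonneg_left (hbd t _ hr).2.2 ht.le)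
          (by positivity) ((abs_nonneg _).trans hL0)
    · intro σ hσ h
      obtain ⟨h1, _, h3⟩ := hz t _ (mul_pos ht hσ) (Or.inr (hout σ h.le))
      simp only [hg, h1, h3, mul_zero, add_zero]
  refine ⟨hint, ?_⟩
  have hsplit : ∫ σ in Ioi (0 : ℝ), g σ = ∫ σ in (0 : ℝ)..N, g σ := by
    rw [intervalIntegral.integral_of_le hN0.le]
    refine (setIntegral_eq_of_subset_of_forall_sdiff_eq_zero measurableSet_Ioi
      Ioc_subset_Ioi_self fun σ hσ => ?_)
    have hσN : N < σ := by
      by_contra! h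
      exact hσ.2 ⟨hσ.1, h⟩
    obtain ⟨h1, _, h3⟩ := hz t _ (mul_pos ht hσ.1) (Or.inr (hout σ hσN.le))
    simp only [hg, h1, h3, mul_zero, add_zero]
  rw [hsplit]
  -- the flux is continuous at the break `b`, so the fundamental theorem of calculus applies
  have hftc := MeasureTheory.integral_eq_of_hasDerivAt_off_countable
    (f := fun σ => σ ^ m * (F σ - σ * A σ) * ψ (t, t * σ)) (f' := g) (a := 0) (b := N)
    (countable_singleton b)
    (by
      rw [uIcc_of_le hN0.le]
      exact (hΦc.mul hcψ).mono Icc_subset_Ici_self)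
    (fun σ hσ => by
      rw [min_eq_left hN0.le, max_eq_right hN0.le] at hσ
      have h1 : HasDerivAt (fun σ => ψ (t, t * σ))
          (t * deriv (fun s => ψ (t, s)) (t * σ)) σ := by
        have h := hψ.hasDerivAt_radius t (mul_pos ht hσ.1.1)
        have h2 : HasDerivAt (fun σ => t * σ) t σ := by
          simpa using (hasDerivAt_id σ).const_mul t
        rw [h.deriv, mul_comm]
        exact h.comp σ h2
      exact (hΦ σ ⟨hσ.1.1, hσ.2⟩).fun_mul h1)
    ((intervalIntegrable_iff_integrableOn_Ioc_of_le hN0.le).2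
      (hint.mono_set Ioc_subset_Ioi_self))
  rw [hftc, (hz t _ (mul_pos ht hN0) (Or.inr (hout N le_rfl))).1, zero_pow hm]
  ring

/-- The balance law for `τ^β (A, F, P)(r / τ)`, tested against `ψ`, at a time `t > 0`. -/
lemma hasDerivAt_integral_mul_test (hm : m ≠ 0) (hA : ContinuousOn A (Ioi 0 ∩ {b}ᶜ))
    (hP : ContinuousOn P (Ioi 0 ∩ {b}ᶜ)) (hKA : ∀ σ, 0 < σ → |A σ| ≤ K)
    (hKP : ∀ σ, 0 < σ → |P σ| ≤ K)
    (hΦc : ContinuousOn (fun σ => σ ^ m * (F σ - σ * A σ)) (Ici 0))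
    (hΦ : ∀ σ ∈ Ioi 0 ∩ {b}ᶜ, HasDerivAt (fun σ => σ ^ m * (F σ - σ * A σ))
      (-(β + m + 1) * σ ^ m * A σ + m * σ ^ (m - 1) * P σ) σ)
    (hψ : IsRadialTest ψ) {t : ℝ} (ht : 0 < t) :
    HasDerivAt (fun t => ∫ r in Ioi (0 : ℝ), t ^ β * A (r / t) * ψ (t, r) * r ^ m)
      (∫ r in Ioi (0 : ℝ), (t ^ β * A (r / t) * deriv (fun s => ψ (s, r)) t +
        t ^ β * F (r / t) * deriv (fun s => ψ (t, s)) r +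
        t ^ β * P (r / t) * (m * ψ (t, r) / r)) * r ^ m) t := by
  have hcv : ∀ t > 0, ∀ H : ℝ → ℝ, ∫ r in Ioi (0 : ℝ), H r = t * ∫ σ in Ioi (0 : ℝ), H (t * σ) := by
    intro t ht H
    rw [integral_comp_mul_left_Ioi _ _ ht, mul_zero, smul_eq_mul, mul_inv_cancel_left₀ ht.ne']
  set G : ℝ → ℝ := fun t => ∫ σ in Ioi (0 : ℝ), A σ * ψ (t, t * σ) * σ ^ m with hG
  have hI : ∀ t > 0, ∫ r in Ioi (0 : ℝ), t ^ β * A (r / t) * ψ (t, r) * r ^ m =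
      t ^ (β + m + 1) * G t := by
    intro t ht
    rw [hcv t ht, hG, ← integral_const_mul, ← integral_const_mul]
    refine setIntegral_congr_fun measurableSet_Ioi fun σ _ => ?_
    rw [mul_div_cancel_left₀ _ ht.ne', mul_pow, Real.rpow_add ht, Real.rpow_add ht, Real.rpow_one,
      Real.rpow_natCast]
    ring
  obtain ⟨he₁, he₂, hdG⟩ := hasDerivAt_integral_ray (m := m) hA hKA hψ ht
  have hd := ((Real.hasDerivAt_rpow_const (p := β + m + 1) (Or.inl ht.ne')).fun_mul
    hdG)
  refine (hd.congr_of_eventuallyEq ?_).congr_deriv ?_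
  · filter_upwards [Ioi_mem_nhds ht] with s hs using hI s hs
  obtain ⟨hint, hzero⟩ := integral_balance_eq_zero hm hA hP hKA hKP hΦc hΦ hψ ht
  rw [show β + m + 1 - 1 = β + m by ring]
  symm
  rw [hcv t ht, ← integral_const_mul]
  calc _ = ∫ σ in Ioi (0 : ℝ), (t ^ (β + m + 1) * (A σ * (deriv (fun s => ψ (s, t * σ)) t +
          σ * deriv (fun s => ψ (t, s)) (t * σ)) * σ ^ m) +
        t ^ (β + m) * (β + m + 1) * (A σ * ψ (t, t * σ) * σ ^ m) + t ^ (β + m) *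
        ((-(β + m + 1) * σ ^ m * A σ + m * σ ^ (m - 1) * P σ) * ψ (t, t * σ) +
          σ ^ m * (F σ - σ * A σ) * (t * deriv (fun s => ψ (t, s)) (t * σ)))) := by
        refine setIntegral_congr_fun measurableSet_Ioi fun σ hσ => ?_
        have hσ0 : σ ≠ 0 := (mem_Ioi.1 hσ).ne'
        obtain ⟨k, rfl⟩ := Nat.exists_eq_succ_of_ne_zero hm
        rw [mul_div_cancel_left₀ _ ht.ne', Real.rpow_add ht, Real.rpow_add ht, Real.rpow_one,
          Real.rpow_natCast, Nat.succ_eq_add_one, Nat.add_sub_cancel]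
        field_simp
        ring
    _ = _ := by
        rw [integral_add, integral_add, integral_const_mul, integral_const_mul,
          integral_const_mul, hzero]
        · ring
        · exact he₂.const_mul _
        · exact he₁.const_mul _
        · exact (he₂.const_mul _).add (he₁.const_mul _)
        · exact hint.const_mul _

end HalfLaw

/-! ### Homogeneous fields on the half plane -/

/-- The field on `ℝ × [0, ∞)`, homogeneous of degree `β`, with profile `X₁` for `t < 0`, `X₂` for
`t > 0`, both as functions of `r / |t|`, and `x₀ r^β` at `t = 0`. -/
noncomputable def homField (β : ℝ) (X₁ X₂ : ℝ → ℝ) (x₀ t r : ℝ) : ℝ :=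
  if t < 0 then |t| ^ β * X₁ (r / |t|) else if t = 0 then x₀ * r ^ β else t ^ β * X₂ (r / t)

section HomField

variable {β x₀ K : ℝ} {X₁ X₂ : ℝ → ℝ} {D₁ D₂ : Set ℝ}

lemma homField_of_neg {t : ℝ} (ht : t < 0) (r : ℝ) :
    homField β X₁ X₂ x₀ t r = |t| ^ β * X₁ (r / |t|) := if_pos ht

lemma homField_zero (r : ℝ) : homField β X₁ X₂ x₀ 0 r = x₀ * r ^ β := by
  simp [homField]

lemma homField_of_pos {t : ℝ} (ht : 0 < t) (r : ℝ) :
    homField β X₁ X₂ x₀ t r = t ^ β * X₂ (r / t) := by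
  rw [homField, if_neg ht.le.not_gt, if_neg ht.ne']

lemma homField_mul (Y₁ Y₂ : ℝ → ℝ) (y₀ t r : ℝ) :
    homField β X₁ X₂ x₀ t r * homField 0 Y₁ Y₂ y₀ t r =
      homField β (fun σ => X₁ σ * Y₁ σ) (fun σ => X₂ σ * Y₂ σ) (x₀ * y₀) t r := by
  unfold homField
  split_ifs
  · rw [Real.rpow_zero]
    ring
  · rw [Real.rpow_zero]
    ring
  · rw [Real.rpow_zero]
    ring

lemma const_mul_homField (c t r : ℝ) :
    c * homField β X₁ X₂ x₀ t r =
      homField β (fun σ => c * X₁ σ) (fun σ => c * X₂ σ) (c * x₀) t r := by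
  unfold homField
  split_ifs <;> ring

lemma continuousOn_homField (h₁ : ContinuousOn X₁ (Ici 0 ∩ D₁ᶜ))
    (h₂ : ContinuousOn X₂ (Ici 0 ∩ D₂ᶜ))
    (hl₁ : Tendsto (fun σ => X₁ σ / σ ^ β) atTop (𝓝 x₀))
    (hl₂ : Tendsto (fun σ => X₂ σ / σ ^ β) atTop (𝓝 x₀)) :
    ContinuousOn (fun z : ℝ × ℝ => homField β X₁ X₂ x₀ z.1 z.2)
      {z | 0 ≤ z.2 ∧ z ≠ (0, 0) ∧ (z.1 < 0 → z.2 / |z.1| ∉ D₁) ∧ (0 < z.1 → z.2 / z.1 ∉ D₂)} := by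
  rintro ⟨t, r⟩ ⟨hr, hne, hd₁, hd₂⟩
  rcases lt_trichotomy t 0 with ht | rfl | ht
  · have hcongr : ∀ᶠ z : ℝ × ℝ in 𝓝 (t, r), z.1 < 0 :=
      (continuous_fst.tendsto (t, r)).eventually (Iio_mem_nhds ht)
    refine ContinuousWithinAt.congr_of_eventuallyEq
      (f := fun z : ℝ × ℝ => |z.1| ^ β * X₁ (z.2 / |z.1|)) ?_
      ((hcongr.filter_mono nhdsWithin_le_nhds).mono fun z hz => homField_of_neg hz z.2)
      (homField_of_neg ht r)
    have ht' : |t| ≠ 0 := (abs_pos.2 ht.ne).ne'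
    refine ContinuousWithinAt.mul (ContinuousAt.continuousWithinAt
      ((continuous_fst.abs.continuousAt).rpow_const (Or.inl ht'))) ?_
    have hc := h₁ (r / |t|) ⟨div_nonneg hr (abs_nonneg _), hd₁ ht⟩
    have hq : ContinuousAt (fun z : ℝ × ℝ => z.2 / |z.1|) (t, r) :=
      continuousAt_snd.div continuous_fst.abs.continuousAt ht'
    refine Tendsto.comp (f := fun z : ℝ × ℝ => z.2 / |z.1|) hc (tendsto_nhdsWithin_iff.2
      ⟨hq.tendsto.mono_left nhdsWithin_le_nhds, ?_⟩)
    filter_upwards [self_mem_nhdsWithin, hcongr.filter_mono nhdsWithin_le_nhds] with z hz hz0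
    exact ⟨div_nonneg hz.1 (abs_nonneg _), hz.2.2.1 hz0⟩
  · have hr0 : 0 < r := lt_of_le_of_ne hr fun h => hne (by rw [← h])
    set k : ℝ × ℝ → ℝ := fun z => if z.1 < 0 then X₁ (z.2 / |z.1|) / (z.2 / |z.1|) ^ β
      else if z.1 = 0 then x₀ else X₂ (z.2 / z.1) / (z.2 / z.1) ^ β with hk
    have hdecomp : ∀ z : ℝ × ℝ, 0 < z.2 → homField β X₁ X₂ x₀ z.1 z.2 = z.2 ^ β * k z := by
      intro z hz
      simp only [hk, homField]
      split_ifs with h h'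
      · have h0 : 0 < |z.1| := abs_pos.2 h.ne
        have h1 := (Real.rpow_pos_of_pos h0 β).ne'
        have h2 := (Real.rpow_pos_of_pos hz β).ne'
        rw [Real.div_rpow hz.le h0.le]
        field_simp
      · ring
      · have h0 : 0 < z.1 := lt_of_le_of_ne (not_lt.1 h) (Ne.symm h')
        have h1 := (Real.rpow_pos_of_pos h0 β).ne'
        have h2 := (Real.rpow_pos_of_pos hz β).ne'
        rw [Real.div_rpow hz.le h0.le]
        field_simp
    have htop : Tendsto (fun z : ℝ × ℝ => z.2 / |z.1|) (𝓝[{z | z.1 ≠ 0}] (0, r)) atTop := by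
      simp only [div_eq_mul_inv]
      refine (continuous_snd.tendsto ((0 : ℝ), r)).mono_left nhdsWithin_le_nhds
        |>.pos_mul_atTop hr0 (tendsto_inv_nhdsGT_zero.comp (tendsto_nhdsWithin_iff.2 ⟨?_, ?_⟩))
      · have := (continuous_fst.abs.tendsto ((0 : ℝ), r)).mono_left
          (nhdsWithin_le_nhds (s := {z : ℝ × ℝ | z.1 ≠ 0}))
        simpa using this
      · filter_upwards [self_mem_nhdsWithin] with z hz using abs_pos.2 hz
    have hkt : Tendsto k (𝓝 (0, r)) (𝓝 x₀) := by
      intro s hs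
      have e₁ := (hl₁.comp htop).eventually hs
      have e₂ := (hl₂.comp htop).eventually hs
      rw [eventually_nhdsWithin_iff] at e₁ e₂
      rw [mem_map]
      filter_upwards [e₁, e₂] with z hz₁ hz₂
      simp only [mem_preimage, hk]
      split_ifs with h h'
      · exact hz₁ h.ne
      · exact mem_of_mem_nhds hs
      · have h0 : 0 < z.1 := lt_of_le_of_ne (not_lt.1 h) (Ne.symm h')
        have := hz₂ h'
        rwa [Function.comp_apply, abs_of_pos h0] at this
    have hp : Tendsto (fun z : ℝ × ℝ => z.2 ^ β) (𝓝 (0, r)) (𝓝 (r ^ β)) :=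
      ((continuousAt_snd (p := ((0 : ℝ), r))).rpow_const (Or.inl hr0.ne')).tendsto
    have hmul := hp.mul hkt
    refine ContinuousAt.continuousWithinAt ?_
    change Tendsto _ _ (𝓝 (homField β X₁ X₂ x₀ 0 r))
    rw [homField_zero, mul_comm x₀]
    refine hmul.congr' ?_
    filter_upwards [(continuous_snd.tendsto ((0 : ℝ), r)).eventually (Ioi_mem_nhds hr0)] with z hz
    exact (hdecomp z hz).symm
  · have hcongr : ∀ᶠ z : ℝ × ℝ in 𝓝 (t, r), 0 < z.1 :=
      (continuous_fst.tendsto (t, r)).eventually (Ioi_mem_nhds ht)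
    refine ContinuousWithinAt.congr_of_eventuallyEq
      (f := fun z : ℝ × ℝ => z.1 ^ β * X₂ (z.2 / z.1)) ?_
      ((hcongr.filter_mono nhdsWithin_le_nhds).mono fun z hz => homField_of_pos hz z.2)
      (homField_of_pos ht r)
    refine ContinuousWithinAt.mul (ContinuousAt.continuousWithinAt
      (continuousAt_fst.rpow_const (Or.inl ht.ne'))) ?_
    have hc := h₂ (r / t) ⟨div_nonneg hr ht.le, hd₂ ht⟩
    have hq : ContinuousAt (fun z : ℝ × ℝ => z.2 / z.1) (t, r) :=
      continuousAt_snd.div continuousAt_fst ht.ne'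
    refine Tendsto.comp (f := fun z : ℝ × ℝ => z.2 / z.1) hc (tendsto_nhdsWithin_iff.2
      ⟨hq.tendsto.mono_left nhdsWithin_le_nhds, ?_⟩)
    filter_upwards [self_mem_nhdsWithin, hcongr.filter_mono nhdsWithin_le_nhds] with z hz hz0
    exact ⟨div_nonneg hz.1 hz0.le, hz.2.2.2 hz0⟩

/-- With profiles that are continuous except at one point each, the field is continuous off two
rays. The truncations `max (-t) 0` and `max t 0` restrict each ray to its own half plane. -/
lemma continuousAt_homField {b₁ b₂ : ℝ} (h₁ : ContinuousOn X₁ (Ici 0 ∩ {b₁}ᶜ))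
    (h₂ : ContinuousOn X₂ (Ici 0 ∩ {b₂}ᶜ))
    (hl₁ : Tendsto (fun σ => X₁ σ / σ ^ β) atTop (𝓝 x₀))
    (hl₂ : Tendsto (fun σ => X₂ σ / σ ^ β) atTop (𝓝 x₀)) {t r : ℝ} (hr : 0 < r)
    (hd₁ : r ≠ b₁ * max (-t) 0) (hd₂ : r ≠ b₂ * max t 0) :
    ContinuousAt (fun z : ℝ × ℝ => homField β X₁ X₂ x₀ z.1 z.2) (t, r) := by
  refine (continuousOn_homField h₁ h₂ hl₁ hl₂).continuousAt ?_
  have e₁ : ∀ᶠ z : ℝ × ℝ in 𝓝 (t, r), 0 < z.2 :=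
    (continuous_snd.tendsto (t, r)).eventually (Ioi_mem_nhds hr)
  have e₂ : ∀ᶠ z : ℝ × ℝ in 𝓝 (t, r), z.2 ≠ b₁ * max (-z.1) 0 :=
    (isOpen_ne_fun (f := fun z : ℝ × ℝ => z.2) (g := fun z => b₁ * max (-z.1) 0)
      (by fun_prop) (by fun_prop)).mem_nhds hd₁
  have e₃ : ∀ᶠ z : ℝ × ℝ in 𝓝 (t, r), z.2 ≠ b₂ * max z.1 0 :=
    (isOpen_ne_fun (f := fun z : ℝ × ℝ => z.2) (g := fun z => b₂ * max (z.1) 0)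
      (by fun_prop) (by fun_prop)).mem_nhds hd₂
  filter_upwards [e₁, e₂, e₃] with z hz₁ hz₂ hz₃
  refine ⟨hz₁.le, fun h => ?_, fun h hb => hz₂ ?_, fun h hb => hz₃ ?_⟩
  · rw [h] at hz₁
    exact lt_irrefl _ hz₁
  · rw [mem_singleton_iff, div_eq_iff (abs_pos.2 h.ne).ne', abs_of_neg h] at hb
    rw [max_eq_left (by linarith), hb]
  · rw [mem_singleton_iff, div_eq_iff h.ne'] at hb
    rw [max_eq_left h.le, hb]

lemma ae_continuousAt_homField {b₁ b₂ : ℝ} (h₁ : ContinuousOn X₁ (Ici 0 ∩ {b₁}ᶜ))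
    (h₂ : ContinuousOn X₂ (Ici 0 ∩ {b₂}ᶜ))
    (hl₁ : Tendsto (fun σ => X₁ σ / σ ^ β) atTop (𝓝 x₀))
    (hl₂ : Tendsto (fun σ => X₂ σ / σ ^ β) atTop (𝓝 x₀)) (t : ℝ) :
    ∀ᵐ r ∂(volume.restrict (Ioi (0 : ℝ))),
      ContinuousAt (fun t => homField β X₁ X₂ x₀ t r) t := by
  filter_upwards [ae_restrict_mem measurableSet_Ioi, ae_ne_restrict_Ioi (b₁ * max (-t) 0),
    ae_ne_restrict_Ioi (b₂ * max t 0)] with r hr hr₁ hr₂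
  exact ContinuousAt.comp (f := fun t => (t, r))
    (continuousAt_homField h₁ h₂ hl₁ hl₂ hr hr₁ hr₂) (by fun_prop)

lemma abs_homField_le (hβ : β ≤ 0) (hK : 0 ≤ K) (h₁ : ∀ σ, 0 ≤ σ → |X₁ σ| ≤ K * (1 + σ) ^ β)
    (h₂ : ∀ σ, 0 ≤ σ → |X₂ σ| ≤ K * (1 + σ) ^ β) (hx : |x₀| ≤ K) (t : ℝ) {r : ℝ} (hr : 0 < r) :
    |homField β X₁ X₂ x₀ t r| ≤ K * r ^ β := by
  have key : ∀ {X : ℝ → ℝ}, (∀ σ, 0 ≤ σ → |X σ| ≤ K * (1 + σ) ^ β) → ∀ τ : ℝ, 0 < τ →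
      |τ ^ β * X (r / τ)| ≤ K * r ^ β := by
    intro X hX τ hτ
    have hq : 0 < r / τ := div_pos hr hτ
    have hp := Real.rpow_pos_of_pos hτ β
    rw [abs_mul, abs_of_pos hp]
    calc _ ≤ τ ^ β * (K * (1 + r / τ) ^ β) := mul_le_mul_of_nonneg_left (hX _ hq.le) hp.le
      _ ≤ τ ^ β * (K * (r / τ) ^ β) := by
          refine mul_le_mul_of_nonneg_left (mul_le_mul_of_nonneg_left ?_ hK) hp.le
          exact Real.rpow_le_rpow_of_nonpos hq (by linarith) hβ
      _ = K * r ^ β := by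
          rw [Real.div_rpow hr.le hτ.le]
          field_simp
  unfold homField
  split_ifs with h h'
  · exact key h₁ _ (abs_pos.2 h.ne)
  · rw [abs_mul, abs_of_pos (Real.rpow_pos_of_pos hr β)]
    exact mul_le_mul_of_nonneg_right hx (Real.rpow_pos_of_pos hr β).le
  · exact key h₂ _ (lt_of_le_of_ne (not_lt.1 h) (Ne.symm h'))

lemma measurable_comp_max {X : ℝ → ℝ} {b : ℝ} (hb : 0 < b) (hX : ContinuousOn X (Ici 0 ∩ {b}ᶜ)) :
    Measurable fun σ => X (max σ 0) := by
  refine measurable_of_continuousOn_compl_singleton b ?_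
  refine hX.comp (f := fun σ => max σ 0) (by fun_prop) fun σ hσ => ⟨mem_Ici.2 (le_max_right σ 0), fun h => ?_⟩
  have h1 : max σ 0 = b := h
  rcases max_choice σ 0 with h' | h'
  · exact hσ (h'.symm.trans h1)
  · exact hb.ne (h'.symm.trans h1)

lemma measurable_homField {b₁ b₂ : ℝ} (hb₁ : 0 < b₁) (hb₂ : 0 < b₂)
    (h₁ : ContinuousOn X₁ (Ici 0 ∩ {b₁}ᶜ)) (h₂ : ContinuousOn X₂ (Ici 0 ∩ {b₂}ᶜ)) :
    Measurable fun z : ℝ × ℝ => homField β X₁ X₂ x₀ z.1 (max z.2 0) := by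
  have m₁ := measurable_comp_max hb₁ h₁
  have m₂ := measurable_comp_max hb₂ h₂
  have e : (fun z : ℝ × ℝ => homField β X₁ X₂ x₀ z.1 (max z.2 0)) = fun z : ℝ × ℝ =>
      if z.1 < 0 then |z.1| ^ β * X₁ (max (max z.2 0 / |z.1|) 0)
      else if z.1 = 0 then x₀ * (max z.2 0) ^ β else z.1 ^ β * X₂ (max (max z.2 0 / z.1) 0) := by
    funext z
    unfold homField
    split_ifs with h h'
    · rw [max_eq_left (div_nonneg (le_max_right _ _) (abs_nonneg z.1))]
    · rfl
    · rw [max_eq_left (div_nonneg (le_max_right z.2 0) (not_lt.1 h))]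
  rw [e]
  refine Measurable.ite (measurableSet_lt measurable_fst measurable_const) ?_
    (Measurable.ite (measurableSet_eq_fun measurable_fst measurable_const) ?_ ?_)
  · exact (by fun_prop : Measurable fun z : ℝ × ℝ => |z.1| ^ β).mul
      (m₁.comp (by fun_prop : Measurable fun z : ℝ × ℝ => max z.2 0 / |z.1|))
  · fun_prop
  · exact (by fun_prop : Measurable fun z : ℝ × ℝ => z.1 ^ β).mul
      (m₂.comp (by fun_prop : Measurable fun z : ℝ × ℝ => max z.2 0 / z.1))

end HomField

/-! ### Dominated fields and the radial measure -/

/-- Dominated convergence on compact sets. -/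
lemma continuousInL1loc_of_dominated {X F : Type*} [TopologicalSpace X] [MeasurableSpace X]
    [OpensMeasurableSpace X] [T2Space X] [LocallyCompactSpace X]
    [NormedAddCommGroup F] {μ : Measure X} {f : ℝ → X → F} {w : X → ℝ}
    (hw : LocallyIntegrable w μ) (hm : ∀ t, AEStronglyMeasurable (f t) μ)
    (hb : ∀ t, ∀ᵐ x ∂μ, ‖f t x‖ ≤ w x)
    (hc : ∀ t₀, ∀ᵐ x ∂μ, ContinuousAt (fun t => f t x) t₀) : ContinuousInL1loc μ f := by
  have hloc : ∀ t, LocallyIntegrable (f t) μ := fun t =>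
    hw.mono (hm t) ((hb t).mono fun x hx => hx.trans (le_abs_self _))
  refine ⟨hloc, fun K hK t₀ => ?_⟩
  have hwK : IntegrableOn w K μ := hw.integrableOn_isCompact hK
  have h := tendsto_integral_filter_of_dominated_convergence (μ := μ.restrict K) (l := 𝓝 t₀)
    (F := fun t x => ‖f t x - f t₀ x‖) (f := fun _ => 0) (fun x => w x + w x)
    (Eventually.of_forall fun t => ((hm t).sub (hm t₀)).norm.restrict)
    (Eventually.of_forall fun t => ?_) (hwK.add hwK) ?_
  · simpa using h
  · filter_upwards [ae_restrict_of_ae (hb t), ae_restrict_of_ae (hb t₀)] with x h1 h2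
    rw [norm_norm]
    exact (norm_sub_le _ _).trans (add_le_add h1 h2)
  · filter_upwards [ae_restrict_of_ae (hc t₀)] with x hx
    have : Tendsto (fun t => f t x - f t₀ x) (𝓝 t₀) (𝓝 0) := by
      simpa using hx.tendsto.sub_const (f t₀ x)
    simpa using this.norm

section RadialMeasure

variable {m : ℕ} {β : ℝ}

instance : SFinite (radialMeasure m) := by
  unfold radialMeasure
  infer_instance

lemma radialMeasure_absolutelyContinuous : radialMeasure m ≪ volume.restrict (Ioi 0) :=
  withDensity_absolutelyContinuous _ _

lemma ae_radialMeasure_of_ae {p : ℝ → Prop} (h : ∀ᵐ r ∂(volume.restrict (Ioi (0 : ℝ))), p r) :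
    ∀ᵐ r ∂(radialMeasure m), p r := radialMeasure_absolutelyContinuous.ae_le h

lemma integrableOn_rpow_mul_pow (hβ : -((m : ℝ) + 1) < β) (N : ℝ) :
    IntegrableOn (fun r : ℝ => r ^ β * r ^ m) (Ioc 0 N) := by
  have h : IntervalIntegrable (fun r : ℝ => r ^ (β + m)) volume 0 N :=
    intervalIntegral.intervalIntegrable_rpow' (by linarith)
  rcases le_total 0 N with hN | hN
  · rw [intervalIntegrable_iff_integrableOn_Ioc_of_le hN] at h
    refine h.congr_fun (fun r hr => ?_) measurableSet_Ioc
    beta_reduce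
    rw [Real.rpow_add hr.1, Real.rpow_natCast]
  · rw [Ioc_eq_empty (by simpa using hN)]
    exact integrableOn_empty

lemma locallyIntegrable_rpow_radialMeasure (hβ : -((m : ℝ) + 1) < β) :
    LocallyIntegrable (fun r : ℝ => r ^ β) (radialMeasure m) := by
  rw [locallyIntegrable_iff]
  intro k hk
  obtain ⟨N, hN⟩ := hk.isBounded.subset_closedBall 0
  have hsub : k ⊆ Iic N := fun x hx => by
    have := hN hx
    rw [mem_closedBall_zero_iff, Real.norm_eq_abs] at this
    exact (le_abs_self x).trans this
  refine IntegrableOn.mono_set ?_ hsub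
  have hmeas : Measurable fun r : ℝ => (Real.toNNReal (r ^ m)) := by fun_prop
  have e : radialMeasure m =
      (volume.restrict (Ioi 0)).withDensity (fun r => ((Real.toNNReal (r ^ m) : NNReal) : ENNReal)) :=
    rfl
  rw [IntegrableOn, e, restrict_withDensity measurableSet_Iic,
    integrable_withDensity_iff_integrable_smul hmeas, Measure.restrict_restrict measurableSet_Iic,
    inter_comm, Ioi_inter_Iic]
  refine (integrableOn_rpow_mul_pow hβ N).congr_fun (fun r hr => ?_) measurableSet_Ioc
  rw [NNReal.smul_def, Real.coe_toNNReal _ (pow_nonneg hr.1.le m), smul_eq_mul, mul_comm]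

lemma LocallyIntegrable.comp_snd_volume {X : Type*} [TopologicalSpace X] [MeasurableSpace X]
    [OpensMeasurableSpace X] [T2Space X] [LocallyCompactSpace X] {μ : Measure X} [SFinite μ]
    {w : X → ℝ} (hw : LocallyIntegrable w μ) :
    LocallyIntegrable (fun z : ℝ × X => w z.2) (volume.prod μ) := by
  intro z
  obtain ⟨k, hk, hkz⟩ := exists_compact_mem_nhds z.2
  refine ⟨Icc (z.1 - 1) (z.1 + 1) ×ˢ k,
    prod_mem_nhds (Icc_mem_nhds (by linarith) (by linarith)) hkz, ?_⟩
  rw [IntegrableOn, ← Measure.prod_restrict]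
  exact (hw.integrableOn_isCompact hk).comp_snd _

lemma locallyIntegrable_of_abs_le {X : Type*} [TopologicalSpace X] [MeasurableSpace X]
    [OpensMeasurableSpace X] [T2Space X] [LocallyCompactSpace X] {μ : Measure X} [SFinite μ]
    {w : X → ℝ} {f : ℝ × X → ℝ} (hw : LocallyIntegrable w μ)
    (hf : AEStronglyMeasurable f (volume.prod μ)) (h : ∀ᵐ z ∂(volume.prod μ), |f z| ≤ w z.2) :
    LocallyIntegrable f (volume.prod μ) :=
  (LocallyIntegrable.comp_snd_volume hw).mono hf (h.mono fun _ hz => hz.trans (le_abs_self _))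

end RadialMeasure

/-! ### The balance laws across `t = 0` -/

/-- The field `τ^β A(r / τ)` satisfies the radial balance law with flux `τ^β F(r / τ)` and source
coefficient `τ^β P(r / τ)`, across the break point `b`. -/
structure SimilarityLaw (m : ℕ) (β : ℝ) (A F P : ℝ → ℝ) (b : ℝ) : Prop where
  break_pos : 0 < b
  continuousOn_field : ContinuousOn A (Ici 0 ∩ {b}ᶜ)
  continuousOn_source : ContinuousOn P (Ici 0 ∩ {b}ᶜ)
  continuousOn_flux : ContinuousOn (fun σ => σ ^ m * (F σ - σ * A σ)) (Ici 0)
  hasDerivAt_flux : ∀ σ ∈ Ioi 0 ∩ {b}ᶜ, HasDerivAt (fun σ => σ ^ m * (F σ - σ * A σ))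
    (-(β + m + 1) * σ ^ m * A σ + m * σ ^ (m - 1) * P σ) σ
  bound : ∃ K, 0 ≤ K ∧ ∀ σ, 0 ≤ σ →
    |A σ| ≤ K * (1 + σ) ^ β ∧ |F σ| ≤ K * (1 + σ) ^ β ∧ |P σ| ≤ K * (1 + σ) ^ β

section Laws

variable {a b β κ v : ℝ} {m : ℕ} {A F P V : ℝ → ℝ}

lemma SimilarityLaw.neg (h : SimilarityLaw m β A F P b) :
    SimilarityLaw m β (fun σ => -A σ) (fun σ => -F σ) (fun σ => -P σ) b := by
  have e : (fun σ => σ ^ m * (-F σ - σ * -A σ)) = fun σ => -(σ ^ m * (F σ - σ * A σ)) := by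
    funext σ
    ring
  refine ⟨h.break_pos, h.continuousOn_field.neg, h.continuousOn_source.neg, ?_, fun σ hσ => ?_, ?_⟩
  · rw [e]
    exact h.continuousOn_flux.neg
  · rw [e]
    exact (h.hasDerivAt_flux σ hσ).fun_neg.congr_deriv (by ring)
  · simpa only [abs_neg] using h.bound

lemma SimilarityFlow.hasDerivAt_velocity (h : SimilarityFlow a m β V A b κ v) {σ : ℝ}
    (hσ : σ ∈ Ioi 0 ∩ {b}ᶜ) : HasDerivAt V (deriv V σ) σ :=
  (h.solvesU σ hσ).2.differentiableAt.hasDerivAt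

/-- The similarity equation for the velocity without denominators. -/
lemma SimilarityFlow.deriv_velocity_mul (ha : 0 < a) (h : SimilarityFlow a m β V A b κ v) {σ : ℝ}
    (hσ : σ ∈ Ioi 0 ∩ {b}ᶜ) :
    deriv V σ * ((V σ - σ) ^ 2 - a ^ 2) * σ = a ^ 2 * (β * σ + m * V σ) := by
  obtain ⟨h1, h2⟩ := h.solvesU σ hσ
  have hσ0 : σ ≠ 0 := (mem_Ioi.1 hσ.1).ne'
  have h3 := sub_ne_zero.2 h1
  rw [h2.deriv]
  field_simp

lemma continuousOn_Ici_of_break {f : ℝ → ℝ} (hf : ContinuousOn f (Ici 0 ∩ {b}ᶜ))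
    (hb : ContinuousAt f b) : ContinuousOn f (Ici 0) := by
  intro σ hσ
  rcases eq_or_ne σ b with rfl | hne
  · exact hb.continuousWithinAt
  · refine (hf σ ⟨hσ, hne⟩).mono_of_mem_nhdsWithin ?_
    exact inter_mem self_mem_nhdsWithin
      (nhdsWithin_le_nhds (isOpen_compl_singleton.mem_nhds hne))

lemma SimilarityFlow.exists_bounds (h : SimilarityFlow a m β V A b κ v) :
    ∃ K M : ℝ, 0 ≤ K ∧ 0 ≤ M ∧ ∀ σ, 0 ≤ σ → |A σ| ≤ K * (1 + σ) ^ β ∧ |V σ| ≤ M := by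
  obtain ⟨c, K, hc, hK⟩ := h.density_bound
  obtain ⟨M, hM⟩ := h.velocity_bound
  have hp : ∀ σ : ℝ, 0 ≤ σ → 0 < (1 + σ) ^ β := fun σ hσ => Real.rpow_pos_of_pos (by linarith) _
  have hA0 : ∀ σ, 0 ≤ σ → 0 < A σ := fun σ hσ => (mul_pos hc (hp σ hσ)).trans_le (hK σ hσ).1
  refine ⟨K, M, ?_, (abs_nonneg _).trans (hM 0 le_rfl), fun σ hσ => ⟨?_, hM σ hσ⟩⟩
  · by_contra! hneg
    exact absurd ((hA0 0 le_rfl).trans_le (hK 0 le_rfl).2)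
      (mul_neg_of_neg_of_pos hneg (hp 0 le_rfl)).not_gt
  · rw [abs_of_pos (hA0 σ hσ)]
    exact (hK σ hσ).2

/-- The equations for `U` and `Ω` amount to conservation of mass in the variable `σ = r / t`. -/
lemma SimilarityFlow.mass_law (ha : 0 < a) (hm : m ≠ 0) (h : SimilarityFlow a m β V A b κ v) :
    SimilarityLaw m β A (fun σ => A σ * V σ) (fun _ => 0) b := by
  have e : (fun σ => σ ^ m * (A σ * V σ - σ * A σ)) = fun σ => σ ^ m * ((V σ - σ) * A σ) := by
    funext σ
    ring
  refine ⟨h.break_pos, h.density_continuousOn, continuousOn_const, ?_, fun σ hσ => ?_, ?_⟩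
  · rw [e]
    refine (continuous_pow m).continuousOn.mul (continuousOn_Ici_of_break ?_ h.mass_flux)
    exact (h.velocity_continuousOn.sub continuousOn_id).mul h.density_continuousOn
  · rw [e]
    have hσ0 : σ ≠ 0 := (mem_Ioi.1 hσ.1).ne'
    have hV := h.hasDerivAt_velocity hσ
    have hrel := h.deriv_velocity_mul ha hσ
    have hrel' : deriv V σ * (V σ - σ) ^ 2 =
        a ^ 2 * deriv V σ + a ^ 2 * (β + m * V σ / σ) := by
      field_simp
      linear_combination hrel
    refine ((hasDerivAt_pow m σ).fun_mul ((hV.fun_sub (hasDerivAt_id' σ)).fun_mul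
      (h.solvesOmega σ hσ))).congr_deriv ?_
    obtain ⟨k, rfl⟩ := Nat.exists_eq_succ_of_ne_zero hm
    rw [show (V σ - σ) * (-(1 / a ^ 2) * (V σ - σ) * deriv V σ * A σ) =
      -(1 / a ^ 2) * (deriv V σ * (V σ - σ) ^ 2) * A σ by ring, hrel']
    simp only [Nat.succ_eq_add_one, Nat.add_sub_cancel]
    field_simp
    ring
  · obtain ⟨K, M, hK, hM, hb⟩ := h.exists_bounds
    refine ⟨K * (1 + M), by positivity, fun σ hσ => ?_⟩
    obtain ⟨h1, h2⟩ := hb σ hσ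
    have hp : 0 < (1 + σ) ^ β := Real.rpow_pos_of_pos (by linarith) _
    have hKp : 0 ≤ K * (1 + σ) ^ β := by positivity
    refine ⟨h1.trans ?_, ?_, ?_⟩
    · nlinarith [mul_nonneg hKp hM]
    · rw [abs_mul]
      nlinarith [mul_le_mul h1 h2 (abs_nonneg _) hKp]
    · rw [abs_zero]
      positivity

/-- Conservation of momentum; the pressure is part of the flux and, through the geometric term
`m r^(m-1) p`, of the source. -/
lemma SimilarityFlow.momentum_law (ha : 0 < a) (hm : m ≠ 0)
    (h : SimilarityFlow a m β V A b κ v) :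
    SimilarityLaw m β (fun σ => A σ * V σ) (fun σ => A σ * V σ ^ 2 + a ^ 2 * A σ)
      (fun σ => a ^ 2 * A σ) b := by
  have e : (fun σ => σ ^ m * (A σ * V σ ^ 2 + a ^ 2 * A σ - σ * (A σ * V σ))) =
      fun σ => σ ^ m * ((V σ - σ) * A σ * V σ + a ^ 2 * A σ) := by
    funext σ
    ring
  refine ⟨h.break_pos, h.density_continuousOn.mul h.velocity_continuousOn,
    continuousOn_const.mul h.density_continuousOn, ?_, fun σ hσ => ?_, ?_⟩
  · rw [e]
    refine (continuous_pow m).continuousOn.mul (continuousOn_Ici_of_break ?_ h.momentum_flux)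
    exact (((h.velocity_continuousOn.sub continuousOn_id).mul h.density_continuousOn).mul
      h.velocity_continuousOn).add (continuousOn_const.mul h.density_continuousOn)
  · rw [e]
    have hσ0 : σ ≠ 0 := (mem_Ioi.1 hσ.1).ne'
    have hV := h.hasDerivAt_velocity hσ
    have hA := h.solvesOmega σ hσ
    have hrel := h.deriv_velocity_mul ha hσ
    have hrel' : deriv V σ * (V σ - σ) ^ 2 =
        a ^ 2 * deriv V σ + a ^ 2 * (β + m * V σ / σ) := by
      field_simp
      linear_combination hrel
    refine ((hasDerivAt_pow m σ).fun_mul ((((hV.fun_sub (hasDerivAt_id' σ)).fun_mul hA).fun_mul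
      hV).fun_add (hA.const_mul (a ^ 2)))).congr_deriv ?_
    obtain ⟨k, rfl⟩ := Nat.exists_eq_succ_of_ne_zero hm
    rw [show (V σ - σ) * (-(1 / a ^ 2) * (V σ - σ) * deriv V σ * A σ) =
      -(1 / a ^ 2) * (deriv V σ * (V σ - σ) ^ 2) * A σ by ring, hrel']
    simp only [Nat.succ_eq_add_one, Nat.add_sub_cancel]
    field_simp
    ring
  · obtain ⟨K, M, hK, hM, hb⟩ := h.exists_bounds
    refine ⟨K * (M + M ^ 2 + a ^ 2), by positivity, fun σ hσ => ?_⟩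
    obtain ⟨h1, h2⟩ := hb σ hσ
    have hp : 0 < (1 + σ) ^ β := Real.rpow_pos_of_pos (by linarith) _
    have hKp : 0 ≤ K * (1 + σ) ^ β := by positivity
    have ha2 : 0 ≤ K * (1 + σ) ^ β * a ^ 2 := by positivity
    have hM1 : 0 ≤ K * (1 + σ) ^ β * M := by positivity
    have hM2 : 0 ≤ K * (1 + σ) ^ β * M ^ 2 := by positivity
    have e1 : |A σ * V σ| ≤ K * (1 + σ) ^ β * M := by
      rw [abs_mul]
      exact mul_le_mul h1 h2 (abs_nonneg _) hKp
    have e2 : |A σ * V σ ^ 2| ≤ K * (1 + σ) ^ β * M ^ 2 := by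
      rw [abs_mul, abs_pow]
      exact mul_le_mul h1 (pow_le_pow_left₀ (abs_nonneg _) h2 2) (by positivity) hKp
    have e3 : |a ^ 2 * A σ| ≤ K * (1 + σ) ^ β * a ^ 2 := by
      rw [abs_mul, abs_of_pos (by positivity : 0 < a ^ 2), mul_comm]
      exact mul_le_mul_of_nonneg_right h1 (by positivity)
    refine ⟨?_, ?_, ?_⟩
    · linarith
    · linarith [abs_add_le (A σ * V σ ^ 2) (a ^ 2 * A σ)]
    · linarith

end Laws

section Integrated

variable {β α₀ f₀ p₀ b₁ b₂ : ℝ} {m : ℕ} {A₁ F₁ P₁ A₂ F₂ P₂ : ℝ → ℝ} {ψ : ℝ × ℝ → ℝ}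

/-- A field which obeys the balance law for `t < 0` and for `t > 0` obeys it on the whole plane,
since it is continuous in time at `t = 0` as a function with values in `L¹_loc`. -/
lemma integral_balance (hm : m ≠ 0) (hβ : -(m : ℝ) < β) (hβ' : β < 0)
    (h₁ : SimilarityLaw m β A₁ F₁ P₁ b₁) (h₂ : SimilarityLaw m β A₂ F₂ P₂ b₂)
    (hl₁ : Tendsto (fun σ => A₁ σ / σ ^ β) atTop (𝓝 α₀))
    (hl₂ : Tendsto (fun σ => A₂ σ / σ ^ β) atTop (𝓝 α₀)) (hψ : IsRadialTest ψ) :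
    ∫ t : ℝ, ∫ r in Ioi (0 : ℝ), (homField β A₁ A₂ α₀ t r * deriv (fun s => ψ (s, r)) t +
      homField β (fun σ => -F₁ σ) F₂ f₀ t r * deriv (fun s => ψ (t, s)) r +
      homField β (fun σ => -P₁ σ) P₂ p₀ t r * (m * ψ (t, r) / r)) * r ^ m = 0 := by
  obtain ⟨B, T, R, hB, hT, hR, hbd, hz⟩ := hψ.exists_bounds
  obtain ⟨K₁, hK₁, hb₁⟩ := h₁.bound
  obtain ⟨K₂, hK₂, hb₂⟩ := h₂.bound
  set E : ℝ → ℝ := fun t => ∫ r in Ioi (0 : ℝ),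
    (homField β A₁ A₂ α₀ t r * deriv (fun s => ψ (s, r)) t +
      homField β (fun σ => -F₁ σ) F₂ f₀ t r * deriv (fun s => ψ (t, s)) r +
      homField β (fun σ => -P₁ σ) P₂ p₀ t r * (m * ψ (t, r) / r)) * r ^ m with hE
  set J : ℝ → ℝ := fun t => ∫ r in Ioi (0 : ℝ), homField β A₁ A₂ α₀ t r * ψ (t, r) * r ^ m with hJ
  -- the balance law on one half, for a positive time variable
  have half : ∀ {A F P : ℝ → ℝ} {b : ℝ}, SimilarityLaw m β A F P b → ∀ {χ : ℝ × ℝ → ℝ},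
      IsRadialTest χ → ∀ {t : ℝ}, 0 < t →
      HasDerivAt (fun t => ∫ r in Ioi (0 : ℝ), t ^ β * A (r / t) * χ (t, r) * r ^ m)
        (∫ r in Ioi (0 : ℝ), (t ^ β * A (r / t) * deriv (fun s => χ (s, r)) t +
          t ^ β * F (r / t) * deriv (fun s => χ (t, s)) r +
          t ^ β * P (r / t) * (m * χ (t, r) / r)) * r ^ m) t := by
    intro A F P b h χ hχ t ht
    obtain ⟨K, hK, hb⟩ := h.bound
    have hle : ∀ σ, 0 < σ → K * (1 + σ) ^ β ≤ K := fun σ hσ =>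
      mul_le_of_le_one_right hK (Real.rpow_le_one_of_one_le_of_nonpos (by linarith) hβ'.le)
    have hsub : Ioi (0 : ℝ) ∩ {b}ᶜ ⊆ Ici 0 ∩ {b}ᶜ := inter_subset_inter_left _ Ioi_subset_Ici_self
    exact hasDerivAt_integral_mul_test hm (h.continuousOn_field.mono hsub)
      (h.continuousOn_source.mono hsub) (fun σ hσ => (hb σ hσ.le).1.trans (hle σ hσ))
      (fun σ hσ => (hb σ hσ.le).2.2.trans (hle σ hσ)) h.continuousOn_flux h.hasDerivAt_flux hχ ht
  have hJpos : ∀ t > 0, HasDerivAt J (E t) t := by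
    intro t ht
    refine ((half h₂ hψ ht).congr_of_eventuallyEq ?_).congr_deriv ?_
    · filter_upwards [Ioi_mem_nhds ht] with s hs
      simp only [hJ, homField_of_pos (mem_Ioi.1 hs)]
    · simp only [hE, homField_of_pos ht]
  have hJneg : ∀ t < 0, HasDerivAt J (E t) t := by
    intro t ht
    have ht' : 0 < -t := by linarith
    have h := (half h₁ hψ.reverse ht').comp t (hasDerivAt_neg t)
    refine (h.congr_of_eventuallyEq ?_).congr_deriv ?_
    · filter_upwards [Iio_mem_nhds ht] with s hs
      simp only [hJ, homField_of_neg (mem_Iio.1 hs), Function.comp_apply, neg_neg,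
        abs_of_neg (mem_Iio.1 hs)]
    · simp only [hE, homField_of_neg ht, abs_of_neg ht, deriv_time_reverse, neg_neg]
      rw [mul_neg_one, ← integral_neg]
      refine setIntegral_congr_fun measurableSet_Ioi fun r _ => ?_
      ring
  have hmeas : ∀ t, AEStronglyMeasurable (fun r => homField β A₁ A₂ α₀ t r * ψ (t, r) * r ^ m)
      (volume.restrict (Ioi 0)) := by
    intro t
    have e := ((measurable_homField (β := β) (x₀ := α₀) h₁.break_pos h₂.break_pos
      h₁.continuousOn_field h₂.continuousOn_field).comp (measurable_prodMk_left (x := t)))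
    refine AEStronglyMeasurable.mul (AEStronglyMeasurable.mul ?_ ?_)
      (continuous_pow m).aestronglyMeasurable
    · refine e.aestronglyMeasurable.congr ?_
      filter_upwards [ae_restrict_mem measurableSet_Ioi] with r hr
      simp only [Function.comp_apply, max_eq_left (mem_Ioi.1 hr).le]
    · refine ContinuousOn.aestronglyMeasurable ?_ measurableSet_Ioi
      exact hψ.contDiffOn.continuousOn.comp (f := fun r => (t, r)) (by fun_prop)
        fun r hr => ⟨mem_univ _, hr⟩
  -- the three fields are of size `O(r^β)`, uniformly in time
  have hlim_le : |α₀| ≤ max K₁ K₂ := by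
    have h := tendsto_one_add_div_rpow β
    refine (le_of_tendsto_of_tendsto hl₁.abs (h.const_mul K₁) ?_).trans
      ((mul_one K₁).trans_le (le_max_left _ _))
    filter_upwards [eventually_gt_atTop 0] with σ hσ
    have hp := Real.rpow_pos_of_pos hσ β
    rw [abs_div, abs_of_pos hp, ← mul_div_assoc]
    exact div_le_div_of_nonneg_right (hb₁ σ hσ.le).1 hp.le
  set K := max K₁ K₂ with hK
  have hK0 : 0 ≤ K := hK₁.trans (le_max_left _ _)
  have hmono : ∀ {K' x σ : ℝ}, 0 ≤ σ → K' ≤ K → x ≤ K' * (1 + σ) ^ β → x ≤ K * (1 + σ) ^ β :=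
    fun hσ hK' hx => hx.trans (mul_le_mul_of_nonneg_right hK'
      (Real.rpow_nonneg (by linarith) _))
  have hle₁ : K₁ ≤ K := le_max_left _ _
  have hle₂ : K₂ ≤ K := le_max_right _ _
  have bα : ∀ t r, 0 < r → |homField β A₁ A₂ α₀ t r| ≤ K * r ^ β := fun t r hr =>
    abs_homField_le hβ'.le hK0 (fun σ hσ => hmono hσ hle₁ (hb₁ σ hσ).1)
      (fun σ hσ => hmono hσ hle₂ (hb₂ σ hσ).1) hlim_le t hr
  have hz0 : ∀ t, t ≠ 0 → ∀ X₁ X₂ x₀ r, homField β X₁ X₂ x₀ t r = homField β X₁ X₂ 0 t r := by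
    intro t ht X₁ X₂ x₀ r
    simp only [homField, if_neg ht]
  have bf : ∀ t r, t ≠ 0 → 0 < r → |homField β (fun σ => -F₁ σ) F₂ f₀ t r| ≤ K * r ^ β :=
      fun t r ht hr => by
    rw [hz0 t ht]
    exact abs_homField_le hβ'.le hK0 (fun σ hσ => by
      rw [abs_neg]
      exact hmono hσ hle₁ (hb₁ σ hσ).2.1)
      (fun σ hσ => hmono hσ hle₂ (hb₂ σ hσ).2.1) (by rwa [abs_zero]) t hr
  have bp : ∀ t r, t ≠ 0 → 0 < r → |homField β (fun σ => -P₁ σ) P₂ p₀ t r| ≤ K * r ^ β :=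
      fun t r ht hr => by
    rw [hz0 t ht]
    exact abs_homField_le hβ'.le hK0 (fun σ hσ => by
      rw [abs_neg]
      exact hmono hσ hle₁ (hb₁ σ hσ).2.2)
      (fun σ hσ => hmono hσ hle₂ (hb₂ σ hσ).2.2) (by rwa [abs_zero]) t hr
  have hw₁ : IntegrableOn (fun r : ℝ => r ^ β * r ^ m) (Ioc 0 R) :=
    integrableOn_rpow_mul_pow (by linarith) R
  have hw₂ : IntegrableOn (fun r : ℝ => r ^ β * r ^ (m - 1)) (Ioc 0 R) := by
    refine integrableOn_rpow_mul_pow ?_ R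
    rw [Nat.cast_sub (Nat.one_le_iff_ne_zero.2 hm)]
    push_cast
    linarith
  have hind : ∀ {g : ℝ → ℝ}, IntegrableOn g (Ioc 0 R) →
      Integrable ((Ioc 0 R).indicator g) (volume.restrict (Ioi 0)) := fun hg =>
    Integrable.integrableOn ((integrable_indicator_iff measurableSet_Ioc).2 hg)
  -- both halves are dominated by `r^β` and have the same trace at `t = 0`
  have hJ0 : ContinuousAt J 0 := by
    refine tendsto_integral_filter_of_dominated_convergence
      ((Ioc 0 R).indicator fun r => K * B * (r ^ β * r ^ m)) (Eventually.of_forall hmeas)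
      (Eventually.of_forall fun t => ?_) (hind (hw₁.const_mul (K * B))) ?_
    · filter_upwards [ae_restrict_mem measurableSet_Ioi] with r hr
      have hr0 : 0 < r := hr
      by_cases h : r ≤ R
      · rw [indicator_of_mem (show r ∈ Ioc 0 R from ⟨hr0, h⟩), Real.norm_eq_abs, abs_mul, abs_mul,
          abs_of_nonneg (pow_nonneg hr0.le m)]
        have := mul_le_mul (bα t r hr0) (hbd t r hr0).1 (abs_nonneg _)
          (mul_nonneg hK0 (Real.rpow_nonneg hr0.le β))
        calc _ ≤ K * r ^ β * B * r ^ m := mul_le_mul_of_nonneg_right this (pow_nonneg hr0.le m)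
          _ = _ := by ring
      · rw [(hz t r hr0 (Or.inr (not_le.1 h))).1, indicator_of_notMem (fun h' => h h'.2)]
        simp
    · filter_upwards [ae_restrict_mem measurableSet_Ioi, ae_continuousAt_homField
        h₁.continuousOn_field h₂.continuousOn_field hl₁ hl₂ 0] with r hr0 hcα
      exact (hcα.mul (hψ.hasDerivAt_time 0 hr0).continuousAt).mul continuousAt_const
  have hd : ∀ t, t ≠ 0 → HasDerivAt J (E t) t := fun t ht => by
    rcases lt_or_gt_of_ne ht with h | h
    · exact hJneg t h
    · exact hJpos t h
  have hEbound : ∀ t, t ≠ 0 → ‖E t‖ ≤ ∫ r in Ioi (0 : ℝ), (Ioc 0 R).indicator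
      (fun r => 2 * K * B * (r ^ β * r ^ m) + K * B * m * (r ^ β * r ^ (m - 1))) r := by
    intro t ht
    refine norm_integral_le_of_norm_le (hind ((hw₁.const_mul _).add (hw₂.const_mul _))) ?_
    filter_upwards [ae_restrict_mem measurableSet_Ioi] with r hr
    have hr0 : 0 < r := hr
    by_cases h : r ≤ R
    · rw [indicator_of_mem (show r ∈ Ioc 0 R from ⟨hr0, h⟩), Real.norm_eq_abs, abs_mul,
        abs_of_nonneg (pow_nonneg hr0.le m)]
      obtain ⟨g1, g2, g3⟩ := hbd t r hr0
      have hq : 0 ≤ K * r ^ β := mul_nonneg hK0 (Real.rpow_nonneg hr0.le β)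
      have k1 := mul_le_mul (bα t r hr0) g2 (abs_nonneg _) hq
      have k2 := mul_le_mul (bf t r ht hr0) g3 (abs_nonneg _) hq
      have k3 : |(m : ℝ) * ψ (t, r) / r| ≤ m * B / r := by
        rw [abs_div, abs_mul, Nat.abs_cast, abs_of_pos hr0]
        exact div_le_div_of_nonneg_right (mul_le_mul_of_nonneg_left g1 (Nat.cast_nonneg m)) hr0.le
      have k4 := mul_le_mul (bp t r ht hr0) k3 (abs_nonneg _) hq
      rw [← abs_mul] at k1 k2 k4
      obtain ⟨k, rfl⟩ := Nat.exists_eq_succ_of_ne_zero hm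
      calc _ ≤ (K * r ^ β * B + K * r ^ β * B + K * r ^ β * ((k.succ : ℕ) * B / r)) * r ^ k.succ := by
            refine mul_le_mul_of_nonneg_right ?_ (pow_nonneg hr0.le _)
            exact (abs_add_le _ _).trans (add_le_add ((abs_add_le _ _).trans (add_le_add k1 k2)) k4)
        _ = _ := by
            rw [Nat.succ_eq_add_one, Nat.add_sub_cancel]
            field_simp
            ring
    · obtain ⟨g1, g2, g3⟩ := hz t r hr0 (Or.inr (not_le.1 h))
      rw [g1, g2, g3, indicator_of_notMem (fun h' => h h'.2)]
      simp
  have hEmeas : AEStronglyMeasurable E volume :=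
    (measurable_deriv J).aestronglyMeasurable.congr
      ((Measure.ae_ne volume (0 : ℝ)).mono fun t ht => (hd t ht).deriv)
  have hout : ∀ t, T < |t| → E t = 0 ∧ J t = 0 := by
    intro t ht
    constructor
    · refine setIntegral_eq_zero_of_forall_eq_zero fun r hr => ?_
      obtain ⟨g1, g2, g3⟩ := hz t r hr (Or.inl ht)
      rw [g1, g2, g3]
      ring
    · refine setIntegral_eq_zero_of_forall_eq_zero fun r hr => ?_
      rw [(hz t r hr (Or.inl ht)).1]
      ring
  have hle : -(T + 1) ≤ T + 1 := by linarith
  have hEint : IntervalIntegrable E volume (-(T + 1)) (T + 1) := by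
    rw [intervalIntegrable_iff_integrableOn_Ioc_of_le hle]
    exact Measure.integrableOn_of_bounded (by simp) hEmeas
      (ae_restrict_of_ae ((Measure.ae_ne volume (0 : ℝ)).mono fun t ht => hEbound t ht))
  -- `E` is the derivative of `J` except at `t = 0`, where `J` is continuous
  have hftc := MeasureTheory.integral_eq_of_hasDerivAt_off_countable (f := J) (f' := E)
    (a := -(T + 1)) (b := T + 1) (countable_singleton 0)
    (fun t _ => by
      rcases eq_or_ne t 0 with rfl | h
      · exact hJ0.continuousWithinAt
      · exact (hd t h).continuousAt.continuousWithinAt)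
    (fun t ht => hd t ht.2) hEint
  have hT1 : T < |T + 1| := (lt_add_one T).trans_le (le_abs_self _)
  rw [(hout (T + 1) hT1).2, (hout (-(T + 1)) (by rwa [abs_neg])).2, sub_zero,
    intervalIntegral.integral_of_le hle] at hftc
  rw [← hftc]
  refine (setIntegral_eq_integral_of_forall_compl_eq_zero fun t ht => (hout t ?_).1).symm
  by_contra! h
  obtain ⟨k1, k2⟩ := abs_le.1 h
  exact ht ⟨by linarith, by linarith⟩

end Integrated

/-! ### Radial weak solutions -/

/-- Profiles which define a homogeneous field with at most one break on each side of `t = 0`, of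
size `O(r^β)` and continuous at `t = 0` with trace `x₀ r^β`. -/
structure FieldData (β b₁ b₂ : ℝ) (X₁ X₂ : ℝ → ℝ) (x₀ : ℝ) : Prop where
  pos₁ : 0 < b₁
  pos₂ : 0 < b₂
  continuousOn₁ : ContinuousOn X₁ (Ici 0 ∩ {b₁}ᶜ)
  continuousOn₂ : ContinuousOn X₂ (Ici 0 ∩ {b₂}ᶜ)
  tendsto₁ : Tendsto (fun σ => X₁ σ / σ ^ β) atTop (𝓝 x₀)
  tendsto₂ : Tendsto (fun σ => X₂ σ / σ ^ β) atTop (𝓝 x₀)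
  bound : ∃ K, 0 ≤ K ∧ ∀ σ, 0 ≤ σ → |X₁ σ| ≤ K * (1 + σ) ^ β ∧ |X₂ σ| ≤ K * (1 + σ) ^ β

section FieldData

variable {β b₁ b₂ x₀ y₀ : ℝ} {X₁ X₂ Y₁ Y₂ : ℝ → ℝ} {m : ℕ}

lemma FieldData.mul (hX : FieldData β b₁ b₂ X₁ X₂ x₀) (hY : FieldData 0 b₁ b₂ Y₁ Y₂ y₀) :
    FieldData β b₁ b₂ (fun σ => X₁ σ * Y₁ σ) (fun σ => X₂ σ * Y₂ σ) (x₀ * y₀) := by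
  refine ⟨hX.pos₁, hX.pos₂, hX.continuousOn₁.mul hY.continuousOn₁,
    hX.continuousOn₂.mul hY.continuousOn₂, ?_, ?_, ?_⟩
  · refine (hX.tendsto₁.mul hY.tendsto₁).congr fun σ => ?_
    rw [Real.rpow_zero]
    ring
  · refine (hX.tendsto₂.mul hY.tendsto₂).congr fun σ => ?_
    rw [Real.rpow_zero]
    ring
  · obtain ⟨K, hK, h⟩ := hX.bound
    obtain ⟨L, hL, h'⟩ := hY.bound
    refine ⟨K * L, mul_nonneg hK hL, fun σ hσ => ?_⟩
    have hp : 0 ≤ (1 + σ) ^ β := Real.rpow_nonneg (by linarith) _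
    obtain ⟨e₁, e₂⟩ := h σ hσ
    obtain ⟨e₃, e₄⟩ := h' σ hσ
    rw [Real.rpow_zero, mul_one] at e₃ e₄
    rw [abs_mul, abs_mul, mul_right_comm]
    exact ⟨mul_le_mul e₁ e₃ (abs_nonneg _) (mul_nonneg hK hp),
      mul_le_mul e₂ e₄ (abs_nonneg _) (mul_nonneg hK hp)⟩

lemma FieldData.const_mul (c : ℝ) (hX : FieldData β b₁ b₂ X₁ X₂ x₀) :
    FieldData β b₁ b₂ (fun σ => c * X₁ σ) (fun σ => c * X₂ σ) (c * x₀) := by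
  refine ⟨hX.pos₁, hX.pos₂, continuousOn_const.mul hX.continuousOn₁,
    continuousOn_const.mul hX.continuousOn₂, ?_, ?_, ?_⟩
  · exact (hX.tendsto₁.const_mul c).congr fun σ => by ring
  · exact (hX.tendsto₂.const_mul c).congr fun σ => by ring
  · obtain ⟨K, hK, h⟩ := hX.bound
    refine ⟨|c| * K, mul_nonneg (abs_nonneg _) hK, fun σ hσ => ?_⟩
    obtain ⟨e₁, e₂⟩ := h σ hσ
    rw [abs_mul, abs_mul, mul_assoc]
    exact ⟨mul_le_mul_of_nonneg_left e₁ (abs_nonneg _),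
      mul_le_mul_of_nonneg_left e₂ (abs_nonneg _)⟩

lemma FieldData.exists_bound (hβ : β ≤ 0) (hX : FieldData β b₁ b₂ X₁ X₂ x₀) :
    ∃ K, 0 ≤ K ∧ ∀ t r, 0 < r → |homField β X₁ X₂ x₀ t r| ≤ K * r ^ β := by
  obtain ⟨K, hK, h⟩ := hX.bound
  refine ⟨K, hK, fun t r hr => abs_homField_le hβ hK (fun σ hσ => (h σ hσ).1)
    (fun σ hσ => (h σ hσ).2) ?_ t hr⟩
  refine (le_of_tendsto_of_tendsto hX.tendsto₁.abs
    ((tendsto_one_add_div_rpow β).const_mul K) ?_).trans (mul_one K).le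
  filter_upwards [eventually_gt_atTop 0] with σ hσ
  have hp := Real.rpow_pos_of_pos hσ β
  rw [abs_div, abs_of_pos hp, ← mul_div_assoc]
  exact div_le_div_of_nonneg_right (h σ hσ.le).1 hp.le

lemma FieldData.measurable (hX : FieldData β b₁ b₂ X₁ X₂ x₀) :
    Measurable fun z : ℝ × ℝ => homField β X₁ X₂ x₀ z.1 (max z.2 0) :=
  measurable_homField hX.pos₁ hX.pos₂ hX.continuousOn₁ hX.continuousOn₂

lemma FieldData.measurable_halfPlane (hX : FieldData β b₁ b₂ X₁ X₂ x₀) :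
    Measurable fun z : ℝ × Ioi (0 : ℝ) => homField β X₁ X₂ x₀ z.1 z.2 := by
  have h : Measurable fun z : ℝ × Ioi (0 : ℝ) => ((z.1, (z.2 : ℝ)) : ℝ × ℝ) := by fun_prop
  have h' := hX.measurable.comp h
  simpa only [Function.comp_def, max_eq_left (mem_Ioi.1 (Subtype.prop _)).le] using h'

lemma ae_radialMeasure_pos : ∀ᵐ r ∂(radialMeasure m), 0 < r :=
  ae_radialMeasure_of_ae (ae_restrict_mem measurableSet_Ioi)

lemma ae_prod_radialMeasure_pos : ∀ᵐ z ∂((volume : Measure ℝ).prod (radialMeasure m)), 0 < z.2 :=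
  Measure.quasiMeasurePreserving_snd.ae ae_radialMeasure_pos

lemma FieldData.continuousInL1loc (hβ : β ≤ 0) (hm : -((m : ℝ) + 1) < β)
    (hX : FieldData β b₁ b₂ X₁ X₂ x₀) :
    ContinuousInL1loc (radialMeasure m) (homField β X₁ X₂ x₀) := by
  obtain ⟨K, hK, h⟩ := hX.exists_bound hβ
  refine continuousInL1loc_of_dominated (w := fun r => K * r ^ β)
    ((locallyIntegrable_rpow_radialMeasure hm).smul K) (fun t => ?_) (fun t => ?_) fun t =>
    ae_radialMeasure_of_ae (ae_continuousAt_homField hX.continuousOn₁ hX.continuousOn₂ hX.tendsto₁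
      hX.tendsto₂ t)
  · refine (hX.measurable.comp (measurable_prodMk_left (x := t))).aestronglyMeasurable.congr ?_
    filter_upwards [ae_radialMeasure_pos] with r hr
    simp only [Function.comp_apply, max_eq_left hr.le]
  · filter_upwards [ae_radialMeasure_pos] with r hr using h t r hr

lemma FieldData.locallyIntegrable (hβ : β ≤ 0) (hm : -((m : ℝ) + 1) < β)
    (hX : FieldData β b₁ b₂ X₁ X₂ x₀) :
    LocallyIntegrable (fun z : ℝ × ℝ => homField β X₁ X₂ x₀ z.1 z.2)
      (volume.prod (radialMeasure m)) := by
  obtain ⟨K, hK, h⟩ := hX.exists_bound hβ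
  refine locallyIntegrable_of_abs_le (w := fun r => K * r ^ β)
    ((locallyIntegrable_rpow_radialMeasure hm).smul K) ?_ ?_
  · refine hX.measurable.aestronglyMeasurable.congr ?_
    filter_upwards [ae_prod_radialMeasure_pos] with z hz
    simp only [max_eq_left hz.le]
  · filter_upwards [ae_prod_radialMeasure_pos] with z hz using h z.1 z.2 hz

end FieldData

section Radial

variable {a β b₁ b₂ κ v : ℝ} {m : ℕ} {V₁ A₁ V₂ A₂ : ℝ → ℝ} {ψ : ℝ × ℝ → ℝ}

/-- The halves `t < 0` and `t > 0` of the density have the same trace `κ r^β` at `t = 0`. The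
velocity has the traces `-(-v)` and `v`, since the first half is reversed in time. -/
lemma fieldData_density (h₁ : SimilarityFlow a m β V₁ A₁ b₁ κ (-v))
    (h₂ : SimilarityFlow a m β V₂ A₂ b₂ κ v) : FieldData β b₁ b₂ A₁ A₂ κ := by
  obtain ⟨K₁, _, hK₁, _, hb₁⟩ := h₁.exists_bounds
  obtain ⟨K₂, _, hK₂, _, hb₂⟩ := h₂.exists_bounds
  refine ⟨h₁.break_pos, h₂.break_pos, h₁.density_continuousOn, h₂.density_continuousOn,
    h₁.density_tendsto, h₂.density_tendsto, K₁ + K₂, by positivity, fun σ hσ => ?_⟩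
  have hp : 0 ≤ (1 + σ) ^ β := Real.rpow_nonneg (by linarith) _
  constructor
  · nlinarith [(hb₁ σ hσ).1, mul_nonneg hK₂ hp]
  · nlinarith [(hb₂ σ hσ).1, mul_nonneg hK₁ hp]

lemma fieldData_velocity (h₁ : SimilarityFlow a m β V₁ A₁ b₁ κ (-v))
    (h₂ : SimilarityFlow a m β V₂ A₂ b₂ κ v) : FieldData 0 b₁ b₂ (fun σ => -V₁ σ) V₂ v := by
  obtain ⟨_, M₁, _, hM₁, hb₁⟩ := h₁.exists_bounds
  obtain ⟨_, M₂, _, hM₂, hb₂⟩ := h₂.exists_bounds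
  refine ⟨h₁.break_pos, h₂.break_pos, h₁.velocity_continuousOn.neg, h₂.velocity_continuousOn,
    ?_, ?_, M₁ + M₂, by positivity, fun σ hσ => ?_⟩
  · simpa using h₁.velocity_tendsto.neg
  · simpa using h₂.velocity_tendsto
  · rw [Real.rpow_zero, mul_one, abs_neg]
    exact ⟨by linarith [(hb₁ σ hσ).2], by linarith [(hb₂ σ hσ).2]⟩

lemma integral_mass (ha : 0 < a) (hm : m ≠ 0) (hβ : -(m : ℝ) < β) (hβ' : β < 0)
    (h₁ : SimilarityFlow a m β V₁ A₁ b₁ κ (-v)) (h₂ : SimilarityFlow a m β V₂ A₂ b₂ κ v)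
    (hψ : IsRadialTest ψ) :
    ∫ t : ℝ, ∫ r in Ioi (0 : ℝ),
      (homField β A₁ A₂ κ t r * deriv (fun s => ψ (s, r)) t + homField β A₁ A₂ κ t r *
        homField 0 (fun σ => -V₁ σ) V₂ v t r * deriv (fun s => ψ (t, s)) r) * r ^ m = 0 := by
  refine Eq.trans ?_ (integral_balance (f₀ := κ * v) (p₀ := 0) hm hβ hβ' (h₁.mass_law ha hm)
    (h₂.mass_law ha hm) h₁.density_tendsto h₂.density_tendsto hψ)
  congr 1
  funext t
  congr 1
  funext r
  have e₁ : homField β (fun _ => -0) (fun _ => 0) 0 t r = 0 := by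
    unfold homField
    split_ifs <;> simp
  rw [homField_mul, e₁]
  simp only [mul_neg, zero_mul, add_zero]

/-- The radial momentum law. The singular term `m ψ / r` is integrable against `r^β r^m` even if
`ψ` does not vanish on `r = 0`, as `β > -m`; this freedom is used in several space dimensions. -/
lemma integral_momentum (ha : 0 < a) (hm : m ≠ 0) (hβ : -(m : ℝ) < β) (hβ' : β < 0)
    (h₁ : SimilarityFlow a m β V₁ A₁ b₁ κ (-v)) (h₂ : SimilarityFlow a m β V₂ A₂ b₂ κ v)
    (hψ : IsRadialTest ψ) :
    ∫ t : ℝ, ∫ r in Ioi (0 : ℝ),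
      (homField β A₁ A₂ κ t r * homField 0 (fun σ => -V₁ σ) V₂ v t r *
          deriv (fun s => ψ (s, r)) t +
        homField β A₁ A₂ κ t r * homField 0 (fun σ => -V₁ σ) V₂ v t r ^ 2 *
          deriv (fun s => ψ (t, s)) r +
        a ^ 2 * homField β A₁ A₂ κ t r *
          (deriv (fun s => ψ (t, s)) r + m * ψ (t, r) / r)) * r ^ m = 0 := by
  have hρu := (fieldData_density h₁ h₂).mul (fieldData_velocity h₁ h₂)
  have hl₁ : Tendsto (fun σ => -(A₁ σ * V₁ σ) / σ ^ β) atTop (𝓝 (κ * v)) := by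
    simpa only [mul_neg] using hρu.tendsto₁
  refine Eq.trans ?_ (integral_balance (f₀ := κ * v ^ 2 + a ^ 2 * κ) (p₀ := a ^ 2 * κ) hm hβ hβ'
    (h₁.momentum_law ha hm).neg (h₂.momentum_law ha hm) hl₁ hρu.tendsto₂ hψ)
  congr 1
  funext t
  congr 1
  funext r
  have e₁ : homField β (fun σ => -(A₁ σ * V₁ σ)) (fun σ => A₂ σ * V₂ σ) (κ * v) t r =
      homField β A₁ A₂ κ t r * homField 0 (fun σ => -V₁ σ) V₂ v t r := by
    rw [homField_mul]
    simp only [mul_neg]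
  have e₂ : homField β (fun σ => - -(a ^ 2 * A₁ σ)) (fun σ => a ^ 2 * A₂ σ) (a ^ 2 * κ) t r =
      a ^ 2 * homField β A₁ A₂ κ t r := by
    rw [const_mul_homField]
    simp only [neg_neg]
  have e₃ : homField β (fun σ => - -(A₁ σ * V₁ σ ^ 2 + a ^ 2 * A₁ σ))
      (fun σ => A₂ σ * V₂ σ ^ 2 + a ^ 2 * A₂ σ) (κ * v ^ 2 + a ^ 2 * κ) t r =
      homField β A₁ A₂ κ t r * homField 0 (fun σ => -V₁ σ) V₂ v t r ^ 2 +
        a ^ 2 * homField β A₁ A₂ κ t r := by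
    unfold homField
    split_ifs <;> rw [Real.rpow_zero] <;> ring
  rw [e₁, e₂, e₃]
  ring

/-- Two expanding flows with opposite asymptotic velocities, the first one reversed in time, form a
radial weak solution. -/
lemma isRadialWeakSolution_homField (ha : 0 < a) (hm : m ≠ 0) (hβ : -(m : ℝ) < β) (hβ' : β < 0)
    (h₁ : SimilarityFlow a m β V₁ A₁ b₁ κ (-v)) (h₂ : SimilarityFlow a m β V₂ A₂ b₂ κ v) :
    IsRadialWeakSolution m (pressure a) (homField β A₁ A₂ κ)
      (homField 0 (fun σ => -V₁ σ) V₂ v) := by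
  have hρ := fieldData_density h₁ h₂
  have hu := fieldData_velocity h₁ h₂
  have hm1 : -((m : ℝ) + 1) < β := by linarith
  refine ⟨hρ.measurable_halfPlane, hu.measurable_halfPlane, hρ.continuousInL1loc hβ'.le hm1,
    ?_, ?_, ?_, fun ψ hψ => integral_mass ha hm hβ hβ' h₁ h₂ hψ,
    fun ψ hψ _ => integral_momentum ha hm hβ hβ' h₁ h₂ hψ⟩
  · simp only [homField_mul]
    exact (hρ.mul hu).continuousInL1loc hβ'.le hm1
  · simp only [pow_two, ← mul_assoc, homField_mul]
    exact ((hρ.mul hu).mul hu).locallyIntegrable hβ'.le hm1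
  · simp only [pressure, const_mul_homField]
    exact (hρ.const_mul (a ^ 2)).locallyIntegrable hβ'.le hm1

end Radial

/-! ### Pointwise properties of the flow -/

section Pointwise

variable {a β Ω₀ : ℝ} {m : ℕ} {S : Profile}

lemma IsConstructed.density_eq (ha : 0 < a) (hm : m = 1 ∨ m = 2) (hβ : -(m : ℝ) < β)
    (hΩ : Ω₀ < 0) (hS : IsConstructed a m β Ω₀ S) :
    S.density a m β = homField β (S.backDensity (xiW a m β)) S.OmegaPos (-S.C) := by
  funext t r
  unfold Profile.density homField
  split_ifs with h h'
  · rw [Profile.backDensity, abs_of_neg h, div_neg, neg_neg]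
    ring
  · rw [abs_of_neg (hS.omk_neg ha hm hβ hΩ).2]
  · rw [abs_of_pos (lt_of_le_of_ne (not_lt.1 h) (Ne.symm h'))]

lemma Profile.velocity_eq :
    S.velocity a m β = homField 0 (fun σ => -S.backVelocity (xiW a m β) σ) (S.U (xiW a m β))
      S.Ustar := by
  funext t r
  unfold Profile.velocity homField
  simp only [Real.rpow_zero, one_mul, mul_one]
  split_ifs with h h' h'
  · exact absurd h h'.ne
  · rfl
  · rw [Profile.backVelocity, abs_of_neg h', div_neg, neg_neg, neg_neg]
  · rfl

/-- Homogeneity turns the bound `A(σ) ≥ c (1 + σ)^β` of the profiles into `ρ ≥ c (|t| + r)^β`. -/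
lemma exists_lower_bound {V₁ A₁ V₂ A₂ : ℝ → ℝ} {b₁ b₂ κ v : ℝ} (hκ : 0 < κ)
    (h₁ : SimilarityFlow a m β V₁ A₁ b₁ κ (-v)) (h₂ : SimilarityFlow a m β V₂ A₂ b₂ κ v) :
    ∃ c, 0 < c ∧ ∀ t r : ℝ, 0 ≤ r → (t ≠ 0 ∨ r ≠ 0) →
      c * (|t| + r) ^ β ≤ homField β A₁ A₂ κ t r := by
  obtain ⟨c₁, _, hc₁, hb₁⟩ := h₁.density_bound
  obtain ⟨c₂, _, hc₂, hb₂⟩ := h₂.density_bound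
  have key : ∀ {c : ℝ} {A : ℝ → ℝ}, (∀ σ, 0 ≤ σ → c * (1 + σ) ^ β ≤ A σ) → ∀ τ r : ℝ, 0 < τ →
      0 ≤ r → c * (τ + r) ^ β ≤ τ ^ β * A (r / τ) := by
    intro c A h τ r hτ hr
    have hq := div_nonneg hr hτ.le
    calc _ = τ ^ β * (c * (1 + r / τ) ^ β) := by
          rw [show τ + r = τ * (1 + r / τ) by field_simp, Real.mul_rpow hτ.le (by linarith)]
          ring
      _ ≤ _ := mul_le_mul_of_nonneg_left (h _ hq) (Real.rpow_nonneg hτ.le _)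
  refine ⟨min κ (min c₁ c₂), lt_min hκ (lt_min hc₁ hc₂), fun t r hr hne => ?_⟩
  have hp : 0 ≤ (|t| + r) ^ β := Real.rpow_nonneg (by positivity) _
  unfold homField
  split_ifs with h h'
  · exact (mul_le_mul_of_nonneg_right ((min_le_right _ _).trans (min_le_left _ _)) hp).trans
      (key (fun σ hσ => (hb₁ σ hσ).1) _ r (abs_pos.2 h.ne) hr)
  · rw [h', abs_zero, zero_add]
    exact mul_le_mul_of_nonneg_right (min_le_left _ _) (Real.rpow_nonneg hr _)
  · have ht : 0 < t := lt_of_le_of_ne (not_lt.1 h) (Ne.symm h')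
    refine (mul_le_mul_of_nonneg_right ((min_le_right _ _).trans (min_le_right _ _)) hp).trans ?_
    rw [abs_of_pos ht]
    exact key (fun σ hσ => (hb₂ σ hσ).1) t r ht hr

/-- The density is at least `c (|t| + |x|)^β`, and `β < 0`. -/
lemma tendsto_density_atTop {n : ℕ} {f : ℝ → ℝ → ℝ} {c : ℝ} (hβ : β < 0) (hc : 0 < c)
    (h : ∀ t r : ℝ, 0 ≤ r → (t ≠ 0 ∨ r ≠ 0) → c * (|t| + r) ^ β ≤ f t r) :
    Tendsto (fun z : ℝ × EuclideanSpace ℝ (Fin n) => f z.1 ‖z.2‖) (𝓝[≠] 0) atTop := by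
  have hlow : Tendsto (fun z : ℝ × EuclideanSpace ℝ (Fin n) => |z.1| + ‖z.2‖) (𝓝[≠] 0)
      (𝓝[>] 0) := by
    refine tendsto_nhdsWithin_iff.2 ⟨?_, ?_⟩
    · have hc : Continuous fun z : ℝ × EuclideanSpace ℝ (Fin n) => |z.1| + ‖z.2‖ := by fun_prop
      have := hc.tendsto 0
      simp only [Prod.fst_zero, Prod.snd_zero, abs_zero, norm_zero, add_zero] at this
      exact this.mono_left nhdsWithin_le_nhds
    · filter_upwards [self_mem_nhdsWithin] with z hz
      rw [mem_Ioi]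
      rcases eq_or_ne z.1 0 with h1 | h1
      · have h2 : z.2 ≠ 0 := fun h2 => hz (Prod.ext h1 h2)
        positivity
      · positivity
  have hpow : Tendsto (fun x : ℝ => c * x ^ β) (𝓝[>] 0) atTop :=
    (tendsto_rpow_neg_nhdsGT_zero hβ).const_mul_atTop hc
  refine tendsto_atTop_mono' _ ?_ (hpow.comp hlow)
  filter_upwards [self_mem_nhdsWithin] with z hz
  refine h z.1 ‖z.2‖ (norm_nonneg _) ?_
  by_contra! hne
  exact hz (Prod.ext hne.1 (norm_eq_zero.1 hne.2))

lemma exists_velocity_bound {V₁ A₁ V₂ A₂ : ℝ → ℝ} {b₁ b₂ κ v : ℝ}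
    (h₁ : SimilarityFlow a m β V₁ A₁ b₁ κ (-v)) (h₂ : SimilarityFlow a m β V₂ A₂ b₂ κ v) :
    ∃ M : ℝ, ∀ t r : ℝ, 0 ≤ r → |homField 0 (fun σ => -V₁ σ) V₂ v t r| ≤ M := by
  obtain ⟨M₁, hM₁⟩ := h₁.velocity_bound
  obtain ⟨M₂, hM₂⟩ := h₂.velocity_bound
  refine ⟨max |v| (max M₁ M₂), fun t r hr => ?_⟩
  unfold homField
  simp only [Real.rpow_zero, one_mul, mul_one]
  split_ifs with h h'
  · rw [abs_neg]
    exact (hM₁ _ (div_nonneg hr (abs_nonneg t))).trans ((le_max_left _ _).trans (le_max_right _ _))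
  · exact le_max_left _ _
  · exact (hM₂ _ (div_nonneg hr (not_lt.1 h))).trans ((le_max_right _ _).trans (le_max_right _ _))

lemma subset_continuity_domain {x : ℝ} :
    {z : ℝ × ℝ | 0 ≤ z.2 ∧ z ≠ (0, 0) ∧ ¬ (0 < z.1 ∧ z.2 = x * z.1)} ⊆
      {z | 0 ≤ z.2 ∧ z ≠ (0, 0) ∧ (z.1 < 0 → z.2 / |z.1| ∉ (∅ : Set ℝ)) ∧
        (0 < z.1 → z.2 / z.1 ∉ ({x} : Set ℝ))} := by
  rintro z ⟨h1, h2, h3⟩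
  refine ⟨h1, h2, fun _ => notMem_empty _, fun h h' => h3 ⟨h, ?_⟩⟩
  exact (div_eq_iff h.ne').1 h'

lemma IsConstructed.continuousOn_density (ha : 0 < a) (hm : m = 1 ∨ m = 2) (hβ : -(m : ℝ) < β)
    (hβ' : β < 0) (hΩ : Ω₀ < 0) (hS : IsConstructed a m β Ω₀ S) :
    ContinuousOn (fun z : ℝ × ℝ => S.density a m β z.1 z.2)
      {z | 0 ≤ z.2 ∧ z ≠ (0, 0) ∧ ¬ (0 < z.1 ∧ z.2 = S.xiS * z.1)} := by
  have h₁ := hS.back_flow ha hm hβ hΩ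
  have h₂ := hS.forward_flow ha hm hβ hβ' hΩ
  rw [hS.density_eq ha hm hβ hΩ]
  refine (continuousOn_homField (D₁ := ∅) ?_ h₂.density_continuousOn h₁.density_tendsto
    h₂.density_tendsto).mono subset_continuity_domain
  rw [compl_empty, inter_univ]
  exact continuousOn_Ici_of_break h₁.density_continuousOn
    (hS.backDensity_continuousAt (xiW_neg ha hm hβ))

lemma IsConstructed.continuousOn_velocity (ha : 0 < a) (hm : m = 1 ∨ m = 2) (hβ : -(m : ℝ) < β)
    (hβ' : β < 0) (hΩ : Ω₀ < 0) (hS : IsConstructed a m β Ω₀ S) :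
    ContinuousOn (fun z : ℝ × ℝ => S.velocity a m β z.1 z.2)
      {z | 0 ≤ z.2 ∧ z ≠ (0, 0) ∧ ¬ (0 < z.1 ∧ z.2 = S.xiS * z.1)} := by
  have h₁ := hS.back_flow ha hm hβ hΩ
  have h₂ := hS.forward_flow ha hm hβ hβ' hΩ
  have hd := fieldData_velocity (v := S.Ustar) h₁ h₂
  rw [Profile.velocity_eq]
  refine (continuousOn_homField (D₁ := ∅) ?_ h₂.velocity_continuousOn hd.tendsto₁
    hd.tendsto₂).mono subset_continuity_domain
  rw [compl_empty, inter_univ]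
  exact (continuousOn_Ici_of_break h₁.velocity_continuousOn
    (hS.backVelocity_continuousAt (xiW_neg ha hm hβ))).neg

lemma IsConstructed.U_xiW (hw : xiW a m β < 0) (hS : IsConstructed a m β Ω₀ S) :
    S.U (xiW a m β) (xiW a m β) = uW a m β := by
  have := hS.xiS_pos
  rw [Profile.U, if_neg (lt_irrefl _), if_pos (by linarith), hS.hat.left]

lemma IsConstructed.hasDerivWithinAt_kink_outer (hw : xiW a m β < 0)
    (hS : IsConstructed a m β Ω₀ S) :
    HasDerivWithinAt (S.U (xiW a m β)) (1 - lamPlus m β) (Iic (xiW a m β)) (xiW a m β) := by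
  rw [← hasDerivWithinAt_Iio_iff_Iic, hasDerivWithinAt_iff_tendsto_slope' (by simp)]
  refine hS.kink.slope.congr' ?_
  filter_upwards [self_mem_nhdsWithin] with ξ hξ
  rw [slope_def_field, hS.U_xiW hw, Profile.U, if_pos (mem_Iio.1 hξ)]

lemma IsConstructed.hasDerivWithinAt_kink_inner (ha : 0 < a) (hm : m = 1 ∨ m = 2)
    (hβ : -(m : ℝ) < β) (hβ' : β < 0) (hS : IsConstructed a m β Ω₀ S) :
    HasDerivWithinAt (S.U (xiW a m β)) (1 - lamMinus m β) (Ici (xiW a m β)) (xiW a m β) := by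
  have hw := xiW_neg ha hm hβ
  have hpos := hS.xiS_pos
  rw [← hasDerivWithinAt_Ioi_iff_Ici, hasDerivWithinAt_iff_tendsto_slope' (by simp)]
  refine (hS.hat.slope ha hm hβ hβ').congr' ?_
  filter_upwards [Ioo_mem_nhdsGT hw] with ξ hξ
  rw [slope_def_field, hS.U_xiW hw, Profile.U, if_neg hξ.1.not_gt,
    if_pos (show ξ < S.xiS by linarith [hξ.2])]

lemma Profile.velocity_of_ne {t : ℝ} (ht : t ≠ 0) :
    S.velocity a m β t = fun r => S.U (xiW a m β) (r / t) := by
  funext r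
  rw [Profile.velocity, if_neg ht]

lemma IsConstructed.kink_conditions (ha : 0 < a) (hm : m = 1 ∨ m = 2) (hβ : -(m : ℝ) < β)
    (hβ' : β < 0) (hS : IsConstructed a m β Ω₀ S) {t : ℝ} (ht : t < 0) :
    S.velocity a m β t (xiW a m β * t) - a = xiW a m β ∧
      HasDerivWithinAt (S.velocity a m β t) ((1 - lamPlus m β) / t)
        (Ici (xiW a m β * t)) (xiW a m β * t) ∧
      HasDerivWithinAt (S.velocity a m β t) ((1 - lamMinus m β) / t)
        (Iic (xiW a m β * t)) (xiW a m β * t) := by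
  have hw := xiW_neg ha hm hβ
  have hq : xiW a m β * t / t = xiW a m β := mul_div_cancel_right₀ _ ht.ne
  have hdiv : ∀ s : Set ℝ, HasDerivWithinAt (fun r : ℝ => r / t) (1 / t) s (xiW a m β * t) :=
    fun s => ((hasDerivAt_id' _).div_const t).hasDerivWithinAt
  rw [Profile.velocity_of_ne ht.ne]
  refine ⟨?_, ?_, ?_⟩
  · beta_reduce
    rw [hq, hS.U_xiW hw, uW_sub_xiW hβ]
  · rw [div_eq_mul_one_div]
    refine HasDerivWithinAt.comp (h₂ := S.U (xiW a m β)) (s' := Iic (xiW a m β)) _ ?_ (hdiv _) fun r hr => ?_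
    · rw [hq]
      exact hS.hasDerivWithinAt_kink_outer hw
    · exact (div_le_iff_of_neg ht).2 hr
  · rw [div_eq_mul_one_div]
    refine HasDerivWithinAt.comp (h₂ := S.U (xiW a m β)) (s' := Ici (xiW a m β)) _ ?_ (hdiv _) fun r hr => ?_
    · rw [hq]
      exact hS.hasDerivWithinAt_kink_inner ha hm hβ hβ'
    · exact (le_div_iff_of_neg ht).2 hr

lemma tendsto_div_nhdsLT {t : ℝ} (ht : 0 < t) (x : ℝ) :
    Tendsto (fun r => r / t) (𝓝[<] (x * t)) (𝓝[<] x) := by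
  have h := tendsto_const_mul_nhdsLT (inv_pos.2 ht) x
  rw [div_inv_eq_mul] at h
  simpa only [div_eq_inv_mul] using h

lemma tendsto_div_nhdsGT {t : ℝ} (ht : 0 < t) (x : ℝ) :
    Tendsto (fun r => r / t) (𝓝[>] (x * t)) (𝓝[>] x) := by
  have h := tendsto_const_mul_nhdsGT (inv_pos.2 ht) x
  rw [div_inv_eq_mul] at h
  simpa only [div_eq_inv_mul] using h

lemma IsConstructed.isTwoShock (ha : 0 < a) (hm : m = 1 ∨ m = 2) (hβ : -(m : ℝ) < β)
    (hβ' : β < 0) (hΩ : Ω₀ < 0) (hS : IsConstructed a m β Ω₀ S) {t : ℝ} (ht : 0 < t) :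
    IsTwoShock (pressure a) (S.density a m β) (S.velocity a m β) (fun s => S.xiS * s) t := by
  have hw := xiW_neg ha hm hβ
  have hrho : S.density a m β t = fun r => t ^ β * S.OmegaPos (r / t) := by
    funext r
    rw [Profile.density, if_neg ht.le.not_gt, if_neg ht.ne', abs_of_pos ht]
  have hp : 0 < t ^ β := Real.rpow_pos_of_pos ht β
  have hdR : deriv (fun s => S.xiS * s) t = S.xiS := by simp
  have hdp : ∀ x, √(deriv (pressure a) x) = a := fun x => by
    have : HasDerivAt (pressure a) (a ^ 2) x :=
      ((hasDerivAt_id x).const_mul (a ^ 2)).congr_deriv (mul_one _)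
    rw [this.deriv, Real.sqrt_sq ha.le]
  have hhat := abs_lt.1 (hS.hat.abs_sub_lt ha hw S.xiS ⟨by linarith [hS.xiS_pos], hS.shock_mem.2⟩)
  have htil := hS.tilde_sub_lt
  have hmass := hS.shock_mass ha hm hβ hβ'
  have hmom := hS.shock_momentum ha hm hβ hβ'
  have hpos := hS.omtilde_pos ha hm hβ hΩ S.xiS le_rfl
  refine ⟨t ^ β * S.OmPos S.xiS, S.Uhat S.xiS, t ^ β * S.Omtilde S.xiS, S.Utilde S.xiS,
    ?_, ?_, ?_, ?_, ?_, ?_, ?_, ?_, ?_, ?_⟩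
  · rw [hrho]
    exact (hS.OmegaPos_tendsto_left.comp (tendsto_div_nhdsLT ht _)).const_mul _
  · rw [Profile.velocity_of_ne ht.ne']
    exact (hS.U_tendsto_left hw).comp (tendsto_div_nhdsLT ht _)
  · rw [hrho]
    exact (hS.OmegaPos_tendsto_right.comp (tendsto_div_nhdsGT ht _)).const_mul _
  · rw [Profile.velocity_of_ne ht.ne']
    exact (hS.U_tendsto_right hw).comp (tendsto_div_nhdsGT ht _)
  · intro h
    have h1 := mul_left_cancel₀ hp.ne' h
    rw [h1] at hmass
    have h2 := mul_right_cancel₀ hpos.ne' hmass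
    linarith
  · intro h
    rw [h] at hhat
    linarith
  · rw [hdR]
    linear_combination t ^ β * hmass
  · rw [hdR, pressure, pressure]
    linear_combination t ^ β * hmom
  · rw [hdR, hdp]
    linarith
  · rw [hdR, hdp]
    linarith

end Pointwise

/-! ### Polar coordinates -/

section Polar

variable {m : ℕ} {β b₁ b₂ x₀ : ℝ} {X₁ X₂ : ℝ → ℝ}

lemma map_volumeIoiPow (m : ℕ) :
    (Measure.volumeIoiPow m).map ((↑) : Ioi (0 : ℝ) → ℝ) = radialMeasure m := by
  ext s hs
  rw [Measure.map_apply measurable_subtype_coe hs, Measure.volumeIoiPow,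
    withDensity_apply _ (measurable_subtype_coe hs),
    setLIntegral_subtype measurableSet_Ioi _ (fun r : ℝ => ENNReal.ofReal (r ^ m)),
    Subtype.image_preimage_coe, radialMeasure, withDensity_apply _ hs,
    Measure.restrict_restrict hs, inter_comm]

/-- Polar coordinates `(ω, r) ↦ r ω`. -/
def polarMap (m : ℕ) (p : Metric.sphere (0 : EuclideanSpace ℝ (Fin (m + 1))) 1 × ℝ) :
    EuclideanSpace ℝ (Fin (m + 1)) := p.2 • (p.1 : EuclideanSpace ℝ (Fin (m + 1)))

/-- The surface measure on the unit sphere of `ℝ^(m+1)`. -/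
noncomputable def sphereMeasure (m : ℕ) :
    Measure (Metric.sphere (0 : EuclideanSpace ℝ (Fin (m + 1))) 1) :=
  (volume : Measure (EuclideanSpace ℝ (Fin (m + 1)))).toSphere

instance : IsFiniteMeasure (sphereMeasure m) := by
  unfold sphereMeasure
  infer_instance

lemma continuous_polarMap : Continuous (polarMap m) := by
  unfold polarMap
  fun_prop

lemma measurePreserving_polarMap :
    MeasurePreserving (polarMap m) ((sphereMeasure m).prod (radialMeasure m)) volume := by
  set E := EuclideanSpace ℝ (Fin (m + 1))
  have hdim : Module.finrank ℝ E - 1 = m := by simp [E]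
  have h₁ := (volume : Measure E).measurePreserving_homeomorphUnitSphereProd
  rw [hdim] at h₁
  have h₂ : MeasurePreserving (homeomorphUnitSphereProd E).symm
      ((sphereMeasure m).prod (Measure.volumeIoiPow m)) ((volume : Measure E).comap (↑)) :=
    h₁.symm (homeomorphUnitSphereProd E).toMeasurableEquiv
  have h₃ : MeasurePreserving (Prod.map id ((↑) : Ioi (0 : ℝ) → ℝ))
      ((sphereMeasure m).prod (Measure.volumeIoiPow m))
      ((sphereMeasure m).prod (radialMeasure m)) :=
    (MeasurePreserving.id _).prod ⟨measurable_subtype_coe, map_volumeIoiPow m⟩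
  refine ⟨continuous_polarMap.measurable, ?_⟩
  have hcomp : polarMap m ∘ Prod.map id ((↑) : Ioi (0 : ℝ) → ℝ) =
      (fun x : ({0}ᶜ : Set E) => (x : E)) ∘ (homeomorphUnitSphereProd E).symm := by
    funext p
    simp [polarMap, homeomorphUnitSphereProd_symm_apply_coe]
  rw [← h₃.map_eq, Measure.map_map continuous_polarMap.measurable h₃.measurable, hcomp,
    ← Measure.map_map measurable_subtype_coe h₂.measurable, h₂.map_eq,
    map_comap_subtype_coe (measurableSet_singleton (0 : E)).compl]
  exact restrict_compl_singleton 0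

lemma integral_radialMeasure (f : ℝ → ℝ) :
    ∫ r, f r ∂(radialMeasure m) = ∫ r in Ioi (0 : ℝ), f r * r ^ m := by
  have hmeas : Measurable fun r : ℝ => (Real.toNNReal (r ^ m)) := by fun_prop
  have e : radialMeasure m =
      (volume.restrict (Ioi 0)).withDensity (fun r => ((Real.toNNReal (r ^ m) : NNReal) : ENNReal)) :=
    rfl
  rw [e, integral_withDensity_eq_integral_smul hmeas]
  refine setIntegral_congr_fun measurableSet_Ioi fun r hr => ?_
  have hr0 : 0 < r := hr
  simp only [NNReal.smul_def, Real.coe_toNNReal _ (pow_nonneg hr0.le m), smul_eq_mul]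
  ring

lemma integral_polar {g : EuclideanSpace ℝ (Fin (m + 1)) → ℝ}
    (hg : AEStronglyMeasurable g volume) :
    ∫ x, g x = ∫ p, g (polarMap m p) ∂((sphereMeasure m).prod (radialMeasure m)) := by
  rw [← measurePreserving_polarMap.map_eq] at hg
  have := integral_map continuous_polarMap.aemeasurable hg
  rwa [measurePreserving_polarMap.map_eq] at this

lemma integral_polar_spheres {g : EuclideanSpace ℝ (Fin (m + 1)) → ℝ} (hg : Integrable g) :
    ∫ x, g x = ∫ r in Ioi (0 : ℝ), (∫ ω, g (polarMap m (ω, r)) ∂(sphereMeasure m)) * r ^ m := by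
  have hint := measurePreserving_polarMap.integrable_comp_of_integrable hg
  rw [integral_polar hg.1, ← integral_radialMeasure]
  exact integral_prod_symm _ hint

/-- Polar coordinates at each time, with the direction `ω` as the outer variable. -/
lemma measurePreserving_time_polarMap : MeasurePreserving
    (fun q : Metric.sphere (0 : EuclideanSpace ℝ (Fin (m + 1))) 1 × ℝ × ℝ =>
      (q.2.1, polarMap m (q.1, q.2.2)))
    ((sphereMeasure m).prod ((volume : Measure ℝ).prod (radialMeasure m))) volume := by
  have h₁ : MeasurePreserving (Prod.map id (polarMap m))
      ((volume : Measure ℝ).prod ((sphereMeasure m).prod (radialMeasure m))) volume :=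
    (MeasurePreserving.id _).prod measurePreserving_polarMap
  have h₂ := measurePreserving_prodAssoc (volume : Measure ℝ) (sphereMeasure m) (radialMeasure m)
  have h₃ := (Measure.measurePreserving_swap (μ := sphereMeasure m)
    (ν := (volume : Measure ℝ))).prod (MeasurePreserving.id (radialMeasure m))
  have h₄ := (measurePreserving_prodAssoc (sphereMeasure m) (volume : Measure ℝ)
    (radialMeasure m)).symm
  exact h₁.comp (h₂.comp (h₃.comp h₄))

lemma integral_time_polar_rays {g : ℝ × EuclideanSpace ℝ (Fin (m + 1)) → ℝ} (hg : Integrable g) :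
    ∫ z, g z = ∫ ω, (∫ t : ℝ, ∫ r in Ioi (0 : ℝ), g (t, polarMap m (ω, r)) * r ^ m)
      ∂(sphereMeasure m) := by
  have hmp := measurePreserving_time_polarMap (m := m)
  have hint := hmp.integrable_comp_of_integrable hg
  have hg' := hg.1
  rw [← hmp.map_eq] at hg'
  have e := integral_map hmp.measurable.aemeasurable hg'
  rw [hmp.map_eq] at e
  rw [e]
  refine (integral_prod _ hint).trans (integral_congr_ae ?_)
  filter_upwards [hint.prod_right_ae] with ω hω
  refine (integral_prod _ hω).trans ?_
  simp only [Function.comp_def, integral_radialMeasure]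

lemma locallyIntegrable_norm_rpow {γ : ℝ} (hγ : -((m : ℝ) + 1) < γ) :
    LocallyIntegrable (fun x : EuclideanSpace ℝ (Fin (m + 1)) => ‖x‖ ^ γ) := by
  rw [locallyIntegrable_iff]
  intro k hk
  obtain ⟨N, hN⟩ := hk.isBounded.subset_ball 0
  refine IntegrableOn.mono_set ?_ hN
  rw [integrableOn_fun_norm_addHaar volume (f := fun r : ℝ => r ^ γ)]
  refine ((integrableOn_rpow_mul_pow hγ N).mono_set Ioo_subset_Ioc_self).congr_fun
    (fun r _ => ?_) measurableSet_Ioo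
  simp [mul_comm]

end Polar

/-! ### The divergence theorem on the unit sphere -/

section Sphere

variable {m : ℕ}

lemma integral_fderiv_eq_zero {E : Type*} [NormedAddCommGroup E] [NormedSpace ℝ E]
    [FiniteDimensional ℝ E] [MeasurableSpace E] [BorelSpace E] {μ : Measure E}
    [μ.IsAddHaarMeasure] {g : E → ℝ} (hg : ContDiff ℝ 1 g) (hc : HasCompactSupport g) (v : E) :
    ∫ x, fderiv ℝ g x v ∂μ = 0 := by
  have h' : Integrable (fun x => fderiv ℝ g x v) μ :=
    ((hg.continuous_fderiv one_ne_zero).clm_apply continuous_const).integrable_of_hasCompactSupport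
      (hc.fderiv_apply (𝕜 := ℝ) v)
  have := integral_mul_fderiv_eq_neg_fderiv_mul_of_integrable (μ := μ) (f := fun _ : E => (1 : ℝ))
    (g := g) (v := v) (by simp) (by simpa using h')
    (by simpa using hg.continuous.integrable_of_hasCompactSupport hc)
    (fun x _ => differentiableAt_const _) (fun x _ => hg.differentiable one_ne_zero x)
  simpa using this

/-- A cut-off function of the radius which vanishes near the origin and has nonzero moment. -/
lemma exists_radial_cutoff (m : ℕ) : ∃ h : ℝ → ℝ, ContDiff ℝ 1 h ∧ HasCompactSupport h ∧
    (∀ s, s ≤ 1 → h s = 0) ∧ ∫ s in Ioi (0 : ℝ), h s * s ^ (m - 1) ≠ 0 := by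
  let b : ContDiffBump (3 : ℝ) := ⟨1, 2, one_pos, one_lt_two⟩
  have hz : ∀ s, s ≤ 1 → b s = 0 := fun s hs => b.zero_of_le_dist (by
    rw [Real.dist_eq]
    exact (by linarith : (2 : ℝ) ≤ -(s - 3)).trans (neg_le_abs _))
  refine ⟨b, b.contDiff, b.hasCompactSupport, hz, ne_of_gt ?_⟩
  have e : ∫ s in Ioi (0 : ℝ), b s * s ^ (m - 1) = ∫ s, b s * s ^ (m - 1) := by
    refine setIntegral_eq_integral_of_forall_compl_eq_zero fun s hs => ?_
    rw [hz s ((not_lt.1 hs).trans zero_le_one), zero_mul]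
  rw [e]
  refine Continuous.integral_pos_of_hasCompactSupport_nonneg_nonzero (x := 3)
    (b.continuous.mul (continuous_pow _)) b.hasCompactSupport.mul_right (fun s => ?_) ?_
  · rcases le_or_gt s 1 with hs | hs
    · simp [hz s hs]
    · exact mul_nonneg b.nonneg (pow_nonneg (by linarith) _)
  · have : b 3 = 1 := b.one_of_mem_closedBall (by simp [b])
    simp [this]

lemma integral_deriv_mul_pow {h : ℝ → ℝ} (hm : m ≠ 0) (hh : ContDiff ℝ 1 h)
    (hc : HasCompactSupport h) :
    ∫ s in Ioi (0 : ℝ), deriv h s * s ^ m = -(m * ∫ s in Ioi (0 : ℝ), h s * s ^ (m - 1)) := by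
  have h₁ : ContDiff ℝ 1 fun s => h s * s ^ m := hh.mul (contDiff_id.pow m)
  have h₂ := (hc.mul_right (f' := fun s => s ^ m)).integral_Ioi_deriv_eq h₁ 0
  have i₁ : Integrable fun s => deriv h s * s ^ m :=
    ((hh.continuous_deriv le_rfl).mul (continuous_pow m)).integrable_of_hasCompactSupport
      hc.deriv.mul_right
  have i₂ : Integrable fun s => h s * s ^ (m - 1) :=
    (hh.continuous.mul (continuous_pow _)).integrable_of_hasCompactSupport hc.mul_right
  have e : ∀ s, deriv (fun s => h s * s ^ m) s = deriv h s * s ^ m + m * (h s * s ^ (m - 1)) :=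
    fun s => by
      rw [((hh.differentiable one_ne_zero s).hasDerivAt.fun_mul (hasDerivAt_pow m s)).deriv]
      ring
  simp only [e] at h₂
  rw [integral_add i₁.integrableOn (i₂.const_mul _).integrableOn, integral_const_mul,
    zero_pow hm] at h₂
  linarith

/-- The derivative at `x = s ω` of a function which is `h(|x|) k(x / |x|)`. -/
lemma fderiv_radial_mul {k : EuclideanSpace ℝ (Fin (m + 1)) → ℝ} {h : ℝ → ℝ}
    (hk : ContDiff ℝ 1 k) (hh : ContDiff ℝ 1 h)
    {ω : EuclideanSpace ℝ (Fin (m + 1))} (hω : ‖ω‖ = 1) {s : ℝ} (hs : 0 < s) (i : Fin (m + 1))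
    (hd : DifferentiableAt ℝ (fun x => h ‖x‖ * k (‖x‖⁻¹ • x)) (s • ω)) :
    fderiv ℝ (fun x => h ‖x‖ * k (‖x‖⁻¹ • x)) (s • ω) (EuclideanSpace.single i 1) =
      deriv h s * (ω i * k ω) + h s * s⁻¹ *
        (fderiv ℝ k ω (EuclideanSpace.single i 1) - ω i * fderiv ℝ k ω ω) := by
  set e : EuclideanSpace ℝ (Fin (m + 1)) := EuclideanSpace.single i 1
  have hns : ‖s • ω‖ = s := by rw [norm_smul, hω, mul_one, Real.norm_of_nonneg hs.le]
  have hline : HasDerivAt (fun τ : ℝ => s • ω + τ • e) e 0 := by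
    simpa using ((hasDerivAt_id (0 : ℝ)).smul_const e).const_add (s • ω)
  have h0 : s • ω + (0 : ℝ) • e = s • ω := by simp
  have hnorm : HasDerivAt (fun τ : ℝ => ‖s • ω + τ • e‖) (ω i) 0 := by
    have h₁ := hline.norm_sq
    have h₂ := h₁.sqrt (by rw [h0, hns]; positivity)
    simp only [Real.sqrt_sq (norm_nonneg _), h0, hns] at h₂
    refine h₂.congr_deriv ?_
    have : inner ℝ (s • ω) e = s * ω i := by
      simp [e, inner_smul_left, EuclideanSpace.inner_single_right]
    rw [this, Real.sqrt_sq hs.le]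
    field_simp
  have hinv : HasDerivAt (fun τ : ℝ => ‖s • ω + τ • e‖⁻¹) (-ω i / s ^ 2) 0 := by
    have := hnorm.fun_inv (by rw [h0, hns]; exact hs.ne')
    rwa [h0, hns] at this
  have hdir := hinv.fun_smul hline
  have hkω : HasFDerivAt k (fderiv ℝ k ω) (‖s • ω + (0 : ℝ) • e‖⁻¹ • (s • ω + (0 : ℝ) • e)) := by
    rw [h0, hns, inv_smul_smul₀ hs.ne']
    exact (hk.differentiable one_ne_zero ω).hasFDerivAt
  have h₁ := hkω.comp_hasDerivAt (0 : ℝ) hdir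
  have hhs : HasDerivAt h (deriv h s) ‖s • ω + (0 : ℝ) • e‖ := by
    rw [h0, hns]
    exact (hh.differentiable one_ne_zero s).hasDerivAt
  have h₂ := (hhs.comp (0 : ℝ) hnorm).fun_mul h₁
  have hd' : HasFDerivAt (fun x => h ‖x‖ * k (‖x‖⁻¹ • x))
      (fderiv ℝ (fun x => h ‖x‖ * k (‖x‖⁻¹ • x)) (s • ω)) (s • ω + (0 : ℝ) • e) := by
    rw [h0]
    exact hd.hasFDerivAt
  have h₃ := hd'.comp_hasDerivAt (0 : ℝ) hline
  rw [h₃.unique h₂]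
  simp only [Function.comp_def, h0, hns, inv_smul_smul₀ hs.ne', map_add, map_smul, smul_eq_mul]
  field_simp
  ring

/-- The integral over the sphere of the tangential part of a derivative of `k`. It follows from
`∫ ∂ᵢ(h(|x|) k(x / |x|)) dx = 0`, where `h` is a cut-off function, in polar coordinates. -/
theorem integral_sphere_tangential (hm : m ≠ 0) {k : EuclideanSpace ℝ (Fin (m + 1)) → ℝ}
    (hk : ContDiff ℝ 1 k) (i : Fin (m + 1)) :
    ∫ ω : Metric.sphere (0 : EuclideanSpace ℝ (Fin (m + 1))) 1,
      (fderiv ℝ k ω (EuclideanSpace.single i 1) - ω.1 i * fderiv ℝ k ω ω -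
        m * (ω.1 i * k ω)) ∂(sphereMeasure m) = 0 := by
  obtain ⟨h, hh, hc, hz, hne⟩ := exists_radial_cutoff m
  set g : EuclideanSpace ℝ (Fin (m + 1)) → ℝ := fun x => h ‖x‖ * k (‖x‖⁻¹ • x) with hgdef
  have hg : ContDiff ℝ 1 g := by
    rw [contDiff_iff_contDiffAt]
    intro x
    by_cases hx : x = 0
    · have : g =ᶠ[𝓝 x] fun _ => 0 := by
        have h1 : ∀ᶠ y in 𝓝 x, ‖y‖ < 1 := by
          refine continuous_norm.continuousAt.eventually_lt continuousAt_const ?_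
          simp [hx]
        filter_upwards [h1] with y hy
        simp only [g, hz _ hy.le, zero_mul]
      exact contDiffAt_const.congr_of_eventuallyEq this
    · have hn : ContDiffAt ℝ 1 (fun x : EuclideanSpace ℝ (Fin (m + 1)) => ‖x‖) x :=
        contDiffAt_norm ℝ hx
      exact (hh.contDiffAt.comp x hn).mul
        (hk.contDiffAt.comp x ((hn.inv (norm_ne_zero_iff.2 hx)).smul contDiffAt_id))
  have hgc : HasCompactSupport g := by
    obtain ⟨N, hN⟩ := hc.isCompact.isBounded.subset_closedBall 0
    refine HasCompactSupport.of_support_subset_isCompact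
      (isCompact_closedBall (0 : EuclideanSpace ℝ (Fin (m + 1))) N) fun x hx => ?_
    have h1 : h ‖x‖ ≠ 0 := left_ne_zero_of_mul hx
    have h2 := hN (subset_tsupport h h1)
    rw [mem_closedBall_zero_iff, norm_norm] at h2
    exact mem_closedBall_zero_iff.2 h2
  have hI := integral_fderiv_eq_zero (μ := volume) hg hgc (EuclideanSpace.single i (1 : ℝ))
  have hint : Integrable (fun x => fderiv ℝ g x (EuclideanSpace.single i (1 : ℝ))) :=
    ((hg.continuous_fderiv one_ne_zero).clm_apply
      continuous_const).integrable_of_hasCompactSupport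
      (hgc.fderiv_apply (𝕜 := ℝ) _)
  rw [integral_polar_spheres hint] at hI
  have hcω : Continuous fun ω : Metric.sphere (0 : EuclideanSpace ℝ (Fin (m + 1))) 1 => ω.1 i := by
    fun_prop
  have c₁ : Continuous fun ω : Metric.sphere (0 : EuclideanSpace ℝ (Fin (m + 1))) 1 =>
      ω.1 i * k ω := hcω.mul (hk.continuous.comp continuous_subtype_val)
  have hfd : Continuous fun ω : Metric.sphere (0 : EuclideanSpace ℝ (Fin (m + 1))) 1 =>
      fderiv ℝ k ω := (hk.continuous_fderiv one_ne_zero).comp continuous_subtype_val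
  have c₂ : Continuous fun ω : Metric.sphere (0 : EuclideanSpace ℝ (Fin (m + 1))) 1 =>
      fderiv ℝ k ω (EuclideanSpace.single i 1) - ω.1 i * fderiv ℝ k ω ω :=
    (hfd.clm_apply continuous_const).sub (hcω.mul (hfd.clm_apply continuous_subtype_val))
  have i₁ := c₁.integrable_of_hasCompactSupport (μ := sphereMeasure m)
    (HasCompactSupport.of_compactSpace _)
  have i₂ := c₂.integrable_of_hasCompactSupport (μ := sphereMeasure m)
    (HasCompactSupport.of_compactSpace _)
  set I₁ := ∫ ω : Metric.sphere (0 : EuclideanSpace ℝ (Fin (m + 1))) 1, ω.1 i * k ω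
    ∂(sphereMeasure m)
  set I₂ := ∫ ω : Metric.sphere (0 : EuclideanSpace ℝ (Fin (m + 1))) 1,
    (fderiv ℝ k ω (EuclideanSpace.single i 1) - ω.1 i * fderiv ℝ k ω ω) ∂(sphereMeasure m)
  have hin : ∀ s ∈ Ioi (0 : ℝ), (∫ ω, fderiv ℝ g (polarMap m (ω, s)) (EuclideanSpace.single i 1)
      ∂(sphereMeasure m)) * s ^ m = I₁ * (deriv h s * s ^ m) + I₂ * (h s * s ^ (m - 1)) := by
    intro s hs
    have hs0 : 0 < s := hs
    have e : ∀ ω : Metric.sphere (0 : EuclideanSpace ℝ (Fin (m + 1))) 1,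
        fderiv ℝ g (polarMap m (ω, s)) (EuclideanSpace.single i 1) =
        deriv h s * (ω.1 i * k ω) + h s * s⁻¹ *
        (fderiv ℝ k ω (EuclideanSpace.single i 1) - ω.1 i * fderiv ℝ k ω ω) := fun ω =>
      fderiv_radial_mul hk hh (mem_sphere_zero_iff_norm.1 ω.2) hs0 i
        (hg.differentiable one_ne_zero _)
    simp only [e]
    rw [integral_add (i₁.const_mul _) (i₂.const_mul _), integral_const_mul, integral_const_mul]
    have hp : s ^ m = s * s ^ (m - 1) := (mul_pow_sub_one hm s).symm
    rw [add_mul, hp]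
    have : s⁻¹ * s = 1 := inv_mul_cancel₀ hs0.ne'
    linear_combination (h s * I₂ * s ^ (m - 1)) * this
  rw [setIntegral_congr_fun measurableSet_Ioi hin] at hI
  have j₁ : Integrable fun s => deriv h s * s ^ m :=
    ((hh.continuous_deriv le_rfl).mul (continuous_pow m)).integrable_of_hasCompactSupport
      hc.deriv.mul_right
  have j₂ : Integrable fun s => h s * s ^ (m - 1) :=
    (hh.continuous.mul (continuous_pow _)).integrable_of_hasCompactSupport hc.mul_right
  rw [integral_add (j₁.const_mul _).integrableOn (j₂.const_mul _).integrableOn, integral_const_mul,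
    integral_const_mul, integral_deriv_mul_pow hm hh hc] at hI
  rw [integral_sub i₂ (i₁.const_mul _), integral_const_mul]
  refine (mul_eq_zero.1 (?_ : (∫ s in Ioi (0 : ℝ), h s * s ^ (m - 1)) * (I₂ - m * I₁) = 0)).resolve_left
    hne
  linear_combination hI

end Sphere

/-! ### Weak solutions in several space dimensions -/

section Space

variable {a β b₁ b₂ x₀ κ v : ℝ} {m : ℕ} {X₁ X₂ V₁ A₁ V₂ A₂ : ℝ → ℝ}

lemma FieldData.measurable_norm (hX : FieldData β b₁ b₂ X₁ X₂ x₀) :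
    Measurable fun z : ℝ × EuclideanSpace ℝ (Fin (m + 1)) =>
      homField β X₁ X₂ x₀ z.1 ‖z.2‖ := by
  have h : Measurable fun z : ℝ × EuclideanSpace ℝ (Fin (m + 1)) => ((z.1, ‖z.2‖) : ℝ × ℝ) := by
    fun_prop
  have h' := hX.measurable.comp h
  simpa only [Function.comp_def, max_eq_left (norm_nonneg _)] using h'

lemma ae_norm_ne (c : ℝ) : ∀ᵐ x : EuclideanSpace ℝ (Fin (m + 1)), ‖x‖ ≠ c := by
  have h : volume (Metric.sphere (0 : EuclideanSpace ℝ (Fin (m + 1))) c) = 0 :=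
    Measure.addHaar_sphere volume 0 c
  filter_upwards [compl_mem_ae_iff.2 h] with x hx
  simpa using hx

lemma ae_ne_zero : ∀ᵐ x : EuclideanSpace ℝ (Fin (m + 1)), 0 < ‖x‖ :=
  (ae_norm_ne 0).mono fun _ hx => (norm_nonneg _).lt_of_ne hx.symm

lemma ae_prod_ne_zero : ∀ᵐ z : ℝ × EuclideanSpace ℝ (Fin (m + 1)), 0 < ‖z.2‖ :=
  Measure.quasiMeasurePreserving_snd.ae ae_ne_zero

lemma FieldData.ae_continuousAt_norm (hX : FieldData β b₁ b₂ X₁ X₂ x₀) (t : ℝ) :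
    ∀ᵐ x : EuclideanSpace ℝ (Fin (m + 1)),
      ContinuousAt (fun t => homField β X₁ X₂ x₀ t ‖x‖) t := by
  filter_upwards [ae_ne_zero, ae_norm_ne (b₁ * max (-t) 0), ae_norm_ne (b₂ * max t 0)]
    with x h0 h1 h2
  exact (continuousAt_homField hX.continuousOn₁ hX.continuousOn₂ hX.tendsto₁ hX.tendsto₂ h0 h1
    h2).comp (f := fun t => (t, ‖x‖)) (by fun_prop)

lemma FieldData.continuousInL1loc_norm (hβ : β ≤ 0) (hm : -((m : ℝ) + 1) < β)
    (hX : FieldData β b₁ b₂ X₁ X₂ x₀) :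
    ContinuousInL1loc volume fun t (x : EuclideanSpace ℝ (Fin (m + 1))) =>
      homField β X₁ X₂ x₀ t ‖x‖ := by
  obtain ⟨K, hK, h⟩ := hX.exists_bound hβ
  refine continuousInL1loc_of_dominated (w := fun x => K * ‖x‖ ^ β)
    ((locallyIntegrable_norm_rpow hm).smul K) (fun t => ?_) (fun t => ?_) hX.ae_continuousAt_norm
  · exact (hX.measurable_norm.comp (measurable_prodMk_left (x := t))).aestronglyMeasurable
  · filter_upwards [ae_ne_zero] with x hx using h t _ hx

lemma norm_div_norm_smul {E : Type*} [NormedAddCommGroup E] [NormedSpace ℝ E] {x : E}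
    (hx : 0 < ‖x‖) (c : ℝ) : ‖(c / ‖x‖) • x‖ = |c| := by
  rw [norm_smul, norm_div, norm_norm, div_mul_cancel₀ _ hx.ne', Real.norm_eq_abs]

lemma FieldData.continuousInL1loc_radial (hβ : β ≤ 0) (hm : -((m : ℝ) + 1) < β)
    (hX : FieldData β b₁ b₂ X₁ X₂ x₀) :
    ContinuousInL1loc volume fun t (x : EuclideanSpace ℝ (Fin (m + 1))) =>
      (homField β X₁ X₂ x₀ t ‖x‖ / ‖x‖) • x := by
  obtain ⟨K, hK, h⟩ := hX.exists_bound hβ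
  refine continuousInL1loc_of_dominated (w := fun x => K * ‖x‖ ^ β)
    ((locallyIntegrable_norm_rpow hm).smul K) (fun t => ?_) (fun t => ?_) fun t => ?_
  · have h₁ : Measurable fun x : EuclideanSpace ℝ (Fin (m + 1)) => homField β X₁ X₂ x₀ t ‖x‖ :=
      hX.measurable_norm.comp (measurable_prodMk_left (x := t))
    exact ((h₁.div _root_.measurable_norm).smul measurable_id).aestronglyMeasurable
  · filter_upwards [ae_ne_zero] with x hx
    rw [norm_div_norm_smul hx]
    exact h t _ hx
  · filter_upwards [hX.ae_continuousAt_norm t] with x hx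
    exact (hx.div_const _).smul continuousAt_const

lemma FieldData.locallyIntegrable_norm (hβ : β ≤ 0) (hm : -((m : ℝ) + 1) < β)
    (hX : FieldData β b₁ b₂ X₁ X₂ x₀) :
    LocallyIntegrable (fun z : ℝ × EuclideanSpace ℝ (Fin (m + 1)) =>
      homField β X₁ X₂ x₀ z.1 ‖z.2‖) := by
  obtain ⟨K, hK, h⟩ := hX.exists_bound hβ
  refine locallyIntegrable_of_abs_le (w := fun x => K * ‖x‖ ^ β)
    ((locallyIntegrable_norm_rpow hm).smul K) hX.measurable_norm.aestronglyMeasurable ?_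
  filter_upwards [ae_prod_ne_zero] with z hz using h z.1 _ hz

lemma integrable_of_abs_le_of_isCompact {w : EuclideanSpace ℝ (Fin (m + 1)) → ℝ}
    {g : ℝ × EuclideanSpace ℝ (Fin (m + 1)) → ℝ} {k : Set (ℝ × EuclideanSpace ℝ (Fin (m + 1)))}
    (hw : LocallyIntegrable w) (hg : AEStronglyMeasurable g) (hk : IsCompact k)
    (hgk : ∀ z ∉ k, g z = 0) (h : ∀ᵐ z, |g z| ≤ w z.2) : Integrable g := by
  have h₁ : IntegrableOn g k := (locallyIntegrable_of_abs_le hw hg h).integrableOn_isCompact hk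
  exact (integrableOn_iff_integrable_of_support_subset fun z hz => by
    by_contra hc
    exact hz (hgk z hc)).1 h₁

lemma integral_eq_zero_of_rays {g : ℝ × EuclideanSpace ℝ (Fin (m + 1)) → ℝ} (hg : Integrable g)
    (h : ∀ ω : EuclideanSpace ℝ (Fin (m + 1)), ‖ω‖ = 1 →
      ∫ t : ℝ, ∫ r in Ioi (0 : ℝ), g (t, r • ω) * r ^ m = 0) : ∫ z, g z = 0 := by
  rw [integral_time_polar_rays hg]
  refine (integral_congr_ae (Eventually.of_forall fun ω => ?_)).trans (integral_zero _ _)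
  exact h ω (mem_sphere_zero_iff_norm.1 ω.2)

lemma integral_eq_zero_of_spheres {g : ℝ × EuclideanSpace ℝ (Fin (m + 1)) → ℝ}
    (hg : Integrable g)
    (h : ∀ t r : ℝ, 0 < r → ∫ ω, g (t, polarMap m (ω, r)) ∂(sphereMeasure m) = 0) :
    ∫ z, g z = 0 := by
  refine (integral_prod _ hg).trans ((integral_congr_ae ?_).trans (integral_zero _ _))
  filter_upwards [hg.prod_right_ae] with t ht
  rw [integral_polar_spheres ht]
  refine (setIntegral_congr_fun measurableSet_Ioi fun r hr => ?_).trans (integral_zero _ _)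
  beta_reduce
  rw [h t r hr, zero_mul]

section Test

variable {φ : ℝ × EuclideanSpace ℝ (Fin (m + 1)) → ℝ}

/-- The restriction of a test function to the ray in direction `ω`. -/
lemma isRadialTest_ray (hφ : ContDiff ℝ 1 φ) (hc : HasCompactSupport φ)
    {ω : EuclideanSpace ℝ (Fin (m + 1))} (hω : ‖ω‖ = 1) (c : ℝ) :
    IsRadialTest fun z => c * φ (z.1, z.2 • ω) := by
  obtain ⟨N, hN⟩ := hc.isCompact.isBounded.subset_closedBall 0
  have hN' : ∀ z, N < ‖z‖ → φ z = 0 := fun z hz => by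
    by_contra hne
    exact absurd (mem_closedBall_zero_iff.1 (hN (subset_tsupport φ hne))) hz.not_ge
  refine ⟨ContDiff.contDiffOn (contDiff_const.mul (hφ.comp (by fun_prop))), max N 1, max N 1,
    by positivity, by positivity, fun t r hr hz => ?_⟩
  suffices N < ‖(t, r • ω)‖ by
    beta_reduce
    rw [hN' _ this, mul_zero]
  rw [Prod.norm_mk, norm_smul, hω, mul_one, Real.norm_eq_abs, Real.norm_eq_abs, abs_of_nonneg hr]
  by_contra! hle
  obtain ⟨h1, h2⟩ := max_le_iff.1 hle
  exact hz ⟨abs_le.1 (h1.trans (le_max_left _ _)), hr, h2.trans (le_max_left _ _)⟩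

lemma deriv_ray_time (hφ : ContDiff ℝ 1 φ) (ω : EuclideanSpace ℝ (Fin (m + 1))) (c t r : ℝ) :
    deriv (fun s => c * φ (s, r • ω)) t = c * fderiv ℝ φ (t, r • ω) (1, 0) :=
  (((hφ.differentiable one_ne_zero (t, r • ω)).hasFDerivAt.comp_hasDerivAt t
    ((hasDerivAt_id t).prodMk (hasDerivAt_const t (r • ω)))).const_mul c).deriv

lemma deriv_ray_radius (hφ : ContDiff ℝ 1 φ) (ω : EuclideanSpace ℝ (Fin (m + 1))) (c t r : ℝ) :
    deriv (fun s => c * φ (t, s • ω)) r = c * fderiv ℝ φ (t, r • ω) (0, ω) := by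
  have h : HasDerivAt (fun s : ℝ => s • ω) ω r := by
    simpa using (hasDerivAt_id r).smul_const ω
  exact (((hφ.differentiable one_ne_zero (t, r • ω)).hasFDerivAt.comp_hasDerivAt r
    ((hasDerivAt_const r t).prodMk h)).const_mul c).deriv

/-- The tangential part of `∂ᵢφ`, minus `m xᵢ φ / |x|²`. Its mean over each sphere vanishes. -/
noncomputable def tangentialTest (φ : ℝ × EuclideanSpace ℝ (Fin (m + 1)) → ℝ) (i : Fin (m + 1))
    (z : ℝ × EuclideanSpace ℝ (Fin (m + 1))) : ℝ :=
  fderiv ℝ φ z (0, EuclideanSpace.single i 1) -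
    z.2 i / ‖z.2‖ * fderiv ℝ φ z (0, ‖z.2‖⁻¹ • z.2) - m * (z.2 i / ‖z.2‖ * φ z) / ‖z.2‖

lemma tangentialTest_ray (i : Fin (m + 1)) {ω : EuclideanSpace ℝ (Fin (m + 1))} (hω : ‖ω‖ = 1)
    (t : ℝ) {r : ℝ} (hr : 0 < r) :
    tangentialTest φ i (t, r • ω) = fderiv ℝ φ (t, r • ω) (0, EuclideanSpace.single i 1) -
      ω i * fderiv ℝ φ (t, r • ω) (0, ω) - m * (ω i * φ (t, r • ω)) / r := by
  have hn : ‖r • ω‖ = r := by rw [norm_smul, hω, mul_one, Real.norm_of_nonneg hr.le]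
  simp only [tangentialTest, hn, inv_smul_smul₀ hr.ne', PiLp.smul_apply, smul_eq_mul,
    mul_div_cancel_left₀ _ hr.ne']

lemma integral_tangentialTest (hm : m ≠ 0) (hφ : ContDiff ℝ 1 φ) (i : Fin (m + 1)) (t : ℝ) {r : ℝ}
    (hr : 0 < r) :
    ∫ ω, tangentialTest φ i (t, polarMap m (ω, r)) ∂(sphereMeasure m) = 0 := by
  have hk : ContDiff ℝ 1 fun y : EuclideanSpace ℝ (Fin (m + 1)) => φ (t, r • y) :=
    hφ.comp (by fun_prop)
  have hd : ∀ y w : EuclideanSpace ℝ (Fin (m + 1)),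
      fderiv ℝ (fun y => φ (t, r • y)) y w = r * fderiv ℝ φ (t, r • y) (0, w) := by
    intro y w
    have h₁ : HasFDerivAt (fun y : EuclideanSpace ℝ (Fin (m + 1)) => (t, r • y))
        (ContinuousLinearMap.prod 0 (r • ContinuousLinearMap.id ℝ _)) y :=
      (hasFDerivAt_const t y).prodMk ((hasFDerivAt_id y).const_smul r)
    have h₂ := ((hφ.differentiable one_ne_zero (t, r • y)).hasFDerivAt.comp y h₁).fderiv
    have h₃ : fderiv ℝ (fun y => φ (t, r • y)) y = _ := h₂
    rw [h₃]
    have : ((0 : ℝ), r • w) = r • ((0 : ℝ), w) := by simp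
    simp only [ContinuousLinearMap.comp_apply, ContinuousLinearMap.prod_apply,
      zero_apply, smul_apply,
      ContinuousLinearMap.id_apply, this, map_smul, smul_eq_mul]
  have h := integral_sphere_tangential hm hk i
  simp only [hd] at h
  refine (mul_eq_zero.1 (?_ : r * _ = 0)).resolve_left hr.ne'
  rw [← integral_const_mul, ← h]
  congr 1
  funext ω
  rw [polarMap, tangentialTest_ray i (mem_sphere_zero_iff_norm.1 ω.2) t hr]
  field_simp

lemma exists_test_bound (hφ : ContDiff ℝ 1 φ) (hc : HasCompactSupport φ) :
    ∃ M, 0 ≤ M ∧ (∀ z, |φ z| ≤ M) ∧ ∀ z w, |fderiv ℝ φ z w| ≤ M * ‖w‖ := by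
  obtain ⟨M₁, h₁⟩ := hc.exists_bound_of_continuous hφ.continuous
  obtain ⟨M₂, h₂⟩ := (hc.fderiv (𝕜 := ℝ)).exists_bound_of_continuous
    (hφ.continuous_fderiv one_ne_zero)
  refine ⟨max M₁ M₂, (norm_nonneg _).trans ((h₁ 0).trans (le_max_left _ _)),
    fun z => (h₁ z).trans (le_max_left _ _), fun z w => ?_⟩
  exact ((fderiv ℝ φ z).le_opNorm w).trans
    (mul_le_mul_of_nonneg_right ((h₂ z).trans (le_max_right _ _)) (norm_nonneg _))

lemma measurable_fderiv_apply_of_measurable (hφ : ContDiff ℝ 1 φ)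
    {w : ℝ × EuclideanSpace ℝ (Fin (m + 1)) → ℝ × EuclideanSpace ℝ (Fin (m + 1))}
    (hw : Measurable w) : Measurable fun z => fderiv ℝ φ z (w z) := by
  have h := (isBoundedBilinearMap_apply (𝕜 := ℝ) (E := ℝ × EuclideanSpace ℝ (Fin (m + 1)))
    (F := ℝ)).continuous.comp_stronglyMeasurable
    ((hφ.continuous_fderiv one_ne_zero).stronglyMeasurable.prodMk hw.stronglyMeasurable)
  exact h.measurable

lemma fderiv_eq_zero_of_notMem (z : ℝ × EuclideanSpace ℝ (Fin (m + 1))) (hz : z ∉ tsupport φ) :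
    φ z = 0 ∧ fderiv ℝ φ z = 0 :=
  ⟨image_eq_zero_of_notMem_tsupport hz, by
    by_contra hne
    exact hz (support_fderiv_subset ℝ hne)⟩

end Test

end Space

section WeakSolution

variable {a β b₁ b₂ κ v : ℝ} {m : ℕ} {V₁ A₁ V₂ A₂ : ℝ → ℝ}
  {φ : ℝ × EuclideanSpace ℝ (Fin (m + 1)) → ℝ}

/-- Since the velocity is radial, the mass law is the radial mass law along each ray, with test
function `φ(t, r ω)`. -/
lemma integral_mass_space (ha : 0 < a) (hm : m ≠ 0) (hβ : -(m : ℝ) < β) (hβ' : β < 0)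
    (h₁ : SimilarityFlow a m β V₁ A₁ b₁ κ (-v)) (h₂ : SimilarityFlow a m β V₂ A₂ b₂ κ v)
    (hφ : ContDiff ℝ 1 φ) (hc : HasCompactSupport φ) :
    ∫ t : ℝ, ∫ x : EuclideanSpace ℝ (Fin (m + 1)),
      (homField β A₁ A₂ κ t ‖x‖ * fderiv ℝ φ (t, x) (1, 0) + homField β A₁ A₂ κ t ‖x‖ *
        fderiv ℝ φ (t, x) (0, (homField 0 (fun σ => -V₁ σ) V₂ v t ‖x‖ / ‖x‖) • x)) = 0 := by
  have hρ := fieldData_density h₁ h₂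
  have hu := fieldData_velocity h₁ h₂
  obtain ⟨K, hK, bρ⟩ := hρ.exists_bound hβ'.le
  obtain ⟨L, hL, bu⟩ := hu.exists_bound le_rfl
  obtain ⟨M, hM, -, bφ⟩ := exists_test_bound hφ hc
  have hint : Integrable fun z : ℝ × EuclideanSpace ℝ (Fin (m + 1)) =>
      homField β A₁ A₂ κ z.1 ‖z.2‖ * fderiv ℝ φ (z.1, z.2) (1, 0) +
        homField β A₁ A₂ κ z.1 ‖z.2‖ *
        fderiv ℝ φ (z.1, z.2) (0, (homField 0 (fun σ => -V₁ σ) V₂ v z.1 ‖z.2‖ / ‖z.2‖) • z.2) := by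
    refine integrable_of_abs_le_of_isCompact
      (w := fun x => (K * (M + M * L)) * ‖x‖ ^ β)
      ((locallyIntegrable_norm_rpow (by linarith)).smul (K * (M + M * L)))
      (Measurable.aestronglyMeasurable ?_) hc.isCompact (fun z hz => ?_) ?_
    · exact (hρ.measurable_norm.mul
        (measurable_fderiv_apply_of_measurable hφ measurable_const)).add
        (hρ.measurable_norm.mul (measurable_fderiv_apply_of_measurable hφ
          (measurable_const.prodMk
            ((hu.measurable_norm.div measurable_snd.norm).smul measurable_snd))))
    · simp [(fderiv_eq_zero_of_notMem z hz).2]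
    · filter_upwards [ae_prod_ne_zero] with z hz
      have e₁ := bφ (z.1, z.2) (1, 0)
      have e₂ := bφ (z.1, z.2) (0, (homField 0 (fun σ => -V₁ σ) V₂ v z.1 ‖z.2‖ / ‖z.2‖) • z.2)
      have e₃ := bu z.1 _ hz
      rw [Real.rpow_zero, mul_one] at e₃
      rw [Prod.norm_mk, norm_zero, norm_one, max_eq_left zero_le_one, mul_one] at e₁
      rw [Prod.norm_mk, norm_zero, norm_div_norm_smul hz, max_eq_right (abs_nonneg _)] at e₂
      rw [← mul_add, abs_mul, mul_right_comm]
      refine mul_le_mul (bρ z.1 _ hz) ((abs_add_le _ _).trans (add_le_add e₁ (e₂.trans ?_)))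
        (abs_nonneg _) (by positivity)
      exact mul_le_mul_of_nonneg_left e₃ hM
  refine (integral_prod _ hint).symm.trans (integral_eq_zero_of_rays hint fun ω hω => ?_)
  refine Eq.trans ?_ (integral_mass ha hm hβ hβ' h₁ h₂ (isRadialTest_ray hφ hc hω 1))
  congr 1
  funext t
  refine setIntegral_congr_fun measurableSet_Ioi fun r hr => ?_
  have hr0 : 0 < r := hr
  have hn : ‖r • ω‖ = r := by rw [norm_smul, hω, mul_one, Real.norm_of_nonneg hr0.le]
  have hv : ∀ c : ℝ, ((0 : ℝ), c • ω) = c • ((0 : ℝ), ω) := fun c => by simp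
  simp only [deriv_ray_time hφ, deriv_ray_radius hφ, hn, smul_smul, div_mul_cancel₀ _ hr0.ne', hv,
    map_smul, smul_eq_mul]
  ring

/-- The momentum law in several space dimensions. Along the ray of direction `ω` the `i`-th component
is the radial momentum law with test function `ω_i φ(t, r ω)`, up to the pressure times
`tangentialTest φ i`, which has mean zero over each sphere. -/
lemma integral_momentum_space (ha : 0 < a) (hm : m ≠ 0) (hβ : -(m : ℝ) < β) (hβ' : β < 0)
    (h₁ : SimilarityFlow a m β V₁ A₁ b₁ κ (-v)) (h₂ : SimilarityFlow a m β V₂ A₂ b₂ κ v)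
    (hφ : ContDiff ℝ 1 φ) (hc : HasCompactSupport φ) (i : Fin (m + 1)) :
    ∫ t : ℝ, ∫ x : EuclideanSpace ℝ (Fin (m + 1)),
      (homField β A₁ A₂ κ t ‖x‖ * ((homField 0 (fun σ => -V₁ σ) V₂ v t ‖x‖ / ‖x‖) • x) i *
          fderiv ℝ φ (t, x) (1, 0) +
        homField β A₁ A₂ κ t ‖x‖ * ((homField 0 (fun σ => -V₁ σ) V₂ v t ‖x‖ / ‖x‖) • x) i *
          fderiv ℝ φ (t, x) (0, (homField 0 (fun σ => -V₁ σ) V₂ v t ‖x‖ / ‖x‖) • x) +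
        a ^ 2 * homField β A₁ A₂ κ t ‖x‖ *
          fderiv ℝ φ (t, x) (0, EuclideanSpace.single i 1)) = 0 := by
  have hρ := fieldData_density h₁ h₂
  have hu := fieldData_velocity h₁ h₂
  obtain ⟨K, hK, bρ⟩ := hρ.exists_bound hβ'.le
  obtain ⟨L, hL, bu⟩ := hu.exists_bound le_rfl
  obtain ⟨M, hM, bφ₀, bφ⟩ := exists_test_bound hφ hc
  have hms : Measurable fun z : ℝ × EuclideanSpace ℝ (Fin (m + 1)) => z.2 i := by fun_prop
  have hmu := (hu.measurable_norm (m := m)).div measurable_snd.norm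
  -- The pressure terms of the integrand which cancel on each sphere.
  have hintG : Integrable fun z : ℝ × EuclideanSpace ℝ (Fin (m + 1)) =>
      a ^ 2 * homField β A₁ A₂ κ z.1 ‖z.2‖ * tangentialTest φ i z := by
    refine integrable_of_abs_le_of_isCompact
      (w := fun x => (a ^ 2 * K * (M + M)) * ‖x‖ ^ β + (a ^ 2 * K * (m * M)) * ‖x‖ ^ (β - 1))
      (((locallyIntegrable_norm_rpow (by linarith)).smul (a ^ 2 * K * (M + M))).add
        ((locallyIntegrable_norm_rpow (by linarith)).smul (a ^ 2 * K * (m * M))))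
      (Measurable.aestronglyMeasurable ?_) hc.isCompact (fun z hz => ?_) ?_
    · refine (hρ.measurable_norm.const_mul _).mul (Measurable.sub (Measurable.sub ?_ ?_) ?_)
      · exact measurable_fderiv_apply_of_measurable hφ measurable_const
      · exact (hms.div measurable_snd.norm).mul (measurable_fderiv_apply_of_measurable hφ
          (measurable_const.prodMk (measurable_snd.norm.inv.smul measurable_snd)))
      · exact (((hms.div measurable_snd.norm).mul hφ.continuous.measurable).const_mul _).div
          measurable_snd.norm
    · simp [tangentialTest, fderiv_eq_zero_of_notMem z hz]
    · filter_upwards [ae_prod_ne_zero] with z hz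
      have e₁ := bφ z (0, EuclideanSpace.single i 1)
      have e₂ := bφ z (0, ‖z.2‖⁻¹ • z.2)
      have e₀ : |z.2 i / ‖z.2‖| ≤ 1 := by
        rw [abs_div, abs_norm]
        exact div_le_one_of_le₀ (PiLp.norm_apply_le z.2 i) hz.le
      rw [Prod.norm_mk, norm_zero, PiLp.norm_single, norm_one, max_eq_right zero_le_one,
        mul_one] at e₁
      rw [Prod.norm_mk, norm_zero, norm_smul, norm_inv, norm_norm, inv_mul_cancel₀ hz.ne',
        max_eq_right zero_le_one, mul_one] at e₂
      have e₃ : |tangentialTest φ i z| ≤ (M + M) + m * M / ‖z.2‖ := by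
        refine (abs_sub _ _).trans (add_le_add ((abs_sub _ _).trans (add_le_add e₁ ?_)) ?_)
        · rw [abs_mul]
          exact (mul_le_mul e₀ e₂ (abs_nonneg _) zero_le_one).trans (one_mul M).le
        · rw [abs_div, abs_norm, abs_mul, Nat.abs_cast, abs_mul]
          refine div_le_div_of_nonneg_right (mul_le_mul_of_nonneg_left ?_ m.cast_nonneg) hz.le
          exact (mul_le_mul e₀ (bφ₀ z) (abs_nonneg _) zero_le_one).trans (one_mul M).le
      rw [abs_mul, abs_mul, abs_of_nonneg (sq_nonneg a)]
      refine (mul_le_mul (mul_le_mul_of_nonneg_left (bρ z.1 _ hz) (sq_nonneg a)) e₃ (abs_nonneg _)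
        (by positivity)).trans (le_of_eq ?_)
      rw [Real.rpow_sub_one hz.ne']
      ring
  have hint : Integrable fun z : ℝ × EuclideanSpace ℝ (Fin (m + 1)) =>
      homField β A₁ A₂ κ z.1 ‖z.2‖ *
          ((homField 0 (fun σ => -V₁ σ) V₂ v z.1 ‖z.2‖ / ‖z.2‖) • z.2) i *
          fderiv ℝ φ (z.1, z.2) (1, 0) +
        homField β A₁ A₂ κ z.1 ‖z.2‖ *
          ((homField 0 (fun σ => -V₁ σ) V₂ v z.1 ‖z.2‖ / ‖z.2‖) • z.2) i *
          fderiv ℝ φ (z.1, z.2)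
            (0, (homField 0 (fun σ => -V₁ σ) V₂ v z.1 ‖z.2‖ / ‖z.2‖) • z.2) +
        a ^ 2 * homField β A₁ A₂ κ z.1 ‖z.2‖ *
          fderiv ℝ φ (z.1, z.2) (0, EuclideanSpace.single i 1) := by
    refine integrable_of_abs_le_of_isCompact
      (w := fun x => (K * (L * M + L * (M * L) + a ^ 2 * M)) * ‖x‖ ^ β)
      ((locallyIntegrable_norm_rpow (by linarith)).smul (K * (L * M + L * (M * L) + a ^ 2 * M)))
      (Measurable.aestronglyMeasurable ?_) hc.isCompact (fun z hz => ?_) ?_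
    · have hmi : Measurable fun z : ℝ × EuclideanSpace ℝ (Fin (m + 1)) =>
          ((homField 0 (fun σ => -V₁ σ) V₂ v z.1 ‖z.2‖ / ‖z.2‖) • z.2) i := by
        simp only [PiLp.smul_apply, smul_eq_mul]
        exact hmu.mul hms
      exact (((hρ.measurable_norm.mul hmi).mul
        (measurable_fderiv_apply_of_measurable hφ measurable_const)).add
        ((hρ.measurable_norm.mul hmi).mul (measurable_fderiv_apply_of_measurable hφ
          (measurable_const.prodMk (hmu.smul measurable_snd))))).add
        ((hρ.measurable_norm.const_mul _).mul
          (measurable_fderiv_apply_of_measurable hφ measurable_const))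
    · simp [(fderiv_eq_zero_of_notMem z hz).2]
    · filter_upwards [ae_prod_ne_zero] with z hz
      set u := (homField 0 (fun σ => -V₁ σ) V₂ v z.1 ‖z.2‖ / ‖z.2‖) • z.2 with hudef
      have e₀ : ‖u‖ ≤ L := by
        have := bu z.1 _ hz
        rw [Real.rpow_zero, mul_one] at this
        rwa [hudef, norm_div_norm_smul hz]
      have e₁ := bφ (z.1, z.2) (1, 0)
      have e₂ := bφ (z.1, z.2) (0, u)
      have e₃ := bφ (z.1, z.2) (0, EuclideanSpace.single i 1)
      rw [Prod.norm_mk, norm_zero, norm_one, max_eq_left zero_le_one, mul_one] at e₁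
      rw [Prod.norm_mk, norm_zero, max_eq_right (norm_nonneg _)] at e₂
      rw [Prod.norm_mk, norm_zero, PiLp.norm_single, norm_one, max_eq_right zero_le_one,
        mul_one] at e₃
      have e₄ : |u i| ≤ L := (PiLp.norm_apply_le u i).trans e₀
      have e₅ : homField β A₁ A₂ κ z.1 ‖z.2‖ * u i * fderiv ℝ φ (z.1, z.2) (1, 0) +
          homField β A₁ A₂ κ z.1 ‖z.2‖ * u i * fderiv ℝ φ (z.1, z.2) (0, u) +
          a ^ 2 * homField β A₁ A₂ κ z.1 ‖z.2‖ *
            fderiv ℝ φ (z.1, z.2) (0, EuclideanSpace.single i 1) =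
          homField β A₁ A₂ κ z.1 ‖z.2‖ * (u i * fderiv ℝ φ (z.1, z.2) (1, 0) +
            u i * fderiv ℝ φ (z.1, z.2) (0, u) +
            a ^ 2 * fderiv ℝ φ (z.1, z.2) (0, EuclideanSpace.single i 1)) := by ring
      rw [e₅, abs_mul, mul_right_comm]
      refine mul_le_mul (bρ z.1 _ hz) ((abs_add_le _ _).trans (add_le_add
        ((abs_add_le _ _).trans (add_le_add ?_ ?_)) ?_)) (abs_nonneg _) (by positivity)
      · rw [abs_mul]
        exact mul_le_mul e₄ e₁ (abs_nonneg _) hL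
      · rw [abs_mul]
        exact mul_le_mul e₄ (e₂.trans (mul_le_mul_of_nonneg_left e₀ hM)) (abs_nonneg _) hL
      · rw [abs_mul, abs_of_nonneg (sq_nonneg a)]
        exact mul_le_mul_of_nonneg_left e₃ (sq_nonneg a)
  have hG : ∫ z : ℝ × EuclideanSpace ℝ (Fin (m + 1)),
      a ^ 2 * homField β A₁ A₂ κ z.1 ‖z.2‖ * tangentialTest φ i z = 0 := by
    refine integral_eq_zero_of_spheres hintG fun t r hr => ?_
    have hn : ∀ ω, ‖polarMap m (ω, r)‖ = r := fun ω => by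
      rw [polarMap, norm_smul, mem_sphere_zero_iff_norm.1 ω.2, mul_one, Real.norm_of_nonneg hr.le]
    simp only [hn]
    rw [integral_const_mul, integral_tangentialTest hm hφ i t hr, mul_zero]
  have hsub := integral_sub hint hintG
  rw [hG, sub_zero] at hsub
  refine (integral_prod _ hint).symm.trans (hsub.symm.trans ?_)
  refine integral_eq_zero_of_rays (hint.sub hintG) fun ω hω => ?_
  refine Eq.trans ?_ (integral_momentum ha hm hβ hβ' h₁ h₂ (isRadialTest_ray hφ hc hω (ω i)))
  congr 1
  funext t
  refine setIntegral_congr_fun measurableSet_Ioi fun r hr => ?_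
  have hr0 : 0 < r := hr
  have hn : ‖r • ω‖ = r := by rw [norm_smul, hω, mul_one, Real.norm_of_nonneg hr0.le]
  have hv : ∀ c : ℝ, ((0 : ℝ), c • ω) = c • ((0 : ℝ), ω) := fun c => by simp
  simp only [deriv_ray_time hφ, deriv_ray_radius hφ, tangentialTest_ray i hω t hr0, hn, smul_smul,
    div_mul_cancel₀ _ hr0.ne', hv, map_smul, smul_eq_mul, PiLp.smul_apply]
  ring

/-- Two expanding flows with opposite asymptotic velocities, the first one reversed in time, form a
weak solution in `m + 1` space dimensions. -/
theorem isWeakSolution_homField (ha : 0 < a) (hm : m ≠ 0) (hβ : -(m : ℝ) < β) (hβ' : β < 0)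
    (h₁ : SimilarityFlow a m β V₁ A₁ b₁ κ (-v)) (h₂ : SimilarityFlow a m β V₂ A₂ b₂ κ v) :
    IsWeakSolution (m + 1) (pressure a) (fun t x => homField β A₁ A₂ κ t ‖x‖)
      (fun t x => (homField 0 (fun σ => -V₁ σ) V₂ v t ‖x‖ / ‖x‖) • x) := by
  have hρ := fieldData_density h₁ h₂
  have hu := fieldData_velocity h₁ h₂
  have hm1 : -((m : ℝ) + 1) < β := by linarith
  refine ⟨hρ.measurable_norm, (hu.measurable_norm.div measurable_snd.norm).smul measurable_snd,
    hρ.continuousInL1loc_norm hβ'.le hm1, ?_, ?_, ?_,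
    fun φ hφ hc => integral_mass_space ha hm hβ hβ' h₁ h₂ hφ hc,
    fun φ hφ hc i => integral_momentum_space ha hm hβ hβ' h₁ h₂ hφ hc i⟩
  · simp only [smul_smul, ← mul_div_assoc, homField_mul]
    exact (hρ.mul hu).continuousInL1loc_radial hβ'.le hm1
  · refine ((((hρ.mul hu).mul hu).locallyIntegrable_norm hβ'.le hm1).congr ?_)
    filter_upwards [ae_prod_ne_zero] with z hz
    rw [norm_div_norm_smul hz, sq_abs, ← homField_mul, ← homField_mul]
    ring
  · simp only [pressure, const_mul_homField]
    exact (hρ.const_mul (a ^ 2)).locallyIntegrable_norm hβ'.le hm1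

end WeakSolution

end IsothermalEuler

theorem theorem1 (a : ℝ) (ha : 0 < a) (m : ℕ) (hm : m = 1 ∨ m = 2) (β : ℝ)
    (hβ : -(m : ℝ) < β) (hβ' : β < 0) :
    -- the kink solution exists, is unique, and has a finite limit at `-∞`
    (∃ (Uk : ℝ → ℝ) (Ustar : ℝ), IsKink a m β Uk ∧ Tendsto Uk atBot (𝓝 Ustar) ∧
      ∀ V : ℝ → ℝ, IsKink a m β V → EqOn V Uk (Iio (xiW a m β))) ∧
    -- there are cases in which its limit is strictly negative
    ((m = 1 ∧ β = -(1 / 2) ∨ m = 2 ∧ β = -1) → KinkLimitNeg a m β) ∧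
    (KinkLimitNeg a m β → ∀ Ω₀ : ℝ, Ω₀ < 0 →
      (∃ S : Profile, IsConstructed a m β Ω₀ S) ∧
      ∀ S : Profile, IsConstructed a m β Ω₀ S →
        IsRadialWeakSolution m (pressure a) (S.density a m β) (S.velocity a m β) ∧
        IsWeakSolution (m + 1) (pressure a) (fun t x => S.density a m β t ‖x‖)
          (fun t x => (S.velocity a m β t ‖x‖ / ‖x‖) • x) ∧
        (∀ t r : ℝ, 0 < r → 0 < S.density a m β t r) ∧
        -- the fields are continuous away from the origin and the shock
        ContinuousOn (fun z : ℝ × ℝ => S.density a m β z.1 z.2)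
          {z | 0 ≤ z.2 ∧ z ≠ (0, 0) ∧ ¬ (0 < z.1 ∧ z.2 = S.xiS * z.1)} ∧
        ContinuousOn (fun z : ℝ × ℝ => S.velocity a m β z.1 z.2)
          {z | 0 ≤ z.2 ∧ z ≠ (0, 0) ∧ ¬ (0 < z.1 ∧ z.2 = S.xiS * z.1)} ∧
        -- a weak discontinuity focuses at the origin along the 1-characteristic `r = xiW * t`
        xiW a m β < 0 ∧ lamMinus m β < lamPlus m β ∧
        (∀ t : ℝ, t < 0 →
          S.velocity a m β t (xiW a m β * t) - a = xiW a m β ∧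
          HasDerivWithinAt (S.velocity a m β t) ((1 - lamPlus m β) / t)
            (Ici (xiW a m β * t)) (xiW a m β * t) ∧
          HasDerivWithinAt (S.velocity a m β t) ((1 - lamMinus m β) / t)
            (Iic (xiW a m β * t)) (xiW a m β * t)) ∧
        -- an admissible 2-shock expands from the origin
        0 < S.xiS ∧
        (∀ t : ℝ, 0 < t →
          IsTwoShock (pressure a) (S.density a m β) (S.velocity a m β) (fun s => S.xiS * s) t) ∧
        -- the density blows up at the origin
        (∃ K : ℝ, 0 < K ∧ ∀ x : EuclideanSpace ℝ (Fin (m + 1)), x ≠ 0 →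
          S.density a m β 0 ‖x‖ = K * ‖x‖ ^ β) ∧
        Tendsto (fun z : ℝ × EuclideanSpace ℝ (Fin (m + 1)) => S.density a m β z.1 ‖z.2‖)
          (𝓝[≠] 0) atTop ∧
        -- the velocity is globally bounded
        (∃ M : ℝ, ∀ t r : ℝ, 0 ≤ r → |S.velocity a m β t r| ≤ M)) := by
  have hm0 : m ≠ 0 := by omega
  refine ⟨?_, ?_, fun hneg Ω₀ hΩ => ⟨exists_profile ha hm hβ hβ' hneg Ω₀, fun S hS => ?_⟩⟩
  · obtain ⟨Uk, Ustar, hk, hlim⟩ := exists_kink ha hm hβ hβ'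
    exact ⟨Uk, Ustar, hk, hlim, fun V hV => hV.eqOn_of_sound_speed ha hm hβ hβ' hk⟩
  · rintro (⟨rfl, rfl⟩ | ⟨rfl, rfl⟩)
    · exact kinkLimitNeg_of_half ha hm (by norm_num)
    · exact kinkLimitNeg_of_half ha hm (by norm_num)
  · have hw := xiW_neg ha hm hβ
    have hC : 0 < -S.C := neg_pos.2 (hS.omk_neg ha hm hβ hΩ).2
    have h₁ := hS.back_flow ha hm hβ hΩ
    have h₂ := hS.forward_flow ha hm hβ hβ' hΩ
    have hρ := hS.density_eq ha hm hβ hΩ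
    have hu : S.velocity a m β = _ := Profile.velocity_eq
    obtain ⟨c, hc, hlow⟩ := exists_lower_bound hC h₁ h₂
    refine ⟨?_, ?_, ?_, hS.continuousOn_density ha hm hβ hβ' hΩ,
      hS.continuousOn_velocity ha hm hβ hβ' hΩ, hw, ?_,
      fun t ht => hS.kink_conditions ha hm hβ hβ' ht, hS.xiS_pos,
      fun t ht => hS.isTwoShock ha hm hβ hβ' hΩ ht, ⟨-S.C, hC, fun x _ => ?_⟩, ?_, ?_⟩
    · rw [hρ, hu]
      exact isRadialWeakSolution_homField ha hm0 hβ hβ' h₁ h₂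
    · rw [hρ, hu]
      exact isWeakSolution_homField ha hm0 hβ hβ' h₁ h₂
    · intro t r hr
      rw [hρ]
      refine lt_of_lt_of_le ?_ (hlow t r hr.le (Or.inr hr.ne'))
      exact mul_pos hc (Real.rpow_pos_of_pos (by positivity) β)
    · obtain ⟨s, hs, hs1, rfl⟩ := exists_eq_mul_sub_one hm hβ hβ'
      exact lamMinus_lt_lamPlus hm hs hs1
    · rw [hρ, homField_zero]
    · rw [hρ]
      exact tendsto_density_atTop hβ' hc hlow
    · rw [hu]
      exact exists_velocity_bound h₁ h₂
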